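/- **Setting.** Let $\mathfrak o$ be a complete discrete valuation ring with maximal ideal $\mathfrak p=(\pi)$ and finite residue field $\mathbf k$ of cardinality $q$ and characteristic $p>3$. Let $\mathfrak O=\mathfrak o[\rho]$, $\rho^2\in\mathfrak o^\times\smallsetminus(\mathfrak o^\times)^2$, be the unramified quadratic extension, with Galois involution $x\mapsto x^\circ$, $\rho^\circ=-\rho$, maximal ideal $\mathfrak P=\pi\mathfrak O$ and residue field $\mathbf K$. For $\ell\ge 2$ put $\mathfrak o_\ell=\mathfrak o/\mathfrak p^\ell$, $\mathfrak O_\ell=\mathfrak O/\mathfrak P^\ell$, $\ell_1=\lfloor \ell/2\rfloor$, $\ell_2=\lceil \ell/2\rceil$, and let $\mathrm{val}$ be the valuation on $\mathfrak O_\ell$ with $\mathrm{val}(0)=\ell$. For a $3\times3$ matrix $X=(x_{ij})$ over $\mathfrak O_\ell$ let $X^\star=(x_{4-j,4-i}^\circ)_{i,j}$. Let $\mathbf G\in\{\mathrm{GL}_3,\mathrm{GU}_3\}$, where $\mathrm{GL}_3(\mathfrak o_\ell)\subset\mathrm{GL}_3(\mathfrak O_\ell)$ and $\mathrm{GU}_3(\mathfrak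 o_\ell)=\{g\in\mathrm{GL}_3(\mathfrak O_\ell): g^\star g=1\}$, and let $\mathfrak g(\mathfrak o_\ell)$ be $\mathfrak{gl}_3(\mathfrak o_\ell)$, respectively $\{X\in\mathfrak{gl}_3(\mathfrak O_\ell) : X+X^\star=0\}$. For a subgroup $U$ of $\mathrm{GL}_3(\mathfrak O_\ell)$ let $U^i$ be the group of those $g\in U$ with $g\equiv 1$ mod $\mathfrak P^i$; write $\mathbf G^i=\mathbf G(\mathfrak o_\ell)^i$. Fix an additive character $\psi:\mathfrak O_\ell\to\mathbb C^\times$ that is non-trivial on $\mathfrak p^{\ell-1}/\mathfrak p^{\ell}\subset\mathfrak o_\ell$. An irreducible character $\chi$ of $\mathbf G(\mathfrak o_\ell)$ is called non-regular non-zero nilpotent if its restriction to $\mathbf G^{\ell-1}$ contains the character $g\mapsto\psi(\mathrm{tr}(X(g-1)))$ for some $X\in\mathfrak g(\mathfrak o_\ell)$ whose reduction in $\mathfrak{gl}_3(\mathbf K)$ is nilpotent, non-zero and not regular (not cyclic). A matrix $A$ is said to be of normal form if $$A=r\begin{bmatrix}\omega&0&1\\ \alpha&\omega+\delta&0\\ \delta^2+\gamma&\beta&\omega\end{bmatrix},\qquad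 \omega,\delta\in\pi\mathfrak O_\ell,\qquad m:=\min\{\mathrm{val}(\alpha),\mathrm{val}(\beta),\mathrm{val}(\gamma)\},\quad 1\le m\le\ell,$$ where $r=1$ and $\omega,\delta,\alpha,\beta,\gamma\in\mathfrak o_\ell$ if $\mathbf G=\mathrm{GL}_3$, and $r=\rho$, $\omega=\omega^\circ$, $\delta=\delta^\circ$, $\gamma=\gamma^\circ$, $\alpha=\beta^\circ$ if $\mathbf G=\mathrm{GU}_3$. Put $m_1=\lfloor\frac{\ell-m}2\rfloor$, $m_2=\lceil\frac{\ell-m}2\rceil$, and let $$\mathbf J=\mathbf J(\mathfrak o_\ell)=\mathbf G(\mathfrak o_\ell)\cap\left\{\begin{bmatrix}a&x&z\\ \delta y&b&y\\ \delta^2z&\delta x&a\end{bmatrix}: a,b,x,y,z\in\mathfrak O_\ell\right\}.$$ Let $\psi_{A_{\ell_1}}$ be the character $g\mapsto\psi(\mathrm{tr}(A(g-1)))$ of $\mathbf G^{\ell_2}$, and let $I$ be its stabiliser (inertia group) in $\mathbf G(\mathfrak o_\ell)$. Put $\Psi_A(g)=\psi(\mathrm{tr}(A\log g))$, where $\log g=\sum_{k=1}^{4}\frac{(-1)^{k+1}}{k}(g-1)^k$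 (on the groups below $(g-1)^5=0$). **Theorem.** For every non-regular non-zero nilpotent irreducible character $\chi$ of $\mathbf G(\mathfrak o_\ell)$ there is $A\in\mathfrak g(\mathfrak o_\ell)$ of normal form such that the stabiliser $S$ of ($A$ modulo $\mathfrak P^{\ell_2}$) in $\mathbf G^{\ell_1}$ equals $\mathbf J^{\ell_1}\mathbf G^{\ell_2}$, the function $\psi_{A_{\ell_2}}:=\Psi_A|_S$ extends $\psi_{A_{\ell_1}}$, $\chi$ lies above the character $\psi_{A_{\ell_2}}$ of $S$, and the following hold. (a) If $m<\ell_2$, then $S\le K:=\mathbf J^{m_2}\mathbf G^{\ell_2}\le I^{m_1}$ and there is an irreducible character $\sigma$ of $I^{m_1}$ with $\sigma(1)=q^{2(\ell_2-\ell_1)+(m_2-m_1)}$, such that $\sigma|_{K}=\sigma(1)\,\Psi_A|_{K}$ and $\sigma$ is induced from a linear character, extending $\Psi_A|_{K}$, of a group between $K$ and $I^{m_1}$; and such that $\sigma$ extends to its stabiliser $I(\sigma)$ in $I$, every extension of $\sigma$ to $I(\sigma)$ induces irreducibly to $\mathbf G(\mathfrak o_\ell)$, and $\chi$ is induced from one of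 these extensions. (b) If $m\ge\ell_2$, then there is an irreducible character $\sigma$ of $I^{\ell_1}$ with $\sigma(1)=q^{2(\ell_2-\ell_1)}$, such that $\sigma|_{S}=\sigma(1)\psi_{A_{\ell_2}}$ and $\sigma$ is induced from a linear character, extending $\psi_{A_{\ell_2}}$, of a group between $S$ and $I^{\ell_1}$; and such that $\sigma$ extends to $I$. Moreover $I=\mathbf J\,\mathbf G^{\ell_1}$, and for every extension $\tilde\sigma$ of $\sigma$ to $I$ there is an irreducible character $\varphi$ of $\mathbf J(\mathfrak o_\ell)$, trivial on $\mathbf J^{\ell_1}$, such that $\chi=\mathrm{Ind}_I^{\mathbf G(\mathfrak o_\ell)}(\tilde\sigma\otimes\varphi)$, where $\varphi$ is inflated to $I$ along $I\to I/\mathbf G^{\ell_1}\cong\mathbf J/\mathbf J^{\ell_1}$. -/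

import Mathlib

namespace NilpotentA2

open IsLocalRing Matrix

noncomputable section

/-! ### Rings -/

section Rings

variable (o : Type*) [CommRing o] [IsLocalRing o]

/-- The finite quotient `o_ℓ = o / 𝔭 ^ ℓ`. -/
abbrev SmallRing (ℓ : ℕ) : Type _ := o ⧸ maximalIdeal o ^ ℓ

variable {o}

/-- The finite quotient `𝔒_ℓ = 𝔒 / 𝔓 ^ ℓ = o_ℓ[ρ]` of the quadratic extension `𝔒 = o[ρ]`, where
`ρ ^ 2 = u`. It carries the involution `star`, with `star ρ = -ρ`. -/
abbrev BigRing (u : o) (ℓ : ℕ) : Type _ :=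
  QuadraticAlgebra (SmallRing o ℓ) (Ideal.Quotient.mk (maximalIdeal o ^ ℓ) u) 0

/-- The ideal `𝔓 = π 𝔒_ℓ` of `𝔒_ℓ`. -/
def bigP (u : o) (ℓ : ℕ) : Ideal (BigRing u ℓ) :=
  (maximalIdeal o).map (algebraMap o (BigRing u ℓ))

/-- The valuation on `𝔒_ℓ`, with values in `{0, …, ℓ}` and `val 0 = ℓ`. -/
def val {u : o} {ℓ : ℕ} (x : BigRing u ℓ) : ℕ := sSup {k | k ≤ ℓ ∧ x ∈ bigP u ℓ ^ k}

/-- The element `x` of `𝔒_ℓ` lies in `o_ℓ`. -/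
def IsReal {u : o} {ℓ : ℕ} (x : BigRing u ℓ) : Prop :=
  x ∈ (algebraMap (SmallRing o ℓ) (BigRing u ℓ)).range

/-- An additive character of `𝔒_ℓ` whose restriction to `𝔭 ^ (ℓ - 1) o_ℓ` is non-trivial. -/
def IsPrimitiveChar {u : o} {ℓ : ℕ} (ψ : AddChar (BigRing u ℓ) ℂ) : Prop :=
  ∃ x ∈ maximalIdeal o ^ (ℓ - 1), ψ (algebraMap o (BigRing u ℓ) x) ≠ 1

end Rings

/-! ### Matrices over a commutative ring -/

section MatrixOps

variable {R : Type*} [CommRing R]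

/-- The subgroup of invertible matrices that commute with `X`. -/
def commSubgroup (X : Matrix (Fin 3) (Fin 3) R) : Subgroup (GL (Fin 3) R) where
  carrier := {g | Commute (g : Matrix (Fin 3) (Fin 3) R) X}
  mul_mem' ha hb := by
    simpa using Commute.mul_left ha hb
  one_mem' := by simp
  inv_mem' {g} hg := Commute.units_inv_left (u := g) hg

/-- The logarithm of `g`, that is the series `∑ (-1) ^ (k + 1) (g - 1) ^ k / k` without the terms
with `k ≥ 5`. It is used where `2` and `3` are invertible, for `g` with `(g - 1) ^ 5 = 0`. -/
def logm (g : GL (Fin 3) R) : Matrix (Fin 3) (Fin 3) R :=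
  ∑ k ∈ Finset.Icc (1 : ℕ) 4,
    ((-1 : R) ^ (k + 1) * Ring.inverse ((k : ℕ) : R)) • ((g : Matrix (Fin 3) (Fin 3) R) - 1) ^ k

/-- A square matrix `X` is regular (cyclic) if some vector generates the whole space under `X`. -/
def IsRegularMatrix (X : Matrix (Fin 3) (Fin 3) R) : Prop :=
  ∃ v : Fin 3 → R, Submodule.span R (Set.range fun i : ℕ => (X ^ i) *ᵥ v) = ⊤

variable [StarRing R]

/-- The involution `X ↦ W X° ᵀ W⁻¹`, where `W` is the antidiagonal permutation matrix: the `(i, j)`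
entry of the result is the conjugate of the `(4 - j, 4 - i)` entry of `X`. -/
def adj (X : Matrix (Fin 3) (Fin 3) R) : Matrix (Fin 3) (Fin 3) R :=
  Xᴴ.submatrix Fin.revPerm Fin.revPerm

lemma adj_mul (X Y : Matrix (Fin 3) (Fin 3) R) : adj (X * Y) = adj Y * adj X := by
  unfold adj
  rw [conjTranspose_mul, submatrix_mul_equiv]

lemma adj_one : adj (1 : Matrix (Fin 3) (Fin 3) R) = 1 := by
  simp [adj]

/-- The unitary group: invertible matrices `g` with `g^⋆ g = 1`. -/
def unitarySubgroup (R : Type*) [CommRing R] [StarRing R] : Subgroup (GL (Fin 3) R) where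
  carrier := {g | adj (g : Matrix (Fin 3) (Fin 3) R) * g = 1}
  mul_mem' {a b} ha hb := by
    simp only [Set.mem_ofPred_eq, Units.val_mul, adj_mul] at *
    calc adj (b : Matrix (Fin 3) (Fin 3) R) * adj (a : Matrix (Fin 3) (Fin 3) R) * (a * b)
        = adj (b : Matrix (Fin 3) (Fin 3) R) *
          (adj (a : Matrix (Fin 3) (Fin 3) R) * a) * b := by simp only [mul_assoc]
      _ = 1 := by rw [ha, mul_one, hb]
  one_mem' := by simp [adj_one]
  inv_mem' {a} ha := by
    simp only [Set.mem_ofPred_eq] at *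
    have h : adj (a : Matrix (Fin 3) (Fin 3) R) = ((a⁻¹ : GL (Fin 3) R) :
        Matrix (Fin 3) (Fin 3) R) := by
      calc adj (a : Matrix (Fin 3) (Fin 3) R)
          = adj (a : Matrix (Fin 3) (Fin 3) R) * (a * (a⁻¹ : GL (Fin 3) R)) := by
            rw [Units.mul_inv, mul_one]
        _ = _ := by rw [← mul_assoc, ha, one_mul]
    have h' : (a : Matrix (Fin 3) (Fin 3) R) * adj (a : Matrix (Fin 3) (Fin 3) R) = 1 := by
      rw [h, Units.mul_inv]
    rw [← h, ← adj_mul, h', adj_one]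

end MatrixOps

/-! ### The groups and Lie rings -/

/-- The two types of groups, `GL_3` and `GU_3`. -/
inductive GroupType
  | linear
  | unitary

section Groups

variable {o : Type*} [CommRing o] [IsLocalRing o]

/-- The group `G(o_ℓ)` inside `GL_3(𝔒_ℓ)`: it is `GL_3(o_ℓ)` or `GU_3(o_ℓ)`. -/
def grp (ε : GroupType) (u : o) (ℓ : ℕ) : Subgroup (GL (Fin 3) (BigRing u ℓ)) :=
  match ε with
  | .linear => (GeneralLinearGroup.map (algebraMap (SmallRing o ℓ) (BigRing u ℓ))).range
  | .unitary => unitarySubgroup (BigRing u ℓ)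

/-- The Lie ring `𝔤(o_ℓ)` inside `𝔤𝔩_3(𝔒_ℓ)`. -/
def lieRing (ε : GroupType) (u : o) (ℓ : ℕ) : Set (Matrix (Fin 3) (Fin 3) (BigRing u ℓ)) :=
  match ε with
  | .linear => {X | ∀ i j, IsReal (X i j)}
  | .unitary => {X | X + adj X = 0}

/-- Reduction of invertible matrices over `𝔒_ℓ` modulo `𝔓 ^ i`. -/
def redGL (u : o) (ℓ i : ℕ) :
    GL (Fin 3) (BigRing u ℓ) →* GL (Fin 3) (BigRing u ℓ ⧸ bigP u ℓ ^ i) :=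
  GeneralLinearGroup.map (Ideal.Quotient.mk (bigP u ℓ ^ i))

/-- Reduction of matrices over `𝔒_ℓ` modulo `𝔓 ^ i`. -/
def redMat (u : o) (ℓ i : ℕ) (X : Matrix (Fin 3) (Fin 3) (BigRing u ℓ)) :
    Matrix (Fin 3) (Fin 3) (BigRing u ℓ ⧸ bigP u ℓ ^ i) :=
  X.map (Ideal.Quotient.mk (bigP u ℓ ^ i))

/-- The congruence subgroup `U^i` of a subgroup `U`: the elements of `U` that are congruent to the
identity matrix modulo `𝔓 ^ i`. -/
def cong {u : o} {ℓ : ℕ} (U : Subgroup (GL (Fin 3) (BigRing u ℓ))) (i : ℕ) :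
    Subgroup (GL (Fin 3) (BigRing u ℓ)) :=
  U ⊓ (redGL u ℓ i).ker

lemma cong_le {u : o} {ℓ : ℕ} (U : Subgroup (GL (Fin 3) (BigRing u ℓ))) (i : ℕ) :
    cong U i ≤ U := inf_le_left

/-- The group `J(o_ℓ)` attached to `δ`: the elements of `G(o_ℓ)` that commute with
`E + δ E_{22} + δ ^ 2 E_{31}`; equivalently those of the shape
`[a, x, z; δ y, b, y; δ ^ 2 z, δ x, a]`. -/
def grpJ (ε : GroupType) {u : o} {ℓ : ℕ} (δ : BigRing u ℓ) :
    Subgroup (GL (Fin 3) (BigRing u ℓ)) :=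
  grp ε u ℓ ⊓ commSubgroup !![0, 0, 1; 0, δ, 0; δ ^ 2, 0, 0]

/-- The subgroup of `U` of the elements that stabilise the image of `A` modulo `𝔓 ^ k`. -/
def stabMod {u : o} {ℓ : ℕ} (U : Subgroup (GL (Fin 3) (BigRing u ℓ)))
    (A : Matrix (Fin 3) (Fin 3) (BigRing u ℓ)) (k : ℕ) :
    Subgroup (GL (Fin 3) (BigRing u ℓ)) :=
  U ⊓ (commSubgroup (redMat u ℓ k A)).comap (redGL u ℓ k)

/-! ### The normal form -/

/-- The scalar `r`, equal to `1` in the linear case and to `ρ` in the unitary case. -/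
def scal (ε : GroupType) (u : o) (ℓ : ℕ) : BigRing u ℓ :=
  match ε with
  | .linear => 1
  | .unitary => ⟨0, 1⟩

/-- The parameters `ω, δ, α, β, γ` of a matrix in normal form. -/
structure Params (u : o) (ℓ : ℕ) where
  ω : BigRing u ℓ
  δ : BigRing u ℓ
  α : BigRing u ℓ
  β : BigRing u ℓ
  γ : BigRing u ℓ

variable {u : o} {ℓ : ℕ}

/-- `m = min (val α, val β, val γ)`. -/
def Params.m (P : Params u ℓ) : ℕ := min (val P.α) (min (val P.β) (val P.γ))

/-- The matrix `A(ℓ, m; ω, δ, α, β, γ)`. -/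
def Params.mat (P : Params u ℓ) (ε : GroupType) : Matrix (Fin 3) (Fin 3) (BigRing u ℓ) :=
  scal ε u ℓ • !![P.ω, 0, 1; P.α, P.ω + P.δ, 0; P.δ ^ 2 + P.γ, P.β, P.ω]

/-- The conditions on the parameters of the normal form. -/
def Params.IsAdmissible (P : Params u ℓ) (ε : GroupType) : Prop :=
  P.ω ∈ bigP u ℓ ∧ P.δ ∈ bigP u ℓ ∧ 1 ≤ P.m ∧ P.m ≤ ℓ ∧
  match ε with
  | .linear => IsReal P.ω ∧ IsReal P.δ ∧ IsReal P.α ∧ IsReal P.β ∧ IsReal P.γ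
  | .unitary => star P.ω = P.ω ∧ star P.δ = P.δ ∧ P.α = star P.β ∧ star P.γ = P.γ

/-! ### The characters attached to a matrix -/

/-- `g ↦ ψ (tr (A (g - 1)))`. For `A ∈ 𝔤(o_ℓ)` this is a character of `G(o_ℓ)^i` if `2 i ≥ ℓ`,
which depends only on `A` modulo `𝔓 ^ (ℓ - i)`. -/
def psiLin (ψ : AddChar (BigRing u ℓ) ℂ) (A : Matrix (Fin 3) (Fin 3) (BigRing u ℓ))
    (g : GL (Fin 3) (BigRing u ℓ)) : ℂ :=
  ψ (trace (A * ((g : Matrix (Fin 3) (Fin 3) (BigRing u ℓ)) - 1)))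

/-- `g ↦ ψ (tr (A log g))`. -/
def psiLog (ψ : AddChar (BigRing u ℓ) ℂ) (A : Matrix (Fin 3) (Fin 3) (BigRing u ℓ))
    (g : GL (Fin 3) (BigRing u ℓ)) : ℂ :=
  ψ (trace (A * logm g))

end Groups

/-! ### Representations of subgroups of a fixed group -/

section Reps

variable {M : Type*} [Group M]

/-- The elements of `T` that normalise `N` and fix the function `f` on `N` under conjugation. -/
def stabConj (T N : Subgroup M) (f : N → ℂ) : Subgroup M where
  carrier := {g | g ∈ T ∧ (∀ n, n ∈ N ↔ g * n * g⁻¹ ∈ N) ∧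
    ∀ n (hn : n ∈ N) (hn' : g * n * g⁻¹ ∈ N), f ⟨g * n * g⁻¹, hn'⟩ = f ⟨n, hn⟩}
  mul_mem' {a b} ha hb := by
    obtain ⟨ha1, ha2, ha3⟩ := ha
    obtain ⟨hb1, hb2, hb3⟩ := hb
    have key : ∀ n, a * b * n * (a * b)⁻¹ = a * (b * n * b⁻¹) * a⁻¹ := fun n => by group
    refine ⟨T.mul_mem ha1 hb1, fun n => ?_, fun n hn hn' => ?_⟩
    · rw [key, ← ha2, ← hb2]
    · have hb' := (hb2 n).1 hn
      have ha' := (ha2 _).1 hb'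
      rw [← hb3 n hn hb', ← ha3 _ hb' ha']
      congr 2
      exact key n
  one_mem' := by
    refine ⟨T.one_mem, fun n => by simp, fun n hn hn' => ?_⟩
    congr 2
    simp
  inv_mem' {a} ha := by
    obtain ⟨ha1, ha2, ha3⟩ := ha
    have key : ∀ n, a * (a⁻¹ * n * a⁻¹⁻¹) * a⁻¹ = n := fun n => by group
    refine ⟨T.inv_mem ha1, fun n => ?_, fun n hn hn' => ?_⟩
    · rw [ha2 (a⁻¹ * n * a⁻¹⁻¹), key]
    · have h := ha3 _ hn' (by rw [key]; exact hn)
      rw [← h]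
      congr 2
      exact key n

lemma stabConj_le (T N : Subgroup M) (f : N → ℂ) : stabConj T N f ≤ T := fun _ h => h.1

/-- The representation `χ` of `T` lies above the one-dimensional character `f` of `N ≤ T`. -/
def LiesAbove {V : Type*} [AddCommGroup V] [Module ℂ V] {T : Subgroup M}
    (χ : Representation ℂ T V) (N : Subgroup M) (f : M → ℂ) : Prop :=
  N ≤ T ∧ ∃ v : V, v ≠ 0 ∧ ∀ n (hn : n ∈ T), n ∈ N → χ ⟨n, hn⟩ v = f n • v

/-- The representation `σ'` of `T` extends the representation `σ` of `N ≤ T`. -/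
def Extends {W : Type*} [AddCommGroup W] [Module ℂ W] {N T : Subgroup M}
    (σ : Representation ℂ N W) (σ' : Representation ℂ T W) : Prop :=
  N ≤ T ∧ ∀ n (hn : n ∈ N) (hn' : n ∈ T), σ' ⟨n, hn'⟩ = σ ⟨n, hn⟩

/-- The induced representation. -/
abbrev indRep {W : Type*} [AddCommGroup W] [Module ℂ W] {N T : Subgroup M} (h : N ≤ T)
    (σ : Representation ℂ N W) :
    Representation ℂ T (Representation.IndV (Subgroup.inclusion h) σ) :=
  Representation.ind (Subgroup.inclusion h) σ

/-- The one-dimensional representation attached to a multiplicative character. -/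
def linRep {L : Type*} [Group L] (lam : L →* ℂ) : Representation ℂ L ℂ where
  toFun g := lam g • LinearMap.id
  map_one' := by ext; simp
  map_mul' a b := by ext; simp [mul_comm]

/-- `σ` is an irreducible representation of `N` on which `K ≤ N` acts by the scalars `f`, and which
is induced from a one-dimensional character, extending `f`, of a group between `K` and `N`. -/
def IsMonomialAbove {W : Type*} [AddCommGroup W] [Module ℂ W] {N : Subgroup M}
    (σ : Representation ℂ N W) (K : Subgroup M) (f : M → ℂ) : Prop :=
  σ.IsIrreducible ∧ K ≤ N ∧
  (∀ g (hg : g ∈ N), g ∈ K → σ ⟨g, hg⟩ = f g • LinearMap.id) ∧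
  ∃ (L : Subgroup M) (hLN : L ≤ N) (lam : L →* ℂ), K ≤ L ∧
    (∀ g (hg : g ∈ L), g ∈ K → lam ⟨g, hg⟩ = f g) ∧
    Nonempty (σ.Equiv (indRep hLN (linRep lam)))

/-- `φ'` is the inflation to `I = J · B` of the representation `φ` of `J`
(so `φ` is trivial on `J ∩ B`). -/
def IsInflation {W : Type*} [AddCommGroup W] [Module ℂ W] {J I : Subgroup M}
    (B : Subgroup M) (φ : Representation ℂ J W) (φ' : Representation ℂ I W) : Prop :=
  (∀ x, x ∈ I ↔ ∃ j ∈ J, ∃ b ∈ B, x = j * b) ∧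
  ∀ j (hj : j ∈ J) b, b ∈ B → ∀ h : j * b ∈ I, φ' ⟨j * b, h⟩ = φ ⟨j, hj⟩

end Reps

section Nilpotent

variable {o : Type*} [CommRing o] [IsLocalRing o] {u : o} {ℓ : ℕ}

/-- The representation `χ` of `G(o_ℓ)` lies above a non-regular non-zero nilpotent orbit in the Lie
algebra over the residue field: its restriction to `G(o_ℓ)^(ℓ - 1)` contains the character
`1 + π ^ (ℓ - 1) Y ↦ ψ (π ^ (ℓ - 1) tr (X Y))` for some `X` whose image modulo `𝔓` is nilpotent,
non-zero and not regular. -/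
def IsNonRegularNilpotent (ε : GroupType) (ψ : AddChar (BigRing u ℓ) ℂ)
    {V : Type*} [AddCommGroup V] [Module ℂ V] (χ : Representation ℂ (grp ε u ℓ) V) : Prop :=
  ∃ X ∈ lieRing ε u ℓ,
    IsNilpotent (redMat u ℓ 1 X) ∧ redMat u ℓ 1 X ≠ 0 ∧ ¬ IsRegularMatrix (redMat u ℓ 1 X) ∧
    LiesAbove χ (cong (grp ε u ℓ) (ℓ - 1)) (psiLin ψ X)

/-- The inertia group, in `G(o_ℓ)`, of the character `ψ_{A_{ℓ₁}}` of `G(o_ℓ)^{ℓ₂}`, where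
`ℓ₁ = ⌊ℓ / 2⌋` and `ℓ₂ = ℓ - ℓ₁`. -/
def inertia (ε : GroupType) (ψ : AddChar (BigRing u ℓ) ℂ)
    (A : Matrix (Fin 3) (Fin 3) (BigRing u ℓ)) : Subgroup (GL (Fin 3) (BigRing u ℓ)) :=
  stabConj (grp ε u ℓ) (cong (grp ε u ℓ) (ℓ - ℓ / 2)) fun g => psiLin ψ A g

lemma inertia_le (ε : GroupType) (ψ : AddChar (BigRing u ℓ) ℂ)
    (A : Matrix (Fin 3) (Fin 3) (BigRing u ℓ)) : inertia ε ψ A ≤ grp ε u ℓ :=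
  stabConj_le _ _ _

end Nilpotent

end

end NilpotentA2

/-!
The proof is Clifford theory over a chain of congruence subgroups, in which every group is treated
as a group of points of its Lie ring and the two series of groups are treated alike: each is the
group of fixed points of an involution `sig` of `GL_3` over the big ring, its Lie ring is the set of
fixed points of an involution `tau` of the matrices, and points can be lifted along congruences
because congruence subgroups have odd order (`IsUniformized.exists_lift`).

*Heisenberg representations.* Let `N` be the congruence subgroup of level `n₁` of the inertia group,
where `n₁ = m₁` if `m < ℓ₂` and `n₁ = ℓ₁` otherwise. Under the trace against `A`, products of at least
three factors from the Lie algebra of `N` can be rotated cyclically, and products of five vanish.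
Modulo such rotations the Baker–Campbell–Hausdorff series stops at the commutator
(`trace_logm_mul`), so that `q = ψ ∘ tr (A log)` satisfies `q (g h) = q g * q h * β g h` with a
bimultiplicative alternating form `β` (`IsDepth.isQuadraticChar`). As `N` has odd order, inducing an
extension of `q` from a maximal isotropic subgroup gives an irreducible representation `σ` of `N`
whose degree squared is the index of the radical of `β`
(`IsQuadraticChar.exists_heisenberg`). That index is a count of linear conditions: on the
commutant of the leading term of `A` the form is a triple product with the vector `(γ, β, α)`, which
is unimodular after division by `π ^ m` (`IsDepth.relIndex_radical`).

*The choice of `A`.* The restriction of `χ` to the abelian group `G^ℓ₂` contains the character of a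
matrix whose reduction is nilpotent of square zero; by successive approximation it is conjugate to
a matrix in normal form (`IsUniformized.exists_conj_eq_mat`). It remains to obtain `q` on the whole
radical of `β`. If it is known on a deeper part of the radical, then the radical has an
eigenvector in `χ`, and its character differs from `q` by a linear character, which is given by the
trace form; changing the parameters of the normal form by a small amount absorbs this character
(`IsDepth.exists_perturb`). At most two such steps are necessary
(`IsUniformized.exists_eigenvector_psiLog`).

*Extension.* Conjugation by an element that fixes `q` is realised on the space of `σ` by an operator
which is unique up to a scalar and commutes with the involution by which inversion acts. The two
eigenspaces of that involution have dimensions differing by one, so that requiring equal determinants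
on them fixes the scalar and gives a true representation (`IsQuadraticChar.exists_weil`), as for the
Weil representation over a finite field. It extends `σ` to `T N` as soon as `q` on `T ∩ N` extends to
a character of `T` (`IsQuadraticChar.exists_extension`). For `m < ℓ₂` the stabiliser of `σ` has this
form with `T` abelian and commuting with `A`: modulo a power of `π`, the commutant of `A` is spanned
by three commuting matrices (`IsDepth.exists_abelian`). For `m ≥ ℓ₂` one takes `T = J`, on which `q`
factors through the determinant and one further linear character
(`IsDepth.exists_extends_inertia`).

*Induction.* An operator that intertwines conjugates of an extension of `σ` forces the conjugating
element into the stabiliser, which gives irreducibility of the induced representation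
(`indRep_isIrreducible`); Frobenius reciprocity identifies it with `χ`
(`IsDepth.exists_induced_of_lt`, `IsDepth.exists_induced_of_le`).
-/

namespace NilpotentA2

open IsLocalRing Matrix TensorProduct

noncomputable section

/-! ### Representations of finite groups over the complex numbers -/

section Irreducible

variable {G V W : Type*} [Group G] [AddCommGroup V] [Module ℂ V] [AddCommGroup W] [Module ℂ W]

lemma isIrreducible_iff_invariant (ρ : Representation ℂ G V) :
    ρ.IsIrreducible ↔ Nontrivial V ∧
      ∀ U : Submodule ℂ V, (∀ g, ∀ v ∈ U, ρ g v ∈ U) → U = ⊥ ∨ U = ⊤ := by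
  constructor
  · intro h
    refine ⟨?_, fun U hU => ?_⟩
    · by_contra hV
      rw [not_nontrivial_iff_subsingleton] at hV
      obtain ⟨a, b, hab⟩ := h.toNontrivial
      exact hab (Subrepresentation.toSubmodule_injective (Subsingleton.elim _ _))
    · rcases h.eq_bot_or_eq_top (⟨U, hU⟩ : Subrepresentation ρ) with h' | h'
      · left; exact congrArg Subrepresentation.toSubmodule h'
      · right; exact congrArg Subrepresentation.toSubmodule h'
  · rintro ⟨hV, h⟩
    refine { exists_pair_ne := ⟨⊥, ⊤, fun h' => ?_⟩, eq_bot_or_eq_top := fun U => ?_ }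
    · have := congrArg Subrepresentation.toSubmodule h'
      exact bot_ne_top (α := Submodule ℂ V) this
    · rcases h U.toSubmodule (fun g v hv => U.apply_mem_toSubmodule g hv) with h' | h'
      · left; exact Subrepresentation.toSubmodule_injective h'
      · right; exact Subrepresentation.toSubmodule_injective h'

lemma exists_eq_smul_id_of_commute [FiniteDimensional ℂ V] {ρ : Representation ℂ G V}
    (h : ρ.IsIrreducible) (f : V →ₗ[ℂ] V) (hf : ∀ g v, f (ρ g v) = ρ g (f v)) :
    ∃ c : ℂ, f = c • LinearMap.id := by
  obtain ⟨hV, h⟩ := (isIrreducible_iff_invariant ρ).1 h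
  obtain ⟨c, hc⟩ := Module.End.exists_eigenvalue f
  refine ⟨c, ?_⟩
  rcases h (Module.End.eigenspace f c) (fun g v hv => by
    rw [Module.End.mem_eigenspace_iff] at *
    rw [hf, hv, map_smul]) with h' | h'
  · exact absurd h' hc
  · ext v
    have : v ∈ Module.End.eigenspace f c := h' ▸ Submodule.mem_top
    simpa using Module.End.mem_eigenspace_iff.1 this

/-- Commuting operators have a common eigenvector in every non-zero invariant subspace. -/
lemma exists_common_eigenvector [FiniteDimensional ℂ V] (ρ : Representation ℂ G V)
    (E : Submodule ℂ V) (hE : E ≠ ⊥) (hinv : ∀ g, ∀ v ∈ E, ρ g v ∈ E)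
    (hcomm : ∀ g h, ∀ v ∈ E, ρ g (ρ h v) = ρ h (ρ g v)) :
    ∃ v ∈ E, v ≠ 0 ∧ ∃ μ : G →* ℂ, ∀ g, ρ g v = μ g • v := by
  induction hn : Module.finrank ℂ E using Nat.strong_induction_on generalizing E with
  | _ n ih =>
  by_cases hsc : ∀ g, ∃ c : ℂ, ∀ v ∈ E, ρ g v = c • v
  · obtain ⟨v, hv, hv0⟩ := Submodule.exists_mem_ne_zero_of_ne_bot hE
    choose c hc using hsc
    refine ⟨v, hv, hv0, { toFun := c, map_one' := ?_, map_mul' := fun g h => ?_ },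
      fun g => hc g v hv⟩
    · have := hc 1 v hv
      rw [map_one, Module.End.one_apply] at this
      exact (smul_left_injective ℂ hv0 (by simpa using this)).symm
    · refine smul_left_injective ℂ hv0 ?_
      change c (g * h) • v = (c g * c h) • v
      rw [← hc _ v hv, map_mul, Module.End.mul_apply, hc h v hv, map_smul, hc g v hv, smul_smul,
        mul_comm]
  · push Not at hsc
    obtain ⟨g, hg⟩ := hsc
    have : Nontrivial E := Submodule.nontrivial_iff_ne_bot.2 hE
    -- an operator that is not scalar on `E` has a proper eigenspace in `E`, stable under the others
    obtain ⟨c, hc⟩ := Module.End.exists_eigenvalue ((ρ g).restrict (hinv g))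
    obtain ⟨w, hw, hw0⟩ := hc.exists_hasEigenvector
    rw [Module.End.mem_eigenspace_iff] at hw
    have hw' : ρ g (w : V) = c • (w : V) := by
      simpa using congrArg Subtype.val hw
    let F : Submodule ℂ V := E ⊓ Module.End.eigenspace (ρ g) c
    have hF : F ≠ ⊥ := by
      intro hF
      apply hw0
      have : (w : V) ∈ F := ⟨w.2, Module.End.mem_eigenspace_iff.2 hw'⟩
      rw [hF] at this
      exact Subtype.ext (by simpa using this)
    have hlt : F < E := by
      refine lt_of_le_of_ne inf_le_left fun h => ?_
      obtain ⟨v, hv, hv'⟩ := hg c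
      exact hv' (Module.End.mem_eigenspace_iff.1 (inf_eq_left.1 h hv))
    obtain ⟨v, hv, h⟩ := ih _ (hn ▸ Submodule.finrank_lt_finrank_of_lt hlt) F hF
      (fun h v hv => ⟨hinv h v hv.1, Module.End.mem_eigenspace_iff.2 (by
        rw [hcomm _ _ _ hv.1, Module.End.mem_eigenspace_iff.1 hv.2, map_smul])⟩)
      (fun g h v hv => hcomm g h v hv.1) rfl
    exact ⟨v, hv.1, h⟩

/-- Maschke's theorem, as the existence of an equivariant projection. -/
lemma exists_equivariant_projection [Finite G] (ρ : Representation ℂ G V) (U : Submodule ℂ V)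
    (hU : ∀ g, ∀ v ∈ U, ρ g v ∈ U) :
    ∃ e : V →ₗ[ℂ] V, (∀ g v, e (ρ g v) = ρ g (e v)) ∧ (∀ v, e v ∈ U) ∧ ∀ v ∈ U, e v = v := by
  classical
  have := Fintype.ofFinite G
  obtain ⟨p, hp⟩ := LinearMap.exists_leftInverse_of_injective U.subtype U.ker_subtype
  have hp' : ∀ v ∈ U, (p v : V) = v := fun v hv => by
    have := LinearMap.congr_fun hp ⟨v, hv⟩
    simpa using congrArg Subtype.val this
  have hcard : (Fintype.card G : ℂ) ≠ 0 := by simp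
  refine ⟨(Fintype.card G : ℂ)⁻¹ • ∑ g, ρ g ∘ₗ U.subtype ∘ₗ p ∘ₗ ρ g⁻¹, fun g v => ?_, fun v => ?_,
    fun v hv => ?_⟩
  · simp only [LinearMap.smul_apply, LinearMap.sum_apply, LinearMap.comp_apply, map_smul, map_sum]
    congr 1
    refine Fintype.sum_equiv (Equiv.mulLeft g⁻¹) _ _ fun x => ?_
    simp only [Equiv.coe_mulLeft, ← Module.End.mul_apply, ← map_mul, _root_.mul_inv_rev, inv_inv]
    simp [← mul_assoc]
  · simp only [LinearMap.smul_apply, LinearMap.sum_apply, LinearMap.comp_apply]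
    exact U.smul_mem _ (U.sum_mem fun g _ => hU g _ (p _).2)
  · simp only [LinearMap.smul_apply, LinearMap.sum_apply, LinearMap.comp_apply]
    have : ∀ g, ρ g (U.subtype (p (ρ g⁻¹ v))) = v := fun g => by
      rw [Submodule.subtype_apply, hp' _ (hU _ _ hv), ← Module.End.mul_apply, ← map_mul]
      simp
    simp only [this, Finset.sum_const, Finset.card_univ, ← Nat.cast_smul_eq_nsmul ℂ, smul_smul]
    rw [inv_mul_cancel₀ hcard, one_smul]

end Irreducible

section Induced

variable {M : Type*} [Group M] {W : Type*} [AddCommGroup W] [Module ℂ W] {N T : Subgroup M}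
  (hNT : N ≤ T) (σ : Representation ℂ N W)

/-- The element `t⁻¹ ⊗ w` of the induced representation. -/
def indMk (t : T) : W →ₗ[ℂ] Representation.IndV (Subgroup.inclusion hNT) σ :=
  Representation.IndV.mk _ _ t

lemma indRep_indMk (g t : T) (w : W) :
    indRep hNT σ g (indMk hNT σ t w) = indMk hNT σ (t * g⁻¹) w :=
  Representation.ind_mk _ _ _ _ _

lemma indMk_mul (n : N) (t : T) (w : W) :
    indMk hNT σ (Subgroup.inclusion hNT n * t) (σ n w) = indMk hNT σ t w := by
  have := Representation.Coinvariants.mk_self_apply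
    (Representation.tprod ((Representation.leftRegular ℂ T).comp (Subgroup.inclusion hNT)) σ) n
    (MonoidAlgebra.single t 1 ⊗ₜ[ℂ] w)
  simpa [indMk] using this

variable {hNT σ} in
lemma ind_hom_ext {X : Type*} [AddCommGroup X] [Module ℂ X]
    {f g : Representation.IndV (Subgroup.inclusion hNT) σ →ₗ[ℂ] X}
    (h : ∀ t w, f (indMk hNT σ t w) = g (indMk hNT σ t w)) : f = g :=
  Representation.IndV.hom_ext _ _ fun t => LinearMap.ext fun w => h t w

open Classical in
/-- The operators of `σ`, extended by zero to the larger group. -/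
def extendZero (t : T) : W →ₗ[ℂ] W := if h : (t : M) ∈ N then σ ⟨t, h⟩ else 0

lemma extendZero_of_mem (t : T) (h : (t : M) ∈ N) : extendZero σ t = σ ⟨t, h⟩ := dif_pos h

lemma extendZero_of_notMem (t : T) (h : (t : M) ∉ N) : extendZero σ t = 0 := dif_neg h

lemma extendZero_inclusion_mul (n : N) (t : T) (w : W) :
    extendZero σ (Subgroup.inclusion hNT n * t) w = σ n (extendZero σ t w) := by
  by_cases h : (t : M) ∈ N
  · have h' : ((Subgroup.inclusion hNT n * t : T) : M) ∈ N := N.mul_mem n.2 h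
    rw [extendZero_of_mem σ _ h, extendZero_of_mem σ _ h', ← Module.End.mul_apply, ← map_mul]
    rfl
  · have h' : ((Subgroup.inclusion hNT n * t : T) : M) ∉ N := fun h' =>
      h ((N.mul_mem_cancel_left n.2).1 h')
    rw [extendZero_of_notMem σ _ h, extendZero_of_notMem σ _ h']
    simp

lemma extendZero_mul_inclusion (n : N) (t : T) (w : W) :
    extendZero σ (t * Subgroup.inclusion hNT n) w = extendZero σ t (σ n w) := by
  by_cases h : (t : M) ∈ N
  · have h' : ((t * Subgroup.inclusion hNT n : T) : M) ∈ N := N.mul_mem h n.2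
    rw [extendZero_of_mem σ _ h, extendZero_of_mem σ _ h', ← Module.End.mul_apply, ← map_mul]
    rfl
  · have h' : ((t * Subgroup.inclusion hNT n : T) : M) ∉ N := fun h' =>
      h ((N.mul_mem_cancel_right n.2).1 h')
    rw [extendZero_of_notMem σ _ h, extendZero_of_notMem σ _ h']
    simp

/-- A linear map on the induced representation, from a compatible family of linear maps. -/
def indLift {X : Type*} [AddCommGroup X] [Module ℂ X] (f : T → W →ₗ[ℂ] X)
    (hf : ∀ n t w, f (Subgroup.inclusion hNT n * t) (σ n w) = f t w) :
    Representation.IndV (Subgroup.inclusion hNT) σ →ₗ[ℂ] X :=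
  Representation.Coinvariants.lift _
    (TensorProduct.lift <| (Finsupp.lift _ _ _ fun h => f h) ∘ₗ
      (MonoidAlgebra.coeffLinearEquiv ℂ).toLinearMap)
    fun n => by
      ext h x
      simpa using hf n h x

lemma indLift_indMk {X : Type*} [AddCommGroup X] [Module ℂ X] (f : T → W →ₗ[ℂ] X)
    (hf : ∀ n t w, f (Subgroup.inclusion hNT n * t) (σ n w) = f t w) (t : T) (w : W) :
    indLift hNT σ f hf (indMk hNT σ t w) = f t w := by
  simp [indLift, indMk, Representation.IndV.mk]

/-- The value at `x` of an element of the induced representation, when that is viewed as a space of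
`N`-equivariant functions on `T`. -/
def indCoord (x : T) : Representation.IndV (Subgroup.inclusion hNT) σ →ₗ[ℂ] W :=
  indLift hNT σ (fun t => extendZero σ (x * t⁻¹)) fun n t w => by
    rw [← extendZero_mul_inclusion hNT]
    congr 2
    group

lemma indCoord_indMk (x t : T) (w : W) :
    indCoord hNT σ x (indMk hNT σ t w) = extendZero σ (x * t⁻¹) w :=
  indLift_indMk _ _ _ _ _ _

lemma indCoord_indRep (x g : T) (v) :
    indCoord hNT σ x (indRep hNT σ g v) = indCoord hNT σ (x * g) v := by
  refine LinearMap.congr_fun (f := indCoord hNT σ x ∘ₗ indRep hNT σ g) (ind_hom_ext fun t w => ?_) v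
  rw [LinearMap.comp_apply, indRep_indMk, indCoord_indMk, indCoord_indMk]
  simp [mul_assoc]

lemma indCoord_inclusion_mul (n : N) (x : T) (v) :
    indCoord hNT σ (Subgroup.inclusion hNT n * x) v = σ n (indCoord hNT σ x v) := by
  refine LinearMap.congr_fun (g := σ n ∘ₗ indCoord hNT σ x) (ind_hom_ext fun t w => ?_) v
  rw [LinearMap.comp_apply, indCoord_indMk, indCoord_indMk, mul_assoc, extendZero_inclusion_mul]

lemma sum_indMk_indCoord [Fintype T] (v) :
    ∑ x, indMk hNT σ x (indCoord hNT σ x v) = (Nat.card N : ℂ) • v := by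
  classical
  have : Finite N := Finite.of_injective _ (Subgroup.inclusion_injective hNT)
  have := Fintype.ofFinite N
  refine LinearMap.congr_fun (f := ∑ x, indMk hNT σ x ∘ₗ indCoord hNT σ x)
    (g := (Nat.card N : ℂ) • LinearMap.id) (ind_hom_ext fun t w => ?_) v |> fun h => by
      simpa using h
  simp only [LinearMap.sum_apply, LinearMap.comp_apply, indCoord_indMk, LinearMap.smul_apply,
    LinearMap.id_apply]
  have h1 : ∑ x, indMk hNT σ x (extendZero σ (x * t⁻¹) w) =
      ∑ x, indMk hNT σ (x * t) (extendZero σ x w) :=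
    Fintype.sum_equiv (Equiv.mulRight t⁻¹) _ _ fun x => by simp
  have h2 : ∀ n : N, indMk hNT σ (Subgroup.inclusion hNT n * t)
      (extendZero σ (Subgroup.inclusion hNT n) w) = indMk hNT σ t w := fun n => by
    rw [extendZero_of_mem σ (Subgroup.inclusion hNT n) n.2]
    exact indMk_mul hNT σ n t w
  rw [h1, ← Finset.sum_subset (Finset.subset_univ
    (Finset.univ.image (Subgroup.inclusion hNT)))]
  · rw [Finset.sum_image (fun a _ b _ h => Subgroup.inclusion_injective hNT h)]
    simp only [h2, Finset.sum_const, Finset.card_univ, ← Nat.cast_smul_eq_nsmul ℂ,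
      Nat.card_eq_fintype_card]
  · intro x _ hx
    rw [extendZero_of_notMem]
    · simp
    · intro hx'
      exact hx (Finset.mem_image.2 ⟨⟨x, hx'⟩, Finset.mem_univ _, rfl⟩)

lemma indMk_one_injective : Function.Injective (indMk hNT σ 1) := fun v w h => by
  have := congrArg (indCoord hNT σ 1) h
  have h1 : ((1 * 1⁻¹ : T) : M) ∈ N := by simp [N.one_mem]
  rw [indCoord_indMk, indCoord_indMk, extendZero_of_mem σ _ h1] at this
  have h2 : (⟨((1 * 1⁻¹ : T) : M), h1⟩ : N) = 1 := Subtype.ext (by simp)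
  rw [h2, map_one] at this
  simpa using this

lemma indRep_indMk_one (n : N) (w : W) :
    indRep hNT σ (Subgroup.inclusion hNT n) (indMk hNT σ 1 w) = indMk hNT σ 1 (σ n w) := by
  rw [indRep_indMk, ← indMk_mul hNT σ n]
  simp

/-- The coordinates of an element of the induced representation at the chosen representatives of the
cosets. -/
def indCoset [Finite T] : Representation.IndV (Subgroup.inclusion hNT) σ →ₗ[ℂ]
    (Quotient (QuotientGroup.rightRel (N.subgroupOf T)) → W) :=
  LinearMap.pi fun c => indCoord hNT σ c.out

/-- An element of the induced representation is determined by its coordinates at a set of coset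
representatives, and these are arbitrary; hence the dimension is the index times that of `W`. -/
lemma indCoset_bijective [Finite T] : Function.Bijective (indCoset hNT σ) := by
  classical
  have := Fintype.ofFinite T
  have : Finite N := Finite.of_injective _ (Subgroup.inclusion_injective hNT)
  constructor
  · rw [← LinearMap.ker_eq_bot, LinearMap.ker_eq_bot']
    intro v hv
    have h1 : ∀ x : T, indCoord hNT σ x v = 0 := fun x => by
      have h2 : x * (Quotient.out (Quotient.mk (QuotientGroup.rightRel (N.subgroupOf T)) x))⁻¹ ∈
          N.subgroupOf T := by
        have := Quotient.mk_out (s := QuotientGroup.rightRel (N.subgroupOf T)) x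
        exact QuotientGroup.rightRel_apply.1 this
      have h3 := congrFun hv (Quotient.mk _ x)
      have h4 := indCoord_inclusion_mul hNT σ ⟨_, h2⟩
        (Quotient.out (Quotient.mk (QuotientGroup.rightRel (N.subgroupOf T)) x)) v
      have h5 : indCoord hNT σ (Quotient.out (Quotient.mk
        (QuotientGroup.rightRel (N.subgroupOf T)) x)) v = 0 := h3
      rw [h5, map_zero] at h4
      rw [← h4]
      congr 2
      exact Subtype.ext (by simp)
    have h2 := sum_indMk_indCoord hNT σ v
    simp only [h1, map_zero, Finset.sum_const_zero] at h2
    exact (smul_eq_zero.1 h2.symm).resolve_left (by simp [Nat.card_pos.ne'])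
  · intro F
    have : Fintype (Quotient (QuotientGroup.rightRel (N.subgroupOf T))) := Fintype.ofFinite _
    refine ⟨∑ c, indMk hNT σ (Quotient.out c) (F c), funext fun c => ?_⟩
    have h0 : ∀ c', indCoord hNT σ (Quotient.out c) (indMk hNT σ (Quotient.out c') (F c')) =
        if c' = c then F c else 0 := by
      intro c'
      rw [indCoord_indMk]
      split_ifs with h
      · subst h
        have h1 : ((Quotient.out c' * (Quotient.out c')⁻¹ : T) : M) ∈ N := by simp [N.one_mem]
        rw [extendZero_of_mem σ _ h1]
        have h2 : (⟨_, h1⟩ : N) = 1 := Subtype.ext (by simp)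
        rw [h2, map_one]
        rfl
      · rw [extendZero_of_notMem]
        · rfl
        · intro h1
          apply h
          have : (QuotientGroup.rightRel (N.subgroupOf T)) (Quotient.out c') (Quotient.out c) :=
            QuotientGroup.rightRel_apply.2 h1
          have := Quotient.sound this
          simpa using this
    change indCoord hNT σ (Quotient.out c) _ = _
    rw [map_sum]
    simp [h0]

lemma finrank_indV [Finite T] [FiniteDimensional ℂ W] :
    Module.finrank ℂ (Representation.IndV (Subgroup.inclusion hNT) σ) =
      N.relIndex T * Module.finrank ℂ W := by
  have : Fintype (Quotient (QuotientGroup.rightRel (N.subgroupOf T))) := Fintype.ofFinite _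
  rw [(LinearEquiv.ofBijective _ (indCoset_bijective hNT σ)).finrank_eq,
    Module.finrank_pi_fintype, Finset.sum_const, Finset.card_univ, smul_eq_mul,
    ← Nat.card_eq_fintype_card,
    Nat.card_congr (QuotientGroup.quotientRightRelEquivQuotientLeftRel (N.subgroupOf T))]
  rfl

instance [Finite T] [FiniteDimensional ℂ W] :
    FiniteDimensional ℂ (Representation.IndV (Subgroup.inclusion hNT) σ) :=
  (LinearEquiv.ofBijective _ (indCoset_bijective hNT σ)).symm.finiteDimensional

/-- Irreducibility of an induced representation, from the vanishing of the intertwining operators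
between the inducing representation and its conjugates. -/
theorem indRep_isIrreducible [Finite T] [FiniteDimensional ℂ W] (hσ : σ.IsIrreducible)
    (hM : ∀ x ∈ T, x ∉ N → ∀ f : W →ₗ[ℂ] W,
      (∀ d (hd : d ∈ N) (hd' : x * d * x⁻¹ ∈ N) w, f (σ ⟨d, hd⟩ w) = σ ⟨x * d * x⁻¹, hd'⟩ (f w)) →
      f = 0) :
    (indRep hNT σ).IsIrreducible := by
  have := Fintype.ofFinite T
  obtain ⟨hW, -⟩ := (isIrreducible_iff_invariant σ).1 hσ
  refine (isIrreducible_iff_invariant _).2 ⟨(indMk_one_injective hNT σ).nontrivial, fun U hU => ?_⟩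
  -- the projection `e` onto `U` is determined by the operators `φ x` of `W`; these are intertwiners,
  -- hence zero outside `N` and a multiple of `σ x` on `N`, so that `e` is a scalar
  obtain ⟨e, he, heU, heU'⟩ := exists_equivariant_projection (indRep hNT σ) U hU
  let φ : T → W →ₗ[ℂ] W := fun x => indCoord hNT σ x ∘ₗ e ∘ₗ indMk hNT σ 1
  have hφ : ∀ (x : T) (d : N) (d' : N) (_ : (d' : M) = x * d * (x : M)⁻¹) (w : W),
      φ x (σ d w) = σ d' (φ x w) := by
    intro x d d' h w
    simp only [φ, LinearMap.comp_apply]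
    rw [← indRep_indMk_one, he, indCoord_indRep, ← indCoord_inclusion_mul]
    congr 2
    exact Subtype.ext (by simp [h])
  have hφ0 : ∀ x : T, (x : M) ∉ N → φ x = 0 := fun x hx =>
    hM x x.2 hx _ fun d hd hd' w => hφ x ⟨d, hd⟩ ⟨_, hd'⟩ rfl w
  obtain ⟨c, hc⟩ := exists_eq_smul_id_of_commute hσ (φ 1) fun n w => hφ 1 n n (by simp) w
  have hφN : ∀ n : N, ∀ w, φ (Subgroup.inclusion hNT n) w = c • σ n w := fun n w => by
    have : φ (Subgroup.inclusion hNT n) w = σ n (φ 1 w) := by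
      simp only [φ, LinearMap.comp_apply]
      rw [← indCoord_inclusion_mul, mul_one]
    rw [this, hc]
    simp
  have hcard : (Nat.card N : ℂ) ≠ 0 := by
    have : Finite N := Finite.of_injective _ (Subgroup.inclusion_injective hNT)
    simp [Nat.card_pos.ne']
  have he1 : ∀ w, e (indMk hNT σ 1 w) = c • indMk hNT σ 1 w := by
    intro w
    have h1 := sum_indMk_indCoord hNT σ (e (indMk hNT σ 1 w))
    have h2 := sum_indMk_indCoord hNT σ (indMk hNT σ 1 w)
    have h3 : ∀ x : T, indCoord hNT σ x (e (indMk hNT σ 1 w)) =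
        c • indCoord hNT σ x (indMk hNT σ 1 w) := by
      intro x
      change φ x w = _
      rw [indCoord_indMk]
      by_cases hx : (x : M) ∈ N
      · rw [extendZero_of_mem σ _ (by simpa using hx)]
        have := hφN ⟨x, hx⟩ w
        have e1 : (⟨((x * 1⁻¹ : T) : M), by simpa using hx⟩ : N) = ⟨x, hx⟩ := Subtype.ext (by simp)
        rw [e1]
        exact this
      · rw [hφ0 x hx, extendZero_of_notMem σ _ (by simpa using hx)]
        simp
    simp only [h3, map_smul, ← Finset.smul_sum] at h1
    rw [h2, smul_comm] at h1
    exact (smul_right_injective _ hcard h1).symm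
  have he' : e = c • LinearMap.id := ind_hom_ext fun t w => by
    have : indMk hNT σ t w = indRep hNT σ t⁻¹ (indMk hNT σ 1 w) := by
      rw [indRep_indMk]; simp
    rw [this, he, he1]
    simp
  by_cases hU0 : U = ⊥
  · exact Or.inl hU0
  · right
    obtain ⟨u, hu, hu0⟩ := Submodule.exists_mem_ne_zero_of_ne_bot hU0
    have hc1 : c • u = u := by
      have := heU' u hu
      rwa [he'] at this
    have hc0 : c = 1 := smul_left_injective ℂ hu0 (by simpa using hc1)
    rw [eq_top_iff]
    intro v _
    have := heU v
    rw [he', hc0] at this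
    simpa using this

/-- Frobenius reciprocity for irreducible representations: if the induced representation is
irreducible, every irreducible representation with a non-zero equivariant map from the inducing
representation is isomorphic to it. -/
theorem nonempty_equiv_indRep {V : Type*} [AddCommGroup V] [Module ℂ V]
    {χ : Representation ℂ T V} (hχ : χ.IsIrreducible) (hi : (indRep hNT σ).IsIrreducible)
    (f : W →ₗ[ℂ] V) (hf0 : f ≠ 0)
    (hf : ∀ n w, f (σ n w) = χ (Subgroup.inclusion hNT n) (f w)) :
    Nonempty (χ.Equiv (indRep hNT σ)) := by
  let F := indLift hNT σ (fun t => χ t⁻¹ ∘ₗ f) fun n t w => by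
    simp only [LinearMap.comp_apply, hf]
    rw [← Module.End.mul_apply, ← map_mul]
    simp
  have hF : ∀ t w, F (indMk hNT σ t w) = χ t⁻¹ (f w) := fun t w => indLift_indMk _ _ _ _ _ _
  let Φ : Representation.IntertwiningMap (indRep hNT σ) χ :=
    ⟨F, fun g => ind_hom_ext fun t w => by
      simp only [LinearMap.comp_apply, indRep_indMk, hF]
      rw [← Module.End.mul_apply, ← map_mul]
      simp⟩
  have hΦ : Φ ≠ 0 := by
    intro h
    apply hf0
    ext w
    have : F (indMk hNT σ 1 w) = 0 := congrArg (fun Ψ => Ψ (indMk hNT σ 1 w)) h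
    rw [hF] at this
    simpa using this
  exact ⟨(Representation.IntertwiningMap.ofBijective Φ
    ((Representation.IsIrreducible.bijective_or_eq_zero Φ).resolve_right hΦ)).symm⟩

end Induced

/-! ### Heisenberg representations -/

section Heisenberg

variable {M : Type*} [Group M]

/-- The function `q` is a quadratic character of the group `N`: it is multiplicative up to the
bimultiplicative alternating form `β`. -/
structure IsQuadraticChar (N : Subgroup M) (q : M → ℂ) (β : M → M → ℂ) : Prop where
  ne_zero : ∀ g ∈ N, q g ≠ 0
  mul : ∀ g ∈ N, ∀ h ∈ N, q (g * h) = q g * q h * β g h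
  mul_left : ∀ g ∈ N, ∀ h ∈ N, ∀ k ∈ N, β (g * h) k = β g k * β h k
  mul_right : ∀ g ∈ N, ∀ h ∈ N, ∀ k ∈ N, β g (h * k) = β g h * β g k
  self : ∀ g ∈ N, β g g = 1

namespace IsQuadraticChar

variable {N : Subgroup M} {q : M → ℂ} {β : M → M → ℂ} (Q : IsQuadraticChar N q β)
include Q

lemma form_ne_zero {g h : M} (hg : g ∈ N) (hh : h ∈ N) : β g h ≠ 0 := by
  intro h0
  have := Q.mul g hg h hh
  rw [h0, mul_zero] at this
  exact Q.ne_zero _ (N.mul_mem hg hh) this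

lemma form_one_left {h : M} (hh : h ∈ N) : β 1 h = 1 := by
  have := Q.mul_left 1 N.one_mem 1 N.one_mem h hh
  rw [mul_one] at this
  exact (mul_eq_left₀ (Q.form_ne_zero N.one_mem hh)).1 this.symm

lemma form_mul_swap {g h : M} (hg : g ∈ N) (hh : h ∈ N) : β g h * β h g = 1 := by
  have h1 := Q.self _ (N.mul_mem hg hh)
  rw [Q.mul_left g hg h hh _ (N.mul_mem hg hh), Q.mul_right g hg g hg h hh,
    Q.mul_right h hh g hg h hh, Q.self g hg, Q.self h hh] at h1
  simpa using h1

lemma form_inv_left {g h : M} (hg : g ∈ N) (hh : h ∈ N) : β g⁻¹ h = (β g h)⁻¹ := by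
  refine eq_inv_of_mul_eq_one_left ?_
  rw [← Q.mul_left _ (N.inv_mem hg) _ hg _ hh, inv_mul_cancel, Q.form_one_left hh]

lemma form_swap {g h : M} (hg : g ∈ N) (hh : h ∈ N) : β h g = (β g h)⁻¹ := by
  refine eq_inv_of_mul_eq_one_left ?_
  rw [Q.form_mul_swap hh hg]

lemma map_one : q 1 = 1 := by
  have := Q.mul 1 N.one_mem 1 N.one_mem
  rw [mul_one, Q.self 1 N.one_mem, mul_one] at this
  exact (mul_eq_left₀ (Q.ne_zero 1 N.one_mem)).1 this.symm

/-- Conjugation inside the group changes a quadratic character by the square of its form. -/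
lemma map_conj {g h : M} (hg : g ∈ N) (hh : h ∈ N) : q (g * h * g⁻¹) = q h * β g h ^ 2 := by
  have hc : g * h * g⁻¹ ∈ N := N.mul_mem (N.mul_mem hg hh) (N.inv_mem hg)
  have h1 := Q.mul _ hc g hg
  rw [inv_mul_cancel_right, Q.mul g hg h hh, Q.mul_left _ (N.mul_mem hg hh) _ (N.inv_mem hg) g hg,
    Q.mul_left g hg h hh g hg, Q.form_inv_left hg hg, Q.self g hg, Q.form_swap hg hh] at h1
  have h2 := Q.form_ne_zero hg hh
  have h3 := Q.ne_zero g hg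
  field_simp at h1
  linear_combination -h1

lemma form_conj_left {g h k : M} (hg : g ∈ N) (hh : h ∈ N) (hk : k ∈ N) :
    β (g * h * g⁻¹) k = β h k := by
  rw [Q.mul_left _ (N.mul_mem hg hh) _ (N.inv_mem hg) _ hk, Q.mul_left g hg h hh k hk,
    Q.form_inv_left hg hk]
  field_simp [Q.form_ne_zero hg hk]

/-- The radical of the form of a quadratic character. -/
def radical : Subgroup M where
  carrier := {r | r ∈ N ∧ ∀ h ∈ N, β r h = 1}
  mul_mem' := fun {a b} ha hb => ⟨N.mul_mem ha.1 hb.1, fun h hh => by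
    rw [Q.mul_left _ ha.1 _ hb.1 _ hh, ha.2 h hh, hb.2 h hh, mul_one]⟩
  one_mem' := ⟨N.one_mem, fun h hh => Q.form_one_left hh⟩
  inv_mem' := fun {a} ha => ⟨N.inv_mem ha.1, fun h hh => by
    rw [Q.form_inv_left ha.1 hh, ha.2 h hh, inv_one]⟩

lemma mem_radical {r : M} : r ∈ Q.radical ↔ r ∈ N ∧ ∀ h ∈ N, β r h = 1 := Iff.rfl

lemma radical_le : Q.radical ≤ N := fun _ h => h.1

lemma map_radical_mul {r h : M} (hr : r ∈ Q.radical) (hh : h ∈ N) : q (r * h) = q r * q h := by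
  rw [Q.mul _ hr.1 _ hh, hr.2 _ hh, mul_one]

lemma form_radical_right {r h : M} (hr : r ∈ Q.radical) (hh : h ∈ N) : β h r = 1 := by
  rw [Q.form_swap hr.1 hh, hr.2 _ hh, inv_one]

lemma conj_mem_radical {g r : M} (hg : g ∈ N) (hr : r ∈ Q.radical) :
    g * r * g⁻¹ ∈ Q.radical :=
  ⟨N.mul_mem (N.mul_mem hg hr.1) (N.inv_mem hg), fun h hh => by
    rw [Q.form_conj_left hg hr.1 hh, hr.2 h hh]⟩

lemma commutator_mem_radical {g h : M} (hg : g ∈ N) (hh : h ∈ N) :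
    g * h * g⁻¹ * h⁻¹ ∈ Q.radical :=
  ⟨N.mul_mem (N.mul_mem (N.mul_mem hg hh) (N.inv_mem hg)) (N.inv_mem hh), fun k hk => by
    rw [Q.mul_left _ (N.mul_mem (N.mul_mem hg hh) (N.inv_mem hg)) _ (N.inv_mem hh) _ hk,
      Q.form_conj_left hg hh hk, Q.form_inv_left hh hk, mul_inv_cancel₀ (Q.form_ne_zero hh hk)]⟩

lemma map_commutator {g h : M} (hg : g ∈ N) (hh : h ∈ N) :
    q (g * h * g⁻¹ * h⁻¹) = β g h ^ 2 := by
  have h1 := Q.map_radical_mul (Q.commutator_mem_radical hg hh) hh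
  rw [inv_mul_cancel_right, Q.map_conj hg hh, mul_comm] at h1
  exact (mul_right_cancel₀ (Q.ne_zero h hh) h1).symm

lemma form_eq_one_of_sq [Finite M] (hodd : Odd (Nat.card N)) {g h : M} (hg : g ∈ N) (hh : h ∈ N)
    (h2 : β g h ^ 2 = 1) : β g h = 1 := by
  have key : ∀ n : ℕ, β (g ^ n) h = β g h ^ n := fun n => by
    induction n with
    | zero => simp [Q.form_one_left hh]
    | succ n ih => rw [pow_succ, Q.mul_left _ (N.pow_mem hg n) _ hg _ hh, ih, pow_succ]
  have h3 := key (Nat.card N)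
  have h4 : g ^ Nat.card N = 1 := by
    exact congrArg Subtype.val (pow_card_eq_one' (x := (⟨g, hg⟩ : N)))
  rw [h4, Q.form_one_left hh] at h3
  obtain ⟨k, hk⟩ := hodd
  rw [hk, pow_succ, pow_mul, h2, one_pow, one_mul] at h3
  exact h3.symm

/-- A maximal isotropic subgroup is its own orthogonal complement. -/
lemma exists_lagrangian [Finite M] : ∃ L : Subgroup M, Q.radical ≤ L ∧ L ≤ N ∧
    (∀ a ∈ L, ∀ b ∈ L, β a b = 1) ∧ ∀ n ∈ N, (∀ l ∈ L, β n l = 1) → n ∈ L := by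
  have hfin : {L : Subgroup M | Q.radical ≤ L ∧ L ≤ N ∧ ∀ a ∈ L, ∀ b ∈ L, β a b = 1}.Finite :=
    Set.toFinite _
  obtain ⟨L, ⟨hL1, hL2, hL3⟩, hmax⟩ := hfin.exists_maximal
    ⟨Q.radical, le_refl _, Q.radical_le, fun a ha b hb => ha.2 b hb.1⟩
  refine ⟨L, hL1, hL2, hL3, fun n hn hnL => ?_⟩
  have perp : ∀ X : Set M, X ⊆ N → ∃ C : Subgroup M, ∀ y, y ∈ C ↔ y ∈ N ∧ ∀ x ∈ X, β y x = 1 :=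
    fun X hX => ⟨{
      carrier := {y | y ∈ N ∧ ∀ x ∈ X, β y x = 1}
      mul_mem' := fun {a b} ha hb => ⟨N.mul_mem ha.1 hb.1, fun x hx => by
        rw [Q.mul_left _ ha.1 _ hb.1 _ (hX hx), ha.2 x hx, hb.2 x hx, mul_one]⟩
      one_mem' := ⟨N.one_mem, fun x hx => Q.form_one_left (hX hx)⟩
      inv_mem' := fun {a} ha => ⟨N.inv_mem ha.1, fun x hx => by
        rw [Q.form_inv_left ha.1 (hX hx), ha.2 x hx, inv_one]⟩ }, fun y => Iff.rfl⟩
  let X : Set M := insert n L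
  have hXN : X ⊆ N := Set.insert_subset hn hL2
  have hX : ∀ x ∈ X, ∀ y ∈ X, β x y = 1 := by
    rintro x (rfl | hx) y (rfl | hy)
    · exact Q.self _ hn
    · exact hnL y hy
    · rw [Q.form_swap hn (hL2 hx), hnL x hx, inv_one]
    · exact hL3 x hx y hy
  obtain ⟨C, hC⟩ := perp X hXN
  have h1 : Subgroup.closure X ≤ C :=
    (Subgroup.closure_le _).2 fun x hx => (hC x).2 ⟨hXN hx, hX x hx⟩
  have hcN : Subgroup.closure X ≤ N := (Subgroup.closure_le _).2 hXN
  obtain ⟨C', hC'⟩ := perp (Subgroup.closure X) hcN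
  have h2 : Subgroup.closure X ≤ C' := (Subgroup.closure_le _).2 fun x hx =>
    (hC' x).2 ⟨hXN hx, fun y hy => by
      rw [Q.form_swap (hcN hy) (hXN hx), ((hC y).1 (h1 hy)).2 x hx, inv_one]⟩
  have hle : L ≤ Subgroup.closure X := fun x hx =>
    Subgroup.subset_closure (Set.mem_insert_of_mem _ hx)
  exact hmax ⟨hL1.trans hle, hcN, fun a ha b hb => ((hC' a).1 (h2 ha)).2 b hb⟩ hle
    (Subgroup.subset_closure (Set.mem_insert _ _))

open Classical in
/-- The sum of the values of a bimultiplicative form along a subgroup. -/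
lemma sum_form_eq_ite {L : Subgroup M} [Fintype L] (hL : L ≤ N) {n : M} (hn : n ∈ N) :
    ∑ l : L, β n l = if ∀ l ∈ L, β n l = 1 then (Nat.card L : ℂ) else 0 := by
  split_ifs with h
  · simp [h]
  · push Not at h
    obtain ⟨l₀, hl₀, hne⟩ := h
    have h1 : β n l₀ * ∑ l : L, β n l = ∑ l : L, β n l := by
      rw [Finset.mul_sum]
      refine Fintype.sum_equiv (Equiv.mulLeft ⟨l₀, hl₀⟩) _ _ fun l => ?_
      exact (Q.mul_right n hn l₀ (hL hl₀) l (hL l.2)).symm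
    have h2 : (β n l₀ - 1) * ∑ l : L, β n l = 0 := by rw [sub_mul, h1, one_mul, sub_self]
    exact (mul_eq_zero.1 h2).resolve_left (sub_ne_zero.2 hne)

open Classical in
lemma sum_form_radical [Fintype N] {n : M} (hn : n ∈ N) :
    ∑ g : N, β g n = if n ∈ Q.radical then (Nat.card N : ℂ) else 0 := by
  have h1 : ∀ g : N, β g n = β n⁻¹ g := fun g => by
    rw [Q.form_inv_left hn g.2, Q.form_swap hn g.2]
  simp only [h1]
  rw [Q.sum_form_eq_ite le_rfl (N.inv_mem hn)]
  congr 1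
  rw [← inv_mem_iff (x := n), Q.mem_radical]
  simp [hn]

/-- Summing `β` over `N × L` in both orders, with orthogonality of characters: `L` is its own orthogonal
complement, and the orthogonal complement of `N` is the radical. -/
lemma card_lagrangian_sq [Finite M] {L : Subgroup M} (hR : Q.radical ≤ L) (hL : L ≤ N)
    (hiso : ∀ a ∈ L, ∀ b ∈ L, β a b = 1)
    (hmax : ∀ n ∈ N, (∀ l ∈ L, β n l = 1) → n ∈ L) :
    Nat.card L ^ 2 = Nat.card N * Nat.card Q.radical := by
  classical
  have := Fintype.ofFinite M
  have h1 : ∑ g : N, ∑ l : L, β g l = (Nat.card L : ℂ) * Nat.card L := by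
    have : ∀ g : N, ∑ l : L, β g l = if (g : M) ∈ L then (Nat.card L : ℂ) else 0 := fun g => by
      rw [Q.sum_form_eq_ite hL g.2]
      congr 1
      exact propext ⟨hmax g g.2, fun h => hiso g h⟩
    rw [Finset.sum_congr rfl fun g _ => this g, ← Finset.sum_filter, Finset.sum_const, nsmul_eq_mul]
    congr 2
    rw [Nat.card_eq_fintype_card, Fintype.card_subtype]
    refine Finset.card_bij (fun g _ => (g : M)) ?_ ?_ ?_
    · intro g hg; simpa using hg
    · intro a _ b _ h; exact Subtype.ext h
    · intro b hb
      have hb' : b ∈ L := by simpa using hb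
      exact ⟨⟨b, hL hb'⟩, by simpa using hb', rfl⟩
  have h2 : ∑ g : N, ∑ l : L, β g l = (Nat.card N : ℂ) * Nat.card Q.radical := by
    rw [Finset.sum_comm]
    rw [Finset.sum_congr rfl fun l _ => Q.sum_form_radical (hL l.2), ← Finset.sum_filter,
      Finset.sum_const, nsmul_eq_mul, mul_comm]
    congr 2
    rw [Nat.card_eq_fintype_card, Fintype.card_subtype]
    refine Finset.card_bij (fun g _ => (g : M)) ?_ ?_ ?_
    · intro g hg; simpa using hg
    · intro a _ b _ h; exact Subtype.ext h
    · intro b hb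
      have hb' : b ∈ Q.radical := by simpa using hb
      exact ⟨⟨b, hR hb'⟩, by simpa using hb', rfl⟩
  rw [h1] at h2
  rw [sq]
  exact_mod_cast h2

lemma relIndex_lagrangian_sq [Finite M] {L : Subgroup M} (hR : Q.radical ≤ L) (hL : L ≤ N)
    (hiso : ∀ a ∈ L, ∀ b ∈ L, β a b = 1)
    (hmax : ∀ n ∈ N, (∀ l ∈ L, β n l = 1) → n ∈ L) :
    L.relIndex N ^ 2 = Q.radical.relIndex N := by
  have h1 := Q.card_lagrangian_sq hR hL hiso hmax
  have h2 : Nat.card L * L.relIndex N = Nat.card N := by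
    rw [← Subgroup.relIndex_bot_left, ← Subgroup.relIndex_bot_left]
    exact Subgroup.relIndex_mul_relIndex _ _ _ bot_le hL
  have h3 : Nat.card Q.radical * Q.radical.relIndex N = Nat.card N := by
    rw [← Subgroup.relIndex_bot_left, ← Subgroup.relIndex_bot_left]
    exact Subgroup.relIndex_mul_relIndex _ _ _ bot_le Q.radical_le
  have h4 : 0 < Nat.card Q.radical := Nat.card_pos
  have h5 : 0 < Nat.card N := Nat.card_pos
  have h6 : Nat.card N * Nat.card Q.radical * L.relIndex N ^ 2 =
      Nat.card N * Nat.card Q.radical * Q.radical.relIndex N := by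
    rw [← h1, ← mul_pow, h2, h1, mul_assoc, h3, sq]
  exact Nat.eq_of_mul_eq_mul_left (Nat.mul_pos h5 h4) h6

end IsQuadraticChar

end Heisenberg

section Transport

variable {G V W : Type*} [Group G] [AddCommGroup V] [Module ℂ V] [AddCommGroup W] [Module ℂ W]

/-- The transport of a representation along a linear isomorphism. -/
def transportRep (e : V ≃ₗ[ℂ] W) (ρ : Representation ℂ G V) : Representation ℂ G W where
  toFun g := e.toLinearMap ∘ₗ ρ g ∘ₗ e.symm.toLinearMap
  map_one' := by ext; simp
  map_mul' g h := by ext; simp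

lemma transportRep_apply (e : V ≃ₗ[ℂ] W) (ρ : Representation ℂ G V) (g : G) (w : W) :
    transportRep e ρ g w = e (ρ g (e.symm w)) := rfl

/-- A representation is equivalent to its transports. -/
def transportRepEquiv (e : V ≃ₗ[ℂ] W) (ρ : Representation ℂ G V) :
    (transportRep e ρ).Equiv ρ :=
  Representation.Equiv.mk e.symm fun g => by ext; simp [transportRep]

lemma isIrreducible_transportRep (e : V ≃ₗ[ℂ] W) {ρ : Representation ℂ G V}
    (h : ρ.IsIrreducible) : (transportRep e ρ).IsIrreducible := by
  rw [isIrreducible_iff_invariant] at *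
  obtain ⟨hV, h⟩ := h
  refine ⟨e.symm.toEquiv.nontrivial, fun U hU => ?_⟩
  rcases h (U.comap e.toLinearMap) (fun g v hv => by
    have := hU g _ hv
    rw [transportRep_apply] at this
    simpa using this) with h' | h'
  · left
    rw [eq_bot_iff]
    intro w hw
    have : e.symm w ∈ U.comap e.toLinearMap := by simpa using hw
    rw [h'] at this
    simpa using this
  · right
    rw [eq_top_iff]
    intro w _
    have : e.symm w ∈ U.comap e.toLinearMap := h' ▸ Submodule.mem_top
    simpa using this

lemma linRep_isIrreducible (lam : G →* ℂ) : (linRep lam).IsIrreducible := by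
  rw [isIrreducible_iff_invariant]
  exact ⟨inferInstance, fun U _ => eq_bot_or_eq_top U⟩

end Transport

section HeisenbergExistence

variable {M : Type*} [Group M]

lemma IsMonomialAbove.mono {W : Type*} [AddCommGroup W] [Module ℂ W] {N : Subgroup M}
    {σ : Representation ℂ N W} {K K' : Subgroup M} {f : M → ℂ} (h : IsMonomialAbove σ K f)
    (hK : K' ≤ K) : IsMonomialAbove σ K' f := by
  obtain ⟨h1, h2, h3, L, hLN, lam, h4, h5, h6⟩ := h
  exact ⟨h1, hK.trans h2, fun g hg hgK => h3 g hg (hK hgK), L, hLN, lam, hK.trans h4,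
    fun g hg hgK => h5 g hg (hK hgK), h6⟩

variable {N : Subgroup M} {q : M → ℂ} {β : M → M → ℂ}

/-- The Heisenberg representation of a quadratic character: the representation induced from an
extension of the quadratic character to a maximal isotropic subgroup. It occurs in every
representation with an eigenvector of the radical for the quadratic character. -/
theorem IsQuadraticChar.exists_heisenberg (Q : IsQuadraticChar N q β) [Finite M]
    (hodd : Odd (Nat.card N)) {V : Type*} [AddCommGroup V] [Module ℂ V] [FiniteDimensional ℂ V]
    (χ : Representation ℂ N V) (v : V) (hv : v ≠ 0)
    (hvR : ∀ r : N, (r : M) ∈ Q.radical → χ r v = q r • v)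
    {d : ℕ} (hd : d ^ 2 = Q.radical.relIndex N) :
    ∃ σ : Representation ℂ N (Fin d → ℂ), IsMonomialAbove σ Q.radical q ∧
      ∃ f : (Fin d → ℂ) →ₗ[ℂ] V, f ≠ 0 ∧ ∀ n w, f (σ n w) = χ n (f w) := by
  obtain ⟨L, hRL, hLN, hiso, hmax⟩ := Q.exists_lagrangian
  have hd' : L.relIndex N = d := by
    have := Q.relIndex_lagrangian_sq hRL hLN hiso hmax
    rw [← hd] at this
    exact (Nat.pow_left_injective (by norm_num : 2 ≠ 0)) this
  -- the eigenspace of the radical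
  let E : Submodule ℂ V :=
    { carrier := {v | ∀ r : N, (r : M) ∈ Q.radical → χ r v = q r • v}
      add_mem' := fun ha hb r hr => by rw [map_add, ha r hr, hb r hr, smul_add]
      zero_mem' := fun r _ => by rw [map_zero, smul_zero]
      smul_mem' := fun c x hx r hr => by rw [map_smul, hx r hr, smul_comm] }
  have hE : E ≠ ⊥ := fun h => hv (by
    have : v ∈ E := hvR
    rw [h] at this
    simpa using this)
  -- `L` normalises the radical and preserves `E`; its commutators lie in the radical and act
  -- trivially on `E`, since `L` is isotropic
  let χL : Representation ℂ L V := χ.comp (Subgroup.inclusion hLN)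
  obtain ⟨u, hu, hu0, lam, hlam⟩ := exists_common_eigenvector χL E hE
    (fun l w hw r hr => by
      have hc : (l : M)⁻¹ * r * (l : M)⁻¹⁻¹ ∈ Q.radical :=
        Q.conj_mem_radical (N.inv_mem (hLN l.2)) hr
      have e1 : r * Subgroup.inclusion hLN l =
          Subgroup.inclusion hLN l * ⟨_, Q.radical_le hc⟩ := Subtype.ext (by simp [mul_assoc])
      change χ r (χ (Subgroup.inclusion hLN l) w) = q r • χ (Subgroup.inclusion hLN l) w
      rw [← Module.End.mul_apply, ← map_mul, e1, map_mul, Module.End.mul_apply, hw _ hc, map_smul]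
      congr 1
      rw [Q.map_conj (N.inv_mem (hLN l.2)) r.2, Q.form_radical_right hr (N.inv_mem (hLN l.2))]
      simp)
    (fun g h w hw => by
      have hg := N.inv_mem (hLN g.2)
      have hh := N.inv_mem (hLN h.2)
      have hc := Q.commutator_mem_radical hg hh
      have e1 : Subgroup.inclusion hLN g * Subgroup.inclusion hLN h =
          Subgroup.inclusion hLN h * Subgroup.inclusion hLN g * ⟨_, Q.radical_le hc⟩ :=
        Subtype.ext (by simp [mul_assoc])
      change χ (Subgroup.inclusion hLN g) (χ (Subgroup.inclusion hLN h) w) =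
        χ (Subgroup.inclusion hLN h) (χ (Subgroup.inclusion hLN g) w)
      rw [← Module.End.mul_apply, ← map_mul, e1, map_mul, Module.End.mul_apply, hw _ hc,
        Q.map_commutator hg hh, hiso _ (L.inv_mem g.2) _ (L.inv_mem h.2)]
      simp)
  have hlamR : ∀ l : L, (l : M) ∈ Q.radical → lam l = q l := fun l hl => by
    have h1 := hu (Subgroup.inclusion hLN l) hl
    have h2 := hlam l
    exact smul_left_injective ℂ hu0 (h2.symm.trans h1)
  have hlam0 : ∀ l : L, lam l ≠ 0 := fun l h => by
    have : lam l * lam l⁻¹ = 1 := by rw [← map_mul]; simp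
    rw [h, zero_mul] at this
    exact zero_ne_one this
  -- `L` is normal in `N`, and conjugation by `n` multiplies `lam` by `β n l ^ 2`
  have hconj : ∀ n ∈ N, ∀ l (hl : l ∈ L), ∃ hl' : n * l * n⁻¹ ∈ L,
      lam ⟨n * l * n⁻¹, hl'⟩ = β n l ^ 2 * lam ⟨l, hl⟩ := fun n hn l hl => by
    have hc := Q.commutator_mem_radical hn (hLN hl)
    have e : n * l * n⁻¹ = (n * l * n⁻¹ * l⁻¹) * l := by group
    have hl' : n * l * n⁻¹ ∈ L := e ▸ L.mul_mem (hRL hc) hl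
    refine ⟨hl', ?_⟩
    have e' : (⟨n * l * n⁻¹, hl'⟩ : L) = ⟨_, hRL hc⟩ * ⟨l, hl⟩ := Subtype.ext e
    rw [e', map_mul, hlamR _ hc, Q.map_commutator hn (hLN hl)]
  have hirr : (indRep hLN (linRep lam)).IsIrreducible := by
    -- outside `L` the conjugate of `lam` is another character, since `N` has odd order
    refine indRep_isIrreducible hLN _ (linRep_isIrreducible lam) fun x hx hxL f hf => ?_
    obtain ⟨l, hl, hne⟩ : ∃ l ∈ L, β x l ≠ 1 := by
      by_contra hcon
      push Not at hcon
      exact hxL (hmax x hx hcon)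
    obtain ⟨hl', he⟩ := hconj x hx l hl
    ext
    have h1 := hf l hl hl' 1
    simp only [linRep, MonoidHom.coe_mk, OneHom.coe_mk, LinearMap.smul_apply, LinearMap.id_apply,
      map_smul, he] at h1
    have h2 : (β x l ^ 2 - 1) * lam ⟨l, hl⟩ * f 1 = 0 := by
      simp only [smul_eq_mul] at h1
      linear_combination -h1
    rcases mul_eq_zero.1 h2 with h2 | h2
    · rcases mul_eq_zero.1 h2 with h2 | h2
      · exact absurd (Q.form_eq_one_of_sq hodd hx (hLN hl) (sub_eq_zero.1 h2)) hne
      · exact absurd h2 (hlam0 _)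
    · simpa using h2
  have hfr : Module.finrank ℂ (Representation.IndV (Subgroup.inclusion hLN) (linRep lam)) =
      Module.finrank ℂ (Fin d → ℂ) := by
    rw [finrank_indV, hd']
    simp
  let e := LinearEquiv.ofFinrankEq _ _ hfr
  refine ⟨transportRep e (indRep hLN (linRep lam)), ⟨isIrreducible_transportRep e hirr,
    Q.radical_le, ?_, L, hLN, lam, hRL, fun g hg hgR => hlamR ⟨g, hg⟩ hgR,
    ⟨transportRepEquiv e _⟩⟩, ?_⟩
  · intro g hg hgR
    -- the radical acts by `q`, since `lam` takes the value `q g` on all conjugates of `g`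
    have h1 : indRep hLN (linRep lam) ⟨g, hg⟩ = q g • LinearMap.id := ind_hom_ext fun t w => by
      obtain ⟨hl', he⟩ := hconj t t.2 g (hRL hgR)
      rw [indRep_indMk]
      have e1 : t * (⟨g, hg⟩ : N)⁻¹ = Subgroup.inclusion hLN (⟨_, hl'⟩)⁻¹ * t :=
        Subtype.ext (by simp [mul_assoc])
      have h2 : w = linRep lam (⟨_, hl'⟩)⁻¹ (linRep lam ⟨_, hl'⟩ w) := by
        rw [← Module.End.mul_apply, ← map_mul]; simp
      rw [e1]
      nth_rw 1 [h2]
      rw [indMk_mul]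
      have h3 : linRep lam ⟨_, hl'⟩ w = q g • w := by
        simp only [linRep, MonoidHom.coe_mk, OneHom.coe_mk, LinearMap.smul_apply,
          LinearMap.id_apply, he]
        rw [Q.form_radical_right hgR t.2, hlamR _ hgR]
        simp
      rw [h3, map_smul]
      rfl
    refine LinearMap.ext fun w => ?_
    rw [transportRep_apply, h1]
    simp
  · -- Frobenius reciprocity: the eigenvector `u` of `L` gives an equivariant map to `V`
    let F := indLift hLN (linRep lam)
      (fun t => χ t⁻¹ ∘ₗ LinearMap.toSpanSingleton ℂ V u) fun n t w => by
        have h1 := hlam n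
        change χ (Subgroup.inclusion hLN n) u = lam n • u at h1
        simp only [LinearMap.comp_apply, LinearMap.toSpanSingleton_apply, linRep, MonoidHom.coe_mk,
          OneHom.coe_mk, LinearMap.smul_apply, LinearMap.id_apply, map_smul, smul_eq_mul]
        rw [mul_comm, mul_smul, ← map_smul _ (lam n), ← h1, ← Module.End.mul_apply, ← map_mul]
        simp
    have hF : ∀ t w, F (indMk hLN (linRep lam) t w) = w • χ t⁻¹ u := fun t w => by
      simp [F, indLift_indMk]
    have hFe : ∀ n x, F (indRep hLN (linRep lam) n x) = χ n (F x) := fun n x => by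
      refine LinearMap.congr_fun (f := F ∘ₗ indRep hLN (linRep lam) n) (g := χ n ∘ₗ F)
        (ind_hom_ext fun t w => ?_) x
      simp only [LinearMap.comp_apply, indRep_indMk, hF, map_smul]
      rw [← Module.End.mul_apply, ← map_mul]
      simp
    refine ⟨F ∘ₗ e.symm.toLinearMap, fun h => hu0 ?_, fun n w => ?_⟩
    · have h1 := LinearMap.congr_fun h (e (indMk hLN (linRep lam) 1 1))
      simp only [LinearMap.comp_apply, LinearEquiv.coe_coe, LinearEquiv.symm_apply_apply, hF] at h1
      simpa using h1
    · simp only [LinearMap.comp_apply, LinearEquiv.coe_coe, transportRep_apply,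
        LinearEquiv.symm_apply_apply, hFe]

end HeisenbergExistence

/-! ### Extension of Heisenberg representations -/

section DetRatio

variable {W : Type*} [AddCommGroup W] [Module ℂ W]

lemma commute_mapsTo_ker {ε T : W →ₗ[ℂ] W} (h : ε * T = T * ε) (c : ℂ) :
    ∀ w ∈ LinearMap.ker (ε - c • LinearMap.id), T w ∈ LinearMap.ker (ε - c • LinearMap.id) := by
  intro w hw
  have hw' : ε w = c • w := by simpa [sub_eq_zero] using hw
  have h1 : ε (T w) = T (ε w) := LinearMap.congr_fun h w
  simp [h1, hw']

/-- The determinant of `T` on the `c`-eigenspace of `ε`. -/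
def detOn (ε : W →ₗ[ℂ] W) (c : ℂ) (T : W →ₗ[ℂ] W) (h : ε * T = T * ε) : ℂ :=
  LinearMap.det (T.restrict (commute_mapsTo_ker h c))

lemma detOn_mul {ε : W →ₗ[ℂ] W} (c : ℂ) {S T : W →ₗ[ℂ] W} (hS : ε * S = S * ε)
    (hT : ε * T = T * ε) (hST : ε * (S * T) = S * T * ε) :
    detOn ε c (S * T) hST = detOn ε c S hS * detOn ε c T hT := by
  unfold detOn
  rw [← LinearMap.det_comp]
  rfl

lemma detOn_smul {ε : W →ₗ[ℂ] W} (c a : ℂ) {T : W →ₗ[ℂ] W} (hT : ε * T = T * ε)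
    (haT : ε * (a • T) = a • T * ε) :
    detOn ε c (a • T) haT =
      a ^ Module.finrank ℂ (LinearMap.ker (ε - c • LinearMap.id)) * detOn ε c T hT := by
  unfold detOn
  rw [← LinearMap.det_smul]
  rfl

lemma detOn_one {ε : W →ₗ[ℂ] W} (c : ℂ) (h : ε * 1 = 1 * ε) : detOn ε c 1 h = 1 := by
  unfold detOn
  have : (1 : W →ₗ[ℂ] W).restrict (commute_mapsTo_ker h c) = LinearMap.id := rfl
  rw [this, LinearMap.det_id]

/-- An involution of trace one has eigenspaces whose dimensions differ by one. -/
lemma finrank_ker_sub_of_trace_eq_one [FiniteDimensional ℂ W] {ε : W →ₗ[ℂ] W} (h2 : ε * ε = 1)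
    (htr : LinearMap.trace ℂ W ε = 1) :
    Module.finrank ℂ (LinearMap.ker (ε - (1 : ℂ) • LinearMap.id)) =
      Module.finrank ℂ (LinearMap.ker (ε - (-1 : ℂ) • LinearMap.id)) + 1 := by
  have h2' : ∀ w, ε (ε w) = w := fun w => LinearMap.congr_fun h2 w
  have key : ∀ c : ℂ, c * c = 1 → (Module.finrank ℂ (LinearMap.ker (ε - c • LinearMap.id)) : ℂ) =
      (1 / 2) * (Module.finrank ℂ W + c) := by
    intro c hc
    have hproj : LinearMap.IsProj (LinearMap.ker (ε - c • LinearMap.id))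
        ((1 / 2 : ℂ) • (LinearMap.id + c • ε)) := by
      constructor
      · intro w
        simp only [LinearMap.mem_ker, LinearMap.sub_apply, LinearMap.smul_apply,
          LinearMap.add_apply, LinearMap.id_apply, map_smul, map_add, h2']
        rw [smul_sub c, smul_smul c c, hc, one_smul]
        simp
      · intro w hw
        have hw' : ε w = c • w := by simpa [sub_eq_zero] using hw
        simp only [LinearMap.smul_apply, LinearMap.add_apply, LinearMap.id_apply, hw', smul_smul,
          hc, one_smul]
        rw [← two_smul ℂ, smul_smul]
        norm_num
    rw [← hproj.trace, map_smul, map_add, map_smul, htr, LinearMap.trace_id]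
    simp
  have h1 := key 1 (by norm_num)
  have h3 := key (-1) (by norm_num)
  have : (Module.finrank ℂ (LinearMap.ker (ε - (1 : ℂ) • LinearMap.id)) : ℂ) =
      Module.finrank ℂ (LinearMap.ker (ε - (-1 : ℂ) • LinearMap.id)) + 1 := by
    rw [h1, h3]; ring
  exact_mod_cast this

end DetRatio

section Weil

variable {M : Type*} [Group M] {N : Subgroup M} {q : M → ℂ} {β : M → M → ℂ}
  {W : Type*} [AddCommGroup W] [Module ℂ W]

namespace IsQuadraticChar

variable (Q : IsQuadraticChar N q β) {σ : Representation ℂ N W}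
  (hσR : ∀ r : N, (r : M) ∈ Q.radical → σ r = q r • LinearMap.id)
include Q hσR

/-- The character of a Heisenberg representation vanishes outside the radical. -/
lemma trace_eq_zero_of_notMem_radical [Finite M] (hodd : Odd (Nat.card N)) (n : N)
    (hn : (n : M) ∉ Q.radical) : LinearMap.trace ℂ W (σ n) = 0 := by
  obtain ⟨h, hh, hne⟩ : ∃ h ∈ N, β n h ≠ 1 := by
    by_contra hcon
    push Not at hcon
    exact hn ⟨n.2, hcon⟩
  have hne' : β h n ^ 2 ≠ 1 := fun h2 => hne (by
    rw [Q.form_swap hh n.2, Q.form_eq_one_of_sq hodd hh n.2 h2, inv_one])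
  have hc := Q.commutator_mem_radical hh n.2
  have e : (⟨h, hh⟩ : N) * n * ⟨h, hh⟩⁻¹ = ⟨_, Q.radical_le hc⟩ * n := Subtype.ext (by simp)
  have h1 : LinearMap.trace ℂ W (σ ((⟨h, hh⟩ : N) * n * ⟨h, hh⟩⁻¹)) =
      LinearMap.trace ℂ W (σ n) := by
    rw [map_mul, LinearMap.trace_mul_comm, ← map_mul]
    congr 2
    group
  rw [e, map_mul, hσR _ hc, Q.map_commutator hh n.2, smul_mul_assoc, map_smul] at h1
  have h2 : (β h n ^ 2 - 1) * LinearMap.trace ℂ W (σ n) = 0 := by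
    rw [sub_mul, one_mul, sub_eq_zero]
    exact h1
  exact (mul_eq_zero.1 h2).resolve_left (sub_ne_zero.2 hne')

lemma trace_of_mem_radical [FiniteDimensional ℂ W] (n : N) (hn : (n : M) ∈ Q.radical) :
    LinearMap.trace ℂ W (σ n) = q n * Module.finrank ℂ W := by
  rw [hσR n hn, map_smul, LinearMap.trace_id, smul_eq_mul]

omit hσR in
lemma map_inv {g : M} (hg : g ∈ N) : q g⁻¹ = (q g)⁻¹ := by
  refine eq_inv_of_mul_eq_one_left ?_
  have h1 := Q.mul _ (N.inv_mem hg) g hg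
  rw [inv_mul_cancel, Q.map_one, Q.form_inv_left hg hg, Q.self g hg, inv_one, mul_one] at h1
  exact h1.symm

/-- The operator by which inversion acts on a Heisenberg representation: a multiple of the sum of
the normalised operators of the group. -/
lemma exists_involution [Finite M] [FiniteDimensional ℂ W] (hodd : Odd (Nat.card N)) (hW : Nontrivial W)
    (hdim : Module.finrank ℂ W ^ 2 = Q.radical.relIndex N) :
    ∃ (c : ℂ) (ε : W →ₗ[ℂ] W), (∀ [Fintype N], ε = c • ∑ n : N, (q n)⁻¹ • σ n) ∧ ε * ε = 1 ∧
      LinearMap.trace ℂ W ε = 1 := by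
  classical
  have := Fintype.ofFinite N
  set d : ℂ := ((Module.finrank ℂ W : ℕ) : ℂ) with hd
  have hd0 : d ≠ 0 := by
    rw [hd]
    exact_mod_cast Module.finrank_pos.ne'
  set r : ℂ := ((Nat.card Q.radical : ℕ) : ℂ) with hr
  have hr0 : r ≠ 0 := by
    rw [hr]
    exact_mod_cast Nat.card_pos.ne'
  have hcard : (Nat.card N : ℂ) = r * d ^ 2 := by
    have h3 : Nat.card Q.radical * Q.radical.relIndex N = Nat.card N := by
      rw [← Subgroup.relIndex_bot_left, ← Subgroup.relIndex_bot_left]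
      exact Subgroup.relIndex_mul_relIndex _ _ _ bot_le Q.radical_le
    rw [← h3, ← hdim, hr, hd]
    push_cast
    rfl
  have hcardR : ((Finset.univ.filter fun n : N => (n : M) ∈ Q.radical).card : ℂ) = r := by
    rw [hr, Nat.card_congr (Equiv.subtypeEquivRight (p := fun x => x ∈ Q.radical)
      (q := fun x => x ∈ N ∧ x ∈ Q.radical) fun x => ⟨fun h => ⟨Q.radical_le h, h⟩, fun h => h.2⟩),
      ← Fintype.card_subtype, ← Nat.card_eq_fintype_card]
    congr 1
    exact Nat.card_congr (Equiv.subtypeSubtypeEquivSubtypeInter (fun x => x ∈ N) fun x =>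
      x ∈ Q.radical)
  refine ⟨(d * r)⁻¹, (d * r)⁻¹ • ∑ n : N, (q n)⁻¹ • σ n, ?_, ?_, ?_⟩
  · intro inst
    congr!
  · -- the substitution `k = g h` in the double sum leaves the coefficient `β g k`, and the sum of
    -- `β g k` over `g` vanishes unless `k` is in the radical
    have h1 : (∑ n : N, (q n)⁻¹ • σ n) * (∑ n : N, (q n)⁻¹ • σ n) =
        ∑ k : N, (∑ g : N, β g k) • ((q k)⁻¹ • σ k) := by
      rw [Finset.sum_mul_sum]
      have h2 : ∀ g : N, ∑ h : N, ((q g)⁻¹ • σ g) * ((q h)⁻¹ • σ h) =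
          ∑ k : N, β g k • ((q k)⁻¹ • σ k) := fun g => by
        refine Fintype.sum_equiv (Equiv.mulLeft g) _ _ fun h => ?_
        rw [Equiv.coe_mulLeft, map_mul, smul_mul_smul_comm, smul_smul]
        congr 1
        rw [Subgroup.coe_mul, Q.mul _ g.2 _ h.2, Q.mul_right _ g.2 _ g.2 _ h.2, Q.self _ g.2]
        have := Q.form_ne_zero g.2 h.2
        have := Q.ne_zero _ g.2
        have := Q.ne_zero _ h.2
        field_simp
      rw [Finset.sum_congr rfl fun g _ => h2 g, Finset.sum_comm]
      simp only [Finset.sum_smul]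
    rw [smul_mul_smul_comm, h1]
    have h3 : ∀ k : N, (∑ g : N, β g k) • ((q k)⁻¹ • σ k) =
        if (k : M) ∈ Q.radical then (Nat.card N : ℂ) • (1 : W →ₗ[ℂ] W) else 0 := fun k => by
      rw [Q.sum_form_radical k.2]
      split_ifs with h
      · rw [hσR k h, smul_smul, smul_smul, inv_mul_cancel_right₀ (Q.ne_zero _ k.2)]
        rfl
      · rw [zero_smul]
    rw [Finset.sum_congr rfl fun k _ => h3 k, ← Finset.sum_filter, Finset.sum_const,
      ← Nat.cast_smul_eq_nsmul ℂ, hcardR, hcard, smul_smul, smul_smul]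
    convert one_smul ℂ (1 : W →ₗ[ℂ] W)
    field_simp
  · rw [map_smul, map_sum]
    have h3 : ∀ k : N, LinearMap.trace ℂ W ((q k)⁻¹ • σ k) =
        if (k : M) ∈ Q.radical then d else 0 := fun k => by
      rw [map_smul]
      split_ifs with h
      · rw [Q.trace_of_mem_radical hσR k h, smul_eq_mul, inv_mul_cancel_left₀ (Q.ne_zero _ k.2)]
      · rw [Q.trace_eq_zero_of_notMem_radical hσR hodd k h, smul_zero]
    rw [Finset.sum_congr rfl fun k _ => h3 k, ← Finset.sum_filter, Finset.sum_const,
      nsmul_eq_mul, hcardR, smul_eq_mul]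
    field_simp

/-- An automorphism of the group that fixes the quadratic character is realised by an operator on
the Heisenberg representation. -/
lemma exists_intertwiner [Finite M] [FiniteDimensional ℂ W] (hodd : Odd (Nat.card N)) (hσ : σ.IsIrreducible)
    (a : N ≃* N) (ha : ∀ n : N, q (a n) = q n) (haR : ∀ n : N, (n : M) ∈ Q.radical →
      (a n : M) ∈ Q.radical) :
    ∃ T : W →ₗ[ℂ] W, Function.Bijective T ∧ ∀ n, T * σ n = σ (a n) * T := by
  classical
  have := Fintype.ofFinite N
  obtain ⟨hW, hsimple⟩ := (isIrreducible_iff_invariant σ).1 hσ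
  let A : (W →ₗ[ℂ] W) → (W →ₗ[ℂ] W) := fun X => ∑ n : N, σ (a n) * X * σ n⁻¹
  have hA : ∀ X n, A X * σ n = σ (a n) * A X := fun X n => by
    simp only [A, Finset.sum_mul, Finset.mul_sum]
    refine Fintype.sum_equiv (Equiv.mulLeft n⁻¹) _ _ fun x => ?_
    rw [Equiv.coe_mulLeft, mul_assoc, ← map_mul, ← mul_assoc, ← mul_assoc, ← map_mul, ← map_mul]
    simp
  -- if all averages `A X` vanished, so would the sum of `tr (σ n⁻¹) σ (a n)`; but only the radical
  -- contributes to it, and its elements contribute the same positive multiple of the identity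
  obtain ⟨X, hX⟩ : ∃ X, A X ≠ 0 := by
    by_contra hcon
    push Not at hcon
    obtain ⟨w, hw⟩ := exists_ne (0 : W)
    let b := Module.finBasis ℂ W
    have h1 : ∀ i, ∑ n : N, (b.repr (σ n⁻¹ (b i)) i) • σ (a n) w = 0 := fun i => by
      have := LinearMap.congr_fun (hcon (LinearMap.toSpanSingleton ℂ W w ∘ₗ b.coord i)) (b i)
      simpa [A, LinearMap.sum_apply] using this
    have h2 : ∑ n : N, (LinearMap.trace ℂ W (σ n⁻¹)) • σ (a n) w = 0 := by
      have : ∀ n : N, LinearMap.trace ℂ W (σ n⁻¹) = ∑ i, b.repr (σ n⁻¹ (b i)) i := fun n => by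
        rw [LinearMap.trace_eq_matrix_trace ℂ b, Matrix.trace]
        simp [LinearMap.toMatrix_apply]
      simp only [this, Finset.sum_smul]
      rw [Finset.sum_comm]
      exact Finset.sum_eq_zero fun i _ => h1 i
    have h3 : ∀ n : N, (LinearMap.trace ℂ W (σ n⁻¹)) • σ (a n) w =
        if (n : M) ∈ Q.radical then (Module.finrank ℂ W : ℂ) • w else 0 := fun n => by
      split_ifs with h
      · rw [Q.trace_of_mem_radical hσR _ (by simpa using Q.radical.inv_mem h), hσR _ (haR n h), ha]
        rw [LinearMap.smul_apply, LinearMap.id_apply, smul_smul, Subgroup.coe_inv, Q.map_inv n.2]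
        congr 1
        field_simp [Q.ne_zero n n.2]
      · rw [Q.trace_eq_zero_of_notMem_radical hσR hodd _ (by simpa using h), zero_smul]
    rw [Finset.sum_congr rfl fun n _ => h3 n, ← Finset.sum_filter, Finset.sum_const,
      ← Nat.cast_smul_eq_nsmul ℂ, smul_smul] at h2
    refine hw ((smul_eq_zero.1 h2).resolve_left (mul_ne_zero ?_ ?_))
    · have : (1 : N) ∈ Finset.univ.filter fun n : N => (n : M) ∈ Q.radical := by
        simp [Q.radical.one_mem]
      exact_mod_cast (Finset.card_pos.2 ⟨_, this⟩).ne'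
    · exact_mod_cast Module.finrank_pos.ne'
  refine ⟨A X, ?_, hA X⟩
  have hinj : Function.Injective (A X) := by
    rw [← LinearMap.ker_eq_bot]
    refine (hsimple (LinearMap.ker (A X)) fun g v hv => ?_).resolve_right fun h => hX ?_
    · have := LinearMap.congr_fun (hA X g) v
      rw [LinearMap.mem_ker] at *
      rw [← Module.End.mul_apply, this, Module.End.mul_apply, hv, map_zero]
    · exact LinearMap.ker_eq_top.1 h
  exact ⟨hinj, LinearMap.injective_iff_surjective.1 hinj⟩

/-- The analogue of the Weil representation: a group of automorphisms that fix a quadratic character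
acts on the Heisenberg representation. The operator of an automorphism is determined up to a scalar;
it commutes with the involution, whose two eigenspaces have dimensions that differ by one, so that
the scalar is fixed by the requirement that the operator has the same determinant on both. -/
theorem exists_weil [Finite M] [FiniteDimensional ℂ W] (hodd : Odd (Nat.card N)) (hσ : σ.IsIrreducible)
    (hdim : Module.finrank ℂ W ^ 2 = Q.radical.relIndex N)
    (T : Subgroup M) (hTN : ∀ t ∈ T, ∀ n, n ∈ N ↔ t * n * t⁻¹ ∈ N)
    (hTq : ∀ t ∈ T, ∀ n ∈ N, q (t * n * t⁻¹) = q n) :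
    ∃ ω : Representation ℂ T W,
      (∀ (t : T) (n n' : N), (n' : M) = t * n * (t : M)⁻¹ → ω t * σ n = σ n' * ω t) ∧
      ∀ t : T, (t : M) ∈ Q.radical → ω t = 1 := by
  classical
  have := Fintype.ofFinite N
  obtain ⟨hW, hsimple⟩ := (isIrreducible_iff_invariant σ).1 hσ
  obtain ⟨c, ε, hε, hε2, htr⟩ := Q.exists_involution hσR hodd hW hdim
  have hfr := finrank_ker_sub_of_trace_eq_one hε2 htr
  let a : T → (N ≃* N) := fun t =>
    { toFun := fun n => ⟨t * n * (t : M)⁻¹, (hTN t t.2 n).1 n.2⟩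
      invFun := fun n => ⟨(t : M)⁻¹ * n * t, (hTN t t.2 _).2 (by simp [mul_assoc])⟩
      left_inv := fun n => Subtype.ext (by simp [mul_assoc])
      right_inv := fun n => Subtype.ext (by simp [mul_assoc])
      map_mul' := fun n m => Subtype.ext (by simp [mul_assoc]) }
  have haq : ∀ t (n : N), q (a t n) = q n := fun t n => hTq t t.2 n n.2
  have hform : ∀ (t : T) (g h : N), β (a t g) (a t h) = β g h := fun t g h => by
    have h1 := Q.mul _ (a t g).2 _ (a t h).2
    rw [← Subgroup.coe_mul, ← map_mul, haq, haq, haq, Subgroup.coe_mul, Q.mul _ g.2 _ h.2] at h1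
    exact (mul_left_cancel₀ (mul_ne_zero (Q.ne_zero _ g.2) (Q.ne_zero _ h.2)) h1).symm
  have haR : ∀ (t : T) (n : N), (n : M) ∈ Q.radical → (a t n : M) ∈ Q.radical := fun t n hn =>
    ⟨(a t n).2, fun h hh => by
      have := hform t n ((a t).symm ⟨h, hh⟩)
      rw [MulEquiv.apply_symm_apply] at this
      rw [this]
      exact hn.2 _ (Subtype.prop _)⟩
  -- every intertwining operator commutes with the involution
  have hcomm : ∀ (t : T) (X : W →ₗ[ℂ] W), (∀ n, X * σ n = σ (a t n) * X) → ε * X = X * ε := by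
    intro t X hX
    rw [hε, smul_mul_assoc, mul_smul_comm, Finset.sum_mul, Finset.mul_sum]
    congr 1
    symm
    refine Fintype.sum_equiv (a t).toEquiv _ _ fun n => ?_
    change X * ((q n)⁻¹ • σ n) = ((q (a t n))⁻¹ • σ (a t n)) * X
    rw [mul_smul_comm, hX, haq, smul_mul_assoc]
  have hdet0 : ∀ (X Y : W →ₗ[ℂ] W) (hX : ε * X = X * ε) (_ : ε * Y = Y * ε) (_ : X * Y = 1)
      (z : ℂ), detOn ε z X hX ≠ 0 := by
    intro X Y hX hY hXY z h0
    have h1 := detOn_mul z hX hY (by rw [hXY, mul_one, one_mul])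
    have h2 : detOn ε z (X * Y) (by rw [hXY, mul_one, one_mul]) = 1 := by
      have := detOn_one (ε := ε) z (by rw [mul_one, one_mul])
      convert this
    rw [h2, h0, zero_mul] at h1
    exact one_ne_zero h1
  -- intertwining operators, normalised
  have hex : ∀ t : T, ∃ (X Y : W →ₗ[ℂ] W) (hX : ε * X = X * ε), X * Y = 1 ∧ Y * X = 1 ∧
      (∀ n, X * σ n = σ (a t n) * X) ∧ detOn ε 1 X hX = detOn ε (-1) X hX := by
    intro t
    obtain ⟨X, hXb, hX⟩ := Q.exists_intertwiner hσR hodd hσ (a t) (haq t) (haR t)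
    let e := LinearEquiv.ofBijective X hXb
    have hXY : X * e.symm.toLinearMap = 1 := LinearMap.ext fun w => e.apply_symm_apply w
    have hYX : e.symm.toLinearMap * X = 1 := LinearMap.ext fun w => e.symm_apply_apply w
    have hεX := hcomm t X hX
    have hεY : ε * e.symm.toLinearMap = e.symm.toLinearMap * ε := by
      calc ε * e.symm.toLinearMap = (e.symm.toLinearMap * X) * ε * e.symm.toLinearMap := by
            rw [hYX, one_mul]
        _ = e.symm.toLinearMap * ε * (X * e.symm.toLinearMap) := by
            simp only [mul_assoc]; rw [← mul_assoc X, ← hεX, mul_assoc]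
        _ = _ := by rw [hXY, mul_one]
    have h1 := hdet0 X _ hεX hεY hXY 1
    have h2 := hdet0 X _ hεX hεY hXY (-1)
    -- scaling by `k` multiplies the determinants by powers of `k` with consecutive exponents
    set k := detOn ε (-1) X hεX / detOn ε 1 X hεX with hk
    have hk0 : k ≠ 0 := div_ne_zero h2 h1
    refine ⟨k • X, k⁻¹ • e.symm.toLinearMap, by rw [mul_smul_comm, smul_mul_assoc, hεX], ?_, ?_,
      fun n => by rw [smul_mul_assoc, hX, mul_smul_comm], ?_⟩
    · rw [smul_mul_smul_comm, hXY, mul_inv_cancel₀ hk0, one_smul]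
    · rw [smul_mul_smul_comm, hYX, inv_mul_cancel₀ hk0, one_smul]
    · rw [detOn_smul 1 k hεX, detOn_smul (-1) k hεX, hfr, pow_succ, mul_assoc]
      congr 1
      rw [hk]
      field_simp
  -- the normalisation determines the operator
  have huniq : ∀ (t : T) (X X' Y : W →ₗ[ℂ] W) (hX : ε * X = X * ε) (hX' : ε * X' = X' * ε),
      X * Y = 1 → Y * X = 1 → (∀ n, X * σ n = σ (a t n) * X) →
      (∀ n, X' * σ n = σ (a t n) * X') → X' ≠ 0 → detOn ε 1 X hX = detOn ε (-1) X hX →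
      detOn ε 1 X' hX' = detOn ε (-1) X' hX' → X' = X := by
    intro t X X' Y hX hX' hXY hYX hXi hXi' hne hd hd'
    obtain ⟨k, hk⟩ := exists_eq_smul_id_of_commute hσ (Y * X') fun n v => by
      have h1 : Y * X' * σ n = σ n * (Y * X') := by
        calc Y * X' * σ n = Y * (σ (a t n) * (X * Y)) * X' := by
              rw [hXY, mul_one, mul_assoc, hXi', mul_assoc]
          _ = Y * (X * σ n) * Y * X' := by rw [hXi]; simp only [mul_assoc]
          _ = (Y * X) * σ n * (Y * X') := by simp only [mul_assoc]
          _ = _ := by rw [hYX, one_mul]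
      exact LinearMap.congr_fun h1 v
    have hX'e : X' = k • X := by
      calc X' = X * (Y * X') := by rw [← mul_assoc, hXY, one_mul]
        _ = k • X := by
          rw [hk, mul_smul_comm]
          rfl
    have hk0 : k ≠ 0 := fun h => hne (by rw [hX'e, h, zero_smul])
    subst hX'e
    rw [detOn_smul 1 k hX, detOn_smul (-1) k hX, hfr, pow_succ, hd, mul_assoc] at hd'
    have hεY : ε * Y = Y * ε := by
      calc ε * Y = (Y * X) * ε * Y := by rw [hYX, one_mul]
        _ = Y * ε * (X * Y) := by simp only [mul_assoc]; rw [← mul_assoc X, ← hX, mul_assoc]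
        _ = _ := by rw [hXY, mul_one]
    have h3 := hdet0 X Y hX hεY hXY (-1)
    have h4 := mul_left_cancel₀ (pow_ne_zero _ hk0) hd'
    rw [mul_eq_right₀ h3] at h4
    rw [h4, one_smul]
  choose X Y hX hXY hYX hXi hXd using hex
  have hX0 : ∀ t, X t ≠ 0 := fun t h => by
    have := hXY t
    rw [h, zero_mul] at this
    exact zero_ne_one this
  refine ⟨{ toFun := X, map_one' := ?_, map_mul' := fun s t => ?_ }, fun t n n' h => ?_,
    fun t ht => ?_⟩
  · refine (huniq 1 (X 1) 1 (Y 1) (hX 1) (by rw [mul_one, one_mul]) (hXY 1) (hYX 1) (hXi 1)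
      (fun n => ?_) one_ne_zero (hXd 1) (by rw [detOn_one, detOn_one])).symm
    have : a 1 n = n := Subtype.ext (by simp [a])
    rw [this, one_mul, mul_one]
  · have hc : ε * (X s * X t) = X s * X t * ε := by
      rw [← mul_assoc, hX, mul_assoc, hX, mul_assoc]
    refine (huniq (s * t) (X (s * t)) (X s * X t) (Y (s * t)) (hX _) hc (hXY _) (hYX _) (hXi _)
      (fun n => ?_) (fun h0 => ?_) (hXd _)
      (by rw [detOn_mul 1 (hX s) (hX t), detOn_mul (-1) (hX s) (hX t), hXd, hXd])).symm
    · have : a (s * t) n = a s (a t n) := Subtype.ext (by simp [a, mul_assoc])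
      rw [this, mul_assoc, hXi, ← mul_assoc, hXi, mul_assoc]
    · have h1 : X s * X t * Y t * Y s = 1 := by
        rw [mul_assoc (X s), hXY, mul_one, hXY]
      rw [h0, zero_mul, zero_mul] at h1
      exact zero_ne_one h1
  · have : n' = a t n := Subtype.ext h
    rw [this]
    exact hXi t n
  · refine (huniq t (X t) 1 (Y t) (hX t) (by rw [mul_one, one_mul]) (hXY t) (hYX t) (hXi t)
      (fun n => ?_) one_ne_zero (hXd t) (by rw [detOn_one, detOn_one])).symm
    have h1 : a t n = ⟨t, Q.radical_le ht⟩ * n * ⟨t, Q.radical_le ht⟩⁻¹ := Subtype.ext (by simp [a])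
    have h2 : σ ⟨t, Q.radical_le ht⟩ = q t • LinearMap.id := hσR ⟨t, Q.radical_le ht⟩ ht
    have h3 : σ (⟨t, Q.radical_le ht⟩ : N)⁻¹ = (q t)⁻¹ • LinearMap.id := by
      rw [hσR _ (by simpa using Q.radical.inv_mem ht), Subgroup.coe_inv, Q.map_inv ht.1]
    rw [one_mul, mul_one, h1, map_mul, map_mul, h2, h3]
    ext w
    simp [smul_smul, Q.ne_zero _ ht.1]

/-- The extension of a Heisenberg representation from `N` to `T N`, twisted by a character of `T`
that agrees with the quadratic character on `T ∩ N`. -/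
theorem exists_extension [Finite M] [FiniteDimensional ℂ W] (hodd : Odd (Nat.card N)) (hσ : σ.IsIrreducible)
    (hdim : Module.finrank ℂ W ^ 2 = Q.radical.relIndex N)
    {T I : Subgroup M} (hNI : N ≤ I) (hI : ∀ x ∈ I, ∃ t ∈ T, ∃ n ∈ N, x = t * n)
    (hTN : ∀ t ∈ T, ∀ n, n ∈ N ↔ t * n * t⁻¹ ∈ N)
    (hTq : ∀ t ∈ T, ∀ n ∈ N, q (t * n * t⁻¹) = q n)
    (hTR : T ⊓ N ≤ Q.radical) (f : T →* ℂ) (hf : ∀ t : T, (t : M) ∈ N → f t = q t) :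
    ∃ σ' : Representation ℂ I W, Extends σ σ' := by
  obtain ⟨ω, hω, hωR⟩ := Q.exists_weil hσR hodd hσ hdim T hTN hTq
  let S : T → N → (W →ₗ[ℂ] W) := fun t n => f t • (ω t * σ n)
  -- `S t n` depends only on the product `t n`: on `T ∩ N`, which lies in the radical, the operators
  -- `f t • ω t` and `σ t` agree
  have hS : ∀ (t t' : T) (n n' : N), (t * n : M) = t' * n' → S t n = S t' n' := by
    intro t t' n n' h
    have hz : ((t'⁻¹ * t : T) : M) = n' * (n : M)⁻¹ := by
      rw [Subgroup.coe_mul, Subgroup.coe_inv, inv_mul_eq_iff_eq_mul, ← mul_assoc, ← h]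
      simp
    have hzN : ((t'⁻¹ * t : T) : M) ∈ N := hz ▸ N.mul_mem n'.2 (N.inv_mem n.2)
    have hzR : ((t'⁻¹ * t : T) : M) ∈ Q.radical := hTR ⟨(t'⁻¹ * t).2, hzN⟩
    have h1 : t = t' * (t'⁻¹ * t) := by group
    have h2 : n' = ⟨_, hzN⟩ * n := Subtype.ext (by
      rw [Subgroup.coe_mul, hz]; simp)
    simp only [S]
    rw [h2]
    nth_rw 1 2 [h1]
    rw [map_mul f, map_mul ω, hωR _ hzR, mul_one, map_mul σ, hσR ⟨_, hzN⟩ hzR, hf _ hzN]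
    ext w
    simp [smul_smul]
  choose! t ht n hn htn using hI
  have hmul : ∀ (t s : T) (n m : N), ∃ k : N, (t * n * (s * m) : M) = ((t * s : T) : M) * k ∧
      S t n * S s m = S (t * s) k := by
    intro t s n m
    have h1 : (s : M)⁻¹ * n * s ∈ N := (hTN s s.2 _).2 (by simp [mul_assoc])
    refine ⟨⟨_, h1⟩ * m, by simp [mul_assoc], ?_⟩
    have h2 := hω s ⟨_, h1⟩ n (by simp [mul_assoc])
    simp only [S]
    rw [smul_mul_smul_comm, map_mul f, map_mul ω, map_mul σ]
    congr 1
    calc ω t * σ n * (ω s * σ m) = ω t * (σ n * ω s) * σ m := by simp only [mul_assoc]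
      _ = _ := by rw [← h2]; simp only [mul_assoc]
  refine ⟨{ toFun := fun x => S ⟨t x, ht x x.2⟩ ⟨n x, hn x x.2⟩, map_one' := ?_,
            map_mul' := fun x y => ?_ }, hNI, fun x hx hx' => ?_⟩
  · rw [hS _ 1 _ 1 (by simp [← htn])]
    simp [S]
  · obtain ⟨k, hk, hk'⟩ := hmul ⟨t x, ht x x.2⟩ ⟨t y, ht y y.2⟩ ⟨n x, hn x x.2⟩ ⟨n y, hn y y.2⟩
    rw [hk']
    refine hS _ _ _ _ ?_
    rw [← hk]
    change t ((x * y : I) : M) * n ((x * y : I) : M) = t x * n x * (t y * n y)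
    rw [← htn _ (x * y).2, ← htn _ x.2, ← htn _ y.2]
    rfl
  · change S ⟨t x, ht x hx'⟩ ⟨n x, hn x hx'⟩ = _
    rw [hS _ 1 _ ⟨x, hx⟩ (by simp [← htn x hx'])]
    simp [S]

end IsQuadraticChar

end Weil

/-! ### Clifford theory -/

section Clifford

variable {M : Type*} [Group M]

lemma exists_minimal_invariant {G V : Type*} [Group G] [AddCommGroup V] [Module ℂ V]
    [FiniteDimensional ℂ V] (ρ : Representation ℂ G V) (E : Submodule ℂ V) (hE : E ≠ ⊥)
    (hinv : ∀ g, ∀ v ∈ E, ρ g v ∈ E) :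
    ∃ F ≤ E, F ≠ ⊥ ∧ (∀ g, ∀ v ∈ F, ρ g v ∈ F) ∧
      ∀ U ≤ F, (∀ g, ∀ v ∈ U, ρ g v ∈ U) → U = ⊥ ∨ U = F := by
  induction hn : Module.finrank ℂ E using Nat.strong_induction_on generalizing E with
  | _ n ih =>
  by_cases h : ∀ U ≤ E, (∀ g, ∀ v ∈ U, ρ g v ∈ U) → U = ⊥ ∨ U = E
  · exact ⟨E, le_rfl, hE, hinv, h⟩
  · push Not at h
    obtain ⟨U, hUE, hUi, hU0, hUne⟩ := h
    obtain ⟨F, hF, h'⟩ := ih _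
      (hn ▸ Submodule.finrank_lt_finrank_of_lt (lt_of_le_of_ne hUE hUne)) U hU0 hUi rfl
    exact ⟨F, hF.trans hUE, h'⟩

/-- A non-zero operator that intertwines an irreducible representation with a twist of itself forces
the characters to agree. -/
lemma trace_eq_of_intertwiner {N : Type*} [Group N] {W : Type*} [AddCommGroup W] [Module ℂ W]
    [FiniteDimensional ℂ W] {σ : Representation ℂ N W} (hσ : σ.IsIrreducible) {a : N → N}
    {f : W →ₗ[ℂ] W} (hf0 : f ≠ 0) (hf : ∀ n w, f (σ n w) = σ (a n) (f w)) (n : N) :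
    LinearMap.trace ℂ W (σ (a n)) = LinearMap.trace ℂ W (σ n) := by
  obtain ⟨-, hsimple⟩ := (isIrreducible_iff_invariant σ).1 hσ
  have hinj : Function.Injective f := by
    rw [← LinearMap.ker_eq_bot]
    refine (hsimple (LinearMap.ker f) fun g v hv => ?_).resolve_right fun h =>
      hf0 (LinearMap.ker_eq_top.1 h)
    rw [LinearMap.mem_ker] at *
    rw [hf, hv, map_zero]
  let e := LinearEquiv.ofBijective f ⟨hinj, LinearMap.injective_iff_surjective.1 hinj⟩
  have h1 : σ (a n) = e.conj (σ n) := by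
    ext w
    obtain ⟨u, rfl⟩ := e.surjective w
    rw [LinearEquiv.conj_apply_apply, LinearEquiv.symm_apply_apply]
    exact (hf n u).symm
  rw [h1, LinearMap.trace_conj']

/-- The tensor product of an extension of an irreducible representation of a subgroup with an
irreducible representation that is trivial on the subgroup is irreducible. -/
theorem tprod_isIrreducible {N I : Subgroup M} [Finite M] (hNI : N ≤ I) {W E : Type*}
    [AddCommGroup W] [Module ℂ W] [FiniteDimensional ℂ W] [AddCommGroup E] [Module ℂ E]
    [FiniteDimensional ℂ E] {σ : Representation ℂ N W} (hσ : σ.IsIrreducible)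
    {σ' : Representation ℂ I W} (hext : Extends σ σ') {φ : Representation ℂ I E}
    (hφ : φ.IsIrreducible) (hφN : ∀ n : I, (n : M) ∈ N → φ n = 1) :
    (σ'.tprod φ).IsIrreducible := by
  obtain ⟨hW, -⟩ := (isIrreducible_iff_invariant σ).1 hσ
  obtain ⟨hE, -⟩ := (isIrreducible_iff_invariant φ).1 hφ
  refine (isIrreducible_iff_invariant _).2 ⟨inferInstance, fun U hU => ?_⟩
  obtain ⟨e, he, heU, heU'⟩ := exists_equivariant_projection (σ'.tprod φ) U hU
  let b := Module.finBasis ℂ E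
  -- the component of `e` along a basis vector of the second factor is a scalar
  let comp : E → Fin (Module.finrank ℂ E) → W →ₗ[ℂ] W := fun y i =>
    (TensorProduct.rid ℂ W).toLinearMap ∘ₗ (b.coord i).lTensor W ∘ₗ e ∘ₗ
      (TensorProduct.mk ℂ W E).flip y
  have hcomp : ∀ y i (n : N) w, comp y i (σ n w) = σ n (comp y i w) := by
    intro y i n w
    have h1 : σ n = σ' (Subgroup.inclusion hNI n) := (hext.2 n n.2 (hNI n.2)).symm
    have h2 : ∀ w y, (σ n w) ⊗ₜ[ℂ] y = (σ'.tprod φ) (Subgroup.inclusion hNI n) (w ⊗ₜ y) := by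
      intro w y
      rw [Representation.tprod_apply, TensorProduct.map_tmul, hφN _ n.2, h1]
      rfl
    have h3 : ∀ z : W ⊗[ℂ] E, (TensorProduct.rid ℂ W) ((b.coord i).lTensor W
        ((σ'.tprod φ) (Subgroup.inclusion hNI n) z)) =
        σ n ((TensorProduct.rid ℂ W) ((b.coord i).lTensor W z)) := by
      intro z
      induction z with
      | zero => simp
      | add x y hx hy => rw [map_add, map_add, map_add, hx, hy, map_add, map_add, map_add]
      | tmul w y => rw [← h2]; simp
    change (TensorProduct.rid ℂ W) ((b.coord i).lTensor W (e ((σ n w) ⊗ₜ[ℂ] y))) = _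
    rw [h2, he, h3]
    rfl
  choose c hc using fun y i => exists_eq_smul_id_of_commute hσ (comp y i) (hcomp y i)
  -- `e` acts on the second factor only, through an operator that commutes with `φ`
  let e' : E → E := fun y => ∑ i, c y i • b i
  have hrec : ∀ z : W ⊗[ℂ] E,
      ∑ i, (TensorProduct.rid ℂ W) ((b.coord i).lTensor W z) ⊗ₜ[ℂ] b i = z := by
    intro z
    induction z with
    | zero => simp
    | add x y hx hy =>
      simp only [map_add, TensorProduct.add_tmul, Finset.sum_add_distrib, hx, hy]
    | tmul w y =>
      have : ∀ i, (TensorProduct.rid ℂ W) ((b.coord i).lTensor W (w ⊗ₜ[ℂ] y)) ⊗ₜ[ℂ] b i =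
          w ⊗ₜ[ℂ] (b.repr y i • b i) := fun i => by simp [TensorProduct.smul_tmul]
      rw [Finset.sum_congr rfl fun i _ => this i, ← TensorProduct.tmul_sum, b.sum_repr]
  have he' : ∀ w y, e (w ⊗ₜ y) = w ⊗ₜ e' y := by
    intro w y
    rw [← hrec (e (w ⊗ₜ y))]
    have : ∀ i, (TensorProduct.rid ℂ W) ((b.coord i).lTensor W (e (w ⊗ₜ[ℂ] y))) = c y i • w :=
      fun i => LinearMap.congr_fun (hc y i) w
    simp only [this, e', TensorProduct.tmul_sum, TensorProduct.smul_tmul]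
  obtain ⟨w₀, hw₀⟩ := exists_ne (0 : W)
  have hcancel : ∀ (w : W) (_ : w ≠ 0) (y y' : E), w ⊗ₜ[ℂ] y = w ⊗ₜ[ℂ] y' → y = y' := by
    intro w hw y y' h
    obtain ⟨ℓ, hℓ⟩ : ∃ ℓ : W →ₗ[ℂ] ℂ, ℓ w ≠ 0 := by
      by_contra hcon
      push Not at hcon
      exact hw ((Module.forall_dual_apply_eq_zero_iff ℂ w).1 hcon)
    have h2 := congrArg (fun z => (TensorProduct.lid ℂ E) (ℓ.rTensor E z)) h
    simp only [LinearMap.rTensor_tmul, TensorProduct.lid_tmul] at h2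
    exact smul_right_injective E hℓ h2
  have hadd : ∀ y y', e' (y + y') = e' y + e' y' := fun y y' => hcancel w₀ hw₀ _ _ (by
    rw [← he', TensorProduct.tmul_add, map_add, he', he', TensorProduct.tmul_add])
  have hsmul : ∀ (a : ℂ) y, e' (a • y) = a • e' y := fun a y => hcancel w₀ hw₀ _ _ (by
    rw [← he', TensorProduct.tmul_smul, map_smul, he', TensorProduct.tmul_smul])
  obtain ⟨k, hk⟩ := exists_eq_smul_id_of_commute hφ
    ({ toFun := e', map_add' := hadd, map_smul' := hsmul } : E →ₗ[ℂ] E) fun g y => by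
      have hinv : σ' g w₀ ≠ 0 := fun h => hw₀ (by
        have h1 : σ' g⁻¹ (σ' g w₀) = w₀ := by
          rw [← Module.End.mul_apply, ← map_mul]; simp
        rw [← h1, h, map_zero])
      refine hcancel _ hinv _ _ ?_
      change σ' g w₀ ⊗ₜ e' (φ g y) = σ' g w₀ ⊗ₜ φ g (e' y)
      have h1 := he g (w₀ ⊗ₜ y)
      rw [Representation.tprod_apply, TensorProduct.map_tmul, he', he', TensorProduct.map_tmul] at h1
      exact h1
  have hek : ∀ z, e z = k • z := by
    intro z
    induction z with
    | zero => simp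
    | add x y hx hy => rw [map_add, hx, hy, smul_add]
    | tmul w y =>
      rw [he', ← TensorProduct.tmul_smul]
      congr 1
      exact LinearMap.congr_fun hk y
  by_cases hU0 : U = ⊥
  · exact Or.inl hU0
  · right
    obtain ⟨u, hu, hu0⟩ := Submodule.exists_mem_ne_zero_of_ne_bot hU0
    have hk1 : k • u = u := by rw [← hek]; exact heU' u hu
    have hk2 : k = 1 := smul_left_injective ℂ hu0 (by simpa using hk1)
    rw [eq_top_iff]
    intro v _
    have := heU v
    rwa [hek, hk2, one_smul] at this

variable {G I N : Subgroup M} (hNI : N ≤ I) (hIG : I ≤ G) {V W : Type*} [AddCommGroup V]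
  [Module ℂ V] [AddCommGroup W] [Module ℂ W]
  (χ : Representation ℂ G V) {σ : Representation ℂ N W} {σ' : Representation ℂ I W}

/-- The space of `N`-equivariant maps from `W` to `V`. -/
def equivariantMaps (hNG : N ≤ G) (χ : Representation ℂ G V) (σ : Representation ℂ N W) :
    Submodule ℂ (W →ₗ[ℂ] V) where
  carrier := {f | ∀ n w, f (σ n w) = χ (Subgroup.inclusion hNG n) (f w)}
  add_mem' := fun ha hb n w => by simp [ha n w, hb n w]
  zero_mem' := fun n w => by simp
  smul_mem' := fun c f hf n w => by simp [hf n w]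

/-- The action of `I` on the linear maps from an extension to `I` of a representation of `N` to a
representation of a larger group. -/
abbrev homRep (hIG : I ≤ G) (χ : Representation ℂ G V) (σ' : Representation ℂ I W) :
    Representation ℂ I (W →ₗ[ℂ] V) :=
  Representation.linHom σ' (χ.comp (Subgroup.inclusion hIG))

lemma homRep_apply (i : I) (f : W →ₗ[ℂ] V) (w : W) :
    homRep hIG χ σ' i f w = χ (Subgroup.inclusion hIG i) (f (σ' i⁻¹ w)) := by
  rw [Representation.linHom_apply]
  rfl

lemma homRep_of_mem (hext : Extends σ σ') {f : W →ₗ[ℂ] V}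
    (hf : f ∈ equivariantMaps (hNI.trans hIG) χ σ) (i : I) (hi : (i : M) ∈ N) :
    homRep hIG χ σ' i f = f := by
  ext w
  rw [homRep_apply]
  have h1 : σ' i⁻¹ w = σ (⟨i, hi⟩ : N)⁻¹ w := by
    have := hext.2 (i : M)⁻¹ (N.inv_mem hi) (I.inv_mem i.2)
    exact LinearMap.congr_fun this w
  have h2 := hf ⟨i, hi⟩ (σ (⟨i, hi⟩ : N)⁻¹ w)
  rw [h1]
  change _ = χ (Subgroup.inclusion hIG i) _ at h2
  rw [← h2, ← Module.End.mul_apply, ← map_mul]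
  simp

lemma homRep_mem (hext : Extends σ σ') (hN : ∀ i ∈ I, ∀ n ∈ N, i * n * i⁻¹ ∈ N) {f : W →ₗ[ℂ] V}
    (hf : f ∈ equivariantMaps (hNI.trans hIG) χ σ) (i : I) :
    homRep hIG χ σ' i f ∈ equivariantMaps (hNI.trans hIG) χ σ := by
  intro n w
  have hn' : (i : M)⁻¹ * n * i ∈ N := by simpa using hN _ (I.inv_mem i.2) n n.2
  have h1 : σ n = σ' (Subgroup.inclusion hNI n) := (hext.2 n n.2 (hNI n.2)).symm
  have h2 : i⁻¹ * Subgroup.inclusion hNI n = Subgroup.inclusion hNI ⟨_, hn'⟩ * i⁻¹ :=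
    Subtype.ext (by simp)
  have h3 : σ' i⁻¹ (σ n w) = σ ⟨_, hn'⟩ (σ' i⁻¹ w) := by
    rw [h1, ← Module.End.mul_apply, ← map_mul, h2, map_mul]
    exact LinearMap.congr_fun (hext.2 _ hn' (hNI hn')) _
  have h4 : Subgroup.inclusion hIG i * Subgroup.inclusion (hNI.trans hIG) ⟨_, hn'⟩ =
      Subgroup.inclusion (hNI.trans hIG) n * Subgroup.inclusion hIG i :=
    Subtype.ext (by simp [mul_assoc])
  rw [homRep_apply, homRep_apply, h3, hf, ← Module.End.mul_apply, ← map_mul, h4, map_mul]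
  rfl

/-- If `I` is generated by `N` and an abelian group, an irreducible representation of `N` that
extends to `I` and occurs in `χ` has an extension that occurs in `χ`. -/
theorem exists_extension_intertwiner [FiniteDimensional ℂ V] [FiniteDimensional ℂ W]
    (hext : Extends σ σ')
    (hN : ∀ i ∈ I, ∀ n ∈ N, i * n * i⁻¹ ∈ N) {T : Subgroup M} (hTI : T ≤ I)
    (hTcomm : ∀ s ∈ T, ∀ t ∈ T, s * t = t * s) (hI : ∀ x ∈ I, ∃ t ∈ T, ∃ n ∈ N, x = t * n)
    (f₀ : W →ₗ[ℂ] V) (hf₀ : f₀ ≠ 0) (hf₀' : f₀ ∈ equivariantMaps (hNI.trans hIG) χ σ) :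
    ∃ σ'' : Representation ℂ I W, Extends σ σ'' ∧ ∃ f : W →ₗ[ℂ] V, f ≠ 0 ∧
      ∀ i w, f (σ'' i w) = χ (Subgroup.inclusion hIG i) (f w) := by
  -- `N` acts trivially on the equivariant maps, so that the abelian group `T` acts through `I`; a
  -- common eigenvector is equivariant for the twist of the extension by its character `μ`
  have hT : ∀ x : I, ∃ t : I, (t : M) ∈ T ∧ ∀ f ∈ equivariantMaps (hNI.trans hIG) χ σ,
      homRep hIG χ σ' x f = homRep hIG χ σ' t f := by
    intro x
    obtain ⟨t, ht, n, hn, hx⟩ := hI x x.2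
    refine ⟨⟨t, hTI ht⟩, ht, fun f hf => ?_⟩
    have : x = ⟨t, hTI ht⟩ * ⟨n, hNI hn⟩ := Subtype.ext hx
    rw [this, map_mul, Module.End.mul_apply, homRep_of_mem hNI hIG χ hext hf ⟨n, hNI hn⟩ hn]
  obtain ⟨f, hf, hf0, μ, hμ⟩ := exists_common_eigenvector (homRep hIG χ σ')
    (equivariantMaps (hNI.trans hIG) χ σ)
    (fun h => hf₀ (by rw [h] at hf₀'; simpa using hf₀'))
    (fun i f hf => homRep_mem hNI hIG χ hext hN hf i)
    (fun x y f hf => by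
      obtain ⟨s, hs, hxs⟩ := hT x
      obtain ⟨t, ht, hyt⟩ := hT y
      rw [hxs _ (homRep_mem hNI hIG χ hext hN hf y), hyt f hf,
        hyt _ (homRep_mem hNI hIG χ hext hN hf x), hxs f hf, ← Module.End.mul_apply,
        ← Module.End.mul_apply, ← map_mul, ← map_mul]
      congr 2
      exact Subtype.ext (hTcomm _ hs _ ht))
  refine ⟨{ toFun := fun i => μ i • σ' i
            map_one' := by simp
            map_mul' := fun x y => by
              rw [map_mul, map_mul, smul_mul_smul_comm] }, ⟨hNI, fun n hn hn' => ?_⟩, f, hf0, fun i w => ?_⟩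
  · have h1 := hμ ⟨n, hn'⟩
    rw [homRep_of_mem hNI hIG χ hext hf ⟨n, hn'⟩ hn] at h1
    have h2 : μ ⟨n, hn'⟩ = 1 := smul_left_injective ℂ hf0 (by simpa using h1.symm)
    change μ ⟨n, hn'⟩ • σ' ⟨n, hn'⟩ = _
    rw [h2, one_smul, hext.2 n hn hn']
  · have h1 := LinearMap.congr_fun (hμ i) (σ' i w)
    rw [homRep_apply, ← Module.End.mul_apply (σ' i⁻¹), ← map_mul] at h1
    simp only [inv_mul_cancel, map_one, Module.End.one_apply, LinearMap.smul_apply] at h1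
    change f (μ i • σ' i w) = _
    rw [map_smul, h1]

/-- If an irreducible representation of `N` extends to `I` and occurs in `χ`, then the product of
the extension with some irreducible representation of `I` that is trivial on `N` occurs in `χ`. -/
theorem exists_tprod_intertwiner [FiniteDimensional ℂ V] [FiniteDimensional ℂ W] (hext : Extends σ σ')
    (hN : ∀ i ∈ I, ∀ n ∈ N, i * n * i⁻¹ ∈ N)
    (f₀ : W →ₗ[ℂ] V) (hf₀ : f₀ ≠ 0) (hf₀' : f₀ ∈ equivariantMaps (hNI.trans hIG) χ σ) :
    ∃ (d : ℕ) (φ : Representation ℂ I (Fin d → ℂ)), φ.IsIrreducible ∧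
      (∀ n : I, (n : M) ∈ N → φ n = 1) ∧ ∃ f : W ⊗[ℂ] (Fin d → ℂ) →ₗ[ℂ] V, f ≠ 0 ∧
      ∀ i z, f ((σ'.tprod φ) i z) = χ (Subgroup.inclusion hIG i) (f z) := by
  -- evaluation `W ⊗ F → V` is equivariant for a minimal invariant space `F` of `N`-equivariant maps
  obtain ⟨F, hF, hF0, hFi, hFmin⟩ := exists_minimal_invariant (homRep hIG χ σ')
    (equivariantMaps (hNI.trans hIG) χ σ)
    (fun h => hf₀ (by rw [h] at hf₀'; simpa using hf₀'))
    (fun i f hf => homRep_mem hNI hIG χ hext hN hf i)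
  let φ : Representation ℂ I F := (⟨F, hFi⟩ : Subrepresentation (homRep hIG χ σ')).toRepresentation
  have hφ : ∀ i (f : F), (φ i f : W →ₗ[ℂ] V) = homRep hIG χ σ' i f := fun i f => rfl
  have hirr : φ.IsIrreducible := by
    refine (isIrreducible_iff_invariant φ).2 ⟨Submodule.nontrivial_iff_ne_bot.2 hF0, fun U hU => ?_⟩
    rcases hFmin (U.map F.subtype) (Submodule.map_subtype_le _ _) (by
      rintro g _ ⟨u, hu, rfl⟩
      exact ⟨φ g u, hU g u hu, hφ g u⟩) with h | h
    · left
      exact Submodule.map_injective_of_injective F.injective_subtype (by rw [h, Submodule.map_bot])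
    · right
      rw [eq_top_iff]
      intro f _
      have : (f : W →ₗ[ℂ] V) ∈ U.map F.subtype := h.symm ▸ f.2
      obtain ⟨u, hu, hu'⟩ := this
      rwa [← Subtype.ext hu']
  let e := LinearEquiv.ofFinrankEq F (Fin (Module.finrank ℂ F) → ℂ)
    (Module.finrank_fin_fun ℂ).symm
  refine ⟨_, transportRep e φ, isIrreducible_transportRep e hirr, fun n hn => ?_, ?_⟩
  · refine LinearMap.ext fun x => ?_
    have : φ n (e.symm x) = e.symm x :=
      Subtype.ext (homRep_of_mem hNI hIG χ hext (hF (e.symm x).2) n hn)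
    rw [transportRep_apply, this]
    simp
  · let Φ : W ⊗[ℂ] (Fin (Module.finrank ℂ F) → ℂ) →ₗ[ℂ] V :=
      TensorProduct.lift ((F.subtype ∘ₗ e.symm.toLinearMap).flip)
    have hΦ : ∀ w x, Φ (w ⊗ₜ x) = (e.symm x : W →ₗ[ℂ] V) w := fun w x => by simp [Φ]
    refine ⟨Φ, fun h => ?_, fun i z => ?_⟩
    · obtain ⟨f, hf, hf0⟩ := Submodule.exists_mem_ne_zero_of_ne_bot hF0
      apply hf0
      ext w
      have h1 := hΦ w (e ⟨f, hf⟩)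
      rw [h] at h1
      simpa using h1.symm
    · induction z with
      | zero => simp
      | add x y hx hy => simp only [map_add, hx, hy]
      | tmul w x =>
        rw [Representation.tprod_apply, TensorProduct.map_tmul, hΦ, hΦ, transportRep_apply,
          LinearEquiv.symm_apply_apply, hφ, homRep_apply]
        rw [← Module.End.mul_apply (σ' i⁻¹), ← map_mul]
        simp

end Clifford

/-! ### The finite rings -/

section RingFacts

/-- The properties of the ring `𝔒_ℓ` and its involution on which the arguments rest; `ϖ` is a
uniformizer that is fixed by the involution, and `q` is the cardinality of the residue field
of `o`. -/
structure IsUniformized {o : Type*} [CommRing o] [IsLocalRing o] (u : o) (ℓ q : ℕ)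
    (ϖ : BigRing u ℓ) : Prop where
  finite : Finite (BigRing u ℓ)
  star_unif : star ϖ = ϖ
  bigP_eq : bigP u ℓ = Ideal.span {ϖ}
  pow_eq_zero : ϖ ^ ℓ = 0
  cancel : ∀ (a c : ℕ) (x y : BigRing u ℓ), a + c ≤ ℓ → ϖ ^ a * x = ϖ ^ (a + c) * y →
    ∃ z, x = ϖ ^ c * z
  isUnit_of_notMem : ∀ x, x ∉ bigP u ℓ → IsUnit x
  isUnit_two : IsUnit (2 : BigRing u ℓ)
  isUnit_three : IsUnit (3 : BigRing u ℓ)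
  exists_prime : ∃ p : ℕ, Odd p ∧ p.Prime ∧ (p : BigRing u ℓ) ∈ bigP u ℓ
  card_quot : Nat.card (BigRing u ℓ ⧸ bigP u ℓ) = q ^ 2
  norm_surj : ∀ x : BigRing u ℓ, star x = x → x ∉ bigP u ℓ →
    ∃ a, a * star a - x ∈ bigP u ℓ
  isUnit_rho : IsUnit (⟨0, 1⟩ : BigRing u ℓ)
  pos : 0 < ℓ
  real_mem : ∀ y ∈ maximalIdeal o ^ (ℓ - 1), algebraMap o (BigRing u ℓ) y ∈ Ideal.span {ϖ ^ (ℓ - 1)}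

lemma star_rho {o : Type*} [CommRing o] [IsLocalRing o] {u : o} {ℓ : ℕ} :
    star (⟨0, 1⟩ : BigRing u ℓ) = -⟨0, 1⟩ := by
  ext <;> simp

lemma star_algebraMap {o : Type*} [CommRing o] [IsLocalRing o] {u : o} {ℓ : ℕ} (x : o) :
    star (algebraMap o (BigRing u ℓ) x) = algebraMap o (BigRing u ℓ) x := by
  rw [IsScalarTower.algebraMap_apply o (SmallRing o ℓ) (BigRing u ℓ)]
  ext <;> simp

variable {o : Type*} [CommRing o] [IsDomain o] [IsDiscreteValuationRing o]
    [IsAdicComplete (IsLocalRing.maximalIdeal o) o] [Finite (IsLocalRing.ResidueField o)]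

/-- Over a discrete valuation ring, the image of a uniformiser of the base ring makes `𝔒_ℓ` a finite
chain ring with surjective norm on the residue fields. -/
lemma exists_isUniformized (hp : 3 < ringChar (IsLocalRing.ResidueField o))
    (u : o) (hu : IsUnit u) (hu' : ¬ IsSquare u) (ℓ : ℕ) (hℓ : 2 ≤ ℓ) :
    ∃ ϖ, IsUniformized u ℓ (Nat.card (IsLocalRing.ResidueField o)) ϖ := by
  obtain ⟨π, hπ⟩ := IsDiscreteValuationRing.exists_irreducible o
  have hm : maximalIdeal o = Ideal.span {π} := hπ.maximalIdeal_eq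
  have hπ0 : π ≠ 0 := hπ.ne_zero
  let S := BigRing u ℓ
  let ϖ : S := algebraMap o S π
  have hnat : ∀ n : ℕ, 0 < n → n < 4 → IsUnit ((n : ℕ) : o) := by
    intro n hn hn4
    by_contra hcon
    have h1 : ((n : ℕ) : o) ∈ maximalIdeal o := (mem_maximalIdeal _).2 hcon
    rw [← residue_eq_zero_iff, map_natCast, ringChar.spec] at h1
    have := Nat.le_of_dvd hn h1
    omega
  have hunit : ∀ x : o, IsUnit x → IsUnit (algebraMap o S x) := fun x hx => hx.map _
  have hmapo : ∀ x : o, algebraMap o S x = ⟨Ideal.Quotient.mk _ x, 0⟩ := fun x => rfl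
  have hϖre : ∀ (k : ℕ) (z : S), (ϖ ^ k * z).re = Ideal.Quotient.mk _ (π ^ k) * z.re := by
    intro k z
    have : ϖ ^ k = algebraMap o S (π ^ k) := (map_pow _ _ _).symm
    rw [this, hmapo, QuadraticAlgebra.re_mul, mul_zero, zero_mul, add_zero]
  have hϖim : ∀ (k : ℕ) (z : S), (ϖ ^ k * z).im = Ideal.Quotient.mk _ (π ^ k) * z.im := by
    intro k z
    have : ϖ ^ k = algebraMap o S (π ^ k) := (map_pow _ _ _).symm
    rw [this, hmapo, QuadraticAlgebra.im_mul, mul_zero, zero_mul, zero_mul, add_zero, add_zero]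
  have hlift : ∀ z : S, ∃ a b : o, z = ⟨Ideal.Quotient.mk _ a, Ideal.Quotient.mk _ b⟩ := fun z => by
    obtain ⟨a, ha⟩ := Ideal.Quotient.mk_surjective z.re
    obtain ⟨b, hb⟩ := Ideal.Quotient.mk_surjective z.im
    exact ⟨a, b, by ext <;> simp [ha, hb]⟩
  have hzero : ∀ a : o, Ideal.Quotient.mk (maximalIdeal o ^ ℓ) a = 0 ↔ π ^ ℓ ∣ a := fun a => by
    rw [Ideal.Quotient.eq_zero_iff_mem, hm, Ideal.span_singleton_pow, Ideal.mem_span_singleton]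
  have hbigP : bigP u ℓ = Ideal.span {ϖ} := by
    exact (congrArg (Ideal.map _) hm).trans (by rw [Ideal.map_span, Set.image_singleton])
  have hmm : ∀ x, x ∈ maximalIdeal o ↔ π ∣ x := fun x => by
    rw [hm, Ideal.mem_span_singleton]
  have hmemP : ∀ a b : o, (⟨Ideal.Quotient.mk _ a, Ideal.Quotient.mk _ b⟩ : S) ∈ bigP u ℓ ↔
      a ∈ maximalIdeal o ∧ b ∈ maximalIdeal o := by
    intro a b
    have hdvd : π ∣ π ^ ℓ := dvd_pow_self _ (by omega)
    rw [hbigP, Ideal.mem_span_singleton, hmm, hmm]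
    constructor
    · rintro ⟨z, hz⟩
      obtain ⟨c, d, rfl⟩ := hlift z
      have h1 := hϖre 1 ⟨Ideal.Quotient.mk _ c, Ideal.Quotient.mk _ d⟩
      have h2 := hϖim 1 ⟨Ideal.Quotient.mk _ c, Ideal.Quotient.mk _ d⟩
      rw [pow_one, ← hz] at h1 h2
      rw [pow_one] at h1 h2
      simp only [← map_mul] at h1 h2
      rw [← sub_eq_zero, ← map_sub, hzero] at h1 h2
      exact ⟨(dvd_sub_left (dvd_mul_right _ _)).1 (hdvd.trans h1),
        (dvd_sub_left (dvd_mul_right _ _)).1 (hdvd.trans h2)⟩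
    · rintro ⟨⟨c, rfl⟩, ⟨d, rfl⟩⟩
      refine ⟨⟨Ideal.Quotient.mk _ c, Ideal.Quotient.mk _ d⟩, ?_⟩
      have h1 := hϖre 1 ⟨Ideal.Quotient.mk _ c, Ideal.Quotient.mk _ d⟩
      have h2 := hϖim 1 ⟨Ideal.Quotient.mk _ c, Ideal.Quotient.mk _ d⟩
      rw [pow_one, pow_one] at h1 h2
      ext
      · rw [h1]; simp
      · rw [h2]; simp
  have hfinR : Finite (SmallRing o ℓ) := by
    have : Finite (o ⧸ maximalIdeal o) := ‹Finite (IsLocalRing.ResidueField o)›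
    exact Ideal.finite_quotient_pow (IsNoetherian.noetherian _) _
  -- an element whose norm is divisible by the uniformizer is itself divisible
  have hnorm : ∀ a b : o, a * a - u * (b * b) ∈ maximalIdeal o →
      a ∈ maximalIdeal o ∧ b ∈ maximalIdeal o := by
    intro a b hab
    have hb : b ∈ maximalIdeal o := by
      by_contra hb
      have hbu : IsUnit b := by
        by_contra h; exact hb ((mem_maximalIdeal _).2 h)
      obtain ⟨b', hb'⟩ := hbu.exists_right_inv
      have hc : (a * b') * (a * b') - u ∈ maximalIdeal o := by
        have h1 : (a * b') * (a * b') - u = (a * a - u * (b * b)) * (b' * b') := by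
          linear_combination u * (b * b' + 1) * hb'
        rw [h1]
        exact Ideal.mul_mem_right _ _ hab
      have hcu : IsUnit (a * b') := by
        by_contra h
        have h1 : a * b' ∈ maximalIdeal o := (mem_maximalIdeal _).2 h
        have h2 : u ∈ maximalIdeal o := by
          have := Ideal.sub_mem _ (Ideal.mul_mem_left _ (a * b') h1) hc
          simpa using this
        exact (mem_maximalIdeal _).1 h2 hu
      obtain ⟨r, hr, -⟩ := HenselianRing.is_henselian (R := o) (I := maximalIdeal o)
        (Polynomial.X ^ 2 - Polynomial.C u) (Polynomial.monic_X_pow_sub_C u (by norm_num)) (a * b')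
        (by simpa [sq] using hc) (by
          have h2 : IsUnit (2 : o) := by simpa using hnat 2 (by norm_num) (by norm_num)
          have : (Polynomial.X ^ 2 - Polynomial.C u).derivative.eval (a * b') = 2 * (a * b') := by
            simp [one_add_one_eq_two]
          rw [this]
          exact (h2.mul hcu).map _)
      apply hu'
      refine ⟨r, ?_⟩
      have : r ^ 2 - u = 0 := by simpa [Polynomial.IsRoot] using hr
      rw [sub_eq_zero] at this
      rw [← this, sq]
    refine ⟨?_, hb⟩
    have h1 : a * a ∈ maximalIdeal o := by
      have := Ideal.add_mem _ hab (Ideal.mul_mem_left _ u (Ideal.mul_mem_left _ b hb))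
      simpa using this
    exact (Ideal.IsPrime.mem_or_mem (maximalIdeal.isMaximal o).isPrime h1).elim id id
  have hmulstar : ∀ a b : o, (⟨Ideal.Quotient.mk _ a, Ideal.Quotient.mk _ b⟩ : S) *
      star (⟨Ideal.Quotient.mk _ a, Ideal.Quotient.mk _ b⟩ : S) =
      algebraMap o S (a * a - u * (b * b)) := by
    intro a b
    rw [hmapo]
    ext
    · simp; ring
    · simp; ring
  have hunitS : ∀ x : S, x ∉ bigP u ℓ → IsUnit x := by
    intro x hx
    obtain ⟨a, b, rfl⟩ := hlift x
    rw [hmemP] at hx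
    have h1 : a * a - u * (b * b) ∉ maximalIdeal o := fun h => hx (hnorm a b h)
    have h2 : IsUnit (a * a - u * (b * b)) := by
      by_contra h; exact h1 ((mem_maximalIdeal _).2 h)
    refine isUnit_of_mul_isUnit_left (y := star (⟨Ideal.Quotient.mk _ a, Ideal.Quotient.mk _ b⟩ : S)) ?_
    rw [hmulstar]
    exact hunit _ h2
  refine ⟨ϖ, ?_⟩
  constructor
  · exact Finite.of_equiv _ (QuadraticAlgebra.equivProd _ _).symm
  · exact star_algebraMap π
  · exact hbigP
  · have h1 : ϖ ^ ℓ = algebraMap o S (π ^ ℓ) := (map_pow _ _ _).symm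
    rw [h1, hmapo, (hzero _).2 dvd_rfl]
    rfl
  · intro a c x y hac h
    obtain ⟨x₁, x₂, rfl⟩ := hlift x
    obtain ⟨y₁, y₂, rfl⟩ := hlift y
    have key : ∀ x₁ y₁ : o, Ideal.Quotient.mk (maximalIdeal o ^ ℓ) (π ^ a) *
        Ideal.Quotient.mk _ x₁ = Ideal.Quotient.mk _ (π ^ (a + c)) * Ideal.Quotient.mk _ y₁ →
        ∃ z₁, x₁ = π ^ c * z₁ := by
      intro x₁ y₁ h
      rw [← map_mul, ← map_mul, ← sub_eq_zero, ← map_sub, hzero] at h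
      obtain ⟨z, hz⟩ := h
      obtain ⟨e, he⟩ := Nat.exists_eq_add_of_le hac
      refine ⟨y₁ + π ^ e * z, ?_⟩
      apply mul_left_cancel₀ (pow_ne_zero a hπ0)
      rw [he, pow_add, pow_add] at hz
      rw [pow_add] at hz
      linear_combination hz
    have h1 := congrArg QuadraticAlgebra.re h
    have h2 := congrArg QuadraticAlgebra.im h
    rw [hϖre, hϖre] at h1
    rw [hϖim, hϖim] at h2
    obtain ⟨z₁, rfl⟩ := key _ _ h1
    obtain ⟨z₂, rfl⟩ := key _ _ h2
    refine ⟨⟨Ideal.Quotient.mk _ z₁, Ideal.Quotient.mk _ z₂⟩, ?_⟩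
    ext
    · rw [hϖre]; simp
    · rw [hϖim]; simp
  · exact hunitS
  · have := hunit _ (hnat 2 (by norm_num) (by norm_num))
    rwa [map_natCast, Nat.cast_ofNat] at this
  · have := hunit _ (hnat 3 (by norm_num) (by norm_num))
    rwa [map_natCast, Nat.cast_ofNat] at this
  · have hprime : (ringChar (IsLocalRing.ResidueField o)).Prime :=
      CharP.char_is_prime (IsLocalRing.ResidueField o) _
    refine ⟨ringChar (IsLocalRing.ResidueField o), hprime.odd_of_ne_two (by omega), hprime, ?_⟩
    have h1 : ((ringChar (IsLocalRing.ResidueField o) : ℕ) : o) ∈ maximalIdeal o := by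
      rw [← residue_eq_zero_iff, map_natCast]
      exact ringChar.Nat.cast_ringChar
    have := Ideal.mem_map_of_mem (algebraMap o S) h1
    rw [map_natCast] at this
    exact this
  · let φ : o × o → S ⧸ bigP u ℓ := fun x =>
      Ideal.Quotient.mk _ ⟨Ideal.Quotient.mk _ x.1, Ideal.Quotient.mk _ x.2⟩
    have hφ : ∀ x y : o × o, φ x = φ y ↔ residue o x.1 = residue o y.1 ∧
        residue o x.2 = residue o y.2 := by
      intro x y
      rw [← sub_eq_zero (a := residue o x.1), ← sub_eq_zero (a := residue o x.2), ← map_sub,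
        ← map_sub, residue_eq_zero_iff, residue_eq_zero_iff, ← hmemP, Ideal.Quotient.eq]
      rw [map_sub, map_sub]
      rfl
    have hsurj : Function.Surjective (fun x : o × o => (residue o x.1, residue o x.2)) := by
      rintro ⟨a, b⟩
      obtain ⟨a, rfl⟩ := residue_surjective a
      obtain ⟨b, rfl⟩ := residue_surjective b
      exact ⟨(a, b), rfl⟩
    have hsurj' : Function.Surjective φ := by
      intro z
      obtain ⟨z, rfl⟩ := Ideal.Quotient.mk_surjective z
      obtain ⟨a, b, rfl⟩ := hlift z
      exact ⟨(a, b), rfl⟩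
    have e : (S ⧸ bigP u ℓ) ≃ (ResidueField o × ResidueField o) := by
      refine Equiv.ofBijective (fun z => (fun x : o × o => (residue o x.1, residue o x.2))
        (Function.surjInv hsurj' z)) ⟨fun z w h => ?_, fun y => ?_⟩
      · have h1 := (hφ (Function.surjInv hsurj' z) (Function.surjInv hsurj' w)).2
          (Prod.ext_iff.1 h)
        rwa [Function.surjInv_eq hsurj' z, Function.surjInv_eq hsurj' w] at h1
      · obtain ⟨x, rfl⟩ := hsurj y
        refine ⟨φ x, ?_⟩
        have h1 := (hφ (Function.surjInv hsurj' (φ x)) x).1 (Function.surjInv_eq hsurj' _)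
        exact Prod.ext h1.1 h1.2
    rw [Nat.card_congr e, Nat.card_prod, sq]
  · intro x hx hxP
    obtain ⟨c, b, rfl⟩ := hlift x
    have := Fintype.ofFinite (ResidueField o)
    have hb : b ∈ maximalIdeal o := by
      have h1 := congrArg QuadraticAlgebra.im hx
      simp only [QuadraticAlgebra.im_star] at h1
      rw [← map_neg, ← sub_eq_zero, ← map_sub, hzero] at h1
      have h2 : IsUnit (2 : o) := by simpa using hnat 2 (by norm_num) (by norm_num)
      obtain ⟨i, hi⟩ := h2.exists_right_inv
      have h3 : π ∣ -b - b := (dvd_pow_self _ (by omega)).trans h1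
      rw [hmm]
      have h4 : b = (-b - b) * (-i) := by linear_combination (-b) * hi
      rw [h4]
      exact dvd_mul_of_dvd_left h3 _
    have hu0 : residue o u ≠ 0 := fun h => by
      rw [residue_eq_zero_iff] at h
      exact (mem_maximalIdeal _).1 h hu
    have hcard : Fintype.card (ResidueField o) % 2 = 1 := by
      refine FiniteField.odd_card_of_char_ne_two ?_
      omega
    obtain ⟨s, t, hst⟩ := FiniteField.exists_root_sum_quadratic
      (f := Polynomial.X ^ 2 - Polynomial.C (residue o c))
      (g := Polynomial.C (-residue o u) * Polynomial.X ^ 2)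
      (Polynomial.degree_X_pow_sub_C (by norm_num) _)
      (by
        have := Polynomial.degree_C_mul_X_pow 2 (neg_ne_zero.2 hu0)
        exact_mod_cast this) hcard
    obtain ⟨s, rfl⟩ := residue_surjective s
    obtain ⟨t, rfl⟩ := residue_surjective t
    refine ⟨⟨Ideal.Quotient.mk _ s, Ideal.Quotient.mk _ t⟩, ?_⟩
    rw [hmulstar, hmapo]
    have h1 : (⟨Ideal.Quotient.mk _ (s * s - u * (t * t)), 0⟩ : S) -
        ⟨Ideal.Quotient.mk _ c, Ideal.Quotient.mk _ b⟩ =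
        ⟨Ideal.Quotient.mk _ (s * s - u * (t * t) - c), Ideal.Quotient.mk _ (-b)⟩ := by
      ext <;> simp
    rw [h1, hmemP]
    refine ⟨?_, neg_mem hb⟩
    rw [← residue_eq_zero_iff]
    simp only [Polynomial.eval_sub, Polynomial.eval_pow, Polynomial.eval_X, Polynomial.eval_C,
      Polynomial.eval_mul] at hst
    simp only [map_sub, map_mul]
    linear_combination hst
  · refine hunitS _ fun h => ?_
    have h1 := (hmemP 0 1).1 (by simpa using h)
    exact (Ideal.ne_top_iff_one _).1 (maximalIdeal.isMaximal o).ne_top h1.2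
  · omega
  · intro y hy
    rw [hm, Ideal.span_singleton_pow, Ideal.mem_span_singleton] at hy
    obtain ⟨z, rfl⟩ := hy
    rw [map_mul, map_pow]
    exact Ideal.mul_mem_right _ _ (Ideal.mem_span_singleton_self _)

end RingFacts

/-! ### Congruence filtration and involutions on matrices -/

section MatrixFiltration

variable {R : Type*} [CommRing R]

/-- The matrices all of whose entries are divisible by `ϖ ^ k`. -/
def matP (ϖ : R) (k : ℕ) : Submodule R (Matrix (Fin 3) (Fin 3) R) where
  carrier := {X | ∃ Y : Matrix (Fin 3) (Fin 3) R, X = ϖ ^ k • Y}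
  add_mem' := by
    rintro _ _ ⟨Y, rfl⟩ ⟨Z, rfl⟩
    exact ⟨Y + Z, (smul_add _ _ _).symm⟩
  zero_mem' := ⟨0, (smul_zero _).symm⟩
  smul_mem' := by
    rintro c _ ⟨Y, rfl⟩
    exact ⟨c • Y, smul_comm _ _ _⟩

variable {ϖ : R} {X Y Z : Matrix (Fin 3) (Fin 3) R} {a b c k l : ℕ}

lemma mem_matP : X ∈ matP ϖ k ↔ ∃ Y : Matrix (Fin 3) (Fin 3) R, X = ϖ ^ k • Y := Iff.rfl

lemma mem_matP_iff : X ∈ matP ϖ k ↔ ∀ i j, ∃ y, X i j = ϖ ^ k * y := by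
  constructor
  · rintro ⟨Y, rfl⟩ i j
    exact ⟨Y i j, rfl⟩
  · intro h
    choose y hy using h
    exact ⟨Matrix.of y, by ext i j; exact hy i j⟩

lemma matP_anti (h : k ≤ l) : matP ϖ l ≤ matP ϖ k := by
  rintro _ ⟨Y, rfl⟩
  obtain ⟨c, rfl⟩ := Nat.exists_eq_add_of_le h
  exact ⟨ϖ ^ c • Y, by rw [smul_smul, ← pow_add]⟩

lemma mul_mem_matP (hX : X ∈ matP ϖ a) (hY : Y ∈ matP ϖ b) (h : c ≤ a + b) :
    X * Y ∈ matP ϖ c := by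
  refine matP_anti h ?_
  obtain ⟨X, rfl⟩ := hX
  obtain ⟨Y, rfl⟩ := hY
  exact ⟨X * Y, by rw [smul_mul_smul_comm, ← pow_add]⟩

lemma mem_matP_zero (X : Matrix (Fin 3) (Fin 3) R) : X ∈ matP ϖ 0 := ⟨X, by simp⟩

lemma mul_mem_matP_left (Y : Matrix (Fin 3) (Fin 3) R) (hX : X ∈ matP ϖ a) : Y * X ∈ matP ϖ a :=
  mul_mem_matP (mem_matP_zero Y) hX (by omega)

lemma mul_mem_matP_right (Y : Matrix (Fin 3) (Fin 3) R) (hX : X ∈ matP ϖ a) : X * Y ∈ matP ϖ a :=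
  mul_mem_matP hX (mem_matP_zero Y) (by omega)

lemma comm_mem_matP (hX : X ∈ matP ϖ a) (hY : Y ∈ matP ϖ b) (h : c ≤ a + b) :
    X * Y - Y * X ∈ matP ϖ c :=
  sub_mem (mul_mem_matP hX hY h) (mul_mem_matP hY hX (by omega))

lemma comm_mem_matP_left (X : Matrix (Fin 3) (Fin 3) R) (hY : Y ∈ matP ϖ b) :
    X * Y - Y * X ∈ matP ϖ b :=
  comm_mem_matP (mem_matP_zero X) hY (by omega)

lemma eq_zero_of_mem_matP (hϖ : ϖ ^ l = 0) (hX : X ∈ matP ϖ k) (h : l ≤ k) : X = 0 := by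
  obtain ⟨Y, rfl⟩ := matP_anti h hX
  rw [hϖ, zero_smul]

lemma trace_mul_eq_zero (hϖ : ϖ ^ l = 0) (hX : X ∈ matP ϖ a) (hY : Y ∈ matP ϖ b) (h : l ≤ a + b) :
    trace (X * Y) = 0 := by
  rw [eq_zero_of_mem_matP hϖ (mul_mem_matP hX hY le_rfl) h, trace_zero]

lemma smul_mem_matP_iff {r : R} (hr : IsUnit r) : r • X ∈ matP ϖ k ↔ X ∈ matP ϖ k := by
  refine ⟨fun h => ?_, fun h => Submodule.smul_mem _ _ h⟩
  obtain ⟨s, hs⟩ := hr.exists_left_inv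
  have := Submodule.smul_mem _ s h
  rwa [smul_smul, hs, one_smul] at this

lemma trace_comm_mul (A X Y : Matrix (Fin 3) (Fin 3) R) :
    trace (A * (X * Y - Y * X)) = trace ((A * X - X * A) * Y) := by
  rw [mul_sub, sub_mul, trace_sub, trace_sub, ← mul_assoc, ← mul_assoc, trace_mul_comm (A * Y) X,
    ← mul_assoc X A Y]

variable [StarRing R]

/-- The involution of the matrix ring over `𝔒_ℓ` that is entrywise conjugation in the linear case
and `X ↦ X^⋆` in the unitary case. -/
def theta (ε : GroupType) (X : Matrix (Fin 3) (Fin 3) R) : Matrix (Fin 3) (Fin 3) R :=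
  match ε with
  | .linear => X.map star
  | .unitary => adj X

/-- The semilinear involution of the Lie ring of all matrices whose fixed points form the Lie
ring of `G`. -/
def tau (ε : GroupType) (X : Matrix (Fin 3) (Fin 3) R) : Matrix (Fin 3) (Fin 3) R :=
  match ε with
  | .linear => X.map star
  | .unitary => -adj X

lemma adj_apply (X : Matrix (Fin 3) (Fin 3) R) (i j : Fin 3) :
    adj X i j = star (X (Fin.rev j) (Fin.rev i)) := rfl

lemma tau_add (ε : GroupType) (X Y : Matrix (Fin 3) (Fin 3) R) :
    tau ε (X + Y) = tau ε X + tau ε Y := by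
  cases ε <;> ext i j <;> simp [tau, adj_apply, add_comm]

lemma tau_smul (ε : GroupType) (c : R) (X : Matrix (Fin 3) (Fin 3) R) :
    tau ε (c • X) = star c • tau ε X := by
  cases ε <;> ext i j <;> simp [tau, adj_apply]

lemma tau_zero (ε : GroupType) : tau ε (0 : Matrix (Fin 3) (Fin 3) R) = 0 := by
  cases ε <;> ext i j <;> simp [tau, adj_apply]

lemma tau_neg (ε : GroupType) (X : Matrix (Fin 3) (Fin 3) R) : tau ε (-X) = -tau ε X := by
  cases ε <;> ext i j <;> simp [tau, adj_apply]

lemma tau_sub (ε : GroupType) (X Y : Matrix (Fin 3) (Fin 3) R) :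
    tau ε (X - Y) = tau ε X - tau ε Y := by
  rw [sub_eq_add_neg, tau_add, tau_neg, ← sub_eq_add_neg]

lemma tau_tau (ε : GroupType) (X : Matrix (Fin 3) (Fin 3) R) : tau ε (tau ε X) = X := by
  cases ε <;> ext i j <;> simp [tau, adj_apply]

lemma adj_adj (X : Matrix (Fin 3) (Fin 3) R) : adj (adj X) = X := by
  ext i j; simp [adj_apply]

lemma adj_sub (X Y : Matrix (Fin 3) (Fin 3) R) : adj (X - Y) = adj X - adj Y := by
  ext i j; simp [adj_apply]

lemma theta_eq (ε : GroupType) (X : Matrix (Fin 3) (Fin 3) R) :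
    theta ε X = tau ε X ∨ theta ε X = -tau ε X := by
  cases ε
  · exact Or.inl rfl
  · exact Or.inr (neg_neg _).symm

lemma map_star_mul (X Y : Matrix (Fin 3) (Fin 3) R) :
    (X * Y).map star = X.map star * Y.map star := by
  rw [show (star : R → R) = (starRingEnd R) from rfl, Matrix.map_mul]

lemma trace_adj (X : Matrix (Fin 3) (Fin 3) R) : trace (adj X) = star (trace X) := by
  simp only [trace_fin_three, adj_apply, star_add]
  simp only [show Fin.rev (0 : Fin 3) = 2 from rfl, show Fin.rev (1 : Fin 3) = 1 from rfl,
    show Fin.rev (2 : Fin 3) = 0 from rfl]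
  ring

lemma trace_tau_mul_tau (ε : GroupType) (X Y : Matrix (Fin 3) (Fin 3) R) :
    trace (tau ε X * tau ε Y) = star (trace (X * Y)) := by
  cases ε
  · simp only [tau, ← map_star_mul]
    simp [trace_fin_three]
  · simp only [tau, neg_mul_neg, ← adj_mul]
    rw [trace_adj, trace_mul_comm]

lemma tau_comm (ε : GroupType) (X Y : Matrix (Fin 3) (Fin 3) R) :
    tau ε (X * Y - Y * X) = tau ε X * tau ε Y - tau ε Y * tau ε X := by
  cases ε
  · simp only [tau, ← map_star_mul]
    ext i j
    simp
  · simp only [tau, neg_mul_neg, ← adj_mul, adj_sub]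
    abel

lemma theta_comm (ε : GroupType) (X Y : Matrix (Fin 3) (Fin 3) R) :
    theta ε (X * Y - Y * X) = theta ε X * tau ε Y - tau ε Y * theta ε X := by
  cases ε
  · simp only [tau, theta, ← map_star_mul]
    ext i j
    simp
  · simp only [tau, theta, neg_mul, mul_neg, ← adj_mul, adj_sub]
    abel

lemma tau_mem_matP (ε : GroupType) (hϖ : star ϖ = ϖ) (hX : X ∈ matP ϖ k) : tau ε X ∈ matP ϖ k := by
  obtain ⟨Y, rfl⟩ := hX
  exact ⟨tau ε Y, by rw [tau_smul, star_pow, hϖ]⟩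

lemma theta_mem_iff (ε : GroupType) (B : Submodule R (Matrix (Fin 3) (Fin 3) R)) :
    theta ε X ∈ B ↔ tau ε X ∈ B := by
  rcases theta_eq ε X with h | h <;> rw [h]
  rw [neg_mem_iff]

/-- The group automorphism of `GL_3` whose fixed points form the group `G`. -/
def sig (ε : GroupType) : GL (Fin 3) R →* GL (Fin 3) R :=
  match ε with
  | .linear => GeneralLinearGroup.map (starRingEnd R)
  | .unitary =>
    { toFun := fun g => ⟨adj (g⁻¹ : GL (Fin 3) R).1, adj g.1,
        by rw [← adj_mul, Units.mul_inv, adj_one], by rw [← adj_mul, Units.inv_mul, adj_one]⟩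
      map_one' := by ext1; simp [adj_one]
      map_mul' := fun g h => by
        ext1
        change adj ((g * h)⁻¹).1 = adj (g⁻¹).1 * adj (h⁻¹).1
        rw [_root_.mul_inv_rev]
        exact adj_mul _ _ }

lemma sig_linear_val (g : GL (Fin 3) R) : (sig .linear g).1 = g.1.map star := rfl

lemma sig_unitary_val (g : GL (Fin 3) R) : (sig .unitary g).1 = adj (g⁻¹).1 := rfl

lemma sig_sig (ε : GroupType) (g : GL (Fin 3) R) : sig ε (sig ε g) = g := by
  cases ε
  · ext i j
    simp [sig_linear_val]
  · apply Units.ext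
    rw [sig_unitary_val, ← map_inv, sig_unitary_val, inv_inv, adj_adj]

/-- To first order, the automorphism of the group is the involution of the Lie ring. -/
lemma sig_sub_one (ε : GroupType) (g : GL (Fin 3) R) :
    (sig ε g).1 - 1 = tau ε (g.1 - 1) ∨
      (sig ε g).1 - 1 = tau ε (g.1 - 1) - tau ε ((g.1 - 1) * (g.1 - 1) * (g⁻¹).1) := by
  cases ε
  · left
    rw [sig_linear_val]
    ext i j
    by_cases hij : i = j <;> simp [tau, hij]
  · right
    rw [sig_unitary_val, ← tau_sub]
    have h : g.1 * (g⁻¹).1 = 1 := Units.mul_inv _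
    have h1 : g.1 - 1 - (g.1 - 1) * (g.1 - 1) * (g⁻¹).1 = -((g⁻¹).1 - 1) := by
      have h2 : (g.1 - 1) * (g.1 - 1) * (g⁻¹).1 =
          g.1 * (g.1 * (g⁻¹).1) - 2 • (g.1 * (g⁻¹).1) + (g⁻¹).1 := by
        noncomm_ring
      rw [h2, h, mul_one]
      abel
    rw [h1]
    simp only [tau]
    rw [neg_sub, adj_sub, adj_one, neg_sub]

lemma sig_commute (ε : GroupType) {g : GL (Fin 3) R} (h : g.1 * X = X * g.1) :
    (sig ε g).1 * theta ε X = theta ε X * (sig ε g).1 := by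
  cases ε
  · simp only [sig_linear_val, theta, ← map_star_mul, h]
  · simp only [sig_unitary_val, theta, ← adj_mul]
    congr 1
    exact (Commute.units_inv_left (u := g) (show Commute g.1 X from h)).eq.symm

end MatrixFiltration

/-! ### Congruence subgroups and lifting -/

section CongruenceSubgroups

variable {o : Type*} [CommRing o] [IsLocalRing o] {u : o} {ℓ q : ℕ} {ϖ : BigRing u ℓ}

namespace IsUniformized

variable (hS : IsUniformized u ℓ q ϖ)

include hS

lemma mem_bigP_pow {k : ℕ} {x : BigRing u ℓ} : x ∈ bigP u ℓ ^ k ↔ ∃ y, x = ϖ ^ k * y := by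
  rw [hS.bigP_eq, Ideal.span_singleton_pow, Ideal.mem_span_singleton]
  rfl

lemma isReal_iff {x : BigRing u ℓ} : IsReal x ↔ star x = x := by
  constructor
  · rintro ⟨y, rfl⟩
    ext <;> simp
  · intro h
    refine ⟨x.re, ?_⟩
    have h1 : (2 : BigRing u ℓ) * (⟨0, x.im⟩ : BigRing u ℓ) = 0 := by
      have h2 := congrArg QuadraticAlgebra.im h
      rw [QuadraticAlgebra.im_star] at h2
      have h3 : x.im + x.im = 0 := by linear_combination -h2
      rw [two_mul]
      ext
      · simp
      · simpa using h3
    have h2 := congrArg QuadraticAlgebra.im ((hS.isUnit_two.mul_right_eq_zero).1 h1)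
    ext
    · simp
    · simpa using h2.symm

/-- Both groups are the fixed points of an involution of `GL_3` over the big ring: entrywise conjugation
for the linear group, the inverse of the adjoint for the unitary one. -/
lemma mem_grp_iff {ε : GroupType} {g : GL (Fin 3) (BigRing u ℓ)} :
    g ∈ grp ε u ℓ ↔ sig ε g = g := by
  cases ε
  · constructor
    · rintro ⟨h, rfl⟩
      apply Units.ext
      rw [sig_linear_val]
      ext1 i j
      exact hS.isReal_iff.1 ⟨h.1 i j, rfl⟩
    · intro h
      have hre : ∀ (k : GL (Fin 3) (BigRing u ℓ)), sig .linear k = k →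
          k.1 = (k.1.map QuadraticAlgebra.re).map (algebraMap (SmallRing o ℓ) (BigRing u ℓ)) := by
        intro k hk
        ext1 i j
        have h0 := congrArg Units.val hk
        have h1 : star (k.1 i j) = k.1 i j := congrFun (congrFun h0 i) j
        obtain ⟨y, hy⟩ := hS.isReal_iff.2 h1
        simp only [map_apply]
        rw [← hy]
        rfl
      have hinj : Function.Injective (algebraMap (SmallRing o ℓ) (BigRing u ℓ)) := fun x y hxy =>
        congrArg QuadraticAlgebra.re hxy
      have h1 := hre g h
      have h2 := hre g⁻¹ (by rw [map_inv, h])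
      have key : ∀ k k' : GL (Fin 3) (BigRing u ℓ), k * k' = 1 →
          k.1 = (k.1.map QuadraticAlgebra.re).map (algebraMap (SmallRing o ℓ) (BigRing u ℓ)) →
          k'.1 = (k'.1.map QuadraticAlgebra.re).map (algebraMap (SmallRing o ℓ) (BigRing u ℓ)) →
          k.1.map QuadraticAlgebra.re * k'.1.map QuadraticAlgebra.re = 1 := by
        intro k k' hk h1 h2
        apply Matrix.map_injective hinj
        beta_reduce
        rw [Matrix.map_mul, ← h1, ← h2, ← Units.val_mul, hk]
        simp
      refine ⟨⟨g.1.map QuadraticAlgebra.re, (g⁻¹).1.map QuadraticAlgebra.re,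
        key _ _ (mul_inv_cancel g) h1 h2, key _ _ (inv_mul_cancel g) h2 h1⟩, ?_⟩
      apply Units.ext
      exact h1.symm
  · constructor
    · intro h
      change adj g.1 * g.1 = 1 at h
      apply Units.ext
      rw [sig_unitary_val]
      have h1 : adj g.1 = (g⁻¹).1 := by
        calc adj g.1 = adj g.1 * (g.1 * (g⁻¹).1) := by rw [Units.mul_inv, mul_one]
          _ = _ := by rw [← mul_assoc, h, one_mul]
      rw [← h1, adj_adj]
    · intro h
      change adj g.1 * g.1 = 1
      have h1 := congrArg Units.val h
      rw [sig_unitary_val] at h1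
      rw [← h1, adj_adj, h1, Units.inv_mul]

lemma mem_lieRing_iff {ε : GroupType} {X : Matrix (Fin 3) (Fin 3) (BigRing u ℓ)} :
    X ∈ lieRing ε u ℓ ↔ tau ε X = X := by
  cases ε
  · change (∀ i j, IsReal (X i j)) ↔ X.map star = X
    simp only [hS.isReal_iff]
    exact ⟨fun h => by ext1 i j; exact h i j, fun h i j => congrFun (congrFun h i) j⟩
  · change X + adj X = 0 ↔ -adj X = X
    constructor
    · intro h
      exact (eq_neg_of_add_eq_zero_left h).symm
    · intro h
      nth_rw 1 [← h]
      exact neg_add_cancel _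

lemma redMat_eq_iff {k : ℕ} {X Y : Matrix (Fin 3) (Fin 3) (BigRing u ℓ)} :
    redMat u ℓ k X = redMat u ℓ k Y ↔ X - Y ∈ matP ϖ k := by
  rw [mem_matP_iff]
  constructor
  · intro h i j
    have h1 := congrFun (congrFun h i) j
    exact hS.mem_bigP_pow.1 (Ideal.Quotient.eq.1 h1)
  · intro h
    ext1 i j
    exact Ideal.Quotient.eq.2 (hS.mem_bigP_pow.2 (h i j))

lemma mem_ker_redGL {k : ℕ} {g : GL (Fin 3) (BigRing u ℓ)} :
    g ∈ (redGL u ℓ k).ker ↔ g.1 - 1 ∈ matP ϖ k := by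
  rw [← hS.redMat_eq_iff, MonoidHom.mem_ker, Units.ext_iff]
  have : redMat u ℓ k 1 = 1 := by
    ext i j
    by_cases hij : i = j
    · subst hij; simp [redMat]
    · simp [redMat, hij]
  rw [this]
  rfl

lemma mem_cong {k : ℕ} {U : Subgroup (GL (Fin 3) (BigRing u ℓ))} {g : GL (Fin 3) (BigRing u ℓ)} :
    g ∈ cong U k ↔ g ∈ U ∧ g.1 - 1 ∈ matP ϖ k := by
  rw [cong, Subgroup.mem_inf, hS.mem_ker_redGL]

lemma mem_stabMod {k : ℕ} {U : Subgroup (GL (Fin 3) (BigRing u ℓ))}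
    {A : Matrix (Fin 3) (Fin 3) (BigRing u ℓ)} {g : GL (Fin 3) (BigRing u ℓ)} :
    g ∈ stabMod U A k ↔ g ∈ U ∧ A * g.1 - g.1 * A ∈ matP ϖ k := by
  rw [stabMod, Subgroup.mem_inf, ← hS.redMat_eq_iff]
  have hmul : ∀ X Y, redMat u ℓ k (X * Y) = redMat u ℓ k X * redMat u ℓ k Y := fun X Y => by
    simp [redMat, Matrix.map_mul]
  rw [hmul, hmul]
  exact and_congr_right fun _ => eq_comm

lemma finite_GL : Finite (GL (Fin 3) (BigRing u ℓ)) := by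
  have := hS.finite
  infer_instance

/-- The matrices congruent to `1` form a group of odd order, since they form a `p`-group. -/
lemma odd_card_ker : Odd (Nat.card (redGL u ℓ 1).ker) := by
  have := hS.finite_GL
  obtain ⟨p, hp, hp', hpP⟩ := hS.exists_prime
  have : Fact p.Prime := ⟨hp'⟩
  have hpϖ : ∃ y, (p : BigRing u ℓ) = ϖ ^ 1 * y := by
    rw [← hS.mem_bigP_pow, pow_one]; exact hpP
  -- the power `g ^ p` of an element of depth `k` has depth at least `k + 1`
  have hpow : ∀ (k n : ℕ) (X : Matrix (Fin 3) (Fin 3) (BigRing u ℓ)), X ∈ matP ϖ k →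
      (1 + X) ^ n - 1 - (n : BigRing u ℓ) • X ∈ matP ϖ (2 * k) := by
    intro k n X hX
    induction n with
    | zero => simp
    | succ n ih =>
      have h1 : (1 + X) ^ (n + 1) - 1 - ((n + 1 : ℕ) : BigRing u ℓ) • X =
          ((1 + X) ^ n - 1 - (n : BigRing u ℓ) • X) * (1 + X) + (n : BigRing u ℓ) • (X * X) := by
        rw [pow_succ, Nat.cast_add, Nat.cast_one, add_smul, one_smul]
        simp only [sub_mul, mul_add, one_mul, mul_one, smul_mul_assoc]
        abel
      rw [h1]
      exact add_mem (mul_mem_matP_right _ ih)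
        (Submodule.smul_mem _ _ (mul_mem_matP hX hX (by omega)))
  have hstep : ∀ (k : ℕ) (g : GL (Fin 3) (BigRing u ℓ)), 1 ≤ k → g.1 - 1 ∈ matP ϖ k →
      (g ^ p).1 - 1 ∈ matP ϖ (k + 1) := by
    intro k g hk hg
    have h1 := hpow k p _ hg
    rw [add_sub_cancel, ← Units.val_pow_eq_pow_val] at h1
    have h2 : (p : BigRing u ℓ) • (g.1 - 1) ∈ matP ϖ (k + 1) := by
      obtain ⟨y, hy⟩ := hpϖ
      obtain ⟨Y, hY⟩ := hg
      refine ⟨y • Y, ?_⟩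
      rw [hY, hy, smul_smul, smul_smul]
      congr 1
      ring
    have h3 := add_mem (matP_anti (show k + 1 ≤ 2 * k by omega) h1) h2
    rwa [sub_add_cancel] at h3
  have hiter : ∀ (n : ℕ) (g : GL (Fin 3) (BigRing u ℓ)), g.1 - 1 ∈ matP ϖ 1 →
      (g ^ p ^ n).1 - 1 ∈ matP ϖ (n + 1) := by
    intro n g hg
    induction n with
    | zero => simpa using hg
    | succ n ih =>
      rw [pow_succ, pow_mul]
      exact hstep _ _ (by omega) ih
  have hP : IsPGroup p (redGL u ℓ 1).ker := by
    rintro ⟨g, hg⟩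
    refine ⟨ℓ, ?_⟩
    have h1 := hiter ℓ g (hS.mem_ker_redGL.1 hg)
    have h2 := eq_zero_of_mem_matP hS.pow_eq_zero h1 (by omega)
    ext1
    apply Units.ext
    exact sub_eq_zero.1 h2
  obtain ⟨n, hn⟩ := IsPGroup.iff_card.1 hP
  rw [hn]
  exact hp.pow

lemma odd_card_of_le {U : Subgroup (GL (Fin 3) (BigRing u ℓ))} (hU : U ≤ (redGL u ℓ 1).ker) :
    Odd (Nat.card U) := by
  refine Odd.of_dvd_nat hS.odd_card_ker (Subgroup.card_dvd_of_le hU)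

/-- An element of a subgroup `H` that is fixed by the involution up to a group of odd order can be
corrected to a fixed element. -/
lemma exists_lift (ε : GroupType) {H B : Subgroup (GL (Fin 3) (BigRing u ℓ))}
    (hB : B ≤ (redGL u ℓ 1).ker) {x : GL (Fin 3) (BigRing u ℓ)} (hx : x ∈ H) (hx' : sig ε x ∈ H)
    (hκ : x⁻¹ * sig ε x ∈ B) : ∃ y ∈ H, y ∈ grp ε u ℓ ∧ x⁻¹ * y ∈ B := by
  have := hS.finite_GL
  have hodd : Odd (Nat.card B) := hS.odd_card_of_le hB
  obtain ⟨n, hn⟩ := hodd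
  set κ := x⁻¹ * sig ε x with hκdef
  have hκ1 : κ ^ (n + 1) * κ ^ n = 1 := by
    rw [← pow_add, show n + 1 + n = Nat.card B by omega]
    exact congrArg Subtype.val (pow_card_eq_one' (x := (⟨κ, hκ⟩ : B)))
  -- `κ` is inverted by the involution, and `κ ^ (n + 1)` is its square root
  have hκ2 : sig ε κ = κ⁻¹ := by
    rw [hκdef, map_mul, map_inv, sig_sig, _root_.mul_inv_rev, inv_inv]
  refine ⟨x * κ ^ (n + 1), H.mul_mem hx (H.pow_mem (H.mul_mem (H.inv_mem hx) hx') _),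
    hS.mem_grp_iff.2 ?_, by simpa using B.pow_mem hκ _⟩
  have h1 : sig ε x = x * κ := by rw [hκdef, mul_inv_cancel_left]
  have h2 : κ⁻¹ ^ (n + 1) = κ ^ n := by
    rw [inv_pow, inv_eq_iff_mul_eq_one, hκ1]
  rw [map_mul, map_pow, hκ2, h1, h2, mul_assoc, ← pow_succ']

omit hS in
lemma sub_mem_iff_inv_mul {B : Submodule (BigRing u ℓ) (Matrix (Fin 3) (Fin 3) (BigRing u ℓ))}
    {x y : GL (Fin 3) (BigRing u ℓ)} (hB : ∀ Z : Matrix (Fin 3) (Fin 3) (BigRing u ℓ), Z ∈ B →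
      x.1 * Z ∈ B ∧ (x⁻¹).1 * Z ∈ B) : (x⁻¹ * y).1 - 1 ∈ B ↔ y.1 - x.1 ∈ B := by
  have h1 : x.1 * ((x⁻¹ * y).1 - 1) = y.1 - x.1 := by
    rw [mul_sub, mul_one, ← Units.val_mul, mul_inv_cancel_left]
  have h2 : (x⁻¹).1 * (y.1 - x.1) = (x⁻¹ * y).1 - 1 := by
    rw [mul_sub, ← Units.val_mul, Units.inv_mul]
  exact ⟨fun h => h1 ▸ (hB _ h).1, fun h => h2 ▸ (hB _ h).2⟩

lemma inv_mul_mem_ker_iff {k : ℕ} {x y : GL (Fin 3) (BigRing u ℓ)} :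
    x⁻¹ * y ∈ (redGL u ℓ k).ker ↔ y.1 - x.1 ∈ matP ϖ k := by
  rw [hS.mem_ker_redGL]
  exact sub_mem_iff_inv_mul fun Z hZ => ⟨mul_mem_matP_left _ hZ, mul_mem_matP_left _ hZ⟩

lemma exists_lift_of_sub_mem (ε : GroupType) {H : Subgroup (GL (Fin 3) (BigRing u ℓ))} {k : ℕ}
    (hk : 1 ≤ k) {x : GL (Fin 3) (BigRing u ℓ)} (hx : x ∈ H) (hx' : sig ε x ∈ H)
    (hκ : (sig ε x).1 - x.1 ∈ matP ϖ k) : ∃ y ∈ H, y ∈ grp ε u ℓ ∧ y.1 - x.1 ∈ matP ϖ k := by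
  obtain ⟨y, hy, hy', h⟩ := hS.exists_lift ε (H := H) (B := (redGL u ℓ k).ker)
    (fun g hg => hS.mem_ker_redGL.2 (matP_anti hk (hS.mem_ker_redGL.1 hg))) hx hx'
    (hS.inv_mul_mem_ker_iff.2 hκ)
  exact ⟨y, hy, hy', hS.inv_mul_mem_ker_iff.1 h⟩

lemma isUnit_of_sub_mem_matP {X Y : Matrix (Fin 3) (Fin 3) (BigRing u ℓ)} (hX : IsUnit X)
    (h : Y - X ∈ matP ϖ 1) : IsUnit Y := by
  obtain ⟨x, rfl⟩ := hX
  have h1 : (x⁻¹).1 * (Y - x.1) ∈ matP ϖ 1 := mul_mem_matP_left _ h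
  have hn : IsNilpotent ((x⁻¹).1 * (Y - x.1)) := by
    refine ⟨ℓ, ?_⟩
    have : ∀ n, ((x⁻¹).1 * (Y - x.1)) ^ n ∈ matP ϖ n := by
      intro n
      induction n with
      | zero => exact mem_matP_zero _
      | succ n ih => rw [pow_succ]; exact mul_mem_matP ih h1 le_rfl
    exact eq_zero_of_mem_matP hS.pow_eq_zero (this ℓ) le_rfl
  have h2 := x.isUnit.mul hn.isUnit_one_add
  rwa [mul_add, mul_one, ← mul_assoc, Units.mul_inv, one_mul, add_sub_cancel] at h2

/-- The Lie ring modulo `𝔓 ^ (2 k)` is the set of all `g - 1`, for `g` in the congruence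
subgroup. -/
lemma exists_mem_grp_sub_one (ε : GroupType) {k : ℕ} (hk : 1 ≤ k)
    {Y : Matrix (Fin 3) (Fin 3) (BigRing u ℓ)} (hY : Y ∈ matP ϖ k) (hY' : tau ε Y = Y)
    {H : Subgroup (GL (Fin 3) (BigRing u ℓ))} (hH : ∀ x : GL (Fin 3) (BigRing u ℓ),
      x.1 = 1 + Y → x ∈ H ∧ sig ε x ∈ H) :
    ∃ g ∈ H, g ∈ grp ε u ℓ ∧ g.1 - 1 - Y ∈ matP ϖ (2 * k) := by
  obtain ⟨x, hx⟩ : IsUnit (1 + Y) := hS.isUnit_of_sub_mem_matP isUnit_one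
    (by rw [add_sub_cancel_left]; exact matP_anti hk hY)
  have hxY : x.1 - 1 = Y := by rw [hx, add_sub_cancel_left]
  obtain ⟨g, hg, hg', h⟩ := hS.exists_lift_of_sub_mem ε (show 1 ≤ 2 * k by omega) (hH x hx).1
    (hH x hx).2 (by
      have h1 : (sig ε x).1 - x.1 = ((sig ε x).1 - 1) - Y := by rw [hx]; abel
      rw [h1]
      rcases sig_sub_one ε x with h | h
      · rw [h, hxY, hY', sub_self]
        exact zero_mem _
      · rw [h, hxY, hY', sub_sub_cancel_left]
        exact neg_mem (tau_mem_matP ε hS.star_unif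
          (mul_mem_matP_right _ (mul_mem_matP hY hY (by omega)))))
  refine ⟨g, hg, hg', ?_⟩
  rw [sub_sub, ← hx]
  exact h

/-- For an element of the congruence subgroup, `g - 1` lies in the Lie ring up to terms of second
order. -/
lemma tau_sub_one_sub_mem {ε : GroupType} {k : ℕ} {g : GL (Fin 3) (BigRing u ℓ)}
    (hg : g ∈ grp ε u ℓ) (hgk : g.1 - 1 ∈ matP ϖ k) :
    tau ε (g.1 - 1) - (g.1 - 1) ∈ matP ϖ (2 * k) := by
  have h0 := hS.mem_grp_iff.1 hg
  rcases sig_sub_one ε g with h | h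
  · rw [← h, h0, sub_self]
    exact zero_mem _
  · rw [h0, eq_sub_iff_add_eq] at h
    rw [← h, add_sub_cancel_left]
    exact tau_mem_matP ε hS.star_unif (mul_mem_matP_right _ (mul_mem_matP hgk hgk (by omega)))

end IsUniformized

end CongruenceSubgroups

/-! ### Duality -/

/-- A character of a group that is trivial on the kernel of a homomorphism to a finite abelian
group comes from a character of the latter. -/
lemma exists_monoidHom_comp_eq {T G : Type*} [Group T] [CommGroup G] [Finite G] (h : T →* G)
    (ν : T →* ℂ) (hν : ∀ t, h t = 1 → ν t = 1) : ∃ Φ : G →* ℂ, ∀ t, Φ (h t) = ν t := by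
  have : NeZero (Monoid.exponent G) := ⟨Monoid.exponent_ne_zero_of_finite⟩
  let f : T →* h.range := h.rangeRestrict
  have hf : Function.Surjective f := h.rangeRestrict_surjective
  let ν' : h.range →* ℂˣ := (f.liftOfRightInverse _ (Function.rightInverse_surjInv hf))
    ⟨ν.toHomUnits, fun t ht => by
      ext
      exact hν t (congrArg Subtype.val ht)⟩
  obtain ⟨Φ, hΦ⟩ := MonoidHom.domRestrict_surjective (M := ℂ) h.range ν'
  refine ⟨(Units.coeHom ℂ).comp Φ, fun t => ?_⟩
  have h1 : Φ (h t) = ν' (f t) := DFunLike.congr_fun hΦ (f t)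
  have h2 : ν' (f t) = ν.toHomUnits t := MonoidHom.liftOfRightInverse_comp_apply ..
  change ((Φ (h t) : ℂˣ) : ℂ) = ν t
  rw [h1, h2]
  rfl

section Duality

variable {o : Type*} [CommRing o] [IsLocalRing o] {u : o} {ℓ q : ℕ} {ϖ : BigRing u ℓ}
  {ψ : AddChar (BigRing u ℓ) ℂ}

namespace IsUniformized

variable (hS : IsUniformized u ℓ q ϖ)

include hS

lemma star_inverse_two : star (Ring.inverse (2 : BigRing u ℓ)) = Ring.inverse 2 := by
  have h : (2 : BigRing u ℓ) * Ring.inverse 2 = 1 := Ring.mul_inverse_cancel _ hS.isUnit_two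
  have h2 : star (2 : BigRing u ℓ) * star (Ring.inverse 2) = 1 := by
    rw [← star_mul', h, star_one]
  rw [star_ofNat] at h2
  linear_combination (-star (Ring.inverse (2 : BigRing u ℓ))) * h + Ring.inverse 2 * h2

lemma half_add_half (x : BigRing u ℓ) : Ring.inverse 2 * x + Ring.inverse 2 * x = x := by
  have h : (2 : BigRing u ℓ) * Ring.inverse 2 = 1 := Ring.mul_inverse_cancel _ hS.isUnit_two
  linear_combination x * h

lemma exists_eq_pow_mul_unit {x : BigRing u ℓ} (hx : x ≠ 0) :
    ∃ j z, j < ℓ ∧ IsUnit z ∧ x = ϖ ^ j * z := by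
  classical
  by_contra hcon
  have h : ∀ j, j ≤ ℓ → ∃ z, x = ϖ ^ j * z := by
    intro j
    induction j with
    | zero => exact fun _ => ⟨x, by simp⟩
    | succ j ih =>
      intro hj
      obtain ⟨z, hz⟩ := ih (by omega)
      by_cases hzP : z ∈ bigP u ℓ
      · rw [← pow_one (bigP u ℓ), hS.mem_bigP_pow] at hzP
        obtain ⟨w, rfl⟩ := hzP
        exact ⟨w, by rw [hz, pow_one, pow_succ, mul_assoc]⟩
      · exact absurd ⟨j, z, by omega, hS.isUnit_of_notMem z hzP, hz⟩ hcon
  obtain ⟨z, hz⟩ := h ℓ le_rfl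
  rw [hS.pow_eq_zero, zero_mul] at hz
  exact hx hz

/-- The trace form of a primitive character is non-degenerate. -/
lemma eq_zero_of_forall_char (hψ : IsPrimitiveChar ψ) {x : BigRing u ℓ}
    (h : ∀ y, ψ (x * y + star (x * y)) = 1) : x = 0 := by
  by_contra hx
  obtain ⟨j, z, hj, hz, rfl⟩ := hS.exists_eq_pow_mul_unit hx
  obtain ⟨z', hz'⟩ := hz.exists_right_inv
  obtain ⟨y, hy, hy'⟩ := hψ
  apply hy'
  have hw := hS.real_mem y hy
  rw [Ideal.mem_span_singleton] at hw
  obtain ⟨w, hw⟩ := hw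
  have h1 := h (z' * (ϖ ^ (ℓ - 1 - j) * w * Ring.inverse 2))
  have h2 : ϖ ^ j * z * (z' * (ϖ ^ (ℓ - 1 - j) * w * Ring.inverse 2)) =
      Ring.inverse 2 * algebraMap o (BigRing u ℓ) y := by
    rw [hw, show ℓ - 1 = j + (ℓ - 1 - j) by omega, pow_add,
      show j + (ℓ - 1 - j) - j = ℓ - 1 - j by omega]
    linear_combination (ϖ ^ j * ϖ ^ (ℓ - 1 - j) * w * Ring.inverse 2) * hz'
  rwa [h2, star_mul', hS.star_inverse_two, star_algebraMap, hS.half_add_half] at h1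

/-- An element of the Lie ring is orthogonal to a stable submodule as soon as the character `ψ`
does not detect its pairing with the points of the Lie ring in that submodule. -/
lemma trace_eq_zero_of_forall (hψ : IsPrimitiveChar ψ) {ε : GroupType}
    {D : Matrix (Fin 3) (Fin 3) (BigRing u ℓ)} (hD : tau ε D = D)
    {C : Submodule (BigRing u ℓ) (Matrix (Fin 3) (Fin 3) (BigRing u ℓ))}
    (hC : ∀ Z ∈ C, tau ε Z ∈ C)
    (h : ∀ Y ∈ C, tau ε Y = Y → ψ (trace (D * Y)) = 1) {Z : Matrix (Fin 3) (Fin 3) (BigRing u ℓ)}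
    (hZ : Z ∈ C) : trace (D * Z) = 0 := by
  refine hS.eq_zero_of_forall_char hψ fun y => ?_
  have h1 := h (y • Z + tau ε (y • Z)) (add_mem (Submodule.smul_mem _ _ hZ)
    (hC _ (Submodule.smul_mem _ _ hZ))) (by rw [tau_add, tau_tau, add_comm])
  have h2 : trace (D * tau ε (y • Z)) = star (trace (D * (y • Z))) := by
    rw [← trace_tau_mul_tau ε, hD]
  rwa [mul_add, trace_add, h2, mul_smul_comm, trace_smul, smul_eq_mul, mul_comm y] at h1

lemma mem_matP_of_trace_eq_zero {D : Matrix (Fin 3) (Fin 3) (BigRing u ℓ)} {k : ℕ} (hk : k ≤ ℓ)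
    (h : ∀ Y ∈ matP ϖ k, trace (D * Y) = 0) : D ∈ matP ϖ (ℓ - k) := by
  rw [mem_matP_iff]
  intro i j
  have h1 := h (ϖ ^ k • Matrix.single j i 1) ⟨_, rfl⟩
  rw [mul_smul_comm, trace_smul, Matrix.trace_mul_single] at h1
  refine hS.cancel k (ℓ - k) _ 0 (by omega) ?_
  simpa using h1

lemma mem_matP_of_forall (hψ : IsPrimitiveChar ψ) {ε : GroupType}
    {D : Matrix (Fin 3) (Fin 3) (BigRing u ℓ)} (hD : tau ε D = D) {k : ℕ} (hk : k ≤ ℓ)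
    (h : ∀ Y ∈ matP ϖ k, tau ε Y = Y → ψ (trace (D * Y)) = 1) : D ∈ matP ϖ (ℓ - k) :=
  hS.mem_matP_of_trace_eq_zero hk fun _ hY => hS.trace_eq_zero_of_forall hψ hD
    (fun _ hZ => tau_mem_matP ε hS.star_unif hZ) h hY

/-- Every additive character of the matrix ring is given by the trace form. -/
lemma exists_addChar_eq_trace (hψ : IsPrimitiveChar ψ)
    (Ψ : AddChar (Matrix (Fin 3) (Fin 3) (BigRing u ℓ)) ℂ) :
    ∃ D : Matrix (Fin 3) (Fin 3) (BigRing u ℓ),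
      ∀ X, Ψ X = ψ (trace (D * X) + star (trace (D * X))) := by
  classical
  have := hS.finite
  have := Fintype.ofFinite (BigRing u ℓ)
  let F : Matrix (Fin 3) (Fin 3) (BigRing u ℓ) →
      AddChar (Matrix (Fin 3) (Fin 3) (BigRing u ℓ)) ℂ := fun D =>
    { toFun := fun X => ψ (trace (D * X) + star (trace (D * X)))
      map_zero_eq_one' := by simp
      map_add_eq_mul' := fun X Y => by
        rw [← AddChar.map_add_eq_mul, mul_add, trace_add, star_add]
        congr 1
        ring }
  have hF : Function.Injective F := by
    intro D D' h
    rw [← sub_eq_zero]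
    have h0 : D - D' ∈ matP ϖ (ℓ - 0) := by
      refine hS.mem_matP_of_trace_eq_zero (Nat.zero_le _) fun Y _ => ?_
      refine hS.eq_zero_of_forall_char hψ fun y => ?_
      have h1 : ψ (trace (D * (y • Y)) + star (trace (D * (y • Y)))) =
        ψ (trace (D' * (y • Y)) + star (trace (D' * (y • Y)))) := DFunLike.congr_fun h (y • Y)
      have h2 : trace ((D - D') * Y) * y + star (trace ((D - D') * Y) * y) =
          (trace (D * (y • Y)) + star (trace (D * (y • Y)))) -
          (trace (D' * (y • Y)) + star (trace (D' * (y • Y)))) := by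
        simp only [sub_mul, trace_sub, mul_smul_comm, trace_smul, smul_eq_mul, star_sub, star_mul']
        ring
      rw [h2, AddChar.map_sub_eq_div, h1, div_self (ψ.val_isUnit _).ne_zero]
    exact eq_zero_of_mem_matP hS.pow_eq_zero h0 le_rfl
  have hbij : Function.Bijective F := by
    rw [Fintype.bijective_iff_injective_and_card]
    refine ⟨hF, ?_⟩
    rw [← Nat.card_eq_fintype_card, ← Nat.card_eq_fintype_card]
    have h1 := AddChar.card_eq (α := Matrix (Fin 3) (Fin 3) (BigRing u ℓ))
    rw [← Nat.card_eq_fintype_card, ← Nat.card_eq_fintype_card] at h1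
    exact h1.symm
  obtain ⟨D, hD⟩ := hbij.2 Ψ
  exact ⟨D, fun X => (DFunLike.congr_fun hD X).symm⟩

/-- Every character of a group of elements `g ≡ 1` modulo `𝔓 ^ i` that is trivial modulo `𝔓 ^ k`,
where `k ≤ 2 i`, is of the form `g ↦ ψ (tr (D (g - 1)))` with `D` in the Lie ring. -/
lemma exists_char_form (hψ : IsPrimitiveChar ψ) {ε : GroupType} {i k : ℕ} (hik : k ≤ 2 * i)
    (hk : k ≤ ℓ) {T : Subgroup (GL (Fin 3) (BigRing u ℓ))} (hT : T ≤ cong (grp ε u ℓ) i)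
    (ν : T →* ℂ) (hν : ∀ g : T, g.1.1 - 1 ∈ matP ϖ k → ν g = 1) :
    ∃ D ∈ matP ϖ (ℓ - k), tau ε D = D ∧ ∀ g : T, ν g = ψ (trace (D * (g.1.1 - 1))) := by
  have := hS.finite
  have hTi : ∀ g : T, g.1.1 - 1 ∈ matP ϖ i := fun g => (hS.mem_cong.1 (hT g.2)).2
  -- the map `g ↦ g - 1` is a homomorphism to the additive group modulo `𝔓 ^ k`, as `k ≤ 2 i`
  let Q := Matrix (Fin 3) (Fin 3) (BigRing u ℓ) ⧸ matP ϖ k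
  have : Finite Q := Quotient.finite _
  let h : T →* Multiplicative Q :=
    { toFun := fun g => Multiplicative.ofAdd ((matP ϖ k).mkQ (g.1.1 - 1))
      map_one' := by simp
      map_mul' := fun g g' => by
        rw [← ofAdd_add, ← map_add]
        congr 1
        simp only [Submodule.mkQ_apply]
        rw [Submodule.Quotient.eq]
        have h1 : (g * g').1.1 - 1 - (g.1.1 - 1 + (g'.1.1 - 1)) =
            (g.1.1 - 1) * (g'.1.1 - 1) := by
          rw [Subgroup.coe_mul, Units.val_mul]
          noncomm_ring
        rw [h1]
        exact mul_mem_matP (hTi g) (hTi g') (by omega) }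
  obtain ⟨Φ, hΦ⟩ := exists_monoidHom_comp_eq h ν fun t ht => hν t (by
    have h1 : (matP ϖ k).mkQ (t.1.1 - 1) = 0 := congrArg Multiplicative.toAdd ht
    rwa [Submodule.mkQ_apply, Submodule.Quotient.mk_eq_zero] at h1)
  let Ψ : AddChar (Matrix (Fin 3) (Fin 3) (BigRing u ℓ)) ℂ :=
    { toFun := fun X => Φ (Multiplicative.ofAdd ((matP ϖ k).mkQ X))
      map_zero_eq_one' := by simp
      map_add_eq_mul' := fun X Y => by rw [map_add, ofAdd_add, map_mul] }
  obtain ⟨D, hD⟩ := hS.exists_addChar_eq_trace hψ Ψ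
  have hDk : D ∈ matP ϖ (ℓ - k) := by
    refine hS.mem_matP_of_trace_eq_zero hk fun Y hY => hS.eq_zero_of_forall_char hψ fun y => ?_
    have h1 := hD (y • Y)
    rw [mul_smul_comm, trace_smul, smul_eq_mul, mul_comm y] at h1
    rw [← h1]
    change Φ (Multiplicative.ofAdd ((matP ϖ k).mkQ (y • Y))) = 1
    rw [Submodule.mkQ_apply, (Submodule.Quotient.mk_eq_zero _).2 (Submodule.smul_mem _ _ hY),
      ofAdd_zero, map_one]
  -- symmetrise: on the group, `g - 1` is fixed by `tau` modulo `𝔓 ^ k`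
  refine ⟨D + tau ε D, add_mem hDk (tau_mem_matP ε hS.star_unif hDk),
    by rw [tau_add, tau_tau, add_comm], fun g => ?_⟩
  rw [← hΦ g]
  refine (hD (g.1.1 - 1)).trans ?_
  rw [← trace_tau_mul_tau ε]
  congr 1
  rw [add_mul, trace_add, add_right_inj, ← sub_eq_zero, ← trace_sub, ← mul_sub]
  refine trace_mul_eq_zero hS.pow_eq_zero (tau_mem_matP ε hS.star_unif hDk)
    (hS.tau_sub_one_sub_mem (ε := ε) (hS.mem_cong.1 (hT g.2)).1 (hTi g)) (by omega)

end IsUniformized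

end Duality

/-! ### The truncated logarithm -/

section Logarithm

variable {R : Type*} [CommRing R]

lemma logm_eq (h2 : IsUnit (2 : R)) (g : GL (Fin 3) R) :
    logm g = (g.1 - 1) - (Ring.inverse (2 : R)) • (g.1 - 1) ^ 2 +
      (Ring.inverse (3 : R)) • (g.1 - 1) ^ 3 - (Ring.inverse (2 : R)) ^ 2 • (g.1 - 1) ^ 4 := by
  have h4 : Ring.inverse (4 : R) = Ring.inverse (2 : R) ^ 2 := by
    have hu : IsUnit (4 : R) := by
      have := h2.mul h2
      norm_num at this
      exact this
    have e2 := Ring.mul_inverse_cancel _ h2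
    have e4 := Ring.mul_inverse_cancel _ hu
    linear_combination (-Ring.inverse (4 : R)) * (2 * Ring.inverse (2 : R) + 1) * e2 +
      Ring.inverse (2 : R) ^ 2 * e4
  rw [logm, Finset.sum_Icc_succ_top (by norm_num), Finset.sum_Icc_succ_top (by norm_num),
    Finset.sum_Icc_succ_top (by norm_num), Finset.Icc_self, Finset.sum_singleton]
  simp only [Nat.cast_one, Nat.cast_ofNat, Nat.reduceAdd]
  rw [h4]
  simp only [show (-1 : R) ^ 2 = 1 by ring, show (-1 : R) ^ 3 = -1 by ring,
    show (-1 : R) ^ 4 = 1 by ring, show (-1 : R) ^ 5 = -1 by ring, Ring.inverse_one, one_mul,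
    one_smul, pow_one, neg_one_mul, neg_smul]
  abel

/-- The logarithm is multiplicative up to half a commutator under a linear form that is invariant
under the cyclic rotations of products of at least three factors: modulo such rotations, the
Baker-Campbell-Hausdorff series of two elements `x, y` is `x + y + [x, y] / 2`. -/
lemma trace_logm_mul (h2 : IsUnit (2 : R)) (h3 : IsUnit (3 : R)) {A : Matrix (Fin 3) (Fin 3) R}
    {C : Submodule R (Matrix (Fin 3) (Fin 3) R)} (hmul : ∀ a ∈ C, ∀ b ∈ C, a * b ∈ C)
    (hrot : ∀ a ∈ C, ∀ b ∈ C, ∀ c ∈ C, trace (A * (a * (b * c))) = trace (A * (c * (a * b))))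
    (hnil : ∀ a ∈ C, ∀ b ∈ C, ∀ c ∈ C, ∀ d ∈ C, ∀ e ∈ C, a * (b * (c * (d * e))) = 0)
    {g h : GL (Fin 3) R} (hg : g.1 - 1 ∈ C) (hh : h.1 - 1 ∈ C) :
    trace (A * logm (g * h)) = trace (A * logm g) + trace (A * logm h) +
      Ring.inverse 2 * trace (A * (g.1 * h.1 - h.1 * g.1)) := by
  set f : Matrix (Fin 3) (Fin 3) R →ₗ[R] R :=
    (traceLinearMap (Fin 3) R R).comp (LinearMap.mulLeft R A) with hf
  have hfA : ∀ X, trace (A * X) = f X := fun X => rfl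
  simp only [hfA] at hrot ⊢
  have e2 := Ring.mul_inverse_cancel _ h2
  have e3 := Ring.mul_inverse_cancel _ h3
  rw [logm_eq h2, logm_eq h2, logm_eq h2]
  set x := g.1 - 1 with hx
  set y := h.1 - 1 with hy
  have hgx : g.1 = 1 + x := by rw [hx]; abel
  have hhy : h.1 = 1 + y := by rw [hy]; abel
  have hcomm : g.1 * h.1 - h.1 * g.1 = x * y - y * x := by
    rw [hgx, hhy]; noncomm_ring
  have hZ : (g * h).1 - 1 = x + y + x * y := by
    rw [Units.val_mul, hgx, hhy]; noncomm_ring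
  rw [hcomm, hZ]
  have hrot4 : ∀ a ∈ C, ∀ b ∈ C, ∀ c ∈ C, ∀ d ∈ C,
      f (a * (b * (c * d))) = f (d * (a * (b * c))) := by
    intro a ha b hb c hc d hd
    have := hrot (a * b) (hmul a ha b hb) c hc d hd
    simpa only [mul_assoc] using this
  have r1 : f (y * (x * x)) = f (x * (x * y)) := (hrot x hg x hg y hh).symm
  have r2 : f (x * (y * x)) = f (x * (x * y)) := hrot x hg y hh x hg
  have r3 : f (y * (y * x)) = f (x * (y * y)) := hrot y hh y hh x hg
  have r4 : f (y * (x * y)) = f (x * (y * y)) := (hrot y hh x hg y hh).trans r3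
  have q1 : f (y * (x * (x * x))) = f (x * (x * (x * y))) := (hrot4 x hg x hg x hg y hh).symm
  have q2 : f (x * (y * (x * x))) = f (x * (x * (x * y))) :=
    (hrot4 y hh x hg x hg x hg).symm.trans q1
  have q3 : f (x * (x * (y * x))) = f (x * (x * (x * y))) :=
    (hrot4 x hg y hh x hg x hg).symm.trans q2
  have q4 : f (y * (y * (y * x))) = f (x * (y * (y * y))) := hrot4 y hh y hh y hh x hg
  have q5 : f (y * (x * (y * y))) = f (x * (y * (y * y))) := (hrot4 x hg y hh y hh y hh).symm
  have q6 : f (y * (y * (x * y))) = f (x * (y * (y * y))) :=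
    (hrot4 y hh x hg y hh y hh).symm.trans q5
  have q7 : f (y * (x * (x * y))) = f (x * (x * (y * y))) := (hrot4 x hg x hg y hh y hh).symm
  have q8 : f (y * (y * (x * x))) = f (x * (x * (y * y))) :=
    (hrot4 y hh x hg x hg y hh).symm.trans q7
  have q9 : f (x * (y * (y * x))) = f (x * (x * (y * y))) :=
    (hrot4 y hh y hh x hg x hg).symm.trans q8
  have q10 : f (y * (x * (y * x))) = f (x * (y * (x * y))) := (hrot4 x hg y hh x hg y hh).symm
  have hs : x + y ∈ C := add_mem hg hh
  have ht : x * y ∈ C := hmul x hg y hh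
  have Z2 : (x + y + x * y) ^ 2 = x ^ 2 + y ^ 2 + x * y + y * x + (x * (x * y) + y * (x * y) +
      x * (y * x) + x * (y * y)) + x * (y * (x * y)) := by
    noncomm_ring
  have Z3 : (x + y + x * y) ^ 3 = x ^ 3 + y ^ 3 + (x * (x * y) + x * (y * x) + y * (x * x)) +
      (x * (y * y) + y * (x * y) + y * (y * x)) +
      (x * (x * (x * y)) + x * (y * (x * y)) + y * (x * (x * y)) + y * (y * (x * y)) +
       x * (x * (y * x)) + x * (x * (y * y)) + y * (x * (y * x)) + y * (x * (y * y)) +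
       x * (y * (x * x)) + x * (y * (x * y)) + x * (y * (y * x)) + x * (y * (y * y))) := by
    have hz : (x + y) * (x * y) * (x * y) + x * y * ((x + y) * (x * y)) +
        x * y * (x * y) * (x + y) + x * y * (x * y) * (x * y) = 0 := by
      have z1 := hnil _ hs _ hg _ hh _ hg _ hh
      have z2 := hnil _ hg _ hh _ hs _ hg _ hh
      have z3 := hnil _ hg _ hh _ hg _ hh _ hs
      have z4 := hnil _ hg _ hh _ hg _ hh _ ht
      simp only [mul_assoc] at z1 z2 z3 z4 ⊢
      rw [z1, z2, z3, z4]
      simp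
    rw [← sub_eq_zero, ← hz]
    noncomm_ring
  have Z4 : (x + y + x * y) ^ 4 = x ^ 4 + y ^ 4 + (x * (x * (x * y)) + x * (x * (y * x)) +
      x * (y * (x * x)) + y * (x * (x * x))) + (y * (y * (y * x)) + y * (y * (x * y)) +
      y * (x * (y * y)) + x * (y * (y * y))) + (x * (x * (y * y)) + x * (y * (y * x)) +
      y * (y * (x * x)) + y * (x * (x * y))) + (x * (y * (x * y)) + y * (x * (y * x))) := by
    have hst : x + y + x * y ∈ C := add_mem hs ht
    have hz : x * y * ((x + y + x * y) * ((x + y + x * y) * (x + y + x * y))) +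
        (x + y) * (x * y * ((x + y + x * y) * (x + y + x * y))) +
        (x + y) * ((x + y) * (x * y * (x + y + x * y))) +
        (x + y) * ((x + y) * ((x + y) * (x * y))) = 0 := by
      have z1 := hnil _ hg _ hh _ hst _ hst _ hst
      have z2 := hnil _ hs _ hg _ hh _ hst _ hst
      have z3 := hnil _ hs _ hs _ hg _ hh _ hst
      have z4 := hnil _ hs _ hs _ hs _ hg _ hh
      rw [mul_assoc x y, z1, mul_assoc x y, z2, mul_assoc x y, z3, z4]
      simp
    have e1 : (x + y + x * y) ^ 4 = (x + y) * ((x + y) * ((x + y) * (x + y))) +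
        (x * y * ((x + y + x * y) * ((x + y + x * y) * (x + y + x * y))) +
        (x + y) * (x * y * ((x + y + x * y) * (x + y + x * y))) +
        (x + y) * ((x + y) * (x * y * (x + y + x * y))) +
        (x + y) * ((x + y) * ((x + y) * (x * y)))) := by
      generalize x * y = t
      generalize x + y = s
      noncomm_ring
    rw [e1, hz, add_zero]
    noncomm_ring
  rw [Z2, Z3, Z4]
  simp only [map_add, map_sub, map_smul, smul_eq_mul]
  -- every word is rotated to the representative of its cyclic class
  rw [r1, r2, r3, r4, q1, q2, q3, q4, q5, q6, q7, q8, q9, q10]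
  linear_combination
    (-f (x * y) - f (x * (x * y)) - f (x * (y * y)) - (2 * Ring.inverse (2 : R) + 1) *
      (f (x * (x * (x * y))) + f (x * (y * (y * y))) + f (x * (x * (y * y)))) -
      (Ring.inverse (2 : R) + 1) * f (x * (y * (x * y)))) * e2 +
    (f (x * (x * y)) + f (x * (y * y)) + f (x * (x * (x * y))) + f (x * (y * (y * y))) +
      f (x * (x * (y * y))) + f (x * (y * (x * y)))) * e3

end Logarithm

section Inertia

variable {o : Type*} [CommRing o] [IsLocalRing o] {u : o} {ℓ q : ℕ} {ϖ : BigRing u ℓ}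
  {ψ : AddChar (BigRing u ℓ) ℂ}

lemma trace_conj (A : Matrix (Fin 3) (Fin 3) (BigRing u ℓ)) (g n : GL (Fin 3) (BigRing u ℓ)) :
    trace (A * ((g * n * g⁻¹).1 - 1)) = trace (A * (n.1 - 1)) +
      trace (((g⁻¹).1 * A * g.1 - A) * (n.1 - 1)) := by
  have h1 : (g * n * g⁻¹).1 - 1 = g.1 * (n.1 - 1) * (g⁻¹).1 := by
    rw [mul_sub, sub_mul, mul_one, Units.mul_inv]
    rfl
  rw [h1, sub_mul, trace_sub, ← mul_assoc, trace_mul_comm _ (g⁻¹).1]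
  simp only [mul_assoc]
  ring

lemma conj_sub_mem_iff {A : Matrix (Fin 3) (Fin 3) (BigRing u ℓ)} {g : GL (Fin 3) (BigRing u ℓ)}
    {k : ℕ} : (g⁻¹).1 * A * g.1 - A ∈ matP ϖ k ↔ A * g.1 - g.1 * A ∈ matP ϖ k := by
  have h1 : g.1 * ((g⁻¹).1 * A * g.1 - A) = A * g.1 - g.1 * A := by
    rw [mul_sub, ← mul_assoc, ← mul_assoc, Units.mul_inv, one_mul]
  have h2 : (g⁻¹).1 * (A * g.1 - g.1 * A) = (g⁻¹).1 * A * g.1 - A := by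
    rw [mul_sub, ← mul_assoc, ← mul_assoc, Units.inv_mul, one_mul]
  exact ⟨fun h => h1 ▸ mul_mem_matP_left _ h, fun h => h2 ▸ mul_mem_matP_left _ h⟩

lemma conj_mem_cong {U : Subgroup (GL (Fin 3) (BigRing u ℓ))} {g n : GL (Fin 3) (BigRing u ℓ)}
    {k : ℕ} (hg : g ∈ U) (hn : n ∈ cong U k) : g * n * g⁻¹ ∈ cong U k :=
  ⟨U.mul_mem (U.mul_mem hg hn.1) (U.inv_mem hg), (MonoidHom.normal_ker _).conj_mem _ hn.2 g⟩

lemma mem_cong_conj_iff {U : Subgroup (GL (Fin 3) (BigRing u ℓ))} {g n : GL (Fin 3) (BigRing u ℓ)}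
    {k : ℕ} (hg : g ∈ U) : n ∈ cong U k ↔ g * n * g⁻¹ ∈ cong U k := by
  refine ⟨fun hn => conj_mem_cong hg hn, fun hn => ?_⟩
  have h1 : n = g⁻¹ * (g * n * g⁻¹) * g⁻¹⁻¹ := by group
  rw [h1]
  exact conj_mem_cong (U.inv_mem hg) hn

namespace IsUniformized

variable (hS : IsUniformized u ℓ q ϖ)

include hS

lemma tau_conj {ε : GroupType} {g : GL (Fin 3) (BigRing u ℓ)} (hg : g ∈ grp ε u ℓ)
    (X : Matrix (Fin 3) (Fin 3) (BigRing u ℓ)) :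
    tau ε ((g⁻¹).1 * X * g.1) = (g⁻¹).1 * tau ε X * g.1 := by
  have hg' := (grp ε u ℓ).inv_mem hg
  rw [hS.mem_grp_iff] at hg hg'
  have h1 := congrArg Units.val hg
  have h2 := congrArg Units.val hg'
  cases ε
  · rw [sig_linear_val] at h1 h2
    simp only [tau, map_star_mul, h1, h2]
  · rw [sig_unitary_val] at h1 h2
    rw [inv_inv] at h2
    simp only [tau, adj_mul, h1, h2, mul_neg, neg_mul, mul_assoc]

lemma exists_grp_eq_one_add (ε : GroupType) {k : ℕ} (hk : 1 ≤ k) (hk' : ℓ ≤ 2 * k)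
    {Y : Matrix (Fin 3) (Fin 3) (BigRing u ℓ)} (hY : Y ∈ matP ϖ k) (hY' : tau ε Y = Y) :
    ∃ g ∈ cong (grp ε u ℓ) k, g.1 - 1 = Y := by
  obtain ⟨g, -, hg, h⟩ := hS.exists_mem_grp_sub_one ε hk hY hY' (H := ⊤) (by simp)
  have h1 := sub_eq_zero.1 (eq_zero_of_mem_matP hS.pow_eq_zero h hk')
  exact ⟨g, hS.mem_cong.2 ⟨hg, h1 ▸ hY⟩, h1⟩

/-- The stabiliser of the character `ψ_A` of `G^ℓ₂` consists of the elements commuting with `A` modulo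
`𝔓 ^ ℓ₁`, because `ψ` makes the trace form non-degenerate. -/
lemma mem_inertia (hψ : IsPrimitiveChar ψ) (hℓ : 2 ≤ ℓ) {ε : GroupType}
    {A : Matrix (Fin 3) (Fin 3) (BigRing u ℓ)} (hA : tau ε A = A) {g : GL (Fin 3) (BigRing u ℓ)} :
    g ∈ inertia ε ψ A ↔ g ∈ grp ε u ℓ ∧ A * g.1 - g.1 * A ∈ matP ϖ (ℓ / 2) := by
  rw [← conj_sub_mem_iff]
  constructor
  · rintro ⟨hg, -, h⟩
    refine ⟨hg, ?_⟩
    have h1 : (g⁻¹).1 * A * g.1 - A ∈ matP ϖ (ℓ - (ℓ - ℓ / 2)) := by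
      refine hS.mem_matP_of_forall hψ (ε := ε) (by rw [tau_sub, hS.tau_conj hg, hA])
        (by omega) fun Y hY hY' => ?_
      obtain ⟨n, hn, rfl⟩ := hS.exists_grp_eq_one_add ε (show 1 ≤ ℓ - ℓ / 2 by omega) (by omega)
        hY hY'
      have hn' := conj_mem_cong hg hn
      have h2 := h n hn hn'
      change psiLin ψ A (g * n * g⁻¹) = psiLin ψ A n at h2
      rw [psiLin, psiLin, trace_conj, AddChar.map_add_eq_mul] at h2
      exact (mul_eq_left₀ (ψ.val_isUnit _).ne_zero).1 h2
    rwa [show ℓ - (ℓ - ℓ / 2) = ℓ / 2 by omega] at h1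
  · rintro ⟨hg, h⟩
    refine ⟨hg, fun n => mem_cong_conj_iff hg, fun n hn hn' => ?_⟩
    change psiLin ψ A (g * n * g⁻¹) = psiLin ψ A n
    rw [psiLin, psiLin, trace_conj,
      trace_mul_eq_zero hS.pow_eq_zero h (hS.mem_cong.1 hn).2 (by omega), add_zero]

end IsUniformized

end Inertia

/-! ### Matrices in normal form -/

section NormalFormMatrices

variable {R : Type*} [CommRing R]

/-- The matrix `E + δ E_{22} + δ ^ 2 E_{31}`, whose commutant contains the group `J`. -/
def matE (δ : R) : Matrix (Fin 3) (Fin 3) R := !![0, 0, 1; 0, δ, 0; δ ^ 2, 0, 0]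

/-- The general element of the commutant of `matE δ`. -/
def matJ (δ a b x y z : R) : Matrix (Fin 3) (Fin 3) R :=
  !![a, x, z; δ * y, b, y; δ ^ 2 * z, δ * x, a]

/-- The commutant of `matE δ`, as a submodule: the Lie algebra of the group `J`. -/
def lieJ (δ : R) : Submodule R (Matrix (Fin 3) (Fin 3) R) where
  carrier := {X | matE δ * X = X * matE δ}
  add_mem' {X Y} hX hY := by
    simp only [Set.mem_ofPred_eq] at *
    rw [mul_add, add_mul, hX, hY]
  zero_mem' := by simp
  smul_mem' c X hX := by
    simp only [Set.mem_ofPred_eq] at *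
    rw [mul_smul_comm, smul_mul_assoc, hX]

variable {ϖ δ : R} {X Y : Matrix (Fin 3) (Fin 3) R} {k l n : ℕ}

lemma mem_lieJ : X ∈ lieJ δ ↔ matE δ * X = X * matE δ := Iff.rfl

lemma mul_mem_lieJ (hX : X ∈ lieJ δ) (hY : Y ∈ lieJ δ) : X * Y ∈ lieJ δ := by
  rw [mem_lieJ] at *
  rw [← mul_assoc, hX, mul_assoc, hY, mul_assoc]

lemma one_mem_lieJ : (1 : Matrix (Fin 3) (Fin 3) R) ∈ lieJ δ := by
  rw [mem_lieJ, mul_one, one_mul]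

lemma matJ_mem_lieJ (a b x y z : R) : matJ δ a b x y z ∈ lieJ δ := by
  rw [mem_lieJ, matE, matJ]
  ext i j
  fin_cases i <;> fin_cases j <;> simp [Matrix.mul_apply, Fin.sum_univ_three] <;> ring

/-- A matrix that commutes with `matE δ` up to `𝔓 ^ k` is congruent to an element of the
commutant, read off from its entries. -/
lemma sub_matJ_mem (h : matE δ * X - X * matE δ ∈ matP ϖ k) :
    X - matJ δ (X 0 0) (X 1 1) (X 0 1) (X 1 2) (X 0 2) ∈ matP ϖ k := by
  rw [mem_matP_iff] at h ⊢
  have h00 := h 0 0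
  have h01 := h 0 1
  have h02 := h 0 2
  have h12 := h 1 2
  simp only [matE, Matrix.sub_apply, Matrix.mul_apply, Fin.sum_univ_three, Matrix.of_apply,
    Matrix.cons_val, zero_mul, mul_zero, one_mul, mul_one, zero_add, add_zero] at h00 h01 h02 h12
  obtain ⟨y00, h00⟩ := h00
  obtain ⟨y01, h01⟩ := h01
  obtain ⟨y02, h02⟩ := h02
  obtain ⟨y12, h12⟩ := h12
  intro i j
  fin_cases i <;> fin_cases j
  · exact ⟨0, by simp [matJ]⟩
  · exact ⟨0, by simp [matJ]⟩
  · exact ⟨0, by simp [matJ]⟩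
  · exact ⟨-y12, by simp [matJ]; linear_combination -h12⟩
  · exact ⟨0, by simp [matJ]⟩
  · exact ⟨0, by simp [matJ]⟩
  · exact ⟨y00, by simp [matJ]; linear_combination h00⟩
  · exact ⟨y01, by simp [matJ]; linear_combination h01⟩
  · exact ⟨y02, by simp [matJ]; linear_combination h02⟩

lemma eq_matJ (h : X ∈ lieJ δ) : X = matJ δ (X 0 0) (X 1 1) (X 0 1) (X 1 2) (X 0 2) := by
  have h1 : matE δ * X - X * matE δ ∈ matP (0 : R) 1 := by
    rw [mem_lieJ.1 h, sub_self]
    exact zero_mem _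
  obtain ⟨Y, hY⟩ := sub_matJ_mem h1
  rw [pow_one, zero_smul, sub_eq_zero] at hY
  exact hY

lemma matJ_mem_matP {a b x y z : R} (ha : ∃ c, a = ϖ ^ k * c) (hb : ∃ c, b = ϖ ^ k * c)
    (hx : ∃ c, x = ϖ ^ k * c) (hy : ∃ c, y = ϖ ^ k * c) (hz : ∃ c, z = ϖ ^ k * c) :
    ∃ a' b' x' y' z', matJ δ a b x y z = ϖ ^ k • matJ δ a' b' x' y' z' := by
  obtain ⟨a, rfl⟩ := ha
  obtain ⟨b, rfl⟩ := hb
  obtain ⟨x, rfl⟩ := hx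
  obtain ⟨y, rfl⟩ := hy
  obtain ⟨z, rfl⟩ := hz
  refine ⟨a, b, x, y, z, ?_⟩
  ext i j
  fin_cases i <;> fin_cases j <;> simp [matJ, mul_left_comm]

lemma exists_eq_pow_smul_matJ (h : X ∈ lieJ δ) (hX : X ∈ matP ϖ k) :
    ∃ a b x y z, X = ϖ ^ k • matJ δ a b x y z := by
  rw [eq_matJ h]
  rw [mem_matP_iff] at hX
  exact matJ_mem_matP (hX _ _) (hX _ _) (hX _ _) (hX _ _) (hX _ _)

/-- The Lie algebra of `J ^ n G ^ l`. -/
def lieN (ϖ δ : R) (n l : ℕ) : Submodule R (Matrix (Fin 3) (Fin 3) R) :=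
  (lieJ δ ⊓ matP ϖ n) ⊔ matP ϖ l

lemma mem_lieN : X ∈ lieN ϖ δ n l ↔ ∃ Y ∈ lieJ δ, Y ∈ matP ϖ n ∧ X - Y ∈ matP ϖ l := by
  rw [lieN, Submodule.mem_sup]
  constructor
  · rintro ⟨Y, hY, Z, hZ, rfl⟩
    exact ⟨Y, hY.1, hY.2, by rwa [add_sub_cancel_left]⟩
  · rintro ⟨Y, hY, hY', h⟩
    exact ⟨Y, ⟨hY, hY'⟩, X - Y, h, by abel⟩

lemma lieN_le (h : n ≤ l) : lieN ϖ δ n l ≤ matP ϖ n :=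
  sup_le inf_le_right (matP_anti h)

lemma mul_mem_lieN (h : n ≤ l) (hX : X ∈ lieN ϖ δ n l) (hY : Y ∈ lieN ϖ δ n l) :
    X * Y ∈ lieN ϖ δ n l := by
  have hXn := lieN_le h hX
  rw [mem_lieN] at *
  obtain ⟨X', hX', hX'n, hX⟩ := hX
  obtain ⟨Y', hY', hY'n, hY⟩ := hY
  refine ⟨X' * Y', mul_mem_lieJ hX' hY', mul_mem_matP hX'n hY'n (by omega), ?_⟩
  have h1 : X * Y - X' * Y' = X * (Y - Y') + (X - X') * Y' := by noncomm_ring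
  rw [h1]
  exact add_mem (mul_mem_matP_left _ hY) (mul_mem_matP_right _ hX)

variable [StarRing R]

lemma theta_matE (ε : GroupType) (hδ : star δ = δ) : theta ε (matE δ) = matE δ := by
  cases ε <;> ext i j <;> fin_cases i <;> fin_cases j <;> simp [theta, matE, adj_apply, hδ]

lemma tau_mem_lieJ (ε : GroupType) (hδ : star δ = δ) (hX : X ∈ lieJ δ) : tau ε X ∈ lieJ δ := by
  rw [mem_lieJ, ← sub_eq_zero] at hX ⊢
  have := theta_comm ε (matE δ) X
  rw [hX, theta_matE ε hδ] at this
  rw [← this]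
  cases ε <;> ext i j <;> simp [theta, adj_apply]

lemma tau_mem_lieN (ε : GroupType) (hϖ : star ϖ = ϖ) (hδ : star δ = δ) (hX : X ∈ lieN ϖ δ n l) :
    tau ε X ∈ lieN ϖ δ n l := by
  rw [mem_lieN] at *
  obtain ⟨Y, h1, h2, h3⟩ := hX
  exact ⟨tau ε Y, tau_mem_lieJ ε hδ h1, tau_mem_matP ε hϖ h2, by
    rw [← tau_sub]; exact tau_mem_matP ε hϖ h3⟩

end NormalFormMatrices

section NormalFormParams

variable {o : Type*} [CommRing o] [IsLocalRing o] {u : o} {ℓ q : ℕ} {ϖ : BigRing u ℓ}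
  {ψ : AddChar (BigRing u ℓ) ℂ} {ε : GroupType} {P : Params u ℓ}
  {X Y : Matrix (Fin 3) (Fin 3) (BigRing u ℓ)}

lemma comm_sub_one (A : Matrix (Fin 3) (Fin 3) (BigRing u ℓ)) (X) :
    A * (X - 1) - (X - 1) * A = A * X - X * A := by
  noncomm_ring

lemma tau_scal_smul (X : Matrix (Fin 3) (Fin 3) (BigRing u ℓ)) :
    tau ε (scal ε u ℓ • X) = scal ε u ℓ • theta ε X := by
  rw [tau_smul]
  cases ε
  · simp [scal, tau, theta]
  · simp only [scal, tau, theta, star_rho, smul_neg, neg_smul, neg_neg]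

namespace IsUniformized

variable (hS : IsUniformized u ℓ q ϖ)

include hS

lemma isUnit_scal : IsUnit (scal ε u ℓ) := by
  cases ε
  · exact isUnit_one
  · exact hS.isUnit_rho

lemma le_val_iff {k : ℕ} (hk : k ≤ ℓ) {x : BigRing u ℓ} : k ≤ val x ↔ ∃ y, x = ϖ ^ k * y := by
  have hbdd : BddAbove {k | k ≤ ℓ ∧ x ∈ bigP u ℓ ^ k} := ⟨ℓ, fun _ h => h.1⟩
  have hne : {k | k ≤ ℓ ∧ x ∈ bigP u ℓ ^ k}.Nonempty := ⟨0, Nat.zero_le _, by simp⟩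
  rw [← hS.mem_bigP_pow]
  constructor
  · intro h
    have h1 := Nat.sSup_mem hne hbdd
    exact Ideal.pow_le_pow_right h h1.2
  · intro h
    exact le_csSup hbdd ⟨hk, h⟩

omit hS in
lemma val_le (x : BigRing u ℓ) : val x ≤ ℓ :=
  csSup_le ⟨0, Nat.zero_le _, by simp⟩ fun _ h => h.1

omit hS in
lemma m_le (P : Params u ℓ) : P.m ≤ ℓ := (min_le_left _ _).trans (val_le _)

lemma le_m_iff {k : ℕ} (hk : k ≤ ℓ) : k ≤ P.m ↔
    (∃ y, P.α = ϖ ^ k * y) ∧ (∃ y, P.β = ϖ ^ k * y) ∧ (∃ y, P.γ = ϖ ^ k * y) := by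
  rw [Params.m, le_min_iff, le_min_iff, hS.le_val_iff hk, hS.le_val_iff hk, hS.le_val_iff hk]

lemma isAdmissible_iff : P.IsAdmissible ε ↔
    ((∃ y, P.ω = ϖ ^ 1 * y) ∧ (∃ y, P.δ = ϖ ^ 1 * y) ∧ 1 ≤ P.m) ∧
    (star P.ω = P.ω ∧ star P.δ = P.δ ∧ star P.γ = P.γ) ∧
    (ε = .linear → star P.α = P.α ∧ star P.β = P.β) ∧ (ε = .unitary → P.α = star P.β) := by
  have h1 : ∀ x : BigRing u ℓ, x ∈ bigP u ℓ ↔ ∃ y, x = ϖ ^ 1 * y := fun x => by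
    rw [← hS.mem_bigP_pow, pow_one]
  have hm := m_le P
  cases ε <;> simp only [Params.IsAdmissible, h1, hS.isReal_iff] <;> simp <;> tauto

lemma admissible_theta (hP : P.IsAdmissible ε) : theta ε !![P.ω, 0, 1; P.α, P.ω + P.δ, 0;
    P.δ ^ 2 + P.γ, P.β, P.ω] = !![P.ω, 0, 1; P.α, P.ω + P.δ, 0; P.δ ^ 2 + P.γ, P.β, P.ω] := by
  obtain ⟨-, ⟨hω, hδ, hγ⟩, hl, hu⟩ := hS.isAdmissible_iff.1 hP
  cases ε
  · obtain ⟨hα, hβ⟩ := hl rfl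
    ext1 i j
    fin_cases i <;> fin_cases j <;> simp [theta, hω, hδ, hγ, hα, hβ]
  · have hα := hu rfl
    ext1 i j
    fin_cases i <;> fin_cases j <;> simp [theta, adj_apply, hω, hδ, hγ, hα]

lemma tau_mat (hP : P.IsAdmissible ε) : tau ε (P.mat ε) = P.mat ε := by
  rw [Params.mat, tau_scal_smul, hS.admissible_theta hP]

lemma mat_sub_mem (ε : GroupType) : P.mat ε - scal ε u ℓ • (P.ω • 1 + matE P.δ) ∈ matP ϖ P.m := by
  obtain ⟨⟨α, hα⟩, ⟨β, hβ⟩, ⟨γ, hγ⟩⟩ := (hS.le_m_iff (m_le P)).1 le_rfl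
  rw [Params.mat, ← smul_sub]
  refine Submodule.smul_mem _ _ ⟨!![0, 0, 0; α, 0, 0; γ, β, 0], ?_⟩
  ext1 i j
  fin_cases i <;> fin_cases j <;> simp [matE, ← hα, ← hβ, ← hγ]

/-- Up to `𝔓 ^ m`, commuting with `A` is the same as commuting with `matE δ`. -/
lemma comm_mat_mem_iff {a c : ℕ} (hX : X ∈ matP ϖ a) (h : c ≤ P.m + a) :
    P.mat ε * X - X * P.mat ε ∈ matP ϖ c ↔ matE P.δ * X - X * matE P.δ ∈ matP ϖ c := by
  have h1 : P.mat ε * X - X * P.mat ε = scal ε u ℓ • (matE P.δ * X - X * matE P.δ) +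
      ((P.mat ε - scal ε u ℓ • (P.ω • 1 + matE P.δ)) * X -
        X * (P.mat ε - scal ε u ℓ • (P.ω • 1 + matE P.δ))) := by
    simp only [sub_mul, mul_sub, smul_mul_assoc, mul_smul_comm, add_mul, mul_add, one_mul, mul_one,
      smul_add, smul_sub]
    abel
  rw [h1, Submodule.add_mem_iff_left _ (comm_mem_matP (hS.mat_sub_mem ε) hX h),
    smul_mem_matP_iff hS.isUnit_scal]

lemma comm_mat_mem_of_lieJ {a c : ℕ} (hX : X ∈ lieJ P.δ) (hXa : X ∈ matP ϖ a) (h : c ≤ P.m + a) :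
    P.mat ε * X - X * P.mat ε ∈ matP ϖ c := by
  rw [hS.comm_mat_mem_iff hXa h, mem_lieJ.1 hX, sub_self]
  exact zero_mem _

lemma sig_mem_ker (ε : GroupType) {k : ℕ} {g : GL (Fin 3) (BigRing u ℓ)}
    (hg : g ∈ (redGL u ℓ k).ker) : sig ε g ∈ (redGL u ℓ k).ker := by
  rw [hS.mem_ker_redGL] at *
  rcases sig_sub_one ε g with h | h <;> rw [h]
  · exact tau_mem_matP ε hS.star_unif hg
  · exact sub_mem (tau_mem_matP ε hS.star_unif hg) (tau_mem_matP ε hS.star_unif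
      (mul_mem_matP_right _ (mul_mem_matP_right _ hg)))

/-- If an element of a subgroup `H` is congruent to an element of `G`, and `H` is stable under the
involution, then the element is congruent to an element of `H ∩ G`. -/
lemma exists_lift_of_congr {k : ℕ} (hk : 1 ≤ k) {H : Subgroup (GL (Fin 3) (BigRing u ℓ))}
    (hH : ∀ x ∈ H, sig ε x ∈ H) {g x : GL (Fin 3) (BigRing u ℓ)} (hg : g ∈ grp ε u ℓ) (hx : x ∈ H)
    (hgx : g.1 - x.1 ∈ matP ϖ k) : ∃ y ∈ H, y ∈ grp ε u ℓ ∧ g.1 - y.1 ∈ matP ϖ k := by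
  have h1 := hS.inv_mul_mem_ker_iff.2 hgx
  have h2 := hS.sig_mem_ker ε h1
  rw [map_mul, map_inv, hS.mem_grp_iff.1 hg] at h2
  obtain ⟨y, hy, hy', h⟩ := hS.exists_lift_of_sub_mem ε hk hx (hH x hx)
    (hS.inv_mul_mem_ker_iff.1 (by
      have := mul_mem h1 (inv_mem h2)
      rwa [_root_.mul_inv_rev, inv_inv, mul_assoc, mul_inv_cancel_left] at this))
  refine ⟨y, hy, hy', ?_⟩
  have := sub_mem hgx h
  rwa [sub_sub_sub_cancel_right] at this

omit hS in
lemma mem_grpJ {δ : BigRing u ℓ} {g : GL (Fin 3) (BigRing u ℓ)} :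
    g ∈ grpJ ε δ ↔ g ∈ grp ε u ℓ ∧ g.1 ∈ lieJ δ := by
  rw [mem_lieJ]
  exact and_congr_right fun _ => eq_comm

omit hS in
lemma sig_mem_commSubgroup {δ : BigRing u ℓ} (hδ : star δ = δ) {x : GL (Fin 3) (BigRing u ℓ)}
    (hx : x ∈ commSubgroup (matE δ)) : sig ε x ∈ commSubgroup (matE δ) := by
  have h1 := sig_commute ε (show x.1 * matE δ = matE δ * x.1 from hx)
  rwa [theta_matE ε hδ] at h1

/-- An element of `G` that commutes with `matE δ` up to `𝔓 ^ k` is congruent to an element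
of `J`. -/
lemma exists_mem_grpJ {δ : BigRing u ℓ} (hδ : star δ = δ) {k : ℕ} (hk : 1 ≤ k)
    {g : GL (Fin 3) (BigRing u ℓ)} (hg : g ∈ grp ε u ℓ)
    (h : matE δ * g.1 - g.1 * matE δ ∈ matP ϖ k) : ∃ j ∈ grpJ ε δ, g.1 - j.1 ∈ matP ϖ k := by
  have h1 := sub_matJ_mem h
  obtain ⟨x, hx⟩ := hS.isUnit_of_sub_mem_matP g.isUnit
    (show matJ δ _ _ _ _ _ - g.1 ∈ matP ϖ 1 by rw [← neg_mem_iff, neg_sub]; exact matP_anti hk h1)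
  have hxH : x ∈ commSubgroup (matE δ) := by
    have := mem_lieJ.1 (matJ_mem_lieJ (δ := δ) (g.1 0 0) (g.1 1 1) (g.1 0 1) (g.1 1 2) (g.1 0 2))
    rw [← hx] at this
    exact this.symm
  obtain ⟨j, hj, hj', h2⟩ := hS.exists_lift_of_congr hk
    (fun y hy => sig_mem_commSubgroup (ε := ε) hδ hy) hg hxH (by rw [hx]; exact h1)
  exact ⟨j, ⟨hj', hj⟩, h2⟩

end IsUniformized

/-- Numerical conditions on the levels `n₁ ≤ n₂` that are used for the matrix with parameters `P`:
the inertia group at level `n₁` carries an alternating form whose radical contains the elements of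
level `n₂`. -/
structure IsDepth (P : Params u ℓ) (μ n₁ n₂ : ℕ) : Prop where
  le_m : μ ≤ P.m
  sum_eq : n₁ + n₂ + μ = ℓ
  le : n₁ ≤ n₂
  le_half : n₂ ≤ ℓ / 2
  le_succ : n₂ ≤ n₁ + 1
  one_le : 1 ≤ n₁
  half_le : ℓ - ℓ / 2 ≤ μ + n₁
  half_le_two_mul : ℓ / 2 ≤ 2 * n₁
  eq_or : n₁ = n₂ ∨ μ = P.m

lemma isDepth_of_lt (h : P.m < ℓ - ℓ / 2) (hm : 1 ≤ P.m) :
    IsDepth P P.m ((ℓ - P.m) / 2) (ℓ - P.m - (ℓ - P.m) / 2) := by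
  constructor <;> omega

namespace IsDepth

variable {μ n₁ n₂ : ℕ} (hd : IsDepth P μ n₁ n₂) (hS : IsUniformized u ℓ q ϖ)

include hd hS

lemma comm_mem (hX : X ∈ lieN ϖ P.δ n₁ (ℓ / 2)) :
    P.mat ε * X - X * P.mat ε ∈ matP ϖ (ℓ / 2) := by
  have ⟨h1, h2, h3, h4, h5, h6, h7, h8, h9⟩ := hd
  obtain ⟨Y, hY, hY', h⟩ := mem_lieN.1 hX
  have e : P.mat ε * X - X * P.mat ε = (P.mat ε * Y - Y * P.mat ε) +
      (P.mat ε * (X - Y) - (X - Y) * P.mat ε) := by noncomm_ring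
  rw [e]
  exact add_mem (hS.comm_mat_mem_of_lieJ hY hY' (by omega)) (comm_mem_matP_left _ h)

lemma trace_comm_mul_eq_zero_aux (hX : X ∈ lieN ϖ P.δ n₁ (ℓ / 2)) (hY : Y ∈ matP ϖ (n₁ + ℓ / 2)) :
    trace ((P.mat ε * X - X * P.mat ε) * Y) = 0 := by
  have ⟨h1, h2, h3, h4, h5, h6, h7, h8, h9⟩ := hd
  obtain ⟨X', hX', hX'', h⟩ := mem_lieN.1 hX
  have e : P.mat ε * X - X * P.mat ε = (P.mat ε * X' - X' * P.mat ε) +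
      (P.mat ε * (X - X') - (X - X') * P.mat ε) := by noncomm_ring
  rw [e, add_mul, trace_add, trace_mul_eq_zero hS.pow_eq_zero
    (hS.comm_mat_mem_of_lieJ hX' hX'' (c := μ + n₁) (by omega)) hY (by omega),
    trace_mul_eq_zero hS.pow_eq_zero (comm_mem_matP_left _ h) hY (by omega), add_zero]

/-- Products of three elements of the Lie algebra of `N` are invariant under rotation for the
linear form `X ↦ tr (A X)`. -/
lemma trace_comm_mul_mul_eq_zero {a b c : Matrix (Fin 3) (Fin 3) (BigRing u ℓ)}
    (ha : a ∈ lieN ϖ P.δ n₁ (ℓ / 2)) (hb : b ∈ lieN ϖ P.δ n₁ (ℓ / 2))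
    (hc : c ∈ lieN ϖ P.δ n₁ (ℓ / 2)) :
    trace ((P.mat ε * a - a * P.mat ε) * (b * c)) = 0 := by
  have ⟨h1, h2, h3, h4, h5, h6, h7, h8, h9⟩ := hd
  have hle : lieN ϖ P.δ n₁ (ℓ / 2) ≤ matP ϖ n₁ := lieN_le (by omega)
  obtain ⟨a', ha', ha'', h⟩ := mem_lieN.1 ha
  have e : P.mat ε * a - a * P.mat ε = (P.mat ε * a' - a' * P.mat ε) +
      (P.mat ε * (a - a') - (a - a') * P.mat ε) := by noncomm_ring
  rw [e, add_mul, trace_add, trace_mul_eq_zero hS.pow_eq_zero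
    (hS.comm_mat_mem_of_lieJ ha' ha'' (c := μ + n₁) (by omega))
    (mul_mem_matP (hle hb) (hle hc) le_rfl) (by omega), zero_add, ← trace_comm_mul]
  set d := a - a'
  have e2 : P.mat ε * (d * (b * c) - b * c * d) = -(P.mat ε * (b * (c * d) - c * d * b)) -
      P.mat ε * (c * (d * b) - d * b * c) := by noncomm_ring
  rw [e2, trace_sub, trace_neg, trace_comm_mul, trace_comm_mul,
    hd.trace_comm_mul_eq_zero_aux hS hb (mul_mem_matP (hle hc) h (by omega)),
    hd.trace_comm_mul_eq_zero_aux hS hc (mul_mem_matP h (hle hb) (by omega))]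
  simp

lemma trace_mul_comm_eq_zero {a b c : Matrix (Fin 3) (Fin 3) (BigRing u ℓ)}
    (ha : a ∈ lieN ϖ P.δ n₁ (ℓ / 2)) (hb : b ∈ lieN ϖ P.δ n₁ (ℓ / 2))
    (hc : c ∈ lieN ϖ P.δ n₁ (ℓ / 2)) :
    trace (P.mat ε * (a * b * c - c * (a * b))) = 0 := by
  have e : P.mat ε * (a * b * c - c * (a * b)) =
      P.mat ε * (a * (b * c) - b * c * a) + P.mat ε * (b * (c * a) - c * a * b) := by
    noncomm_ring
  rw [e, trace_add, trace_comm_mul, trace_comm_mul, hd.trace_comm_mul_mul_eq_zero hS ha hb hc,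
    hd.trace_comm_mul_mul_eq_zero hS hb hc ha, add_zero]

variable (hψ : IsPrimitiveChar ψ) (hP : P.IsAdmissible ε)

include hψ hP

lemma mem_cong_inertia {g : GL (Fin 3) (BigRing u ℓ)} :
    g ∈ cong (inertia ε ψ (P.mat ε)) n₁ ↔ g ∈ grp ε u ℓ ∧ g.1 - 1 ∈ lieN ϖ P.δ n₁ (ℓ / 2) := by
  have ⟨h1, h2, h3, h4, h5, h6, h7, h8, h9⟩ := hd
  rw [hS.mem_cong, hS.mem_inertia hψ (by omega) (hS.tau_mat hP), and_assoc, ← comm_sub_one]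
  refine and_congr_right fun _ => ⟨fun ⟨h, h'⟩ => ?_, fun h => ⟨hd.comm_mem hS h,
    lieN_le (by omega) h⟩⟩
  rw [hS.comm_mat_mem_iff h' (by omega)] at h
  have h'' := mem_matP_iff.1 h'
  obtain ⟨a', b', x', y', z', e⟩ := matJ_mem_matP (δ := P.δ) (h'' 0 0) (h'' 1 1) (h'' 0 1)
    (h'' 1 2) (h'' 0 2)
  exact mem_lieN.2 ⟨_, matJ_mem_lieJ _ _ _ _ _, ⟨_, e⟩, sub_matJ_mem h⟩

end IsDepth

/-- The alternating form `ψ (tr (A [g, h]) / 2)`. -/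
def altForm (ψ : AddChar (BigRing u ℓ) ℂ) (A : Matrix (Fin 3) (Fin 3) (BigRing u ℓ))
    (g h : GL (Fin 3) (BigRing u ℓ)) : ℂ :=
  ψ (Ring.inverse 2 * trace (A * (g.1 * h.1 - h.1 * g.1)))

lemma comm_eq_comm_sub_one (g h : Matrix (Fin 3) (Fin 3) (BigRing u ℓ)) :
    g * h - h * g = (g - 1) * (h - 1) - (h - 1) * (g - 1) := by
  noncomm_ring

/-- The truncated logarithm turns `A` into a quadratic character: `psiLog` is multiplicative up to the
square root `ψ (tr (A [g, h]) / 2)` of the commutator pairing. -/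
lemma IsDepth.isQuadraticChar {μ n₁ n₂ : ℕ} (hd : IsDepth P μ n₁ n₂)
    (hS : IsUniformized u ℓ q ϖ) (hψ : IsPrimitiveChar ψ) (hP : P.IsAdmissible ε) :
    IsQuadraticChar (cong (inertia ε ψ (P.mat ε)) n₁) (psiLog ψ (P.mat ε))
      (altForm ψ (P.mat ε)) := by
  have ⟨h1, h2, h3, h4, h5, h6, h7, h8, h9⟩ := hd
  have hle : lieN ϖ P.δ n₁ (ℓ / 2) ≤ matP ϖ n₁ := lieN_le (by omega)
  have hmem : ∀ {g}, g ∈ cong (inertia ε ψ (P.mat ε)) n₁ → g.1 - 1 ∈ lieN ϖ P.δ n₁ (ℓ / 2) :=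
    fun hg => ((hd.mem_cong_inertia hS hψ hP).1 hg).2
  have hmul : ∀ g g' h, g ∈ cong (inertia ε ψ (P.mat ε)) n₁ →
      g' ∈ cong (inertia ε ψ (P.mat ε)) n₁ → h ∈ cong (inertia ε ψ (P.mat ε)) n₁ →
      trace (P.mat ε * ((g * g').1 * h.1 - h.1 * (g * g').1)) =
        trace (P.mat ε * (g.1 * h.1 - h.1 * g.1)) +
        trace (P.mat ε * (g'.1 * h.1 - h.1 * g'.1)) := by
    intro g g' h hg hg' hh
    have h0 := hd.trace_mul_comm_eq_zero hS (ε := ε) (hmem hg) (hmem hg') (hmem hh)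
    rw [← trace_add, ← mul_add, ← sub_eq_zero, ← trace_sub, ← mul_sub, ← h0]
    congr 2
    rw [Units.val_mul]
    noncomm_ring
  constructor
  · exact fun g _ => (ψ.val_isUnit _).ne_zero
  · intro g hg h hh
    rw [psiLog, trace_logm_mul hS.isUnit_two hS.isUnit_three (C := lieN ϖ P.δ n₁ (ℓ / 2))
      (fun a ha b hb => mul_mem_lieN (by omega) ha hb) ?_ ?_ (hmem hg) (hmem hh),
      AddChar.map_add_eq_mul, AddChar.map_add_eq_mul]
    · rfl
    · intro a ha b hb c hc
      have h0 := hd.trace_mul_comm_eq_zero hS (ε := ε) ha hb hc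
      rwa [mul_sub, trace_sub, sub_eq_zero, mul_assoc] at h0
    · intro a ha b hb c hc d hd' e he
      exact eq_zero_of_mem_matP hS.pow_eq_zero (k := n₁ + (n₁ + (n₁ + (n₁ + n₁))))
        (mul_mem_matP (hle ha) (mul_mem_matP (hle hb) (mul_mem_matP (hle hc)
        (mul_mem_matP (hle hd') (hle he) le_rfl) le_rfl) le_rfl) le_rfl) (by omega)
  · intro g hg g' hg' h hh
    rw [altForm, hmul g g' h hg hg' hh, mul_add, AddChar.map_add_eq_mul]
    rfl
  · intro g hg h hh h' hh'
    have e : ∀ x y : GL (Fin 3) (BigRing u ℓ), trace (P.mat ε * (x.1 * y.1 - y.1 * x.1)) =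
        -trace (P.mat ε * (y.1 * x.1 - x.1 * y.1)) := by
      intro x y
      rw [← trace_neg, ← mul_neg, neg_sub]
    rw [altForm, e, hmul h h' g hh hh' hg, mul_neg, mul_add, neg_add, AddChar.map_add_eq_mul,
      ← mul_neg, ← mul_neg, ← e, ← e]
    rfl
  · intro g hg
    rw [altForm, sub_self, mul_zero, trace_zero, mul_zero, AddChar.map_zero_eq_one]

end NormalFormParams

/-! ### The radical of the alternating form -/

section Radical

variable {o : Type*} [CommRing o] [IsLocalRing o] {u : o} {ℓ q : ℕ} {ϖ : BigRing u ℓ}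
  {ψ : AddChar (BigRing u ℓ) ℂ} {ε : GroupType} {P : Params u ℓ}
  {X Y : Matrix (Fin 3) (Fin 3) (BigRing u ℓ)} {μ n₁ n₂ : ℕ}

/-- The radical of the alternating form `tr (A [X, Y])` on the Lie algebra of `N`. -/
def lieR (ε : GroupType) (P : Params u ℓ) (ϖ : BigRing u ℓ) (n : ℕ) :
    Submodule (BigRing u ℓ) (Matrix (Fin 3) (Fin 3) (BigRing u ℓ)) where
  carrier := {X | X ∈ lieN ϖ P.δ n (ℓ / 2) ∧
    ∀ Y ∈ lieN ϖ P.δ n (ℓ / 2), trace (P.mat ε * (X * Y - Y * X)) = 0}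
  add_mem' {X X'} hX hX' := ⟨add_mem hX.1 hX'.1, fun Y hY => by
    have e : P.mat ε * ((X + X') * Y - Y * (X + X')) = P.mat ε * (X * Y - Y * X) +
        P.mat ε * (X' * Y - Y * X') := by noncomm_ring
    rw [e, trace_add, hX.2 Y hY, hX'.2 Y hY, add_zero]⟩
  zero_mem' := ⟨zero_mem _, fun Y _ => by simp⟩
  smul_mem' c X hX := ⟨Submodule.smul_mem _ _ hX.1, fun Y hY => by
    rw [smul_mul_assoc, mul_smul_comm, ← smul_sub, mul_smul_comm, trace_smul, hX.2 Y hY,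
      smul_zero]⟩

lemma lieR_le {n : ℕ} : lieR ε P ϖ n ≤ lieN ϖ P.δ n (ℓ / 2) := fun _ h => h.1

/-- The group of all invertible matrices `1 + X` with `X` in a multiplicatively closed submodule. -/
def oneAdd (C : Submodule (BigRing u ℓ) (Matrix (Fin 3) (Fin 3) (BigRing u ℓ)))
    [Finite (GL (Fin 3) (BigRing u ℓ))]
    (hC : ∀ X ∈ C, ∀ Y ∈ C, X * Y ∈ C) : Subgroup (GL (Fin 3) (BigRing u ℓ)) :=
  let S : Submonoid (GL (Fin 3) (BigRing u ℓ)) :=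
    { carrier := {g | g.1 - 1 ∈ C}
      one_mem' := by simp
      mul_mem' := fun {g h} hg hh => by
        have e : (g * h).1 - 1 = (g.1 - 1) * (h.1 - 1) + (g.1 - 1) + (h.1 - 1) := by
          rw [Units.val_mul]; noncomm_ring
        rw [Set.mem_ofPred_eq, e]
        exact add_mem (add_mem (hC _ hg _ hh) hg) hh }
  { S with
    inv_mem' := fun {g} hg => by
      have h1 : g⁻¹ = g ^ (orderOf g - 1) := by
        rw [inv_eq_iff_mul_eq_one, ← pow_succ', Nat.sub_add_cancel (orderOf_pos g),
          pow_orderOf_eq_one]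
      rw [h1]
      exact S.pow_mem hg _ }

lemma mem_oneAdd {C : Submodule (BigRing u ℓ) (Matrix (Fin 3) (Fin 3) (BigRing u ℓ))}
    [Finite (GL (Fin 3) (BigRing u ℓ))] {hC : ∀ X ∈ C, ∀ Y ∈ C, X * Y ∈ C}
    {g : GL (Fin 3) (BigRing u ℓ)} : g ∈ oneAdd C hC ↔ g.1 - 1 ∈ C := Iff.rfl

lemma tau_mem_lieR (hS : IsUniformized u ℓ q ϖ) (hP : P.IsAdmissible ε) (hX : X ∈ lieR ε P ϖ n₁) :
    tau ε X ∈ lieR ε P ϖ n₁ := by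
  have hδ : star P.δ = P.δ := (hS.isAdmissible_iff.1 hP).2.1.2.1
  refine ⟨tau_mem_lieN ε hS.star_unif hδ hX.1, fun Y hY => ?_⟩
  have h1 := hX.2 _ (tau_mem_lieN ε hS.star_unif hδ hY)
  have h2 := trace_tau_mul_tau ε (P.mat ε) (X * tau ε Y - tau ε Y * X)
  rwa [h1, star_zero, hS.tau_mat hP, tau_comm, tau_tau] at h2

namespace IsDepth

variable (hd : IsDepth P μ n₁ n₂) (hS : IsUniformized u ℓ q ϖ)

include hd hS

lemma mul_mem_lieR (hX : X ∈ lieN ϖ P.δ n₁ (ℓ / 2)) (hY : Y ∈ lieN ϖ P.δ n₁ (ℓ / 2)) :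
    X * Y ∈ lieR ε P ϖ n₁ :=
  ⟨mul_mem_lieN (hd.le.trans hd.le_half) hX hY,
    fun _ hZ => hd.trace_mul_comm_eq_zero hS hX hY hZ⟩

/-- Right multiplication by `1 + C`, where `C` is the Lie algebra of `N`, preserves the radical
on products. -/
lemma mul_inv_mem_lieR {g : GL (Fin 3) (BigRing u ℓ)} (hg : g.1 - 1 ∈ lieN ϖ P.δ n₁ (ℓ / 2))
    (hX : X ∈ lieR ε P ϖ n₁) :
    X * (g⁻¹).1 ∈ lieR ε P ϖ n₁ ∧ (g⁻¹).1 * X ∈ lieR ε P ϖ n₁ ∧ g.1 * X ∈ lieR ε P ϖ n₁ := by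
  have := hS.finite_GL
  have hC : ∀ X ∈ lieN ϖ P.δ n₁ (ℓ / 2), ∀ Y ∈ lieN ϖ P.δ n₁ (ℓ / 2),
    X * Y ∈ lieN ϖ P.δ n₁ (ℓ / 2) := fun X hX Y hY => mul_mem_lieN (hd.le.trans hd.le_half) hX hY
  have hg' : (g⁻¹).1 - 1 ∈ lieN ϖ P.δ n₁ (ℓ / 2) := (oneAdd _ hC).inv_mem hg
  refine ⟨?_, ?_, ?_⟩
  · have e : X * (g⁻¹).1 = X * ((g⁻¹).1 - 1) + X := by noncomm_ring
    rw [e]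
    exact add_mem (hd.mul_mem_lieR hS hX.1 hg') hX
  · have e : (g⁻¹).1 * X = ((g⁻¹).1 - 1) * X + X := by noncomm_ring
    rw [e]
    exact add_mem (hd.mul_mem_lieR hS hg' hX.1) hX
  · have e : g.1 * X = (g.1 - 1) * X + X := by noncomm_ring
    rw [e]
    exact add_mem (hd.mul_mem_lieR hS hg hX.1) hX

variable (hP : P.IsAdmissible ε)

include hP

lemma sig_sub_one_sub_mem {g : GL (Fin 3) (BigRing u ℓ)}
    (hg : g.1 - 1 ∈ lieN ϖ P.δ n₁ (ℓ / 2)) :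
    (sig ε g).1 - 1 - tau ε (g.1 - 1) ∈ lieR ε P ϖ n₁ := by
  rcases sig_sub_one ε g with h | h
  · rw [h, sub_self]
    exact zero_mem _
  · rw [h, sub_sub_cancel_left]
    exact neg_mem (tau_mem_lieR hS hP
      (hd.mul_inv_mem_lieR hS hg (hd.mul_mem_lieR hS hg hg)).1)

variable (hψ : IsPrimitiveChar ψ)

include hψ

/-- The points of the Lie algebra of `N` that are fixed by the involution are the elements `g - 1`,
for `g` in `N`, modulo the radical. -/
lemma exists_mem_sub_one_sub_mem (hY : Y ∈ lieN ϖ P.δ n₁ (ℓ / 2)) (hY' : tau ε Y = Y) :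
    ∃ g ∈ cong (inertia ε ψ (P.mat ε)) n₁, g.1 - 1 - Y ∈ lieR ε P ϖ n₁ := by
  have := hS.finite_GL
  have hle : lieN ϖ P.δ n₁ (ℓ / 2) ≤ matP ϖ 1 :=
    (lieN_le (hd.le.trans hd.le_half)).trans (matP_anti hd.one_le)
  let B := oneAdd (lieR ε P ϖ n₁) fun X hX Y hY => hd.mul_mem_lieR hS hX.1 hY.1
  obtain ⟨x, hx⟩ : IsUnit (1 + Y) := hS.isUnit_of_sub_mem_matP isUnit_one
    (by rw [add_sub_cancel_left]; exact hle hY)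
  have hxY : x.1 - 1 = Y := by rw [hx, add_sub_cancel_left]
  have hxN : x.1 - 1 ∈ lieN ϖ P.δ n₁ (ℓ / 2) := by rwa [hxY]
  obtain ⟨g, -, hg, h⟩ := hS.exists_lift ε (H := ⊤) (B := B) (x := x)
    (fun b hb => hS.mem_ker_redGL.2 (hle (lieR_le hb))) trivial trivial (by
      change (x⁻¹ * sig ε x).1 - 1 ∈ lieR ε P ϖ n₁
      have h1 := hd.sig_sub_one_sub_mem hS hP hxN
      rw [hxY, hY', ← hxY, sub_sub_sub_cancel_right] at h1
      have h2 := (hd.mul_inv_mem_lieR hS hxN h1).2.1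
      rwa [mul_sub, Units.inv_mul] at h2)
  have h1 : g.1 - 1 - Y ∈ lieR ε P ϖ n₁ := by
    have h2 := (hd.mul_inv_mem_lieR hS hxN (show (x⁻¹ * g).1 - 1 ∈ lieR ε P ϖ n₁ from h)).2.2
    rw [mul_sub, ← Units.val_mul, mul_inv_cancel_left, mul_one] at h2
    rwa [sub_sub, ← hx]
  refine ⟨g, (hd.mem_cong_inertia hS hψ hP).2 ⟨hg, ?_⟩, h1⟩
  have h2 := add_mem (lieR_le h1) hY
  rwa [sub_add_cancel] at h2

/-- The radical of the alternating form on `N` is the set of elements of `N` that come from the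
radical of the trace form on its Lie algebra. -/
lemma mem_radical_iff {g : GL (Fin 3) (BigRing u ℓ)} :
    g ∈ (hd.isQuadraticChar hS hψ hP).radical ↔
      g ∈ grp ε u ℓ ∧ g.1 - 1 ∈ lieR ε P ϖ n₁ := by
  rw [IsQuadraticChar.mem_radical]
  have hmem := fun g => hd.mem_cong_inertia hS hψ hP (g := g)
  have hδ : star P.δ = P.δ := (hS.isAdmissible_iff.1 hP).2.1.2.1
  have hhalf : IsUnit (Ring.inverse (2 : BigRing u ℓ)) := hS.isUnit_two.ringInverse
  constructor
  · rintro ⟨hg, h⟩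
    have hgx := ((hmem g).1 hg).2
    refine ⟨((hmem g).1 hg).1, ?_⟩
    set x := g.1 - 1 with hx
    have h1 : tau ε x - x ∈ lieR ε P ϖ n₁ := by
      have h2 := hd.sig_sub_one_sub_mem hS hP hgx
      rw [hS.mem_grp_iff.1 ((hmem g).1 hg).1] at h2
      rwa [← neg_mem_iff, neg_sub]
    -- the point `x₀` of the Lie ring represents `g - 1` modulo the radical
    set x₀ := Ring.inverse (2 : BigRing u ℓ) • (x + tau ε x) with hx₀
    have hxx₀ : x₀ - x ∈ lieR ε P ϖ n₁ := by
      have e : x₀ - x = Ring.inverse (2 : BigRing u ℓ) • (tau ε x - x) := by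
        ext1 i j
        simp only [hx₀, Matrix.sub_apply, Matrix.smul_apply, Matrix.add_apply, smul_eq_mul]
        linear_combination hS.half_add_half (x i j)
      rw [e]
      exact Submodule.smul_mem _ _ h1
    have hx₀N : x₀ ∈ lieN ϖ P.δ n₁ (ℓ / 2) := by
      have := add_mem (lieR_le hxx₀) hgx
      rwa [sub_add_cancel] at this
    have hx₀τ : tau ε x₀ = x₀ := by
      rw [hx₀, tau_smul, hS.star_inverse_two, tau_add, tau_tau, add_comm]
    have key : ∀ Y ∈ lieN ϖ P.δ n₁ (ℓ / 2),
        trace (Ring.inverse (2 : BigRing u ℓ) • (P.mat ε * x₀ - x₀ * P.mat ε) * Y) = 0 := by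
      intro Y hY
      refine hS.trace_eq_zero_of_forall (ε := ε) hψ ?_
        (fun Z hZ => tau_mem_lieN ε hS.star_unif hδ hZ) (fun Y hY hY' => ?_) hY
      · rw [tau_smul, tau_comm, hS.tau_mat hP, hx₀τ, hS.star_inverse_two]
      · obtain ⟨k, hk, hkY⟩ := hd.exists_mem_sub_one_sub_mem hS hP hψ hY hY'
        have h3 := h k hk
        rw [altForm, comm_eq_comm_sub_one] at h3
        have h4 := hkY.2 x hgx
        have h5 := hxx₀.2 Y hY
        rw [smul_mul_assoc, trace_smul, smul_eq_mul, ← trace_comm_mul]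
        have e : trace (P.mat ε * (x₀ * Y - Y * x₀)) =
            trace (P.mat ε * (x * (k.1 - 1) - (k.1 - 1) * x)) := by
          have e1 : P.mat ε * (x₀ * Y - Y * x₀) =
              P.mat ε * (x * (k.1 - 1) - (k.1 - 1) * x) +
              P.mat ε * ((k.1 - 1 - Y) * x - x * (k.1 - 1 - Y)) +
              P.mat ε * ((x₀ - x) * Y - Y * (x₀ - x)) := by noncomm_ring
          rw [e1, trace_add, trace_add, h4, h5, add_zero, add_zero]
        rwa [e]
    have hx₀R : x₀ ∈ lieR ε P ϖ n₁ := by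
      refine ⟨hx₀N, fun Y hY => ?_⟩
      have h3 := key Y hY
      rw [smul_mul_assoc, trace_smul, smul_eq_mul, hhalf.mul_right_eq_zero] at h3
      rwa [trace_comm_mul]
    have := sub_mem hx₀R hxx₀
    rwa [sub_sub_cancel] at this
  · rintro ⟨hg, h⟩
    refine ⟨(hmem g).2 ⟨hg, h.1⟩, fun k hk => ?_⟩
    rw [altForm, comm_eq_comm_sub_one, h.2 _ ((hmem k).1 hk).2, mul_zero, AddChar.map_zero_eq_one]

end IsDepth

/-- A stable submodule of the matrices is the direct sum of its fixed points and `ρ` times its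
fixed points. -/
lemma IsUniformized.card_fixed_sq (hS : IsUniformized u ℓ q ϖ) (ε : GroupType)
    (C : Submodule (BigRing u ℓ) (Matrix (Fin 3) (Fin 3) (BigRing u ℓ)))
    (hC : ∀ X ∈ C, tau ε X ∈ C) :
    Nat.card {X // X ∈ C ∧ tau ε X = X} ^ 2 = Nat.card C := by
  set ρ : BigRing u ℓ := ⟨0, 1⟩ with hρ
  have hρs : star ρ = -ρ := star_rho
  obtain ⟨ρ', hρ'⟩ := hS.isUnit_rho.exists_right_inv
  have e2 := Ring.mul_inverse_cancel _ hS.isUnit_two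
  set i := Ring.inverse (2 : BigRing u ℓ)
  have hρ's : star ρ' = -ρ' := by
    have h1 : star ρ * star ρ' = 1 := by rw [← star_mul', hρ', star_one]
    rw [hρs] at h1
    linear_combination (-star ρ') * hρ' - ρ' * h1
  rw [sq, ← Nat.card_prod]
  refine Nat.card_congr (Equiv.ofBijective (fun p => (⟨p.1.1 + ρ • p.2.1,
    add_mem p.1.2.1 (Submodule.smul_mem _ _ p.2.2.1)⟩ : C)) ⟨?_, ?_⟩)
  · rintro ⟨⟨X, hX⟩, ⟨Y, hY⟩⟩ ⟨⟨X', hX'⟩, ⟨Y', hY'⟩⟩ h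
    have h1 : X + ρ • Y = X' + ρ • Y' := congrArg Subtype.val h
    have h2 := congrArg (tau ε) h1
    rw [tau_add, tau_add, tau_smul, tau_smul, hρs, hX.2, hY.2, hX'.2, hY'.2] at h2
    have hXX : X = X' := by
      ext1 a b
      have h3 := congrFun (congrFun h1 a) b
      have h4 := congrFun (congrFun h2 a) b
      simp only [Matrix.add_apply, Matrix.smul_apply, smul_eq_mul] at h3 h4
      linear_combination i * h3 + i * h4 - (X a b - X' a b) * e2
    subst hXX
    have hYY : Y = Y' := by
      ext1 a b
      have h3 := congrFun (congrFun h1 a) b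
      simp only [Matrix.add_apply, Matrix.smul_apply, smul_eq_mul] at h3
      linear_combination ρ' * h3 - (Y a b - Y' a b) * hρ'
    subst hYY
    rfl
  · rintro ⟨Z, hZ⟩
    refine ⟨⟨⟨i • (Z + tau ε Z), Submodule.smul_mem _ _ (add_mem hZ (hC _ hZ)), ?_⟩,
      ⟨(i * ρ') • (Z - tau ε Z), Submodule.smul_mem _ _ (sub_mem hZ (hC _ hZ)), ?_⟩⟩, ?_⟩
    · rw [tau_smul, hS.star_inverse_two, tau_add, tau_tau, add_comm]
    · rw [tau_smul, star_mul', hS.star_inverse_two, hρ's, tau_sub, tau_tau, mul_neg, neg_smul,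
        ← smul_neg, neg_sub]
    · ext1
      change i • (Z + tau ε Z) + ρ • (i * ρ') • (Z - tau ε Z) = Z
      ext1 a b
      simp only [Matrix.add_apply, Matrix.sub_apply, Matrix.smul_apply, smul_eq_mul]
      linear_combination Z a b * e2 + i * (Z a b - tau ε Z a b) * hρ'

/-- The index of the radical in `N`, in terms of the Lie algebras. -/
lemma IsDepth.relIndex_radical_sq (hd : IsDepth P μ n₁ n₂) (hS : IsUniformized u ℓ q ϖ)
    (hP : P.IsAdmissible ε) (hψ : IsPrimitiveChar ψ) :
    ((hd.isQuadraticChar hS hψ hP).radical.relIndex (cong (inertia ε ψ (P.mat ε)) n₁)) ^ 2 *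
      Nat.card (lieR ε P ϖ n₁) = Nat.card (lieN ϖ P.δ n₁ (ℓ / 2)) := by
  have := hS.finite
  have hδ : star P.δ = P.δ := (hS.isAdmissible_iff.1 hP).2.1.2.1
  rw [← hS.card_fixed_sq ε (lieR ε P ϖ n₁) fun X hX => tau_mem_lieR hS hP hX,
    ← hS.card_fixed_sq ε (lieN ϖ P.δ n₁ (ℓ / 2)) fun X hX => tau_mem_lieN ε hS.star_unif hδ hX,
    ← mul_pow]
  congr 1
  set N := cong (inertia ε ψ (P.mat ε)) n₁
  set R := (hd.isQuadraticChar hS hψ hP).radical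
  have hmem := fun g => hd.mem_cong_inertia hS hψ hP (g := g)
  -- the group `N` and the fixed points of its Lie algebra have the same image modulo the radical
  -- of the Lie algebra
  let Q := Matrix (Fin 3) (Fin 3) (BigRing u ℓ) ⧸ lieR ε P ϖ n₁
  have : Finite Q := Quotient.finite _
  let h : N →* Multiplicative Q :=
    { toFun := fun g => Multiplicative.ofAdd ((lieR ε P ϖ n₁).mkQ (g.1.1 - 1))
      map_one' := by simp
      map_mul' := fun g g' => by
        rw [← ofAdd_add, ← map_add]
        congr 1
        simp only [Submodule.mkQ_apply]
        rw [Submodule.Quotient.eq]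
        have h1 : (g * g').1.1 - 1 - (g.1.1 - 1 + (g'.1.1 - 1)) =
            (g.1.1 - 1) * (g'.1.1 - 1) := by
          rw [Subgroup.coe_mul, Units.val_mul]
          noncomm_ring
        rw [h1]
        exact hd.mul_mem_lieR hS ((hmem _).1 g.2).2 ((hmem _).1 g'.2).2 }
  have hker : R.subgroupOf N = h.ker := by
    ext g
    rw [Subgroup.mem_subgroupOf, hd.mem_radical_iff hS hP hψ, MonoidHom.mem_ker]
    have h1 : h g = 1 ↔ (lieR ε P ϖ n₁).mkQ (g.1.1 - 1) = 0 := Iff.rfl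
    rw [h1, Submodule.mkQ_apply, Submodule.Quotient.mk_eq_zero]
    exact and_iff_right ((hmem _).1 g.2).1
  let F : AddSubgroup (Matrix (Fin 3) (Fin 3) (BigRing u ℓ)) :=
    { carrier := {X | X ∈ lieN ϖ P.δ n₁ (ℓ / 2) ∧ tau ε X = X}
      zero_mem' := ⟨zero_mem _, tau_zero ε⟩
      add_mem' := fun hX hY => ⟨add_mem hX.1 hY.1, by rw [tau_add, hX.2, hY.2]⟩
      neg_mem' := fun hX => ⟨neg_mem hX.1, by rw [tau_neg, hX.2]⟩ }
  let k : F →+ Q := (lieR ε P ϖ n₁).mkQ.toAddMonoidHom.comp F.subtype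
  have hk : ∀ X : F, k X = (lieR ε P ϖ n₁).mkQ X.1 := fun _ => rfl
  have hrange : Nat.card h.range = Nat.card k.range := by
    have hs : ∀ x : Q, Multiplicative.ofAdd x ∈ h.range ↔ x ∈ k.range := by
      intro x
      constructor
      · rintro ⟨g, hg⟩
        have hg' : (lieR ε P ϖ n₁).mkQ (g.1.1 - 1) = x := congrArg Multiplicative.toAdd hg
        have hgx := ((hmem _).1 g.2).2
        have h1 : tau ε (g.1.1 - 1) - (g.1.1 - 1) ∈ lieR ε P ϖ n₁ := by
          have h2 := hd.sig_sub_one_sub_mem hS hP hgx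
          rw [hS.mem_grp_iff.1 ((hmem _).1 g.2).1] at h2
          rwa [← neg_mem_iff, neg_sub]
        refine ⟨⟨Ring.inverse (2 : BigRing u ℓ) • ((g.1.1 - 1) + tau ε (g.1.1 - 1)),
          Submodule.smul_mem _ _ (add_mem hgx (tau_mem_lieN ε hS.star_unif hδ hgx)), ?_⟩, ?_⟩
        · rw [tau_smul, hS.star_inverse_two, tau_add, tau_tau, add_comm]
        · rw [hk, ← hg', Submodule.mkQ_apply, Submodule.mkQ_apply, Submodule.Quotient.eq]
          have e : Ring.inverse (2 : BigRing u ℓ) • ((g.1.1 - 1) + tau ε (g.1.1 - 1)) -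
              (g.1.1 - 1) = Ring.inverse (2 : BigRing u ℓ) •
                (tau ε (g.1.1 - 1) - (g.1.1 - 1)) := by
            generalize g.1.1 - 1 = x
            ext1 i j
            simp only [Matrix.sub_apply, Matrix.smul_apply, Matrix.add_apply, smul_eq_mul]
            linear_combination hS.half_add_half (x i j)
          rw [e]
          exact Submodule.smul_mem _ _ h1
      · rintro ⟨⟨Y, hY, hY'⟩, rfl⟩
        obtain ⟨g, hg, h1⟩ := hd.exists_mem_sub_one_sub_mem hS hP hψ hY hY'
        refine ⟨⟨g, hg⟩, ?_⟩
        have h2 : (lieR ε P ϖ n₁).mkQ (g.1 - 1) = (lieR ε P ϖ n₁).mkQ Y := by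
          rwa [Submodule.mkQ_apply, Submodule.mkQ_apply, Submodule.Quotient.eq]
        exact congrArg Multiplicative.ofAdd h2
    exact Nat.card_congr ((Multiplicative.toAdd).subtypeEquiv fun x => hs (Multiplicative.toAdd x))
  rw [Subgroup.relIndex, hker, Subgroup.index_ker, hrange, ← AddSubgroup.index_ker]
  have h1 := k.ker.index_mul_card
  have h2 : Nat.card k.ker = Nat.card {X // X ∈ lieR ε P ϖ n₁ ∧ tau ε X = X} := by
    refine Nat.card_congr ⟨fun X => ⟨X.1.1, ?_, X.1.2.2⟩, fun X => ⟨⟨X.1, lieR_le X.2.1, X.2.2⟩, ?_⟩,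
      fun _ => rfl, fun _ => rfl⟩
    · have := X.2
      rwa [AddMonoidHom.mem_ker, hk, Submodule.mkQ_apply, Submodule.Quotient.mk_eq_zero] at this
    · rw [AddMonoidHom.mem_ker, hk, Submodule.mkQ_apply, Submodule.Quotient.mk_eq_zero]
      exact X.2.1
  rw [h2] at h1
  exact h1

end Radical

/-! ### The index of the radical -/

section RadicalIndex

variable {o : Type*} [CommRing o] [IsLocalRing o] {u : o} {ℓ q : ℕ} {ϖ : BigRing u ℓ}
  {ψ : AddChar (BigRing u ℓ) ℂ} {ε : GroupType} {P : Params u ℓ}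
  {X Y : Matrix (Fin 3) (Fin 3) (BigRing u ℓ)} {μ n₁ n₂ : ℕ}

lemma index_eq_card_of_surjective {G H : Type*} [AddCommGroup G] [AddCommGroup H] (f : G →+ H)
    (hf : Function.Surjective f) {K : AddSubgroup G} (hK : ∀ g, g ∈ K ↔ f g = 0) :
    K.index = Nat.card H := by
  have h1 : K = f.ker := by
    ext g
    rw [hK, AddMonoidHom.mem_ker]
  rw [h1, AddSubgroup.index_ker, AddMonoidHom.range_eq_top.2 hf, AddSubgroup.card_top]

/-- The alternating form on the commutant of `matE δ` is a triple product with `(γ, β, α)`. -/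
lemma trace_mat_matJ_comm (ε : GroupType) (P : Params u ℓ)
    (a b x y z a' b' x' y' z' : BigRing u ℓ) :
    trace (P.mat ε * (matJ P.δ a b x y z * matJ P.δ a' b' x' y' z' -
      matJ P.δ a' b' x' y' z' * matJ P.δ a b x y z)) =
    scal ε u ℓ * (x' * (P.α * (a - b + P.δ * z) - P.γ * y) +
      y' * (P.γ * x - P.β * (a - b + P.δ * z)) +
      (a' - b' + P.δ * z') * (P.β * y - P.α * x)) := by
  rw [Params.mat, smul_mul_assoc, trace_smul, smul_eq_mul]
  congr 1
  simp only [matJ, trace_fin_three, Matrix.mul_apply, Matrix.sub_apply, Fin.sum_univ_three,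
    Matrix.of_apply, Matrix.cons_val]
  ring

/-- The triples proportional, modulo an ideal, to a unimodular vector `(γ, β, α)` form a subgroup
whose index is the square of the order of the quotient ring. -/
lemma index_cross {R : Type*} [CommRing R] (I : Ideal R) {α β γ δ : R}
    (h : IsUnit α ∨ IsUnit β ∨ IsUnit γ) {K : AddSubgroup (R × R × R × R × R)}
    (hK : ∀ a b x y z, (a, b, x, y, z) ∈ K ↔ α * (a - b + δ * z) - γ * y ∈ I ∧
      γ * x - β * (a - b + δ * z) ∈ I ∧ β * y - α * x ∈ I) :
    K.index = Nat.card (R ⧸ I) ^ 2 := by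
  rw [sq, ← Nat.card_prod]
  have hmk : ∀ x, Ideal.Quotient.mk I x = 0 ↔ x ∈ I := fun x => Ideal.Quotient.eq_zero_iff_mem
  have hcancel : ∀ c x : R, IsUnit c → c * x ∈ I → x ∈ I := by
    intro c x hc hcx
    obtain ⟨c', hc'⟩ := hc.exists_left_inv
    have := Ideal.mul_mem_left _ c' hcx
    rwa [← mul_assoc, hc', one_mul] at this
  -- two of the three conditions imply the third one
  have key : ∀ f g : (R × R × R × R × R) →+ R, (Function.Surjective fun p => (f p, g p)) →
      (∀ a b x y z, (a, b, x, y, z) ∈ K ↔ f (a, b, x, y, z) ∈ I ∧ g (a, b, x, y, z) ∈ I) →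
      K.index = Nat.card ((R ⧸ I) × (R ⧸ I)) := by
    intro f g hfg hK'
    refine index_eq_card_of_surjective
      (((Ideal.Quotient.mk I).toAddMonoidHom.comp f).prod
        ((Ideal.Quotient.mk I).toAddMonoidHom.comp g)) ?_ ?_
    · rintro ⟨s, t⟩
      obtain ⟨s, rfl⟩ := Ideal.Quotient.mk_surjective s
      obtain ⟨t, rfl⟩ := Ideal.Quotient.mk_surjective t
      obtain ⟨p, hp⟩ := hfg (s, t)
      rw [Prod.mk.injEq] at hp
      refine ⟨p, Prod.ext ?_ ?_⟩
      · exact congrArg (Ideal.Quotient.mk I) hp.1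
      · exact congrArg (Ideal.Quotient.mk I) hp.2
    · rintro ⟨a, b, x, y, z⟩
      rw [hK', ← hmk, ← hmk]
      exact Prod.mk_eq_zero.symm
  let f₁ : (R × R × R × R × R) →+ R := AddMonoidHom.mk'
    (fun p => α * (p.1 - p.2.1 + δ * p.2.2.2.2) - γ * p.2.2.2.1)
    (fun p p' => by simp only [Prod.fst_add, Prod.snd_add]; ring)
  let f₂ : (R × R × R × R × R) →+ R := AddMonoidHom.mk'
    (fun p => γ * p.2.2.1 - β * (p.1 - p.2.1 + δ * p.2.2.2.2))
    (fun p p' => by simp only [Prod.fst_add, Prod.snd_add]; ring)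
  let f₃ : (R × R × R × R × R) →+ R := AddMonoidHom.mk' (fun p => β * p.2.2.2.1 - α * p.2.2.1)
    (fun p p' => by simp only [Prod.fst_add, Prod.snd_add]; ring)
  rcases h with h | h | h
  · obtain ⟨c, hc⟩ := h.exists_right_inv
    refine key f₁ f₃ ?_ fun a b x y z => ?_
    · rintro ⟨s, t⟩
      refine ⟨(c * s, 0, -(c * t), 0, 0), Prod.ext ?_ ?_⟩
      · change α * (c * s - 0 + δ * 0) - γ * 0 = s
        linear_combination s * hc
      · change β * 0 - α * (-(c * t)) = t
        linear_combination t * hc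
    · rw [hK]
      refine ⟨fun h' => ⟨h'.1, h'.2.2⟩, fun h' => ⟨h'.1, hcancel _ _ h ?_, h'.2⟩⟩
      have e : α * (γ * x - β * (a - b + δ * z)) = -β * (α * (a - b + δ * z) - γ * y) -
          γ * (β * y - α * x) := by ring
      rw [e]
      exact Ideal.sub_mem _ (Ideal.mul_mem_left _ (-β) h'.1) (Ideal.mul_mem_left _ γ h'.2)
  · obtain ⟨c, hc⟩ := h.exists_right_inv
    refine key f₂ f₃ ?_ fun a b x y z => ?_
    · rintro ⟨s, t⟩
      refine ⟨(-(c * s), 0, 0, c * t, 0), Prod.ext ?_ ?_⟩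
      · change γ * 0 - β * (-(c * s) - 0 + δ * 0) = s
        linear_combination s * hc
      · change β * (c * t) - α * 0 = t
        linear_combination t * hc
    · rw [hK]
      refine ⟨fun h' => ⟨h'.2.1, h'.2.2⟩, fun h' => ⟨hcancel _ _ h ?_, h'.1, h'.2⟩⟩
      have e : β * (α * (a - b + δ * z) - γ * y) = -α * (γ * x - β * (a - b + δ * z)) -
          γ * (β * y - α * x) := by ring
      rw [e]
      exact Ideal.sub_mem _ (Ideal.mul_mem_left _ (-α) h'.1) (Ideal.mul_mem_left _ γ h'.2)
  · obtain ⟨c, hc⟩ := h.exists_right_inv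
    refine key f₁ f₂ ?_ fun a b x y z => ?_
    · rintro ⟨s, t⟩
      refine ⟨(0, 0, c * t, -(c * s), 0), Prod.ext ?_ ?_⟩
      · change α * (0 - 0 + δ * 0) - γ * (-(c * s)) = s
        linear_combination s * hc
      · change γ * (c * t) - β * (0 - 0 + δ * 0) = t
        linear_combination t * hc
    · rw [hK]
      refine ⟨fun h' => ⟨h'.1, h'.2.1⟩, fun h' => ⟨h'.1, h'.2, hcancel _ _ h ?_⟩⟩
      have e : γ * (β * y - α * x) = -β * (α * (a - b + δ * z) - γ * y) -
          α * (γ * x - β * (a - b + δ * z)) := by ring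
      rw [e]
      exact Ideal.sub_mem _ (Ideal.mul_mem_left _ (-β) h'.1) (Ideal.mul_mem_left _ α h'.2)

lemma matE_comm {R : Type*} [CommRing R] (δ : R) (X : Matrix (Fin 3) (Fin 3) R) :
    matE δ * X - X * matE δ =
    !![X 2 0 - δ ^ 2 * X 0 2, X 2 1 - δ * X 0 1, X 2 2 - X 0 0;
      δ * X 1 0 - δ ^ 2 * X 1 2, 0, δ * X 1 2 - X 1 0;
      δ ^ 2 * X 0 0 - δ ^ 2 * X 2 2, δ ^ 2 * X 0 1 - δ * X 2 1, δ ^ 2 * X 0 2 - X 2 0] := by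
  ext i j
  fin_cases i <;> fin_cases j <;> simp only [matE, Matrix.sub_apply, Matrix.mul_apply,
    Fin.sum_univ_three, Matrix.of_apply, Matrix.cons_val, Fin.zero_eta, Fin.mk_one,
    Fin.reduceFinMk] <;> ring

/-- The matrices that commute with `matE δ` modulo an ideal that contains `δ` are given by four
linear conditions. -/
lemma index_comm_matE {R : Type*} [CommRing R] (I : Ideal R) {δ : R} (hδ : δ ∈ I)
    {K : AddSubgroup (Matrix (Fin 3) (Fin 3) R)}
    (hK : ∀ X, X ∈ K ↔ ∀ i j, (matE δ * X - X * matE δ) i j ∈ I) :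
    K.index = Nat.card (R ⧸ I) ^ 4 := by
  have hcard : Nat.card ((R ⧸ I) × (R ⧸ I) × (R ⧸ I) × (R ⧸ I)) = Nat.card (R ⧸ I) ^ 4 := by
    simp only [Nat.card_prod]
    ring
  rw [← hcard]
  have hmk : ∀ x, x ∈ I ↔ Ideal.Quotient.mk I x = 0 := fun x => Ideal.Quotient.eq_zero_iff_mem.symm
  have hδ' : Ideal.Quotient.mk I δ = 0 := (hmk δ).1 hδ
  refine index_eq_card_of_surjective (AddMonoidHom.mk' (fun X =>
    (Ideal.Quotient.mk I (X 1 0), Ideal.Quotient.mk I (X 2 0), Ideal.Quotient.mk I (X 2 1),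
      Ideal.Quotient.mk I (X 2 2 - X 0 0))) fun p p' => ?_) ?_ ?_
  · simp only [Matrix.add_apply, map_add, map_sub, Prod.mk_add_mk, add_sub_add_comm]
  · rintro ⟨s, t, v, w⟩
    obtain ⟨s, rfl⟩ := Ideal.Quotient.mk_surjective s
    obtain ⟨t, rfl⟩ := Ideal.Quotient.mk_surjective t
    obtain ⟨v, rfl⟩ := Ideal.Quotient.mk_surjective v
    obtain ⟨w, rfl⟩ := Ideal.Quotient.mk_surjective w
    refine ⟨!![0, 0, 0; s, 0, 0; t, v, w], ?_⟩
    simp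
  · intro X
    rw [hK]
    simp only [hmk, AddMonoidHom.mk'_apply, Prod.mk_eq_zero, matE_comm]
    constructor
    · intro h
      have h1 := h 0 0
      have h2 := h 0 1
      have h3 := h 0 2
      have h4 := h 1 2
      simp only [Matrix.of_apply, Matrix.cons_val, map_sub, map_mul, map_pow, hδ'] at h1 h2 h3 h4
      rw [map_sub]
      exact ⟨by linear_combination -h4, by linear_combination h1, by linear_combination h2, h3⟩
    · rintro ⟨h1, h2, h3, h4⟩ i j
      rw [map_sub] at h4
      fin_cases i <;> fin_cases j <;> simp [hδ', h1, h2, h3, h4]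

/-- The radical of the layer `𝔓 ^ ℓ₁` of the Lie algebra. The exponent `ℓ - 2 (ℓ / 2)` is the parity of
`ℓ`, so that there is a condition only for odd `ℓ`. -/
lemma trace_comm_eq_zero_iff (hS : IsUniformized u ℓ q ϖ) (hm : 1 ≤ P.m) : (∀ Y ∈ matP ϖ (ℓ / 2), trace (P.mat ε *
      ((ϖ ^ (ℓ / 2) • X) * Y - Y * (ϖ ^ (ℓ / 2) • X))) = 0) ↔
    matE P.δ * X - X * matE P.δ ∈ matP ϖ (ℓ - 2 * (ℓ / 2)) := by
  rw [← hS.comm_mat_mem_iff (ε := ε) (mem_matP_zero X) (by omega)]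
  have e : P.mat ε * (ϖ ^ (ℓ / 2) • X) - (ϖ ^ (ℓ / 2) • X) * P.mat ε =
      ϖ ^ (ℓ / 2) • (P.mat ε * X - X * P.mat ε) := by
    rw [smul_sub, mul_smul_comm, smul_mul_assoc]
  constructor
  · intro h
    have h1 := hS.mem_matP_of_trace_eq_zero (D := ϖ ^ (ℓ / 2) • (P.mat ε * X - X * P.mat ε))
      (k := ℓ / 2) (by omega) fun Y hY => by
        rw [← e, ← trace_comm_mul]
        exact h Y hY
    rw [mem_matP_iff] at h1 ⊢
    intro i j
    obtain ⟨y, hy⟩ := h1 i j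
    refine hS.cancel (ℓ / 2) _ _ y (by omega) ?_
    rw [show ℓ / 2 + (ℓ - 2 * (ℓ / 2)) = ℓ - ℓ / 2 by omega]
    exact hy
  · intro h Y hY
    rw [trace_comm_mul, e]
    obtain ⟨Z, hZ⟩ := h
    rw [hZ, smul_smul, ← pow_add]
    exact trace_mul_eq_zero hS.pow_eq_zero ⟨Z, rfl⟩ hY (by omega)

namespace IsDepth

variable (hd : IsDepth P μ n₁ n₂) (hS : IsUniformized u ℓ q ϖ)

include hd hS

/-- The two layers of the Lie algebra of `N` are orthogonal. -/
lemma add_mem_lieR_iff {J : Matrix (Fin 3) (Fin 3) (BigRing u ℓ)} (hJ : J ∈ lieJ P.δ)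
    (hJ' : J ∈ matP ϖ n₁) (hX : X ∈ matP ϖ (ℓ / 2)) : X + J ∈ lieR ε P ϖ n₁ ↔
      (∀ Y ∈ matP ϖ (ℓ / 2), trace (P.mat ε * (X * Y - Y * X)) = 0) ∧
      ∀ Y ∈ lieJ P.δ, Y ∈ matP ϖ n₁ → trace (P.mat ε * (J * Y - Y * J)) = 0 := by
  have ⟨h1, h2, h3, h4, h5, h6, h7, h8, h9⟩ := hd
  have horth : ∀ J ∈ lieJ P.δ, J ∈ matP ϖ n₁ → ∀ X ∈ matP ϖ (ℓ / 2),
      trace (P.mat ε * (J * X - X * J)) = 0 := by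
    intro J hJ hJ' X hX
    rw [trace_comm_mul]
    exact trace_mul_eq_zero hS.pow_eq_zero
      (hS.comm_mat_mem_of_lieJ hJ hJ' (c := μ + n₁) (by omega)) hX (by omega)
  have e : ∀ X J Y K : Matrix (Fin 3) (Fin 3) (BigRing u ℓ),
      trace (P.mat ε * ((X + J) * (Y + K) - (Y + K) * (X + J))) =
      trace (P.mat ε * (X * Y - Y * X)) + trace (P.mat ε * (J * K - K * J)) +
      (trace (P.mat ε * (J * Y - Y * J)) - trace (P.mat ε * (K * X - X * K))) := by
    intro X J Y K
    rw [← trace_add, ← trace_sub, ← trace_add]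
    congr 1
    noncomm_ring
  constructor
  · rintro ⟨-, h⟩
    constructor
    · intro Y hY
      have h' := h (Y + 0) (mem_lieN.2 ⟨0, zero_mem _, zero_mem _, by simpa using hY⟩)
      rw [e, horth J hJ hJ' Y hY] at h'
      simpa using h'
    · intro K hK hK'
      have h' := h (0 + K) (mem_lieN.2 ⟨K, hK, hK', by simp⟩)
      rw [e, horth K hK hK' X hX] at h'
      simpa using h'
  · rintro ⟨hX', hJX⟩
    refine ⟨mem_lieN.2 ⟨J, hJ, hJ', by rwa [add_sub_cancel_right]⟩, fun Y hY => ?_⟩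
    obtain ⟨K, hK, hK', hYK⟩ := mem_lieN.1 hY
    have h' := e X J (Y - K) K
    rw [sub_add_cancel] at h'
    rw [h', hX' _ hYK, hJX K hK hK', horth J hJ hJ' _ hYK, horth K hK hK' X hX]
    simp

/-- The index of the radical in the Lie algebra. The layer `𝔓 ^ ℓ₁` contributes four conditions over the
residue field if `ℓ` is odd, and the layer `𝔓 ^ n₁` of the commutant contributes two if `n₁ < n₂`. -/
lemma card_lieN (hP : P.IsAdmissible ε) :
    Nat.card (lieN ϖ P.δ n₁ (ℓ / 2)) =
      (q ^ (8 * (ℓ - ℓ / 2 - ℓ / 2) + 4 * (n₂ - n₁))) * Nat.card (lieR ε P ϖ n₁) := by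
  have ⟨h1, h2, h3, h4, h5, h6, h7, h8, h9⟩ := hd
  obtain ⟨⟨-, hδ, hm⟩, -⟩ := hS.isAdmissible_iff.1 hP
  have hδP : P.δ ∈ bigP u ℓ := by rw [← pow_one (bigP u ℓ), hS.mem_bigP_pow]; exact hδ
  have := hS.finite
  let S5 := BigRing u ℓ × BigRing u ℓ × BigRing u ℓ × BigRing u ℓ × BigRing u ℓ
  let J : S5 → Matrix (Fin 3) (Fin 3) (BigRing u ℓ) := fun p =>
    matJ P.δ p.1 p.2.1 p.2.2.1 p.2.2.2.1 p.2.2.2.2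
  have hJadd : ∀ p p', J (p + p') = J p + J p' := by
    rintro ⟨a, b, x, y, z⟩ ⟨a', b', x', y', z'⟩
    change matJ P.δ (a + a') (b + b') (x + x') (y + y') (z + z') =
      matJ P.δ a b x y z + matJ P.δ a' b' x' y' z'
    ext1 i j
    fin_cases i <;> fin_cases j <;> simp [matJ, mul_add]
  have hJmem : ∀ p, ϖ ^ n₁ • J p ∈ lieJ P.δ := fun p =>
    Submodule.smul_mem _ _ (matJ_mem_lieJ _ _ _ _ _)
  -- the Lie algebra is the sum of its two layers, and the radical splits accordingly as `K₁ × K₂`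
  let Θ : Matrix (Fin 3) (Fin 3) (BigRing u ℓ) × S5 →+ lieN ϖ P.δ n₁ (ℓ / 2) :=
    AddMonoidHom.mk' (fun p => ⟨ϖ ^ (ℓ / 2) • p.1 + ϖ ^ n₁ • J p.2,
      mem_lieN.2 ⟨_, hJmem p.2, ⟨_, rfl⟩, by rw [add_sub_cancel_right]; exact ⟨_, rfl⟩⟩⟩)
      fun p p' => by
        ext1
        simp only [Prod.fst_add, Prod.snd_add, hJadd, smul_add, Submodule.coe_add]
        abel
  have hΘ : Function.Surjective Θ := by
    rintro ⟨X, hX⟩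
    obtain ⟨Y, hY, hY', ⟨Z, hZ⟩⟩ := mem_lieN.1 hX
    obtain ⟨a, b, x, y, z, rfl⟩ := exists_eq_pow_smul_matJ hY hY'
    refine ⟨(Z, (a, b, x, y, z)), ?_⟩
    ext1
    change ϖ ^ (ℓ / 2) • Z + ϖ ^ n₁ • matJ P.δ a b x y z = X
    rw [← hZ]
    abel
  let K₁ : AddSubgroup (Matrix (Fin 3) (Fin 3) (BigRing u ℓ)) :=
    { carrier := {X | matE P.δ * X - X * matE P.δ ∈ matP ϖ (ℓ - 2 * (ℓ / 2))}
      zero_mem' := by simp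
      add_mem' := fun {X Y} hX hY => by
        simp only [Set.mem_ofPred_eq] at *
        rw [mul_add, add_mul, add_sub_add_comm]
        exact add_mem hX hY
      neg_mem' := fun {X} hX => by
        simp only [Set.mem_ofPred_eq] at *
        rw [mul_neg, neg_mul, neg_sub_neg, ← neg_mem_iff, neg_sub]
        exact hX }
  let R' : AddSubgroup (lieN ϖ P.δ n₁ (ℓ / 2)) :=
    (lieR ε P ϖ n₁).toAddSubgroup.addSubgroupOf (lieN ϖ P.δ n₁ (ℓ / 2)).toAddSubgroup
  let K₂ : AddSubgroup S5 := (R'.comap Θ).comap (AddMonoidHom.inr _ _)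
  have hK₂ : ∀ p, p ∈ K₂ ↔ ∀ Y ∈ lieJ P.δ, Y ∈ matP ϖ n₁ →
      trace (P.mat ε * ((ϖ ^ n₁ • J p) * Y - Y * (ϖ ^ n₁ • J p))) = 0 := by
    intro p
    change ϖ ^ (ℓ / 2) • 0 + ϖ ^ n₁ • J p ∈ lieR ε P ϖ n₁ ↔ _
    rw [hd.add_mem_lieR_iff hS (hJmem p) ⟨_, rfl⟩ ⟨_, rfl⟩]
    simp
  have hcomap : R'.comap Θ = K₁.prod K₂ := by
    ext ⟨X, p⟩
    rw [AddSubgroup.mem_prod, hK₂]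
    change ϖ ^ (ℓ / 2) • X + ϖ ^ n₁ • J p ∈ lieR ε P ϖ n₁ ↔ X ∈ K₁ ∧ _
    rw [hd.add_mem_lieR_iff hS (hJmem p) ⟨_, rfl⟩ ⟨_, rfl⟩, trace_comm_eq_zero_iff hS hm]
    rfl
  have hindex : R'.index = K₁.index * K₂.index := by
    rw [← AddSubgroup.index_comap_of_surjective R' hΘ, hcomap, AddSubgroup.index_prod]
  have hcardR : Nat.card R' = Nat.card (lieR ε P ϖ n₁) :=
    Nat.card_congr ⟨fun X => ⟨X.1.1, X.2⟩, fun X => ⟨⟨X.1, lieR_le X.2⟩, X.2⟩,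
      fun _ => rfl, fun _ => rfl⟩
  have h10 := R'.index_mul_card
  rw [hindex, hcardR] at h10
  rw [← h10]
  congr 1
  rw [pow_add]
  congr 1
  · -- the layer `𝔓 ^ ℓ₁`
    have hcase : ℓ - 2 * (ℓ / 2) = 0 ∨ ℓ - 2 * (ℓ / 2) = 1 := by omega
    rcases hcase with hc | hc
    · have : K₁ = ⊤ := by
        rw [eq_top_iff]
        intro X _
        change _ ∈ matP ϖ (ℓ - 2 * (ℓ / 2))
        rw [hc]
        exact mem_matP_zero _
      rw [this, AddSubgroup.index_top, show ℓ - ℓ / 2 - ℓ / 2 = 0 by omega, mul_zero, pow_zero]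
    · have hK₁ : ∀ X, X ∈ K₁ ↔ ∀ i j, (matE P.δ * X - X * matE P.δ) i j ∈ bigP u ℓ := by
        intro X
        change _ ∈ matP ϖ (ℓ - 2 * (ℓ / 2)) ↔ _
        rw [hc, mem_matP_iff, ← pow_one (bigP u ℓ)]
        simp only [hS.mem_bigP_pow]
      rw [index_comm_matE _ hδP hK₁, hS.card_quot, ← pow_mul,
        show ℓ - ℓ / 2 - ℓ / 2 = 1 by omega]
  · -- the layer `𝔓 ^ n₁` of the commutant
    by_cases hn : n₁ = n₂
    · have : K₂ = ⊤ := by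
        rw [eq_top_iff]
        intro p _
        rw [hK₂]
        intro Y hY hY'
        rw [trace_comm_mul]
        exact trace_mul_eq_zero hS.pow_eq_zero (hS.comm_mat_mem_of_lieJ (hJmem p) ⟨_, rfl⟩
          (c := μ + n₁) (by omega)) hY' (by omega)
      rw [this, AddSubgroup.index_top, hn, Nat.sub_self, mul_zero, pow_zero]
    · have hμ : μ = P.m := h9.resolve_left hn
      have hn' : n₂ - n₁ = 1 := by omega
      rw [hn']
      obtain ⟨⟨α, hα⟩, ⟨β, hβ⟩, ⟨γ, hγ⟩⟩ := (hS.le_m_iff (IsUniformized.m_le P)).1 le_rfl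
      -- by the definition of `m`, one of the quotients of the parameters by `ϖ ^ m` is a unit
      have hunit : α ∉ bigP u ℓ ∨ β ∉ bigP u ℓ ∨ γ ∉ bigP u ℓ := by
        by_contra hcon
        push Not at hcon
        rw [← pow_one (bigP u ℓ), hS.mem_bigP_pow, hS.mem_bigP_pow, hS.mem_bigP_pow] at hcon
        obtain ⟨⟨α', hα'⟩, ⟨β', hβ'⟩, ⟨γ', hγ'⟩⟩ := hcon
        have := (hS.le_m_iff (P := P) (k := P.m + 1) (by omega)).2
          ⟨⟨α', by rw [hα, hα', pow_succ]; ring⟩, ⟨β', by rw [hβ, hβ', pow_succ]; ring⟩,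
            ⟨γ', by rw [hγ, hγ', pow_succ]; ring⟩⟩
        omega
      have hunit' := hunit.imp (hS.isUnit_of_notMem _)
        (Or.imp (hS.isUnit_of_notMem _) (hS.isUnit_of_notMem _))
      refine (index_cross (bigP u ℓ) (δ := P.δ) hunit' fun a b x y z => ?_).trans
        (by rw [hS.card_quot, ← pow_mul])
      have hform : ∀ a' b' x' y' z', trace (P.mat ε * ((ϖ ^ n₁ • matJ P.δ a b x y z) *
          (ϖ ^ n₁ • matJ P.δ a' b' x' y' z') - (ϖ ^ n₁ • matJ P.δ a' b' x' y' z') *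
          (ϖ ^ n₁ • matJ P.δ a b x y z))) = ϖ ^ (ℓ - 1) * (scal ε u ℓ *
          (x' * (α * (a - b + P.δ * z) - γ * y) + y' * (γ * x - β * (a - b + P.δ * z)) +
            (a' - b' + P.δ * z') * (β * y - α * x))) := by
        intro a' b' x' y' z'
        rw [smul_mul_smul_comm, smul_mul_smul_comm, ← smul_sub, mul_smul_comm, trace_smul,
          trace_mat_matJ_comm, hα, hβ, hγ, show ℓ - 1 = n₁ + n₁ + P.m by omega, smul_eq_mul]
        ring
      have hzero : ∀ w : BigRing u ℓ, ϖ ^ (ℓ - 1) * (scal ε u ℓ * w) = 0 ↔ w ∈ bigP u ℓ := by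
        intro w
        rw [← pow_one (bigP u ℓ), hS.mem_bigP_pow]
        constructor
        · intro h
          obtain ⟨z, hz⟩ := hS.cancel (ℓ - 1) 1 _ 0 (by omega) (h.trans (mul_zero _).symm)
          obtain ⟨r, hr⟩ := (hS.isUnit_scal (ε := ε)).exists_left_inv
          exact ⟨r * z, by linear_combination r * hz - w * hr⟩
        · rintro ⟨z, rfl⟩
          have : ϖ ^ (ℓ - 1) * ϖ ^ 1 = 0 := by
            rw [← pow_add, Nat.sub_add_cancel (by omega), hS.pow_eq_zero]
          linear_combination scal ε u ℓ * z * this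
      rw [hK₂]
      constructor
      · intro h
        have key : ∀ a' b' x' y' z', _ := fun a' b' x' y' z' => (hzero _).1
          ((hform a' b' x' y' z').symm.trans (h _ (Submodule.smul_mem _ _
            (matJ_mem_lieJ a' b' x' y' z')) ⟨_, rfl⟩))
        refine ⟨?_, ?_, ?_⟩
        · simpa using key 0 0 1 0 0
        · simpa using key 0 0 0 1 0
        · simpa using key 1 0 0 0 0
      · rintro ⟨k1, k2, k3⟩ Y hY hY'
        obtain ⟨a', b', x', y', z', rfl⟩ := exists_eq_pow_smul_matJ hY hY'
        refine (hform a' b' x' y' z').trans ((hzero _).2 ?_)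
        exact add_mem (add_mem (Ideal.mul_mem_left _ _ k1) (Ideal.mul_mem_left _ _ k2))
          (Ideal.mul_mem_left _ _ k3)

/-- The index of the radical is the square of the dimension of the Heisenberg representation. -/
lemma relIndex_radical (hψ : IsPrimitiveChar ψ) (hP : P.IsAdmissible ε) :
    (q ^ (2 * (ℓ - ℓ / 2 - ℓ / 2) + (n₂ - n₁))) ^ 2 =
      (hd.isQuadraticChar hS hψ hP).radical.relIndex (cong (inertia ε ψ (P.mat ε)) n₁) := by
  have := hS.finite
  have h1 := hd.relIndex_radical_sq hS hP hψ
  rw [hd.card_lieN hS hP] at h1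
  have h2 := Nat.eq_of_mul_eq_mul_right Nat.card_pos h1
  refine Nat.pow_left_injective (n := 2) (by norm_num) ?_
  simp only
  rw [h2, ← pow_mul, ← pow_mul]
  congr 1
  ring

end IsDepth

end RadicalIndex

/-! ### The groups attached to a normal form -/

section NormalFormGroups

variable {o : Type*} [CommRing o] [IsLocalRing o] {u : o} {ℓ q : ℕ} {ϖ : BigRing u ℓ}
  {ε : GroupType} {P : Params u ℓ} {X Y : Matrix (Fin 3) (Fin 3) (BigRing u ℓ)}
  {ψ : AddChar (BigRing u ℓ) ℂ} {μ n₁ n₂ k c : ℕ} {g : GL (Fin 3) (BigRing u ℓ)}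

lemma isDepth_half (hm : 1 ≤ P.m) (hℓ : 2 ≤ ℓ) :
    IsDepth P (ℓ - 2 * (ℓ / 2)) (ℓ / 2) (ℓ / 2) := by
  constructor <;> omega

lemma mem_lieN_of_comm_mem {R : Type*} [CommRing R] {ϖ δ : R} {X : Matrix (Fin 3) (Fin 3) R}
    (hkc : k ≤ c) (hX : X ∈ matP ϖ k) (h : matE δ * X - X * matE δ ∈ matP ϖ c) :
    X ∈ lieN ϖ δ k c := by
  refine mem_lieN.2 ⟨_, matJ_mem_lieJ _ _ _ _ _, ?_, sub_matJ_mem h⟩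
  have := sub_mem hX (matP_anti hkc (sub_matJ_mem h))
  rwa [sub_sub_cancel] at this

lemma comm_mem_of_mem_lieN {R : Type*} [CommRing R] {ϖ δ : R} {X : Matrix (Fin 3) (Fin 3) R}
    (h : X ∈ lieN ϖ δ k c) : matE δ * X - X * matE δ ∈ matP ϖ c := by
  obtain ⟨Y, hY, -, hXY⟩ := mem_lieN.1 h
  have : matE δ * X - X * matE δ = matE δ * (X - Y) - (X - Y) * matE δ := by
    rw [mul_sub, sub_mul, mem_lieJ.1 hY]; abel
  rw [this]
  exact comm_mem_matP_left _ hXY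

lemma mul_logm_eq {R : Type*} [CommRing R] (h2 : IsUnit (2 : R)) {g : GL (Fin 3) R}
    {A : Matrix (Fin 3) (Fin 3) R} (h : A * ((g.1 - 1) * (g.1 - 1)) = 0) :
    A * logm g = A * (g.1 - 1) := by
  rw [logm_eq h2]
  rw [← sq] at h
  have h3 : A * (g.1 - 1) ^ 3 = 0 := by rw [pow_succ, ← mul_assoc, h, zero_mul]
  have h4 : A * (g.1 - 1) ^ 4 = 0 := by rw [pow_succ, ← mul_assoc, h3, zero_mul]
  simp only [mul_add, mul_sub, mul_smul_comm, h, h3, h4, smul_zero, sub_zero, add_zero]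

lemma trace_mul_conj {R : Type*} [CommRing R] (A L G H : Matrix (Fin 3) (Fin 3) R) :
    trace (A * (G * L * H)) = trace (A * L) + trace ((H * A * G - A) * L) := by
  rw [← trace_add, sub_mul, add_sub_cancel, ← mul_assoc, trace_mul_comm]
  simp only [mul_assoc]

namespace IsUniformized

variable (hS : IsUniformized u ℓ q ϖ)
include hS

lemma mem_cong_grpJ_sup {δ : BigRing u ℓ} (hδ : star δ = δ) (hkc : k ≤ c) (hc : 1 ≤ c) :
    g ∈ cong (grpJ ε δ) k ⊔ cong (grp ε u ℓ) c ↔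
      g ∈ grp ε u ℓ ∧ g.1 - 1 ∈ lieN ϖ δ k c := by
  constructor
  · have := hS.finite_GL
    suffices h : cong (grpJ ε δ) k ⊔ cong (grp ε u ℓ) c ≤
        grp ε u ℓ ⊓ oneAdd (lieN ϖ δ k c) (fun X hX Y hY => mul_mem_lieN hkc hX hY) from
      fun hg => h hg
    refine sup_le (fun j hj => ?_) fun b hb => ?_
    · obtain ⟨hj, hjk⟩ := hS.mem_cong.1 hj
      refine ⟨(mem_grpJ.1 hj).1, mem_oneAdd.2 (mem_lieN.2 ⟨_, sub_mem (mem_grpJ.1 hj).2 one_mem_lieJ,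
        hjk, by simp⟩)⟩
    · obtain ⟨hb, hbk⟩ := hS.mem_cong.1 hb
      exact ⟨hb, mem_oneAdd.2 (mem_lieN.2 ⟨0, zero_mem _, zero_mem _, by simpa using hbk⟩)⟩
  · rintro ⟨hg, hX⟩
    have h := comm_mem_of_mem_lieN hX
    rw [comm_sub_one] at h
    obtain ⟨j, hj, hgj⟩ := hS.exists_mem_grpJ hδ hc hg h
    have hj' : j ∈ cong (grpJ ε δ) k := hS.mem_cong.2 ⟨hj, by
      have := sub_mem (lieN_le hkc hX) (matP_anti hkc hgj)
      rwa [sub_sub_sub_cancel_left, ← neg_sub, ← neg_mem_iff, neg_neg,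
        ← neg_sub, neg_mem_iff] at this⟩
    have : g = j * (j⁻¹ * g) := by group
    rw [this]
    refine mul_mem (Subgroup.mem_sup_left hj') (Subgroup.mem_sup_right ⟨?_, ?_⟩)
    · exact Subgroup.mul_mem _ (Subgroup.inv_mem _ (mem_grpJ.1 hj).1) hg
    · exact hS.inv_mul_mem_ker_iff.2 hgj

lemma mem_stabMod_iff (hP : P.IsAdmissible ε) (hℓ : 2 ≤ ℓ) :
    g ∈ stabMod (cong (grp ε u ℓ) (ℓ / 2)) (P.mat ε) (ℓ - ℓ / 2) ↔
      g ∈ grp ε u ℓ ∧ g.1 - 1 ∈ lieN ϖ P.δ (ℓ / 2) (ℓ - ℓ / 2) := by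
  have hm := ((hS.isAdmissible_iff).1 hP).1.2.2
  rw [hS.mem_stabMod, hS.mem_cong]
  constructor
  · rintro ⟨⟨hg, hX⟩, h⟩
    refine ⟨hg, mem_lieN_of_comm_mem (by omega) hX ?_⟩
    rw [← comm_sub_one] at h
    exact (hS.comm_mat_mem_iff hX (by omega)).1 h
  · rintro ⟨hg, hX⟩
    have hX' := lieN_le (by omega) hX
    refine ⟨⟨hg, hX'⟩, ?_⟩
    rw [← comm_sub_one]
    exact (hS.comm_mat_mem_iff hX' (by omega)).2 (comm_mem_of_mem_lieN hX)

lemma stabMod_eq (hP : P.IsAdmissible ε) (hℓ : 2 ≤ ℓ) :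
    stabMod (cong (grp ε u ℓ) (ℓ / 2)) (P.mat ε) (ℓ - ℓ / 2) =
      cong (grpJ ε P.δ) (ℓ / 2) ⊔ cong (grp ε u ℓ) (ℓ - ℓ / 2) := by
  ext g
  rw [hS.mem_stabMod_iff hP hℓ, hS.mem_cong_grpJ_sup ((hS.isAdmissible_iff).1 hP).2.1.2.1
    (by omega) (by omega)]

lemma mem_inertia_iff_of_le (hψ : IsPrimitiveChar ψ) (hℓ : 2 ≤ ℓ) (hP : P.IsAdmissible ε)
    (hm : ℓ - ℓ / 2 ≤ P.m) : g ∈ inertia ε ψ (P.mat ε) ↔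
      ∃ j ∈ grpJ ε P.δ, ∃ b ∈ cong (grp ε u ℓ) (ℓ / 2), g = j * b := by
  have hδ := ((hS.isAdmissible_iff).1 hP).2.1.2.1
  rw [hS.mem_inertia hψ hℓ (hS.tau_mat hP)]
  constructor
  · rintro ⟨hg, h⟩
    obtain ⟨j, hj, hgj⟩ := hS.exists_mem_grpJ hδ (by omega) hg
      ((hS.comm_mat_mem_iff (mem_matP_zero _) (by omega)).1 h)
    exact ⟨j, hj, j⁻¹ * g, ⟨Subgroup.mul_mem _ (Subgroup.inv_mem _ (mem_grpJ.1 hj).1) hg,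
      hS.inv_mul_mem_ker_iff.2 hgj⟩, by group⟩
  · rintro ⟨j, hj, b, hb, rfl⟩
    obtain ⟨hb, hbk⟩ := hS.mem_cong.1 hb
    refine ⟨mul_mem (mem_grpJ.1 hj).1 hb, ?_⟩
    refine (hS.comm_mat_mem_iff (mem_matP_zero _) (by omega)).2 ?_
    have : matE P.δ * (j * b).1 - (j * b).1 * matE P.δ =
        j.1 * (matE P.δ * (b.1 - 1) - (b.1 - 1) * matE P.δ) := by
      rw [Units.val_mul, ← mul_assoc, mem_lieJ.1 (mem_grpJ.1 hj).2]
      noncomm_ring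
    rw [this]
    exact mul_mem_matP_left _ (comm_mem_matP_left _ hbk)

lemma psiLog_eq_of_mem {A : Matrix (Fin 3) (Fin 3) (BigRing u ℓ)}
    (hA : A ∈ matP ϖ c) (hg : g.1 - 1 ∈ matP ϖ k) (h : ℓ ≤ c + 2 * k) :
    psiLog ψ A g = psiLin ψ A g := by
  unfold psiLog psiLin
  rw [mul_logm_eq hS.isUnit_two]
  exact eq_zero_of_mem_matP hS.pow_eq_zero (mul_mem_matP hA (mul_mem_matP hg hg le_rfl) le_rfl)
    (by omega)

end IsUniformized

lemma logm_conj {R : Type*} [CommRing R] (g n : GL (Fin 3) R) :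
    logm (g * n * g⁻¹) = g.1 * logm n * (g⁻¹).1 := by
  have h : (g * n * g⁻¹).1 - 1 = g.1 * (n.1 - 1) * (g⁻¹).1 := by
    rw [mul_sub, sub_mul, mul_one, Units.mul_inv]; rfl
  have hk : ∀ k : ℕ, (g.1 * (n.1 - 1) * (g⁻¹).1) ^ k = g.1 * (n.1 - 1) ^ k * (g⁻¹).1 := by
    intro k
    induction k with
    | zero => simp
    | succ k ih =>
      rw [pow_succ, ih, pow_succ]
      have : (g⁻¹).1 * g.1 = 1 := Units.inv_mul g
      calc _ = g.1 * (n.1 - 1) ^ k * ((g⁻¹).1 * g.1) * (n.1 - 1) * (g⁻¹).1 := by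
            simp only [mul_assoc]
        _ = _ := by rw [this]; simp only [mul_assoc, one_mul]
  unfold logm
  simp only [h, hk, Finset.mul_sum, Finset.sum_mul, mul_smul_comm, smul_mul_assoc]

lemma psiLog_conj (A : Matrix (Fin 3) (Fin 3) (BigRing u ℓ)) (g n : GL (Fin 3) (BigRing u ℓ)) :
    psiLog ψ A (g * n * g⁻¹) =
      psiLog ψ A n * ψ (trace (((g⁻¹).1 * A * g.1 - A) * logm n)) := by
  unfold psiLog
  rw [logm_conj, ← AddChar.map_add_eq_mul, trace_mul_conj]

lemma psiLog_conj_of_commute {A : Matrix (Fin 3) (Fin 3) (BigRing u ℓ)}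
    {g : GL (Fin 3) (BigRing u ℓ)} (h : A * g.1 = g.1 * A) (n : GL (Fin 3) (BigRing u ℓ)) :
    psiLog ψ A (g * n * g⁻¹) = psiLog ψ A n := by
  rw [psiLog_conj, mul_assoc, h, ← mul_assoc, Units.inv_mul, one_mul, sub_self, zero_mul,
    trace_zero, AddChar.map_zero_eq_one, mul_one]

lemma IsUniformized.logm_mem (hS : IsUniformized u ℓ q ϖ) (hg : g.1 - 1 ∈ matP ϖ k) :
    logm g ∈ matP ϖ k := by
  rw [logm_eq hS.isUnit_two]
  refine sub_mem (add_mem (sub_mem hg ?_) ?_) ?_ <;> refine Submodule.smul_mem _ _ ?_ <;>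
  · rw [pow_succ]; exact mul_mem_matP_left _ hg

namespace IsDepth

variable (hd : IsDepth P μ n₁ n₂) (hS : IsUniformized u ℓ q ϖ) (hψ : IsPrimitiveChar ψ)
  (hP : P.IsAdmissible ε)
include hd hS

lemma mem_lieR_of_mem_lieN (hX : X ∈ lieN ϖ P.δ n₂ (ℓ - ℓ / 2)) : X ∈ lieR ε P ϖ n₁ := by
  obtain ⟨J, hJ, hJn, hXJ⟩ := mem_lieN.1 hX
  refine ⟨mem_lieN.2 ⟨J, hJ, matP_anti hd.le hJn, matP_anti (by omega) hXJ⟩, fun Y hY => ?_⟩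
  have hYn := lieN_le (hd.le.trans hd.le_half) hY
  have h1 : trace (P.mat ε * (J * Y - Y * J)) = 0 := by
    rw [trace_comm_mul]
    refine trace_mul_eq_zero hS.pow_eq_zero (hS.comm_mat_mem_of_lieJ (c := μ + n₂) hJ hJn ?_) hYn ?_
    · have := hd.le_m; omega
    · have := hd.sum_eq; omega
  have h2 : trace (P.mat ε * ((X - J) * Y - Y * (X - J))) = 0 := by
    rw [← neg_sub, mul_neg, trace_neg, trace_comm_mul,
      trace_mul_eq_zero hS.pow_eq_zero (hd.comm_mem hS hY) hXJ (by omega), neg_zero]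
  have : X * Y - Y * X = (J * Y - Y * J) + ((X - J) * Y - Y * (X - J)) := by noncomm_ring
  rw [this, mul_add, trace_add, h1, h2, add_zero]

include hψ hP

lemma sup_le_radical : cong (grpJ ε P.δ) n₂ ⊔ cong (grp ε u ℓ) (ℓ - ℓ / 2) ≤
    (hd.isQuadraticChar hS hψ hP).radical := by
  intro g hg
  have := hd.half_le; have := hd.le_half; have := hd.one_le; have := hd.le
  rw [hS.mem_cong_grpJ_sup ((hS.isAdmissible_iff).1 hP).2.1.2.1 (by omega) (by omega)] at hg
  exact (hd.mem_radical_iff hS hP hψ).2 ⟨hg.1, hd.mem_lieR_of_mem_lieN hS hg.2⟩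

omit hψ in
lemma stabMod_le_sup : stabMod (cong (grp ε u ℓ) (ℓ / 2)) (P.mat ε) (ℓ - ℓ / 2) ≤
    cong (grpJ ε P.δ) n₂ ⊔ cong (grp ε u ℓ) (ℓ - ℓ / 2) := by
  have := hd.le_half; have := hd.one_le; have := hd.le
  rw [hS.stabMod_eq hP (by omega)]
  refine sup_le_sup_right (fun g hg => ?_) _
  rw [hS.mem_cong] at hg ⊢
  exact ⟨hg.1, matP_anti hd.le_half hg.2⟩

lemma mem_stabMod_of_mem_radical (hg : g ∈ (hd.isQuadraticChar hS hψ hP).radical)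
    (hg' : g.1 - 1 ∈ matP ϖ (ℓ / 2)) :
    g ∈ stabMod (cong (grp ε u ℓ) (ℓ / 2)) (P.mat ε) (ℓ - ℓ / 2) := by
  rw [hd.mem_radical_iff hS hP hψ] at hg
  refine hS.mem_stabMod.2 ⟨hS.mem_cong.2 ⟨hg.1, hg'⟩, ?_⟩
  rw [← comm_sub_one]
  refine hS.mem_matP_of_trace_eq_zero (by omega) fun Y hY => ?_
  rw [← trace_comm_mul]
  exact hg.2.2 Y (mem_lieN.2 ⟨0, zero_mem _, zero_mem _, by simpa using hY⟩)

omit hψ hP in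
lemma odd_card_cong : Odd (Nat.card (cong (inertia ε ψ (P.mat ε)) n₁)) := by
  refine hS.odd_card_of_le fun g hg => hS.mem_ker_redGL.2 (matP_anti hd.one_le (hS.mem_cong.1 hg).2)

end IsDepth

end NormalFormGroups

/-! ### Perturbation of a normal form -/

section Perturbation

variable {o : Type*} [CommRing o] [IsLocalRing o] {u : o} {ℓ q : ℕ} {ϖ : BigRing u ℓ}
  {ε : GroupType} {P P' : Params u ℓ} {X Y : Matrix (Fin 3) (Fin 3) (BigRing u ℓ)}
  {ψ : AddChar (BigRing u ℓ) ℂ} {μ n₁ n₂ k c : ℕ} {g : GL (Fin 3) (BigRing u ℓ)}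

/-- The normal form whose matrix differs from that of `P` by a matrix with the same pairing as `r H`
with the commutant of `E + δ E_{22} + δ ^ 2 E_{31}`. -/
def Params.perturb (P : Params u ℓ) (H : Matrix (Fin 3) (Fin 3) (BigRing u ℓ)) : Params u ℓ :=
  let w := Ring.inverse 2 * (H 0 0 + H 2 2)
  { ω := P.ω + w
    δ := P.δ + (H 1 1 - w)
    α := P.α + (H 1 0 + P.δ * H 1 2)
    β := P.β + (H 2 1 + P.δ * H 0 1)
    γ := P.δ ^ 2 + P.γ + (H 2 0 + P.δ ^ 2 * H 0 2) - (P.δ + (H 1 1 - w)) ^ 2 }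

lemma matrix_sub_eq {R : Type*} [CommRing R] (ω δ α β γ w a b c e : R) :
    !![ω + w, 0, 1; α + a, ω + w + (δ + (e - w)), 0;
      (δ + (e - w)) ^ 2 + (δ ^ 2 + γ + c - (δ + (e - w)) ^ 2), β + b, ω + w] -
      !![ω, 0, 1; α, ω + δ, 0; δ ^ 2 + γ, β, ω] = !![w, 0, 0; a, e, 0; c, b, w] := by
  ext i j
  fin_cases i <;> fin_cases j <;> simp <;> ring

lemma mat_perturb_sub (P : Params u ℓ) (H : Matrix (Fin 3) (Fin 3) (BigRing u ℓ)) :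
    (P.perturb H).mat ε - P.mat ε = scal ε u ℓ •
      !![Ring.inverse 2 * (H 0 0 + H 2 2), 0, 0; H 1 0 + P.δ * H 1 2, H 1 1, 0;
        H 2 0 + P.δ ^ 2 * H 0 2, H 2 1 + P.δ * H 0 1, Ring.inverse 2 * (H 0 0 + H 2 2)] := by
  unfold Params.mat
  rw [← smul_sub]
  congr 1
  exact matrix_sub_eq _ _ _ _ _ _ _ _ _ _

lemma trace_mul_matJ_eq {R : Type*} [CommRing R] (H : Matrix (Fin 3) (Fin 3) R) {i δ : R}
    (hi : i * (H 0 0 + H 2 2) + i * (H 0 0 + H 2 2) = H 0 0 + H 2 2) (a b x y z : R) :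
    trace (!![i * (H 0 0 + H 2 2), 0, 0; H 1 0 + δ * H 1 2, H 1 1, 0;
        H 2 0 + δ ^ 2 * H 0 2, H 2 1 + δ * H 0 1, i * (H 0 0 + H 2 2)] * matJ δ a b x y z) =
      trace (H * matJ δ a b x y z) := by
  simp only [trace_fin_three, matJ, Matrix.mul_apply, Fin.sum_univ_three]
  simp
  linear_combination a * hi

namespace IsUniformized

variable (hS : IsUniformized u ℓ q ϖ)
include hS

lemma trace_mat_perturb_sub {H J : Matrix (Fin 3) (Fin 3) (BigRing u ℓ)} (hJ : J ∈ lieJ P.δ) :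
    trace (((P.perturb H).mat ε - P.mat ε) * J) = trace ((scal ε u ℓ • H) * J) := by
  rw [mat_perturb_sub, smul_mul_assoc, smul_mul_assoc, trace_smul, trace_smul, eq_matJ hJ]
  congr 1
  exact trace_mul_matJ_eq _ (hS.half_add_half _) _ _ _ _ _

omit hS in
lemma exists_smul_of_mem {H : Matrix (Fin 3) (Fin 3) (BigRing u ℓ)} (hH : H ∈ matP ϖ k) :
    ∃ K : Matrix (Fin 3) (Fin 3) (BigRing u ℓ), ∀ i j, H i j = ϖ ^ k * K i j := by
  obtain ⟨K, rfl⟩ := mem_matP.1 hH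
  exact ⟨K, fun i j => rfl⟩

omit hS in
lemma mat_perturb_sub_mem {H : Matrix (Fin 3) (Fin 3) (BigRing u ℓ)} (hH : H ∈ matP ϖ k) :
    (P.perturb H).mat ε - P.mat ε ∈ matP ϖ k := by
  obtain ⟨K, hK⟩ := exists_smul_of_mem hH
  rw [mat_perturb_sub]
  refine Submodule.smul_mem _ _ (mem_matP.2 ⟨!![Ring.inverse 2 * (K 0 0 + K 2 2), 0, 0;
    K 1 0 + P.δ * K 1 2, K 1 1, 0;
    K 2 0 + P.δ ^ 2 * K 0 2, K 2 1 + P.δ * K 0 1, Ring.inverse 2 * (K 0 0 + K 2 2)], ?_⟩)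
  simp only [hK]
  generalize ϖ ^ k = π
  generalize P.δ = δ
  ext1 i j
  fin_cases i <;> fin_cases j <;> simp <;> ring

omit hS in
lemma perturb_sub_eq {H : Matrix (Fin 3) (Fin 3) (BigRing u ℓ)} (hH : H ∈ matP ϖ k) :
    (∃ y, (P.perturb H).ω = P.ω + ϖ ^ k * y) ∧ (∃ y, (P.perturb H).δ = P.δ + ϖ ^ k * y) ∧
    (∃ y, (P.perturb H).α = P.α + ϖ ^ k * y) ∧ (∃ y, (P.perturb H).β = P.β + ϖ ^ k * y) ∧
    (∃ y, (P.perturb H).γ = P.γ + ϖ ^ k * y) := by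
  obtain ⟨K, hK⟩ := exists_smul_of_mem hH
  unfold Params.perturb
  simp only [hK]
  generalize ϖ ^ k = π
  refine ⟨⟨Ring.inverse 2 * (K 0 0 + K 2 2), by ring⟩,
    ⟨K 1 1 - Ring.inverse 2 * (K 0 0 + K 2 2), by ring⟩, ⟨K 1 0 + P.δ * K 1 2, by ring⟩,
    ⟨K 2 1 + P.δ * K 0 1, by ring⟩,
    ⟨K 2 0 + P.δ ^ 2 * K 0 2 - 2 * P.δ * (K 1 1 - Ring.inverse 2 * (K 0 0 + K 2 2)) -
      π * (K 1 1 - Ring.inverse 2 * (K 0 0 + K 2 2)) ^ 2, by ring⟩⟩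

lemma le_m_perturb_iff {H : Matrix (Fin 3) (Fin 3) (BigRing u ℓ)} (hH : H ∈ matP ϖ k) (hk : k ≤ ℓ)
    {j : ℕ} (hj : j ≤ k) : j ≤ (P.perturb H).m ↔ j ≤ P.m := by
  obtain ⟨-, -, ⟨a, ha⟩, ⟨b, hb⟩, ⟨c, hc⟩⟩ := perturb_sub_eq (P := P) hH
  have key : ∀ x y : BigRing u ℓ, (∃ z, x + ϖ ^ k * y = ϖ ^ j * z) ↔ ∃ z, x = ϖ ^ j * z := by
    intro x y
    obtain ⟨i, rfl⟩ := Nat.exists_eq_add_of_le hj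
    generalize ϖ = π
    rw [pow_add]
    constructor
    · rintro ⟨z, hz⟩
      exact ⟨z - π ^ i * y, by rw [mul_sub, ← hz]; ring⟩
    · rintro ⟨z, hz⟩
      exact ⟨z + π ^ i * y, by rw [hz]; ring⟩
  rw [hS.le_m_iff (hj.trans hk), hS.le_m_iff (hj.trans hk), ha, hb, hc]
  simp only [key]

omit hS in
lemma theta_eq_self_entries {H : Matrix (Fin 3) (Fin 3) (BigRing u ℓ)} (hH : theta ε H = H) :
    (ε = .linear ∧ ∀ i j, star (H i j) = H i j) ∨
      (ε = .unitary ∧ ∀ i j, star (H (Fin.rev j) (Fin.rev i)) = H i j) := by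
  cases ε with
  | linear => exact Or.inl ⟨rfl, fun i j => congrFun₂ hH i j⟩
  | unitary => exact Or.inr ⟨rfl, fun i j => congrFun₂ hH i j⟩

/-- Admissibility survives a small perturbation by a matrix fixed by `theta`: the entries that enter
`P.perturb H` are real, or conjugate to each other, as required. -/
lemma isAdmissible_perturb (hP : P.IsAdmissible ε) {H : Matrix (Fin 3) (Fin 3) (BigRing u ℓ)}
    (hH : H ∈ matP ϖ 1) (hH' : theta ε H = H) : (P.perturb H).IsAdmissible ε := by
  have hpos := hS.pos
  obtain ⟨⟨⟨a, ha⟩, ⟨b, hb⟩, hm⟩, ⟨h1, h2, h3⟩, h4, h5⟩ := hS.isAdmissible_iff.1 hP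
  refine hS.isAdmissible_iff.2 ⟨⟨?_, ?_, ?_⟩, ⟨?_, ?_, ?_⟩, ?_, ?_⟩
  · obtain ⟨⟨y, hy⟩, -⟩ := perturb_sub_eq (P := P) hH
    exact ⟨a + y, by rw [hy, ha, mul_add]⟩
  · obtain ⟨-, ⟨y, hy⟩, -⟩ := perturb_sub_eq (P := P) hH
    exact ⟨b + y, by rw [hy, hb, mul_add]⟩
  · exact (hS.le_m_perturb_iff hH hpos le_rfl).2 hm
  all_goals
    have hi := hS.star_inverse_two
    rcases theta_eq_self_entries hH' with ⟨rfl, h⟩ | ⟨rfl, h⟩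
  · simp only [Params.perturb, star_add, star_mul', hi, h, h1]
  · have e1 : star (H 0 0) = H 2 2 := h 2 2
    have e2 : star (H 2 2) = H 0 0 := h 0 0
    simp only [Params.perturb, star_add, star_mul', hi, e1, e2, h1, add_comm]
  · simp only [Params.perturb, star_add, star_sub, star_mul', hi, h, h2]
  · have e1 : star (H 0 0) = H 2 2 := h 2 2
    have e2 : star (H 2 2) = H 0 0 := h 0 0
    have e3 : star (H 1 1) = H 1 1 := h 1 1
    simp only [Params.perturb, star_add, star_sub, star_mul', hi, e1, e2, e3, h2, add_comm]
  · simp only [Params.perturb, star_add, star_sub, star_mul', star_pow, hi, h, h2, h3]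
  · have e1 : star (H 0 0) = H 2 2 := h 2 2
    have e2 : star (H 2 2) = H 0 0 := h 0 0
    have e3 : star (H 1 1) = H 1 1 := h 1 1
    have e4 : star (H 2 0) = H 2 0 := h 2 0
    have e5 : star (H 0 2) = H 0 2 := h 0 2
    simp only [Params.perturb, star_add, star_sub, star_mul', star_pow, hi, e1, e2, e3, e4, e5, h2,
      h3, add_comm]
  · intro _
    obtain ⟨h4, h4'⟩ := h4 rfl
    simp only [Params.perturb, star_add, star_mul', h, h2, h4, h4', and_self]
  · rintro ⟨⟩
  · rintro ⟨⟩
  · intro _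
    have e1 : star (H 2 1) = H 1 0 := h 1 0
    have e2 : star (H 0 1) = H 1 2 := h 1 2
    simp only [Params.perturb, star_add, star_mul', e1, e2, h2, h5 rfl]

lemma exists_eq_scal_smul {D : Matrix (Fin 3) (Fin 3) (BigRing u ℓ)} (hD : tau ε D = D)
    (hk : D ∈ matP ϖ k) : ∃ H ∈ matP ϖ k, theta ε H = H ∧ D = scal ε u ℓ • H := by
  obtain ⟨r, hr⟩ := hS.isUnit_scal (ε := ε)
  have e : D = scal ε u ℓ • ((r⁻¹).1 • D) := by
    rw [← hr, smul_smul, Units.mul_inv, one_smul]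
  refine ⟨(r⁻¹).1 • D, Submodule.smul_mem _ _ hk, ?_, e⟩
  have h := hD
  rw [e, tau_scal_smul, ← hr] at h
  have := congrArg (fun X => (r⁻¹).1 • X) h
  simpa only [smul_smul, ← mul_assoc, Units.inv_mul, one_mul, one_smul] using this

omit hS in
lemma mem_lieN_congr {δ δ' y : BigRing u ℓ} {n l : ℕ} (hnl : n ≤ l) (h : δ' = δ + ϖ ^ l * y)
    (hX : X ∈ lieN ϖ δ n l) : X ∈ lieN ϖ δ' n l := by
  refine mem_lieN_of_comm_mem hnl (lieN_le hnl hX) ?_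
  have h1 := comm_mem_of_mem_lieN hX
  have hE : matE δ' - matE δ ∈ matP ϖ l := by
    refine mem_matP.2 ⟨!![0, 0, 0; 0, y, 0; 2 * δ * y + ϖ ^ l * y * y, 0, 0], ?_⟩
    rw [h, matE, matE]
    generalize ϖ ^ l = π
    ext1 i j
    fin_cases i <;> fin_cases j <;> simp <;> ring
  have : matE δ' * X - X * matE δ' = (matE δ * X - X * matE δ) +
      ((matE δ' - matE δ) * X - X * (matE δ' - matE δ)) := by noncomm_ring
  rw [this]
  exact add_mem h1 (sub_mem (mul_mem_matP_right _ hE) (mul_mem_matP_left _ hE))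

end IsUniformized

/-- If an eigenvector is known on the part of the radical at depth `k`, then the radical has an
eigenvector whose character comes from a normal form congruent to the given one modulo
`𝔓 ^ (ℓ - k)`. -/
theorem IsDepth.exists_perturb (hd : IsDepth P μ n₁ n₂) (hS : IsUniformized u ℓ q ϖ)
    (hψ : IsPrimitiveChar ψ) (hP : P.IsAdmissible ε) (hk : k ≤ 2 * n₁) (hkℓ : k ≤ ℓ - ℓ / 2)
    (hR : ∀ g ∈ (hd.isQuadraticChar hS hψ hP).radical, g.1 - 1 ∈ lieN ϖ P.δ n₁ k)
    {V : Type*} [AddCommGroup V] [Module ℂ V] [FiniteDimensional ℂ V]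
    (χ : Representation ℂ (grp ε u ℓ) V) {v : V} (hv : v ≠ 0)
    (hv' : ∀ g (hg : g ∈ grp ε u ℓ), g ∈ (hd.isQuadraticChar hS hψ hP).radical →
      g.1 - 1 ∈ matP ϖ k → χ ⟨g, hg⟩ v = psiLog ψ (P.mat ε) g • v) :
    ∃ H ∈ matP ϖ (ℓ - k), (P.perturb H).IsAdmissible ε ∧ ∃ w : V, w ≠ 0 ∧
      ∀ (hP' : (P.perturb H).IsAdmissible ε) (hd' : IsDepth (P.perturb H) μ n₁ n₂), ∀ g
        (hg : g ∈ grp ε u ℓ),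
        g ∈ (hd'.isQuadraticChar hS hψ hP').radical →
          χ ⟨g, hg⟩ w = psiLog ψ ((P.perturb H).mat ε) g • w := by
  have hfin := hS.finite_GL
  set Q := hd.isQuadraticChar hS hψ hP with hQ
  have hle1 := hd.le; have hle2 := hd.le_half; have hone := hd.one_le
  have hRN : ∀ g ∈ Q.radical, g.1 - 1 ∈ matP ϖ n₁ := fun g hg =>
    (hS.mem_cong.1 (Q.radical_le hg)).2
  have hRG : Q.radical ≤ grp ε u ℓ := fun g hg =>
    ((hd.mem_cong_inertia hS hψ hP).1 (Q.radical_le hg)).1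
  have hne : ∀ g ∈ Q.radical, psiLog ψ (P.mat ε) g ≠ 0 := fun g hg => Q.ne_zero g (Q.radical_le hg)
  have hmul : ∀ g ∈ Q.radical, ∀ h ∈ Q.radical,
      psiLog ψ (P.mat ε) (g * h) = psiLog ψ (P.mat ε) g * psiLog ψ (P.mat ε) h :=
    fun g hg h hh => Q.map_radical_mul hg (Q.radical_le hh)
  let E : Submodule ℂ V :=
    { carrier := {v | ∀ g (hg : g ∈ grp ε u ℓ), g ∈ Q.radical →
        g.1 - 1 ∈ matP ϖ k → χ ⟨g, hg⟩ v = psiLog ψ (P.mat ε) g • v}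
      add_mem' := fun {a b} ha hb g hg h1 h2 => by
        rw [map_add, ha g hg h1 h2, hb g hg h1 h2, smul_add]
      zero_mem' := fun g hg _ _ => by rw [map_zero, smul_zero]
      smul_mem' := fun c a ha g hg h1 h2 => by rw [map_smul, ha g hg h1 h2, smul_comm] }
  have hcommk : ∀ g ∈ Q.radical, ∀ h ∈ Q.radical, (g * h * (h * g)⁻¹).1 - 1 ∈ matP ϖ k := by
    intro g hg h hh
    have e : (g * h * (h * g)⁻¹).1 - 1 =
        ((g.1 - 1) * (h.1 - 1) - (h.1 - 1) * (g.1 - 1)) * ((h * g)⁻¹).1 := by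
      rw [← comm_eq_comm_sub_one, ← Units.val_mul, ← Units.val_mul, sub_mul, ← Units.val_mul,
        ← Units.val_mul, mul_inv_cancel]
      rfl
    rw [e]
    exact mul_mem_matP_right _ (comm_mem_matP (hRN g hg) (hRN h hh) (by omega))
  -- the space `E` is stable under the radical, which acts on it by commuting operators: commutators
  -- have depth `k`, and `psiLog` is trivial on them
  obtain ⟨w, hwE, hw0, ν, hν⟩ := exists_common_eigenvector
    (χ.comp (Subgroup.inclusion hRG)) E
    (fun h => hv ((Submodule.mem_bot ℂ).1 (h ▸ (hv' : v ∈ E))))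
    (by
      rintro ⟨r, hr⟩ a ha g hg hgR hgk
      change χ ⟨g, hg⟩ (χ ⟨r, hRG hr⟩ a) = _ • χ ⟨r, hRG hr⟩ a
      have hg' : r⁻¹ * g * r ∈ Q.radical := by
        simpa using mul_mem (mul_mem (inv_mem hr) hgR) hr
      have e : psiLog ψ (P.mat ε) (r⁻¹ * g * r) = psiLog ψ (P.mat ε) g := by
        have h1 := hmul r hr _ hg'
        have h2 := hmul g hgR r hr
        have e' : r * (r⁻¹ * g * r) = g * r := by group
        rw [e', h2, mul_comm] at h1
        exact (mul_left_cancel₀ (hne r hr) h1).symm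
      have hgk' : (r⁻¹ * g * r).1 - 1 ∈ matP ϖ k := by
        have := (conj_mem_cong (Subgroup.inv_mem _ (hRG hr)) (hS.mem_cong.2 ⟨hg, hgk⟩))
        rw [inv_inv] at this
        exact (hS.mem_cong.1 this).2
      have := ha _ (hRG hg') hg' hgk'
      rw [e] at this
      rw [← map_smul, ← this, ← Module.End.mul_apply, ← Module.End.mul_apply, ← map_mul,
        ← map_mul]
      congr 2
      ext1
      simp only [Subgroup.coe_mul]
      group)
    (by
      rintro ⟨r, hr⟩ ⟨s, hs⟩ a ha
      change χ ⟨r, hRG hr⟩ (χ ⟨s, hRG hs⟩ a) = χ ⟨s, hRG hs⟩ (χ ⟨r, hRG hr⟩ a)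
      have hc : (s⁻¹ * r⁻¹ * (r⁻¹ * s⁻¹)⁻¹) ∈ Q.radical :=
        mul_mem (mul_mem (inv_mem hs) (inv_mem hr)) (inv_mem (mul_mem (inv_mem hr) (inv_mem hs)))
      have e : psiLog ψ (P.mat ε) (s⁻¹ * r⁻¹ * (r⁻¹ * s⁻¹)⁻¹) = 1 := by
        have h1 := hmul _ (mul_mem hr hs) _ hc
        have e' : r * s * (s⁻¹ * r⁻¹ * (r⁻¹ * s⁻¹)⁻¹) = s * r := by group
        rw [e', hmul r hr s hs, hmul s hs r hr, mul_comm] at h1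
        exact (mul_left_cancel₀ (mul_ne_zero (hne r hr) (hne s hs)) (by rw [← h1, mul_one]))
      have := ha _ (hRG hc) hc (hcommk _ (inv_mem hs) _ (inv_mem hr))
      rw [e, one_smul] at this
      conv_lhs => rw [← this]
      rw [← Module.End.mul_apply, ← Module.End.mul_apply, ← Module.End.mul_apply, ← map_mul,
        ← map_mul, ← map_mul]
      congr 2
      ext1
      simp only [Subgroup.coe_mul]
      group)
  -- the eigencharacter differs from `psiLog` by a character that is trivial at depth `k`, hence given
  -- by a matrix `D` in the Lie ring; only its pairing with the commutant matters, so that it can be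
  -- absorbed into the parameters of the normal form
  let ν' : Q.radical →* ℂ :=
    { toFun := fun g => ν g * (psiLog ψ (P.mat ε) g)⁻¹
      map_one' := by
        have := Q.map_one
        simp [this]
      map_mul' := fun a b => by
        simp only [map_mul, Subgroup.coe_mul, hmul a a.2 b b.2, mul_inv]
        ring }
  obtain ⟨D, hDk, hD, hDν⟩ := hS.exists_char_form hψ (ε := ε) (i := n₁) (k := k) hk (by omega)
    (T := Q.radical) (fun g hg => hS.mem_cong.2 ⟨hRG hg, hRN g hg⟩) ν' (fun g hgk => by
      have h1 := hwE g.1 (hRG g.2) g.2 hgk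
      have h2 : χ ⟨g.1, hRG g.2⟩ w = ν g • w := hν g
      rw [h2] at h1
      have h3 := smul_left_injective ℂ hw0 h1
      change ν g * _ = 1
      rw [h3]
      exact mul_inv_cancel₀ (hne g g.2))
  obtain ⟨H, hH, hHθ, rfl⟩ := hS.exists_eq_scal_smul hD hDk
  refine ⟨H, hH, hS.isAdmissible_perturb hP (matP_anti (by omega) hH) hHθ, w, hw0,
    fun hP' hd' g hg hgR => ?_⟩
  have hM := IsUniformized.mat_perturb_sub_mem (ε := ε) (P := P) hH
  -- the perturbation does not change the radical
  have hgR' : g ∈ Q.radical := by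
    rw [hd'.mem_radical_iff hS hP' hψ] at hgR
    rw [hQ, hd.mem_radical_iff hS hP hψ]
    have hδ : ∃ y, (P.perturb H).δ = P.δ + ϖ ^ (ℓ / 2) * y :=
      (IsUniformized.perturb_sub_eq (matP_anti (by omega) hH)).2.1
    obtain ⟨y, hy⟩ := hδ
    refine ⟨hg, IsUniformized.mem_lieN_congr (y := -y) (by omega) (by rw [hy]; ring) hgR.2.1, fun Z hZ => ?_⟩
    have h1 := hgR.2.2 Z (IsUniformized.mem_lieN_congr (by omega) hy hZ)
    have h2 : trace (((P.perturb H).mat ε - P.mat ε) * ((g.1 - 1) * Z - Z * (g.1 - 1))) = 0 :=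
      trace_mul_eq_zero hS.pow_eq_zero hM (comm_mem_matP (c := 2 * n₁)
        (lieN_le (by omega) hgR.2.1) (lieN_le (by omega) hZ) (by omega)) (by omega)
    rw [sub_mul, trace_sub, h1, zero_sub, neg_eq_zero] at h2
    exact h2
  have h1 : χ ⟨g, hg⟩ w = ν ⟨g, hgR'⟩ • w := hν ⟨g, hgR'⟩
  have h2 : ν ⟨g, hgR'⟩ * (psiLog ψ (P.mat ε) g)⁻¹ = ψ (trace (scal ε u ℓ • H * (g.1 - 1))) :=
    hDν ⟨g, hgR'⟩
  rw [h1, mul_inv_eq_iff_eq_mul₀ (hne g hgR')|>.1 h2]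
  congr 1
  have h3 : trace (scal ε u ℓ • H * (g.1 - 1)) =
      trace (((P.perturb H).mat ε - P.mat ε) * (g.1 - 1)) := by
    obtain ⟨J, hJ, hJn, hXJ⟩ := mem_lieN.1 (hR g hgR')
    have e : g.1 - 1 = J + (g.1 - 1 - J) := by abel
    rw [e, mul_add, mul_add, trace_add, trace_add, hS.trace_mat_perturb_sub hJ,
      trace_mul_eq_zero hS.pow_eq_zero (Submodule.smul_mem _ _ hH) hXJ (by omega),
      trace_mul_eq_zero hS.pow_eq_zero hM hXJ (by omega)]
  have h4 := hS.psiLog_eq_of_mem (ψ := ψ) hM (hRN g hgR') (by omega)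
  have h5 : psiLog ψ ((P.perturb H).mat ε) g =
      psiLog ψ ((P.perturb H).mat ε - P.mat ε) g * psiLog ψ (P.mat ε) g := by
    unfold psiLog
    rw [← AddChar.map_add_eq_mul, ← trace_add, ← add_mul, sub_add_cancel]
  rw [h5, h4, h3]
  rfl

end Perturbation

/-! ### Reduction to normal form -/

section NilpotentMatrices

/-- The Cayley–Hamilton identity for `3 × 3` matrices. -/
lemma pow_three_eq {K : Type*} [CommRing K] (N : Matrix (Fin 3) (Fin 3) K) :
    2 • N ^ 3 = (2 * trace N) • N ^ 2 - (trace N ^ 2 - trace (N ^ 2)) • N +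
      (2 * N.det) • (1 : Matrix (Fin 3) (Fin 3) K) := by
  ext i j
  fin_cases i <;> fin_cases j <;>
    simp [pow_succ, trace_fin_three, det_fin_three, Matrix.mul_apply, Fin.sum_univ_three] <;> ring

lemma two_smul_adjugate_eq {K : Type*} [CommRing K] (N : Matrix (Fin 3) (Fin 3) K) :
    (2 : K) • N.adjugate = (2 : K) • N ^ 2 - (2 * trace N) • N +
      (trace N ^ 2 - trace (N ^ 2)) • (1 : Matrix (Fin 3) (Fin 3) K) := by
  rw [adjugate_fin_three, sq]
  ext i j
  fin_cases i <;> fin_cases j <;>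
    simp [trace_fin_three, Matrix.mul_apply, Fin.sum_univ_three] <;> ring

/-- A matrix of trace zero and square zero has rank at most one. -/
lemma two_mul_minor_eq {K : Type*} [CommRing K] {N : Matrix (Fin 3) (Fin 3) K}
    (h1 : trace N = 0) (h2 : N ^ 2 = 0) (i j k l : Fin 3) :
    2 * (N i j * N k l - N i l * N k j) = 0 := by
  have h := two_smul_adjugate_eq N
  rw [h1, h2, trace_zero, smul_zero, mul_zero, zero_smul, sub_zero, zero_pow two_ne_zero,
    sub_zero, zero_smul, add_zero, adjugate_fin_three] at h
  have e := fun i j => congrFun₂ h i j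
  have main : ∀ i k j l : Fin 3, i < k → j < l → 2 * (N i j * N k l - N i l * N k j) = 0 := by
    have e00 := e 0 0
    have e01 := e 0 1
    have e02 := e 0 2
    have e10 := e 1 0
    have e11 := e 1 1
    have e12 := e 1 2
    have e20 := e 2 0
    have e21 := e 2 1
    have e22 := e 2 2
    simp at e00 e01 e02 e10 e11 e12 e20 e21 e22
    intro i k j l hik hjl
    fin_cases i <;> fin_cases k <;> first
    | exact absurd hik (by decide)
    | (fin_cases j <;> fin_cases l <;> first
      | exact absurd hjl (by decide)
      | (simp only [Fin.isValue, Fin.mk_one, Fin.reduceFinMk, Fin.zero_eta]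
         first
         | linear_combination e00
         | linear_combination -e01
         | linear_combination e01
         | linear_combination e02
         | linear_combination -e10
         | linear_combination e10
         | linear_combination e11
         | linear_combination -e12
         | linear_combination e12
         | linear_combination e20
         | linear_combination -e21
         | linear_combination e21
         | linear_combination e22))
  rcases lt_trichotomy i k with hik | rfl | hik
  · rcases lt_trichotomy j l with hjl | rfl | hjl
    · exact main _ _ _ _ hik hjl
    · ring
    · linear_combination -main _ _ _ _ hik hjl
  · ring
  · rcases lt_trichotomy j l with hjl | rfl | hjl
    · linear_combination -main _ _ _ _ hik hjl
    · ring
    · linear_combination main _ _ _ _ hik hjl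

/-- If `N ^ 2 v ≠ 0`, then `v`, `N v`, `N ^ 2 v` is a basis and `N` is regular. -/
lemma sq_eq_zero_of_not_isRegularMatrix {K : Type*} [Field K] (h2 : (2 : K) ≠ 0)
    {N : Matrix (Fin 3) (Fin 3) K} (hN : IsNilpotent N) (hreg : ¬ IsRegularMatrix N) :
    trace N = 0 ∧ N ^ 2 = 0 := by
  have ht : trace N = 0 := (isNilpotent_trace_of_isNilpotent hN).eq_zero
  have ht2 : trace (N ^ 2) = 0 :=
    (isNilpotent_trace_of_isNilpotent (hN.pow_of_pos two_ne_zero)).eq_zero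
  have hdet : N.det = 0 := by
    obtain ⟨k, hk⟩ := hN
    refine eq_zero_of_pow_eq_zero (n := k) ?_
    rw [← det_pow, hk]
    rcases k with _ | k
    · simp at hk
    · simp
  -- the characteristic polynomial is `X ^ 3`
  have h3 : N ^ 3 = 0 := by
    have := pow_three_eq N
    rw [ht, ht2, hdet] at this
    simp only [mul_zero, zero_smul, sub_zero, ne_eq, OfNat.ofNat_ne_zero, not_false_eq_true,
      zero_pow, add_zero] at this
    ext i j
    have := congrFun₂ this i j
    simpa [h2] using this
  refine ⟨ht, ?_⟩
  by_contra hN2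
  obtain ⟨v, hv⟩ : ∃ v, N ^ 2 *ᵥ v ≠ 0 := by
    by_contra! h
    refine hN2 (Matrix.toLin'.injective (LinearMap.ext fun v => ?_))
    rw [Matrix.toLin'_apply, h v, map_zero, LinearMap.zero_apply]
  refine hreg ⟨v, ?_⟩
  have hli : LinearIndependent K fun i : Fin 3 => N ^ (i : ℕ) *ᵥ v := by
    rw [Fintype.linearIndependent_iff]
    intro c hc
    rw [Fin.sum_univ_three] at hc
    simp only [Fin.val_zero, Fin.val_one, Fin.val_two, pow_zero, one_mulVec, pow_one] at hc
    have hN3 : ∀ k, 3 ≤ k → N ^ k = 0 := fun k hk => pow_eq_zero_of_le hk h3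
    have a0 : c 0 = 0 := by
      have := congrArg (N ^ 2 *ᵥ ·) hc
      simp only [mulVec_add, mulVec_smul, mulVec_mulVec, ← pow_succ, ← pow_add, mulVec_zero,
        hN3 (2 + 1) le_rfl, hN3 (2 + 2) (by norm_num), zero_mulVec, smul_zero, add_zero] at this
      exact (smul_eq_zero.1 this).resolve_right hv
    rw [a0, zero_smul, zero_add] at hc
    have a1 : c 1 = 0 := by
      have := congrArg (N *ᵥ ·) hc
      simp only [mulVec_add, mulVec_smul, mulVec_mulVec, ← sq, ← pow_succ', mulVec_zero,
        hN3 (2 + 1) le_rfl, zero_mulVec, smul_zero, add_zero] at this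
      exact (smul_eq_zero.1 this).resolve_right hv
    rw [a1, zero_smul, zero_add] at hc
    have a2 := (smul_eq_zero.1 hc).resolve_right hv
    intro i
    fin_cases i <;> assumption
  have := hli.span_eq_top_of_card_eq_finrank (by simp)
  rw [eq_top_iff, ← this]
  refine Submodule.span_mono ?_
  rintro _ ⟨i, rfl⟩
  exact ⟨i, rfl⟩

end NilpotentMatrices

section ResidueConjugation

/-- The matrix with columns `N e_j`, `w × e_i` and `e_j`, where `w` is the `i`-th row of `N`. -/
def columnMatrix {K : Type*} [CommRing K] (N : Matrix (Fin 3) (Fin 3) K) (i j : Fin 3) :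
    Matrix (Fin 3) (Fin 3) K :=
  Matrix.of fun k => ![N k j, crossProduct (N i) (Pi.single i 1) k, Pi.single (M := fun _ => K) j 1 k]

lemma columnMatrix_map {K L : Type*} [CommRing K] [CommRing L] (f : K →+* L)
    (N : Matrix (Fin 3) (Fin 3) K) (i j : Fin 3) :
    (columnMatrix N i j).map f = columnMatrix (N.map f) i j := by
  ext k l
  fin_cases i <;> fin_cases l <;> fin_cases k <;> fin_cases j <;>
    simp [columnMatrix, cross_apply]

lemma mul_columnMatrix {K : Type*} [CommRing K] {N : Matrix (Fin 3) (Fin 3) K}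
    (h2 : N ^ 2 = 0) (hm : ∀ i j k l, N i j * N k l - N i l * N k j = 0) (i j : Fin 3) :
    N * columnMatrix N i j = columnMatrix N i j * matE 0 := by
  have e : ∀ i j, N i 0 * N 0 j + N i 1 * N 1 j + N i 2 * N 2 j = 0 := fun i j => by
    have := congrFun₂ h2 i j
    simpa [sq, Matrix.mul_apply, Fin.sum_univ_three] using this
  ext k l
  fin_cases l
  · simpa [columnMatrix, matE, Matrix.mul_apply, Fin.sum_univ_three] using e k j
  · fin_cases i <;>
      simp [columnMatrix, matE, Matrix.mul_apply, Fin.sum_univ_three, cross_apply]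
    · linear_combination hm k 1 0 2
    · linear_combination hm k 2 1 0
    · linear_combination hm k 0 2 1
  · fin_cases j <;> simp [columnMatrix, matE, Matrix.mul_apply, Fin.sum_univ_three]

lemma det_columnMatrix {K : Type*} [CommRing K] {N : Matrix (Fin 3) (Fin 3) K}
    (h2 : N ^ 2 = 0) (i j : Fin 3) : (columnMatrix N i j).det = N i j ^ 2 := by
  have e : ∀ i j, N i 0 * N 0 j + N i 1 * N 1 j + N i 2 * N 2 j = 0 := fun i j => by
    have := congrFun₂ h2 i j
    simpa [sq, Matrix.mul_apply, Fin.sum_univ_three] using this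
  have e0 := e 0 0
  have e1 := e 1 1
  have e2 := e 2 2
  fin_cases i <;> fin_cases j <;> simp [columnMatrix, det_fin_three, cross_apply]
  · linear_combination -e0
  · ring
  · ring
  · ring
  · linear_combination -e1
  · ring
  · ring
  · ring
  · linear_combination -e2

/-- A rank one matrix `a a° v v°`, with `v` isotropic, is brought to normal form by a unitary
matrix: the case `v 0 ≠ 0`. The variables `v'`, `a'` and `e'` stand for the conjugates of `v`, `a`
and `e`. -/
lemma unitary_columns_fst {K : Type*} [CommRing K] {N : Matrix (Fin 3) (Fin 3) K}
    {v v' : Fin 3 → K} {a a' e e' : K} (hN : ∀ k l, N k l = a * a' * (v k * v' (Fin.rev l)))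
    (hiso : v' 2 * v 0 + v' 1 * v 1 + v' 0 * v 2 = 0)
    (he : a * v 0 * e = 1) (he' : a' * v' 0 * e' = 1) :
    !![e, 0, 0; -(a * v 1 * e), 1, 0; a' * v' 2, a' * v' 1, a' * v' 0] *
      !![a * v 0, 0, 0; a * v 1, 1, 0; a * v 2, -(a' * v' 1 * e'), e'] = 1 ∧
    N * !![a * v 0, 0, 0; a * v 1, 1, 0; a * v 2, -(a' * v' 1 * e'), e'] =
      !![a * v 0, 0, 0; a * v 1, 1, 0; a * v 2, -(a' * v' 1 * e'), e'] * matE 0 := by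
  have r0 : Fin.rev (0 : Fin 3) = 2 := rfl
  have r1 : Fin.rev (1 : Fin 3) = 1 := rfl
  have r2 : Fin.rev (2 : Fin 3) = 0 := rfl
  constructor
  · ext i j
    fin_cases i <;> fin_cases j <;> simp [Matrix.mul_apply, Fin.sum_univ_three]
    · linear_combination he
    · linear_combination -(a * v 1) * he
    · linear_combination a * a' * hiso
    · linear_combination -(a' * v' 1) * he'
    · linear_combination he'
  · ext k l
    fin_cases l
    · simp [matE, Matrix.mul_apply, Fin.sum_univ_three, hN, r0, r1, r2]
      linear_combination a * a' * v k * a * hiso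
    · simp [matE, Matrix.mul_apply, Fin.sum_univ_three, hN, r0, r1, r2]
      linear_combination -a * a' * v k * v' 1 * he'
    · fin_cases k <;> simp [matE, Matrix.mul_apply, Fin.sum_univ_three, hN, r0, r1, r2]
      · linear_combination a * v 0 * he'
      · linear_combination a * v 1 * he'
      · linear_combination a * v 2 * he'

/-- The case `v 0 = v 1 = 0` of `unitary_columns_fst`. -/
lemma unitary_columns_snd {K : Type*} [CommRing K] {N : Matrix (Fin 3) (Fin 3) K}
    {v v' : Fin 3 → K} {a a' e e' : K} (hN : ∀ k l, N k l = a * a' * (v k * v' (Fin.rev l)))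
    (h0 : v 0 = 0) (h1 : v 1 = 0) (h0' : v' 0 = 0) (h1' : v' 1 = 0)
    (he : a * v 2 * e = 1) (he' : a' * v' 2 * e' = 1) :
    !![0, 0, e; 0, 1, 0; a' * v' 2, 0, 0] * !![0, 0, e'; 0, 1, 0; a * v 2, 0, 0] = 1 ∧
    N * !![0, 0, e'; 0, 1, 0; a * v 2, 0, 0] =
      !![0, 0, e'; 0, 1, 0; a * v 2, 0, 0] * matE 0 := by
  have r0 : Fin.rev (0 : Fin 3) = 2 := rfl
  have r1 : Fin.rev (1 : Fin 3) = 1 := rfl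
  have r2 : Fin.rev (2 : Fin 3) = 0 := rfl
  constructor
  · ext i j
    fin_cases i <;> fin_cases j <;> simp [Matrix.mul_apply, Fin.sum_univ_three]
    · linear_combination he
    · linear_combination he'
  · ext k l
    fin_cases l
    · simp [matE, Matrix.mul_apply, Fin.sum_univ_three, hN, r2, h0']
    · simp [matE, Matrix.mul_apply, Fin.sum_univ_three, hN, r1, h1']
    · fin_cases k <;> simp [matE, Matrix.mul_apply, Fin.sum_univ_three, hN, r0, h0, h1]
      linear_combination a * v 2 * he'

variable {o : Type*} [CommRing o] [IsLocalRing o] {u : o} {ℓ q : ℕ} {ϖ : BigRing u ℓ}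
  {ε : GroupType}

namespace IsUniformized

variable (hS : IsUniformized u ℓ q ϖ)
include hS

/-- If `X` is a solution modulo `𝔓` of the equations for an element of `G` which conjugates `H` to
`E_{13}`, then there is such an element. -/
lemma exists_conj_of_redMat {H X : Matrix (Fin 3) (Fin 3) (BigRing u ℓ)} (hX : IsUnit X)
    (h1 : ε = .linear → X.map star = X) (h2 : ε = .unitary → redMat u ℓ 1 (adj X * X) = redMat u ℓ 1 1)
    (h3 : redMat u ℓ 1 (H * X) = redMat u ℓ 1 (X * matE 0)) :
    ∃ g ∈ grp ε u ℓ, g.1 * H * (g⁻¹).1 - matE 0 ∈ matP ϖ 1 := by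
  obtain ⟨x, rfl⟩ := hX
  obtain ⟨y, -, hy, hyx⟩ := hS.exists_lift_of_sub_mem ε (H := ⊤) (k := 1) le_rfl (x := x) trivial
    trivial (by
      cases ε with
      | linear => rw [sig_linear_val, h1 rfl, sub_self]; exact zero_mem _
      | unitary =>
        have h := hS.redMat_eq_iff.1 (h2 rfl)
        have h' : adj x.1 - (x⁻¹).1 ∈ matP ϖ 1 := by
          have := mul_mem_matP_right (x⁻¹).1 h
          rwa [sub_mul, mul_assoc, Units.mul_inv, mul_one, one_mul] at this
        have h'' := tau_mem_matP .unitary hS.star_unif h'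
        rw [← theta_mem_iff] at h''
        have e : theta .unitary (adj x.1 - (x⁻¹).1) = x.1 - (sig .unitary x).1 := by
          change adj _ = _
          rw [adj_sub, adj_adj]; rfl
        rw [e] at h''
        rwa [← neg_mem_iff, neg_sub])
  refine ⟨y⁻¹, Subgroup.inv_mem _ hy, ?_⟩
  have h := hS.redMat_eq_iff.1 h3
  have e : (y⁻¹).1 * H * (y⁻¹⁻¹).1 - matE 0 = (y⁻¹).1 *
      ((H * x.1 - x.1 * matE 0) + (H * (y.1 - x.1) - (y.1 - x.1) * matE 0)) := by
    have e1 : (H * x.1 - x.1 * matE 0) + (H * (y.1 - x.1) - (y.1 - x.1) * matE 0) =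
      H * y.1 - y.1 * matE 0 := by noncomm_ring
    rw [e1, mul_sub, ← mul_assoc, ← mul_assoc, Units.inv_mul, one_mul, inv_inv]
  rw [e]
  exact mul_mem_matP_left _ (add_mem h (sub_mem (mul_mem_matP_left _ hyx)
    (mul_mem_matP_right _ hyx)))

lemma isUnit_of_isUnit_det_redMat {x : BigRing u ℓ}
    (h : Ideal.Quotient.mk (bigP u ℓ ^ 1) x ≠ 0) : IsUnit x := by
  refine hS.isUnit_of_notMem x fun hx => h ?_
  rwa [Ideal.Quotient.eq_zero_iff_mem, pow_one]

end IsUniformized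

end ResidueConjugation

section NormalFormReduction

lemma map_of_fin_three {R S : Type*} (f : R → S) (a b c d e g h i j : R) :
    (!![a, b, c; d, e, g; h, i, j] : Matrix (Fin 3) (Fin 3) R).map f =
      !![f a, f b, f c; f d, f e, f g; f h, f i, f j] := by
  ext1 k l
  fin_cases k <;> fin_cases l <;> rfl

lemma adj_of_fin_three {R : Type*} [CommRing R] [StarRing R] (a b c d e g h i j : R) :
    adj (!![a, b, c; d, e, g; h, i, j] : Matrix (Fin 3) (Fin 3) R) =
      !![star j, star g, star c; star i, star e, star b; star h, star d, star a] := by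
  ext1 k l
  fin_cases k <;> fin_cases l <;> rfl

variable {o : Type*} [CommRing o] [IsLocalRing o] {u : o} {ℓ q : ℕ} {ϖ : BigRing u ℓ}
  {ε : GroupType}

namespace IsUniformized

variable (hS : IsUniformized u ℓ q ϖ)
include hS

lemma redMat_rank_one [Nontrivial (BigRing u ℓ ⧸ bigP u ℓ ^ 1)]
    {H : Matrix (Fin 3) (Fin 3) (BigRing u ℓ)}
    (hnil : IsNilpotent (redMat u ℓ 1 H)) (hreg : ¬ IsRegularMatrix (redMat u ℓ 1 H)) :
    redMat u ℓ 1 H ^ 2 = 0 ∧ (∀ i j k l, redMat u ℓ 1 H i j * redMat u ℓ 1 H k l -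
      redMat u ℓ 1 H i l * redMat u ℓ 1 H k j = 0) ∧ IsDomain (BigRing u ℓ ⧸ bigP u ℓ ^ 1) := by
  have hmax : (bigP u ℓ ^ 1).IsMaximal := by
    refine Ideal.isMaximal_iff.2 ⟨fun h => ?_, fun J x hJ hx hxJ => ?_⟩
    · exact one_ne_zero (α := BigRing u ℓ ⧸ bigP u ℓ ^ 1)
        ((map_one (Ideal.Quotient.mk _)).symm.trans (Ideal.Quotient.eq_zero_iff_mem.2 h))
    · rw [pow_one] at hx
      exact J.eq_top_iff_one.1 (J.eq_top_of_isUnit_mem hxJ (hS.isUnit_of_notMem x hx))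
  let := Ideal.Quotient.field (bigP u ℓ ^ 1)
  have h2 : (2 : BigRing u ℓ ⧸ bigP u ℓ ^ 1) ≠ 0 := by
    have := (hS.isUnit_two.map (Ideal.Quotient.mk (bigP u ℓ ^ 1))).ne_zero
    rwa [map_ofNat] at this
  have h := sq_eq_zero_of_not_isRegularMatrix h2 hnil hreg
  exact ⟨h.2, fun i j k l => (mul_eq_zero.1 (two_mul_minor_eq h.1 h.2 i j k l)).resolve_left h2,
    inferInstance⟩

lemma mk_star_eq_zero_iff {x : BigRing u ℓ} :
    Ideal.Quotient.mk (bigP u ℓ ^ 1) (star x) = 0 ↔ Ideal.Quotient.mk (bigP u ℓ ^ 1) x = 0 := by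
  have key : ∀ x : BigRing u ℓ, Ideal.Quotient.mk (bigP u ℓ ^ 1) x = 0 →
      Ideal.Quotient.mk (bigP u ℓ ^ 1) (star x) = 0 := by
    intro x hx
    rw [Ideal.Quotient.eq_zero_iff_mem, hS.mem_bigP_pow] at hx ⊢
    obtain ⟨y, rfl⟩ := hx
    exact ⟨star y, by rw [star_mul', star_pow, hS.star_unif]⟩
  exact ⟨fun h => by simpa using key _ h, key x⟩

set_option maxHeartbeats 1000000 in
/-- A matrix of the Lie ring whose reduction is nilpotent, non-zero and not regular is conjugate,
modulo `𝔓`, to a multiple of `E_{13}`. -/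
lemma exists_conj_sub_matE_mem {H : Matrix (Fin 3) (Fin 3) (BigRing u ℓ)} (hH : theta ε H = H)
    (hnil : IsNilpotent (redMat u ℓ 1 H)) (hne : redMat u ℓ 1 H ≠ 0)
    (hreg : ¬ IsRegularMatrix (redMat u ℓ 1 H)) :
    ∃ g ∈ grp ε u ℓ, g.1 * H * (g⁻¹).1 - matE 0 ∈ matP ϖ 1 := by
  obtain ⟨i, j, hij⟩ : ∃ i j, redMat u ℓ 1 H i j ≠ 0 := by
    by_contra! h
    exact hne (Matrix.ext h)
  have : Nontrivial (BigRing u ℓ ⧸ bigP u ℓ ^ 1) := ⟨⟨_, _, hij⟩⟩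
  obtain ⟨h2, hm, hdom⟩ := hS.redMat_rank_one hnil hreg
  set φ := Ideal.Quotient.mk (bigP u ℓ ^ 1) with hφ
  have hN : ∀ i j, redMat u ℓ 1 H i j = φ (H i j) := fun i j => rfl
  have hmap : ∀ X Y : Matrix (Fin 3) (Fin 3) (BigRing u ℓ),
      redMat u ℓ 1 (X * Y) = redMat u ℓ 1 X * redMat u ℓ 1 Y := fun X Y => Matrix.map_mul
  have hE : redMat u ℓ 1 (matE 0) = matE 0 := by
    ext i j
    fin_cases i <;> fin_cases j <;> simp [redMat, matE]
  have hE1 : redMat u ℓ 1 1 = 1 := Matrix.map_one _ (map_zero _) (map_one _)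
  cases ε with
  | linear =>
    have hc : redMat u ℓ 1 (columnMatrix H i j) = columnMatrix (redMat u ℓ 1 H) i j :=
      columnMatrix_map φ H i j
    refine hS.exists_conj_of_redMat (X := columnMatrix H i j) ?_ (fun _ => ?_) (by rintro ⟨⟩) ?_
    · rw [Matrix.isUnit_iff_isUnit_det]
      refine hS.isUnit_of_isUnit_det_redMat ?_
      have : φ (columnMatrix H i j).det = (redMat u ℓ 1 (columnMatrix H i j)).det :=
        RingHom.map_det φ _
      rw [this, hc, det_columnMatrix h2]
      exact pow_ne_zero 2 hij
    · exact (columnMatrix_map (starRingEnd (BigRing u ℓ)) H i j).trans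
        (congrArg (fun X => columnMatrix X i j) hH)
    · rw [hmap, hmap, hc, hE, mul_columnMatrix h2 hm]
  | unitary =>
    have hst : ∀ k l, φ (star (H k l)) = redMat u ℓ 1 H (Fin.rev l) (Fin.rev k) := fun k l => by
      rw [hN]
      congr 1
      have := congrFun₂ hH (Fin.rev l) (Fin.rev k)
      change star (H (Fin.rev (Fin.rev k)) (Fin.rev (Fin.rev l))) = _ at this
      rwa [Fin.rev_rev, Fin.rev_rev] at this
    have hji : redMat u ℓ 1 H (Fin.rev j) (Fin.rev i) ≠ 0 := by
      rw [← hst]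
      exact fun h => hij (hS.mk_star_eq_zero_iff.1 h)
    have hjj : redMat u ℓ 1 H (Fin.rev j) j ≠ 0 := by
      intro h
      have := hm i j (Fin.rev j) (Fin.rev i)
      rw [h, mul_zero, sub_zero] at this
      exact (mul_ne_zero hij hji) this
    have hreal : star (H (Fin.rev j) j) = H (Fin.rev j) j := by
      have := congrFun₂ hH (Fin.rev j) j
      change star (H (Fin.rev j) (Fin.rev (Fin.rev j))) = _ at this
      rwa [Fin.rev_rev] at this
    obtain ⟨b, hb⟩ := hS.norm_surj _ hreal (by
      rw [← pow_one (bigP u ℓ), ← Ideal.Quotient.eq_zero_iff_mem]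
      exact hjj)
    have hb' : φ b * φ (star b) = redMat u ℓ 1 H (Fin.rev j) j := by
      rw [← pow_one (bigP u ℓ), ← Ideal.Quotient.eq, map_mul] at hb
      exact hb
    have hbu : IsUnit b := hS.isUnit_of_isUnit_det_redMat fun h => hjj (by
      rw [← hb']; exact mul_eq_zero_of_left h _)
    obtain ⟨b, rfl⟩ := hbu
    set a : BigRing u ℓ := (b⁻¹).1 with ha
    have hab : φ a * φ b.1 = 1 := by rw [← map_mul, ha, Units.inv_mul, map_one]
    have hab' : φ (star a) * φ (star b.1) = 1 := by
      rw [← map_mul, ← star_mul', ha, Units.inv_mul, star_one, map_one]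
    -- the reduction is `a a° v v°` with `v` one of its columns; the scalar is a norm because the norm
    -- is surjective on the residue fields
    set v : Fin 3 → BigRing u ℓ ⧸ bigP u ℓ ^ 1 := fun k => φ (H k j) with hv
    set v' : Fin 3 → BigRing u ℓ ⧸ bigP u ℓ ^ 1 := fun k => φ (star (H k j)) with hv'
    have hvN : ∀ k l, redMat u ℓ 1 H k l = φ a * φ (star a) * (v k * v' (Fin.rev l)) := by
      intro k l
      have h1 : v' (Fin.rev l) = redMat u ℓ 1 H (Fin.rev j) l := by
        rw [hv']
        simp only
        rw [hst, Fin.rev_rev]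
      have h3 := hm k l (Fin.rev j) j
      rw [← hb'] at h3
      rw [h1]
      change redMat u ℓ 1 H k l = φ a * φ (star a) *
        (redMat u ℓ 1 H k j * redMat u ℓ 1 H (Fin.rev j) l)
      linear_combination φ a * φ (star a) * h3 - redMat u ℓ 1 H k l * φ (star a) * φ (star b.1) * hab
        - redMat u ℓ 1 H k l * hab'
    have hiso : v' 2 * v 0 + v' 1 * v 1 + v' 0 * v 2 = 0 := by
      have := congrFun₂ h2 (Fin.rev j) j
      rw [sq, Matrix.mul_apply, Fin.sum_univ_three] at this
      simp only [hv, hv', hst]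
      exact this
    have hva : φ a ≠ 0 := fun h => by rw [h, zero_mul] at hab; exact zero_ne_one hab
    have hunit : ∀ k, v k ≠ 0 → ∃ e, a * H k j * e = 1 := fun k hk => by
      obtain ⟨c, hc⟩ := hS.isUnit_of_isUnit_det_redMat (x := a * H k j) (by
        rw [map_mul]; exact mul_ne_zero hva hk)
      exact ⟨(c⁻¹).1, by rw [← hc, Units.mul_inv]⟩
    suffices h : ∃ X : Matrix (Fin 3) (Fin 3) (BigRing u ℓ),
        redMat u ℓ 1 (adj X * X) = redMat u ℓ 1 1 ∧
        redMat u ℓ 1 (H * X) = redMat u ℓ 1 (X * matE 0) by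
      obtain ⟨X, hX1, hX2⟩ := h
      refine hS.exists_conj_of_redMat (X := X) ?_ (by rintro ⟨⟩) (fun _ => hX1) hX2
      have h1 : IsUnit (adj X * X) :=
        hS.isUnit_of_sub_mem_matP isUnit_one (hS.redMat_eq_iff.1 hX1)
      rw [Matrix.isUnit_iff_isUnit_det, det_mul] at h1
      rw [Matrix.isUnit_iff_isUnit_det]
      exact isUnit_of_mul_isUnit_right h1
    have hr0 : Fin.rev (0 : Fin 3) = 2 := rfl
    have hr1 : Fin.rev (1 : Fin 3) = 1 := rfl
    have hr2 : Fin.rev (2 : Fin 3) = 0 := rfl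
    by_cases h0 : v 0 = 0
    · have h0' : v' 0 = 0 := hS.mk_star_eq_zero_iff.2 h0
      have h1 : v 1 = 0 := by
        rw [h0, h0', mul_zero, zero_mul, zero_add, add_zero] at hiso
        rcases mul_eq_zero.1 hiso with h | h
        · exact hS.mk_star_eq_zero_iff.1 h
        · exact h
      have h1' : v' 1 = 0 := hS.mk_star_eq_zero_iff.2 h1
      have h2v : v 2 ≠ 0 := by
        intro h2v
        have : ∀ k, v k = 0 := fun k => by fin_cases k <;> assumption
        exact hjj (this (Fin.rev j))
      obtain ⟨e, he⟩ := hunit 2 h2v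
      have he1 : φ a * v 2 * φ e = 1 := by
        have := congrArg φ he
        rwa [map_mul, map_mul, map_one] at this
      have he2 : φ (star a) * v' 2 * φ (star e) = 1 := by
        have := congrArg (fun x => φ (star x)) he
        simpa only [star_mul', map_mul, star_one, map_one] using this
      obtain ⟨k1, k2⟩ := unitary_columns_snd hvN h0 h1 h0' h1' he1 he2
      refine ⟨!![0, 0, star e; 0, 1, 0; a * H 2 j, 0, 0], ?_, ?_⟩
      · rw [hmap, hE1, ← k1, adj_of_fin_three]
        simp only [redMat, map_of_fin_three, ← hφ, map_zero, map_one, star_zero, star_one, map_mul,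
          star_star, star_mul', hv, hv']
      · rw [hmap, hmap, hE]
        simp only [redMat, map_of_fin_three, ← hφ, map_zero, map_one, map_mul]
        exact k2
    · obtain ⟨e, he⟩ := hunit 0 h0
      have he1 : φ a * v 0 * φ e = 1 := by
        have := congrArg φ he
        rwa [map_mul, map_mul, map_one] at this
      have he2 : φ (star a) * v' 0 * φ (star e) = 1 := by
        have := congrArg (fun x => φ (star x)) he
        simpa only [star_mul', map_mul, star_one, map_one] using this
      obtain ⟨k1, k2⟩ := unitary_columns_fst hvN hiso he1 he2
      refine ⟨!![a * H 0 j, 0, 0; a * H 1 j, 1, 0; a * H 2 j,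
        -(star a * star (H 1 j) * star e), star e], ?_, ?_⟩
      · rw [hmap, hE1, ← k1, adj_of_fin_three]
        simp only [redMat, map_of_fin_three, ← hφ, map_zero, map_one, star_zero, star_one, map_mul,
          map_neg, star_neg, star_star, star_mul', hv, hv']
      · rw [hmap, hmap, hE]
        simp only [redMat, map_of_fin_three, ← hφ, map_zero, map_one, map_mul, map_neg]
        exact k2

end IsUniformized

end NormalFormReduction

section NormalFormExistence

variable {o : Type*} [CommRing o] [IsLocalRing o] {u : o} {ℓ q k : ℕ} {ϖ : BigRing u ℓ}
  {ε : GroupType} {P : Params u ℓ} {ψ : AddChar (BigRing u ℓ) ℂ}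

/-- The solution `Z` of `H - M = [E_{13}, Z]`, where `M` is the matrix in normal form that pairs with
the commutant in the same way as `H`. -/
def sliceMatrix {R : Type*} [CommRing R] (i : R) (H : Matrix (Fin 3) (Fin 3) R) :
    Matrix (Fin 3) (Fin 3) R :=
  !![-(i * H 0 2), 0, 0; -H 1 2, 0, 0; i * (H 0 0 - H 2 2), H 0 1, i * H 0 2]

lemma sub_comm_sliceMatrix {R : Type*} [CommRing R] {i δ : R} (H : Matrix (Fin 3) (Fin 3) R)
    (hi : ∀ x, i * x + i * x = x) :
    H - !![i * (H 0 0 + H 2 2), 0, 0; H 1 0 + δ * H 1 2, H 1 1, 0;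
        H 2 0 + δ ^ 2 * H 0 2, H 2 1 + δ * H 0 1, i * (H 0 0 + H 2 2)] -
      (matE 0 * sliceMatrix i H - sliceMatrix i H * matE 0) =
    δ • !![0, 0, 0; -H 1 2, 0, 0; -(δ * H 0 2), -H 0 1, 0] := by
  rw [matE_comm, sliceMatrix]
  ext1 k l
  fin_cases k <;> fin_cases l <;> simp
  · linear_combination -hi (H 0 0)
  · linear_combination -hi (H 0 2)
  · ring
  · linear_combination -hi (H 2 2)

lemma sliceMatrix_smul {R : Type*} [CommRing R] (i c : R) (H : Matrix (Fin 3) (Fin 3) R) :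
    sliceMatrix i (c • H) = c • sliceMatrix i H := by
  unfold sliceMatrix
  ext1 k l
  fin_cases k <;> fin_cases l <;> simp <;> ring

lemma tau_sliceMatrix {R : Type*} [CommRing R] [StarRing R] {ε : GroupType} {i : R}
    (hi : star i = i) {H : Matrix (Fin 3) (Fin 3) R} (hH : theta ε H = H) :
    tau ε (sliceMatrix i H) = sliceMatrix i H := by
  unfold sliceMatrix
  cases ε with
  | linear =>
    have h : ∀ k l, star (H k l) = H k l := fun k l => congrFun₂ hH k l
    change Matrix.map _ star = _
    rw [map_of_fin_three]
    simp [h, hi]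
  | unitary =>
    have h : ∀ k l, star (H (Fin.rev l) (Fin.rev k)) = H k l := fun k l => congrFun₂ hH k l
    have h1 : star (H 0 2) = H 0 2 := h 0 2
    have h2 : star (H 1 2) = H 0 1 := h 0 1
    have h3 : star (H 0 1) = H 1 2 := h 1 2
    have h4 : star (H 0 0) = H 2 2 := h 2 2
    have h5 : star (H 2 2) = H 0 0 := h 0 0
    change -adj _ = _
    rw [adj_of_fin_three]
    ext1 k l
    fin_cases k <;> fin_cases l <;> simp [h1, h2, h3, h4, h5, hi] <;> ring

lemma conj_sub_eq {R : Type*} [CommRing R] (A D M Z' Z E : Matrix (Fin 3) (Fin 3) R) (r : R) :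
    (1 + Z') * (A + D) - (A + M) * (1 + Z') =
      (D - M - r • (E * Z - Z * E)) - ((A - r • E) * Z' - Z' * (A - r • E)) -
        r • (E * (Z' - Z) - (Z' - Z) * E) + (Z' * D - M * Z') := by
  simp only [mul_sub, sub_mul, mul_add, add_mul, smul_sub, mul_smul_comm, smul_mul_assoc, one_mul,
    mul_one]
  abel

namespace IsUniformized

variable (hS : IsUniformized u ℓ q ϖ)
include hS

/-- One step of the approximation: a conjugation improves the precision of a normal form. -/
lemma exists_conj_sub_mem_succ (hk : 1 ≤ k) {B : Matrix (Fin 3) (Fin 3) (BigRing u ℓ)}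
    (hB : tau ε B = B) (hP : P.IsAdmissible ε) (h : B - P.mat ε ∈ matP ϖ k) :
    ∃ g ∈ grp ε u ℓ, ∃ P' : Params u ℓ, P'.IsAdmissible ε ∧
      g.1 * B * (g⁻¹).1 - P'.mat ε ∈ matP ϖ (k + 1) := by
  obtain ⟨H, hH, hHθ, hD⟩ := hS.exists_eq_scal_smul (D := B - P.mat ε)
    (by rw [tau_sub, hB, hS.tau_mat hP]) h
  set i := Ring.inverse (2 : BigRing u ℓ) with hi
  have hZ : sliceMatrix i H ∈ matP ϖ k := by
    obtain ⟨K, rfl⟩ := mem_matP.1 hH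
    exact mem_matP.2 ⟨_, sliceMatrix_smul _ _ _⟩
  obtain ⟨y, -, hy, hyZ⟩ := hS.exists_mem_grp_sub_one ε hk hZ
    (tau_sliceMatrix hS.star_inverse_two hHθ) (H := ⊤) (fun _ _ => ⟨trivial, trivial⟩)
  refine ⟨y, hy, P.perturb H, hS.isAdmissible_perturb hP (matP_anti hk hH) hHθ, ?_⟩
  have hM := mat_perturb_sub_mem (ε := ε) (P := P) hH
  have hy1 : y.1 - 1 ∈ matP ϖ k := by
    have := add_mem (matP_anti (by omega) hyZ) hZ
    rwa [sub_add_cancel] at this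
  have hA : P.mat ε - scal ε u ℓ • matE 0 ∈ matP ϖ 1 := by
    obtain ⟨⟨⟨a, ha⟩, ⟨b, hb⟩, hm⟩, -⟩ := hS.isAdmissible_iff.1 hP
    obtain ⟨⟨c, hc⟩, ⟨d, hd⟩, ⟨e, he⟩⟩ := (hS.le_m_iff hS.pos).1 hm
    unfold Params.mat
    rw [← smul_sub]
    refine Submodule.smul_mem _ _ (mem_matP.2
      ⟨!![a, 0, 0; c, a + b, 0; b * (ϖ * b) + e, d, a], ?_⟩)
    rw [ha, hb, hc, hd, he, matE]
    simp only [Nat.succ_eq_add_one, zero_add, pow_one]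
    generalize ϖ = π
    ext1 k l
    fin_cases k <;> fin_cases l <;> simp <;> ring
  have e : y.1 * B * (y⁻¹).1 - (P.perturb H).mat ε =
      ((1 + (y.1 - 1)) * (P.mat ε + (B - P.mat ε)) -
        (P.mat ε + ((P.perturb H).mat ε - P.mat ε)) * (1 + (y.1 - 1))) * (y⁻¹).1 := by
    rw [add_sub_cancel, add_sub_cancel, add_sub_cancel, sub_mul, mul_assoc ((P.perturb H).mat ε),
      Units.mul_inv, mul_one]
  rw [e, conj_sub_eq (P.mat ε) _ _ _ (sliceMatrix i H) (matE 0) (scal ε u ℓ)]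
  refine mul_mem_matP_right _ (add_mem (sub_mem (sub_mem ?_ ?_) ?_) (sub_mem ?_ ?_))
  · rw [hD, mat_perturb_sub, ← smul_sub, ← smul_sub, sub_comm_sliceMatrix H hS.half_add_half]
    refine Submodule.smul_mem _ _ ?_
    obtain ⟨-, ⟨b, hb⟩, -⟩ := (hS.isAdmissible_iff.1 hP).1
    obtain ⟨K, rfl⟩ := mem_matP.1 hH
    refine mem_matP.2 ⟨b • !![0, 0, 0; -K 1 2, 0, 0; -(P.δ * K 0 2), -K 0 1, 0], ?_⟩
    have e2 : ϖ ^ (k + 1) * b = P.δ * ϖ ^ k := by rw [hb]; ring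
    rw [smul_smul, e2, mul_smul]
    congr 1
    generalize ϖ ^ k = π
    generalize P.δ = δ
    ext1 k l
    fin_cases k <;> fin_cases l <;> simp <;> ring
  · exact comm_mem_matP hA hy1 (by omega)
  · exact Submodule.smul_mem _ _ (comm_mem_matP_left _ (matP_anti (by omega) hyZ))
  · exact mul_mem_matP hy1 h (by omega)
  · exact mul_mem_matP hM hy1 (by omega)

/-- Every element of the Lie ring whose reduction is nilpotent, non-zero and not regular is conjugate
to a matrix in normal form. -/
theorem exists_conj_eq_mat {B : Matrix (Fin 3) (Fin 3) (BigRing u ℓ)} (hB : tau ε B = B)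
    (hnil : IsNilpotent (redMat u ℓ 1 B)) (hne : redMat u ℓ 1 B ≠ 0)
    (hreg : ¬ IsRegularMatrix (redMat u ℓ 1 B)) :
    ∃ g ∈ grp ε u ℓ, ∃ P : Params u ℓ, P.IsAdmissible ε ∧ g.1 * B * (g⁻¹).1 = P.mat ε := by
  have hconj : ∀ g ∈ grp ε u ℓ, tau ε (g.1 * B * (g⁻¹).1) = g.1 * B * (g⁻¹).1 := by
    intro g hg
    have := hS.tau_conj (Subgroup.inv_mem _ hg) B
    rwa [inv_inv, hB] at this
  suffices h : ∀ k, 1 ≤ k → ∃ g ∈ grp ε u ℓ, ∃ P : Params u ℓ, P.IsAdmissible ε ∧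
      g.1 * B * (g⁻¹).1 - P.mat ε ∈ matP ϖ k by
    obtain ⟨g, hg, P, hP, h⟩ := h ℓ hS.pos
    exact ⟨g, hg, P, hP, sub_eq_zero.1 (eq_zero_of_mem_matP hS.pow_eq_zero h le_rfl)⟩
  intro k hk
  induction k, hk using Nat.le_induction with
  -- modulo `𝔓` the matrix is conjugate to `r E_{13}`, the normal form with all parameters zero
  | base =>
    obtain ⟨H, -, hH, rfl⟩ := hS.exists_eq_scal_smul hB (mem_matP_zero (ϖ := ϖ) B)
    obtain ⟨c, hc⟩ := (hS.isUnit_scal (ε := ε)).map (Ideal.Quotient.mk (bigP u ℓ ^ 1))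
    have e : redMat u ℓ 1 (scal ε u ℓ • H) = c.1 • redMat u ℓ 1 H := by
      ext1 i j
      rw [hc]
      exact map_mul (Ideal.Quotient.mk (bigP u ℓ ^ 1)) _ _
    rw [e] at hnil hne hreg
    obtain ⟨g, hg, h⟩ := hS.exists_conj_sub_matE_mem hH (by
        obtain ⟨n, hn⟩ := hnil
        refine ⟨n, ?_⟩
        have := congrArg (fun X => (c⁻¹).1 ^ n • X) hn
        simpa only [smul_pow, smul_smul, ← mul_pow, Units.inv_mul, one_pow, one_smul,
          smul_zero] using this)
      (fun h => hne (by rw [h, smul_zero]))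
      (fun ⟨v, hv⟩ => hreg ⟨v, by
        rw [eq_top_iff, ← hv, Submodule.span_le]
        rintro _ ⟨n, rfl⟩
        have : (redMat u ℓ 1 H ^ n) *ᵥ v =
            (c⁻¹).1 ^ n • ((c.1 • redMat u ℓ 1 H) ^ n *ᵥ v) := by
          rw [smul_pow, smul_mulVec, smul_smul, ← mul_pow, Units.inv_mul, one_pow, one_smul]
        change redMat u ℓ 1 H ^ n *ᵥ v ∈ Submodule.span _ _
        rw [this]
        exact Submodule.smul_mem _ _ (Submodule.subset_span ⟨n, rfl⟩)⟩)
    refine ⟨g, hg, ⟨0, 0, 0, 0, 0⟩, hS.isAdmissible_iff.2 ⟨⟨⟨0, by simp⟩, ⟨0, by simp⟩,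
      (hS.le_m_iff hS.pos).2 ⟨⟨0, by simp⟩, ⟨0, by simp⟩, ⟨0, by simp⟩⟩⟩, by simp, by simp, by simp⟩, ?_⟩
    have e : g.1 * (scal ε u ℓ • H) * (g⁻¹).1 - Params.mat ⟨0, 0, 0, 0, 0⟩ ε =
        scal ε u ℓ • (g.1 * H * (g⁻¹).1 - matE 0) := by
      rw [mul_smul_comm, smul_mul_assoc, smul_sub]
      unfold Params.mat matE
      simp
    rw [e]
    exact Submodule.smul_mem _ _ h
  | succ k hk ih =>
    obtain ⟨g, hg, P, hP, h⟩ := ih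
    obtain ⟨y, hy, P', hP', h'⟩ := hS.exists_conj_sub_mem_succ hk (hconj g hg) hP h
    refine ⟨y * g, Subgroup.mul_mem _ hy hg, P', hP', ?_⟩
    have e : (y * g).1 * B * ((y * g)⁻¹).1 = y.1 * (g.1 * B * (g⁻¹).1) * (y⁻¹).1 := by
      rw [_root_.mul_inv_rev, Units.val_mul, Units.val_mul]
      simp only [mul_assoc]
    rw [e]
    exact h'

end IsUniformized

end NormalFormExistence

/-! ### The choice of the normal form -/

section ChoiceOfNormalForm

variable {o : Type*} [CommRing o] [IsLocalRing o] {u : o} {ℓ q k : ℕ} {ϖ : BigRing u ℓ}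
  {ε : GroupType} {P : Params u ℓ} {ψ : AddChar (BigRing u ℓ) ℂ}

namespace IsUniformized

variable (hS : IsUniformized u ℓ q ϖ) (hψ : IsPrimitiveChar ψ) (hℓ : 2 ≤ ℓ)
include hS

lemma commute_of_mem {g h : GL (Fin 3) (BigRing u ℓ)} (hk : ℓ ≤ 2 * k) (hg : g.1 - 1 ∈ matP ϖ k)
    (hh : h.1 - 1 ∈ matP ϖ k) : g * h = h * g := by
  have h1 : (g.1 - 1) * (h.1 - 1) - (h.1 - 1) * (g.1 - 1) = 0 :=
    eq_zero_of_mem_matP hS.pow_eq_zero (comm_mem_matP hg hh le_rfl) (by omega)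
  rw [← comm_eq_comm_sub_one, sub_eq_zero] at h1
  exact Units.ext h1

include hψ hℓ

variable {V : Type*} [AddCommGroup V] [Module ℂ V] [FiniteDimensional ℂ V]
    (χ : Representation ℂ (grp ε u ℓ) V)

/-- The group `G^ℓ₂` has an eigenvector whose character comes from a matrix in normal form. -/
lemma exists_eigenvector_psiLin (hχ' : IsNonRegularNilpotent ε ψ χ) :
    ∃ P : Params u ℓ, P.IsAdmissible ε ∧ ∃ v : V, v ≠ 0 ∧ ∀ g (hg : g ∈ grp ε u ℓ),
      g ∈ cong (grp ε u ℓ) (ℓ - ℓ / 2) → χ ⟨g, hg⟩ v = psiLin ψ (P.mat ε) g • v := by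
  obtain ⟨X, hX, hnil, hne, hreg, -, v₀, hv₀, hv₀'⟩ := hχ'
  rw [hS.mem_lieRing_iff] at hX
  let E : Submodule ℂ V :=
    { carrier := {v | ∀ g (hg : g ∈ grp ε u ℓ), g ∈ cong (grp ε u ℓ) (ℓ - 1) →
        χ ⟨g, hg⟩ v = psiLin ψ X g • v}
      add_mem' := fun {a b} ha hb g hg h1 => by
        rw [map_add, ha g hg h1, hb g hg h1, smul_add]
      zero_mem' := fun g hg _ => by rw [map_zero, smul_zero]
      smul_mem' := fun c a ha g hg h1 => by rw [map_smul, ha g hg h1, smul_comm] }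
  have hle : cong (grp ε u ℓ) (ℓ - 1) ≤ cong (grp ε u ℓ) (ℓ - ℓ / 2) := fun g hg =>
    hS.mem_cong.2 ⟨(hS.mem_cong.1 hg).1, matP_anti (by omega) (hS.mem_cong.1 hg).2⟩
  have hcomm : ∀ g (hg : g ∈ grp ε u ℓ), g ∈ cong (grp ε u ℓ) (ℓ - ℓ / 2) →
      ∀ h (hh : h ∈ grp ε u ℓ), h ∈ cong (grp ε u ℓ) (ℓ - ℓ / 2) → ∀ v,
      χ ⟨g, hg⟩ (χ ⟨h, hh⟩ v) = χ ⟨h, hh⟩ (χ ⟨g, hg⟩ v) := by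
    intro g hg hgk h hh hhk v
    rw [← Module.End.mul_apply, ← Module.End.mul_apply, ← map_mul, ← map_mul]
    congr 2
    exact Subtype.ext (hS.commute_of_mem (by omega) (hS.mem_cong.1 hgk).2 (hS.mem_cong.1 hhk).2)
  -- `G^ℓ₂` is abelian, so that it has an eigenvector among those of `G^(ℓ - 1)` for `X`
  obtain ⟨w, hwE, hw0, ν, hν⟩ := exists_common_eigenvector
    (χ.comp (Subgroup.inclusion (cong_le (grp ε u ℓ) (ℓ - ℓ / 2)))) E
    (fun h => hv₀ ((Submodule.mem_bot ℂ).1 (h ▸ (hv₀' : v₀ ∈ E))))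
    (by
      rintro ⟨r, hr⟩ a ha g hg hgk
      change χ ⟨g, hg⟩ (χ ⟨r, cong_le _ _ hr⟩ a) = _ • χ ⟨r, cong_le _ _ hr⟩ a
      rw [hcomm g hg (hle hgk) r _ hr, ha g hg hgk, map_smul])
    (fun r s a _ => hcomm r.1 _ r.2 s.1 _ s.2 a)
  obtain ⟨D, -, hD, hDν⟩ := hS.exists_char_form hψ (ε := ε) (i := ℓ - ℓ / 2) (k := ℓ) (by omega) le_rfl
    (T := cong (grp ε u ℓ) (ℓ - ℓ / 2)) le_rfl ν (fun g hg => by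
      have h1 := eq_zero_of_mem_matP hS.pow_eq_zero hg le_rfl
      have h2 : g = 1 := Subtype.ext (Units.ext (sub_eq_zero.1 h1))
      rw [h2, map_one])
  -- the matrix `D` of the character of `G^ℓ₂` reduces to that of `X`, and has a normal form
  have hDX : D - X ∈ matP ϖ 1 := by
    have := hS.mem_matP_of_forall hψ (ε := ε) (D := D - X) (by rw [tau_sub, hD, hX]) (k := ℓ - 1)
      (by omega) (fun Y hY hY' => by
        obtain ⟨g, hg, rfl⟩ := hS.exists_grp_eq_one_add ε (by omega) (by omega) hY hY'
        have h1 : χ ⟨g, cong_le _ _ hg⟩ w = ν ⟨g, hle hg⟩ • w := hν ⟨g, hle hg⟩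
        rw [hwE g _ hg, hDν] at h1
        have h2 : psiLin ψ X g = ψ (trace (D * (g.1 - 1))) := smul_left_injective ℂ hw0 h1
        rw [sub_mul, trace_sub, AddChar.map_sub_eq_div, ← h2]
        exact div_self (ψ.val_isUnit _).ne_zero)
    rwa [Nat.sub_sub_self (by omega)] at this
  rw [← hS.redMat_eq_iff.2 hDX] at hnil hne hreg
  obtain ⟨g, hg, P, hP, hgP⟩ := hS.exists_conj_eq_mat hD hnil hne hreg
  refine ⟨P, hP, χ ⟨g, hg⟩ w, fun h => hw0 ?_, fun b hb hbk => ?_⟩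
  · have := congrArg (χ ⟨g, hg⟩⁻¹) h
    rwa [map_zero, ← Module.End.mul_apply, ← map_mul, inv_mul_cancel, map_one] at this
  · have hb' : g⁻¹ * b * g ∈ cong (grp ε u ℓ) (ℓ - ℓ / 2) := by
      have := conj_mem_cong (Subgroup.inv_mem _ hg) hbk
      rwa [inv_inv] at this
    have h1 : χ ⟨g⁻¹ * b * g, cong_le _ _ hb'⟩ w = ν ⟨_, hb'⟩ • w := hν ⟨_, hb'⟩
    rw [hDν] at h1
    have h2 : trace (D * ((g⁻¹ * b * g).1 - 1)) = trace (P.mat ε * (b.1 - 1)) := by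
      have e : (g⁻¹ * b * g).1 - 1 = (g⁻¹).1 * (b.1 - 1) * g.1 := by
        rw [mul_sub, sub_mul, mul_one, Units.inv_mul]; rfl
      rw [e, ← hgP, ← mul_assoc, trace_mul_comm, ← mul_assoc, ← mul_assoc]
    have h3 : χ ⟨b, hb⟩ (χ ⟨g, hg⟩ w) = χ ⟨g, hg⟩ (χ ⟨g⁻¹ * b * g, cong_le _ _ hb'⟩ w) := by
      rw [← Module.End.mul_apply, ← Module.End.mul_apply, ← map_mul, ← map_mul]
      congr 2
      ext1
      simp only [Subgroup.coe_mul]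
      group
    rw [h3, h1, map_smul]
    change ψ (trace (D * ((g⁻¹ * b * g).1 - 1))) • _ = _
    rw [h2]
    rfl

/-- The normal form can be chosen such that the radical has an eigenvector with the character
`psiLog`. -/
theorem exists_eigenvector_psiLog (hχ' : IsNonRegularNilpotent ε ψ χ) :
    ∃ (P : Params u ℓ) (hP : P.IsAdmissible ε) (μ n₁ n₂ : ℕ) (hd : IsDepth P μ n₁ n₂),
      (P.m < ℓ - ℓ / 2 → μ = P.m ∧ n₁ = (ℓ - P.m) / 2 ∧ n₂ = ℓ - P.m - (ℓ - P.m) / 2) ∧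
      (ℓ - ℓ / 2 ≤ P.m → n₁ = ℓ / 2 ∧ n₂ = ℓ / 2) ∧
      ∃ v : V, v ≠ 0 ∧ ∀ g (hg : g ∈ grp ε u ℓ), g ∈ (hd.isQuadraticChar hS hψ hP).radical →
        χ ⟨g, hg⟩ v = psiLog ψ (P.mat ε) g • v := by
  have hm : ∀ {P : Params u ℓ}, P.IsAdmissible ε → 1 ≤ P.m := fun hP =>
    (hS.isAdmissible_iff.1 hP).1.2.2
  -- two perturbations: the first one passes from `G^ℓ₂` to the radical of `I^ℓ₁`, which suffices
  -- for `m ≥ ℓ₂`; otherwise the second one passes to the larger radical for the depth `m₁`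
  obtain ⟨P₀, hP₀, v₀, hv₀, hv₀'⟩ := hS.exists_eigenvector_psiLin hψ hℓ χ hχ'
  have hd₀ := isDepth_half (hm hP₀) hℓ
  obtain ⟨H, -, hP₁, v₁, hv₁, hv₁'⟩ := hd₀.exists_perturb hS hψ hP₀ (k := ℓ - ℓ / 2) (by omega)
    le_rfl (fun g hg => by
      have h1 := (hS.mem_cong.1 ((hd₀.isQuadraticChar hS hψ hP₀).radical_le hg)).2
      exact ((hS.mem_stabMod_iff hP₀ hℓ).1 (hd₀.mem_stabMod_of_mem_radical hS hψ hP₀ hg h1)).2)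
    χ hv₀ (fun g hg _ hgk => by
      rw [hv₀' g hg (hS.mem_cong.2 ⟨hg, hgk⟩),
        hS.psiLog_eq_of_mem (mem_matP_zero _) hgk (by omega)])
  generalize P₀.perturb H = P₁ at hP₁ hv₁'
  have hd₁ := isDepth_half (hm hP₁) hℓ
  by_cases hm₁ : ℓ - ℓ / 2 ≤ P₁.m
  · exact ⟨P₁, hP₁, _, _, _, hd₁, fun h => absurd h (not_lt.2 hm₁), fun _ => ⟨rfl, rfl⟩, v₁, hv₁,
      hv₁' hP₁ hd₁⟩
  · rw [not_le] at hm₁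
    have hd := isDepth_of_lt hm₁ (hm hP₁)
    obtain ⟨H', hH', hP₂, v₂, hv₂, hv₂'⟩ := hd.exists_perturb hS hψ hP₁ (k := ℓ / 2)
      hd.half_le_two_mul (by omega) (fun g hg =>
        ((hd.mem_cong_inertia hS hψ hP₁).1 ((hd.isQuadraticChar hS hψ hP₁).radical_le hg)).2)
      χ hv₁ (fun g hg hgR hgk => hv₁' hP₁ hd₁ g hg (hd₁.sup_le_radical hS hψ hP₁
        (hd₁.stabMod_le_sup hS hP₁ (hd.mem_stabMod_of_mem_radical hS hψ hP₁ hgR hgk))))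
    -- the second perturbation lies in `𝔓 ^ ℓ₂` and does not change `m < ℓ₂`
    have hmm : (P₁.perturb H').m = P₁.m := by
      refine le_antisymm ?_ ((hS.le_m_perturb_iff hH' (by omega) hm₁.le).2 le_rfl)
      by_contra h
      have := (hS.le_m_perturb_iff (P := P₁) hH' (by omega) (j := P₁.m + 1) (by omega)).1 (by omega)
      omega
    have hd₂ := isDepth_of_lt (P := P₁.perturb H') (by omega) (hm hP₂)
    rw [hmm] at hd₂
    refine ⟨_, hP₂, P₁.m, _, _, hd₂, fun _ => ⟨hmm.symm, by rw [hmm], by rw [hmm]⟩,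
      fun h => by omega, v₂, hv₂, fun g hg hgR => hv₂' hP₂ hd₂ g hg hgR⟩

end IsUniformized

end ChoiceOfNormalForm

/-! ### Extension to the inertia group for large `m` -/

section ExtensionLarge

lemma two_mul_det_one_add {R : Type*} [CommRing R] (X : Matrix (Fin 3) (Fin 3) R) :
    2 * (1 + X).det = 2 + 2 * trace X + trace X * trace X - trace (X * X) + 2 * X.det := by
  simp [det_fin_three, trace_fin_three, Matrix.mul_apply, Fin.sum_univ_three]
  ring

/-- The entry `a - δ z` defines a ring homomorphism on the commutant. -/
lemma mul_apply_lieJ {R : Type*} [CommRing R] {δ : R} {X Y : Matrix (Fin 3) (Fin 3) R}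
    (hX : X ∈ lieJ δ) (hY : Y ∈ lieJ δ) :
    (X * Y) 0 0 - δ * (X * Y) 0 2 = (X 0 0 - δ * X 0 2) * (Y 0 0 - δ * Y 0 2) := by
  rw [eq_matJ hX, eq_matJ hY]
  simp [matJ, Matrix.mul_apply, Fin.sum_univ_three]
  ring

lemma trace_matE_mul {R : Type*} [CommRing R] {δ : R} {X : Matrix (Fin 3) (Fin 3) R}
    (hX : X ∈ lieJ δ) :
    trace (matE δ * X) = δ * (trace X - 2 * (X 0 0 - δ * X 0 2)) := by
  rw [eq_matJ hX]
  simp [matJ, matE, trace_fin_three]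
  ring

lemma logm_eq_of_cube_eq_zero {R : Type*} [CommRing R] (h2 : IsUnit (2 : R)) {g : GL (Fin 3) R}
    (h : (g.1 - 1) * ((g.1 - 1) * (g.1 - 1)) = 0) :
    logm g = (g.1 - 1) - Ring.inverse (2 : R) • ((g.1 - 1) * (g.1 - 1)) := by
  have h3 : (g.1 - 1) ^ 3 = 0 := by rw [pow_succ', sq, h]
  have h4 : (g.1 - 1) ^ 4 = 0 := by rw [pow_succ, h3, zero_mul]
  rw [logm_eq h2, h3, h4, sq, smul_zero, smul_zero, add_zero, sub_zero]

/-- The logarithm of an element of the commutant with determinant `1` and `a - δ z = 1` has trace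
zero, and so has its product with `E + δ E_{22} + δ ^ 2 E_{31}`. -/
lemma trace_log_eq_zero {R : Type*} [CommRing R] {ϖ δ : R} {k ℓ : ℕ} (h2 : IsUnit (2 : R))
    (hϖ : ϖ ^ ℓ = 0) (hk : ℓ ≤ 3 * k) {X : Matrix (Fin 3) (Fin 3) R} (hXJ : X ∈ lieJ δ)
    (hX : X ∈ matP ϖ k) (hdet : (1 + X).det = 1) (hκ : X 0 0 - δ * X 0 2 = 0) :
    trace (X - Ring.inverse (2 : R) • (X * X)) = 0 ∧
      trace (matE δ * (X - Ring.inverse (2 : R) • (X * X))) = 0 := by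
  have h0 : ∀ n, ℓ ≤ n → ϖ ^ n = 0 := fun n hn => pow_eq_zero_of_le hn hϖ
  have hX2 : X * X ∈ matP ϖ (2 * k) := mul_mem_matP hX hX (by omega)
  obtain ⟨Y, hY⟩ := mem_matP.1 hX
  obtain ⟨Y2, hY2⟩ := mem_matP.1 hX2
  have hdX : X.det = 0 := by
    rw [hY, det_smul, ← pow_mul, Fintype.card_fin, h0 _ (by omega), zero_mul]
  have htr : 2 * trace X = trace (X * X) - trace X * trace X := by
    have := two_mul_det_one_add X
    rw [hdX, hdet] at this
    linear_combination -this
  have htt : trace X * trace X = 0 := by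
    refine h2.mul_left_cancel ?_
    have e : 2 * (trace X * trace X) = trace X * (trace (X * X) - trace X * trace X) := by
      rw [← htr]; ring
    rw [e, mul_zero, hY2, hY, trace_smul, trace_smul, smul_eq_mul, smul_eq_mul]
    linear_combination trace Y * (trace Y2 - trace Y * trace Y) * h0 (3 * k) hk
  have htl : trace (X - Ring.inverse (2 : R) • (X * X)) = 0 := by
    refine h2.mul_left_cancel ?_
    rw [trace_sub, trace_smul, smul_eq_mul, mul_sub, ← mul_assoc 2,
      Ring.mul_inverse_cancel _ h2, one_mul, htr, htt, sub_zero, sub_self, mul_zero]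
  refine ⟨htl, ?_⟩
  rw [trace_matE_mul (sub_mem hXJ (Submodule.smul_mem _ _ (mul_mem_lieJ hXJ hXJ))), htl]
  have hκ2 := mul_apply_lieJ hXJ hXJ
  rw [hκ, zero_mul] at hκ2
  simp only [Matrix.sub_apply, Matrix.smul_apply, smul_eq_mul]
  linear_combination (-2 * δ) * hκ + 2 * δ * Ring.inverse 2 * hκ2

variable {o : Type*} [CommRing o] [IsLocalRing o] {u : o} {ℓ q k : ℕ} {ϖ : BigRing u ℓ}
  {ε : GroupType} {P : Params u ℓ} {ψ : AddChar (BigRing u ℓ) ℂ}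

/-- The homomorphism `g ↦ (det g, a - δ z)` on `J`. -/
def grpJHom (ε : GroupType) (δ : BigRing u ℓ) :
    grpJ ε δ →* (BigRing u ℓ)ˣ × (BigRing u ℓ)ˣ :=
  (GeneralLinearGroup.det.comp (grpJ ε δ).subtype).prod
    (MonoidHom.toHomUnits
      { toFun := fun g => g.1.1 0 0 - δ * g.1.1 0 2
        map_one' := by simp
        map_mul' := fun g h => mul_apply_lieJ (IsUniformized.mem_grpJ.1 g.2).2 (IsUniformized.mem_grpJ.1 h.2).2 })

lemma IsUniformized.trace_eq_zero_of_grpJHom_eq_one (hS : IsUniformized u ℓ q ϖ) (hℓ : 2 ≤ ℓ)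
    (hm : ℓ - ℓ / 2 ≤ P.m) {g : grpJ ε P.δ} (hg : g.1.1 - 1 ∈ matP ϖ (ℓ / 2))
    (h : grpJHom ε P.δ g = 1) : trace (P.mat ε * logm g.1) = 0 := by
  have hdet : g.1.1.det = 1 := congrArg (fun x => x.1.1) h
  have hκ : g.1.1 0 0 - P.δ * g.1.1 0 2 = 1 := congrArg (fun x => x.2.1) h
  obtain ⟨h1, h2⟩ := trace_log_eq_zero hS.isUnit_two hS.pow_eq_zero (by omega)
    (sub_mem (IsUniformized.mem_grpJ.1 g.2).2 one_mem_lieJ) hg (by rw [add_sub_cancel, hdet]) (by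
      rw [Matrix.sub_apply, Matrix.sub_apply, Matrix.one_apply_eq,
        Matrix.one_apply_ne (by decide)]
      linear_combination hκ)
  rw [← logm_eq_of_cube_eq_zero hS.isUnit_two (eq_zero_of_mem_matP hS.pow_eq_zero
    (mul_mem_matP hg (mul_mem_matP hg hg le_rfl) le_rfl) (by omega))] at h1 h2
  have h3 : trace ((P.mat ε - scal ε u ℓ • (P.ω • 1 + matE P.δ)) * logm g.1) = 0 :=
    trace_mul_eq_zero hS.pow_eq_zero (hS.mat_sub_mem ε) (hS.logm_mem hg) (by omega)
  rw [sub_mul, trace_sub, smul_mul_assoc, trace_smul, add_mul, trace_add, h2, smul_mul_assoc,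
    one_mul, trace_smul, h1, smul_zero, add_zero, smul_zero, sub_zero] at h3
  exact h3

lemma IsDepth.cong_le_cong_inertia {μ n₁ n₂ : ℕ} (hd : IsDepth P μ n₁ n₂) (hS : IsUniformized u ℓ q ϖ)
    (hψ : IsPrimitiveChar ψ) (hP : P.IsAdmissible ε) :
    cong (grp ε u ℓ) (ℓ / 2) ≤ cong (inertia ε ψ (P.mat ε)) n₁ := fun g hg => by
  obtain ⟨hg, hgk⟩ := hS.mem_cong.1 hg
  exact (hd.mem_cong_inertia hS hψ hP).2 ⟨hg, mem_lieN.2 ⟨0, zero_mem _, zero_mem _, by simpa⟩⟩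

/-- For `m ≥ ℓ₂` the representation of the group `N` extends to the inertia group. -/
theorem IsDepth.exists_extends_inertia {μ : ℕ} (hd : IsDepth P μ (ℓ / 2) (ℓ / 2))
    (hS : IsUniformized u ℓ q ϖ) (hψ : IsPrimitiveChar ψ) (hP : P.IsAdmissible ε) (hℓ : 2 ≤ ℓ)
    (hm : ℓ - ℓ / 2 ≤ P.m) {W : Type*} [AddCommGroup W] [Module ℂ W] [FiniteDimensional ℂ W]
    {σ : Representation ℂ (cong (inertia ε ψ (P.mat ε)) (ℓ / 2)) W}
    (hσ : IsMonomialAbove σ (hd.isQuadraticChar hS hψ hP).radical (psiLog ψ (P.mat ε)))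
    (hdim : Module.finrank ℂ W ^ 2 =
      (hd.isQuadraticChar hS hψ hP).radical.relIndex (cong (inertia ε ψ (P.mat ε)) (ℓ / 2))) :
    ∃ σ' : Representation ℂ (inertia ε ψ (P.mat ε)) W, Extends σ σ' := by
  have := hS.finite_GL
  have hfin := hS.finite
  set Q := hd.isQuadraticChar hS hψ hP
  have hTR : cong (grpJ ε P.δ) (ℓ / 2) ≤ Q.radical :=
    le_sup_left.trans (hd.sup_le_radical hS hψ hP)
  have hTI : grpJ ε P.δ ≤ inertia ε ψ (P.mat ε) := fun t ht =>
    (hS.mem_inertia_iff_of_le hψ hℓ hP hm).2 ⟨t, ht, 1, one_mem _, (mul_one t).symm⟩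
  -- `psiLog` on `J^ℓ₁` factors through `(det g, a - δ z)`, hence extends to a character of `J`
  obtain ⟨Φ, hΦ⟩ := exists_monoidHom_comp_eq
    ((grpJHom ε P.δ).comp (Subgroup.inclusion (cong_le (grpJ ε P.δ) (ℓ / 2))))
    { toFun := fun t => psiLog ψ (P.mat ε) t
      map_one' := Q.map_one
      map_mul' := fun a b => Q.map_radical_mul (hTR a.2) (Q.radical_le (hTR b.2)) }
    (fun t ht => by
      change ψ (trace (P.mat ε * logm t.1)) = 1
      have : trace (P.mat ε * logm t.1) = 0 := hS.trace_eq_zero_of_grpJHom_eq_one hℓ hm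
        (g := Subgroup.inclusion (cong_le (grpJ ε P.δ) (ℓ / 2)) t) (hS.mem_cong.1 t.2).2 ht
      rw [this, AddChar.map_zero_eq_one])
  have hcong : ∀ t ∈ grpJ ε P.δ, t ∈ cong (inertia ε ψ (P.mat ε)) (ℓ / 2) →
      t ∈ cong (grpJ ε P.δ) (ℓ / 2) := fun t ht htN =>
    hS.mem_cong.2 ⟨ht, (hS.mem_cong.1 htN).2⟩
  refine Q.exists_extension (T := grpJ ε P.δ) (fun r hr => hσ.2.2.1 r r.2 hr)
    (hd.odd_card_cong hS) hσ.1 hdim (cong_le _ _) (fun x hx => ?_)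
    (fun t ht n => mem_cong_conj_iff (hTI ht)) (fun t ht n hn => ?_)
    (fun t ht => hTR (hcong t ht.1 ht.2)) (Φ.comp (grpJHom ε P.δ))
    (fun t ht => hΦ ⟨t, hcong t t.2 ht⟩)
  · obtain ⟨j, hj, b, hb, rfl⟩ := (hS.mem_inertia_iff_of_le hψ hℓ hP hm).1 hx
    exact ⟨j, hj, b, hd.cong_le_cong_inertia hS hψ hP hb, rfl⟩
  · rw [psiLog_conj, trace_mul_eq_zero hS.pow_eq_zero (conj_sub_mem_iff.2
      (hS.comm_mat_mem_of_lieJ (a := 0) (c := P.m) (IsUniformized.mem_grpJ.1 ht).2 (mem_matP_zero _) (by omega)))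
      (hS.logm_mem (hS.mem_cong.1 hn).2) (by omega), AddChar.map_zero_eq_one, mul_one]

end ExtensionLarge

/-! ### The commutant of the normal form -/

section NormalFormCommutant

/-- The normal form without its scalar part; `c` stands for `π ^ m` and `c α`, `c β`, `c γ` for the
parameters `α`, `β`, `γ`. -/
def matF {R : Type*} [CommRing R] (δ c α β γ : R) : Matrix (Fin 3) (Fin 3) R :=
  !![0, 0, 1; c * α, δ, 0; δ ^ 2 + c * γ, c * β, 0]

/-- The matrix `(F ^ 2 - δ ^ 2) / c`, where `F = matF δ c α β γ`. -/
def matB {R : Type*} [CommRing R] (δ c α β γ : R) : Matrix (Fin 3) (Fin 3) R :=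
  !![γ, β, 0; δ * α, 0, α; c * α * β, β * δ, γ]

lemma matF_mul_matB {R : Type*} [CommRing R] (δ c α β γ : R) :
    matF δ c α β γ * matB δ c α β γ = matB δ c α β γ * matF δ c α β γ := by
  ext1 i j
  fin_cases i <;> fin_cases j <;>
    simp [matF, matB, Matrix.mul_apply, Fin.sum_univ_three] <;> ring

/-- Commuting with `F` is, up to the entries that are determined linearly, the vanishing of the
cross product of `(a - b + δ z, x, y)` and `(γ, β, α)`, multiplied by `c`. -/
lemma entries_of_matF_comm {R : Type*} [CommRing R] {δ c α β γ : R} {G : Matrix (Fin 3) (Fin 3) R}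
    (h : matF δ c α β γ * G = G * matF δ c α β γ) :
    (G 2 2 = G 0 0 ∧ G 1 0 = c * α * G 0 2 + δ * G 1 2 ∧
      G 2 0 = c * α * G 0 1 + (δ ^ 2 + c * γ) * G 0 2 ∧ G 2 1 = δ * G 0 1 + c * β * G 0 2) ∧
    c * (α * (G 0 0 - G 1 1 + δ * G 0 2) - γ * G 1 2) = 0 ∧
    c * (γ * G 0 1 - β * (G 0 0 - G 1 1 + δ * G 0 2)) = 0 ∧
    c * (β * G 1 2 - α * G 0 1) = 0 := by
  have e := fun i j => congrFun (congrFun h i) j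
  simp only [matF, Matrix.mul_apply, Fin.sum_univ_three] at e
  have e00 := e 0 0
  have e01 := e 0 1
  have e02 := e 0 2
  have e10 := e 1 0
  have e11 := e 1 1
  have e12 := e 1 2
  have e20 := e 2 0
  have e21 := e 2 1
  simp at e00 e01 e02 e10 e11 e12 e20 e21
  refine ⟨⟨?_, ?_, ?_, ?_⟩, ?_, ?_, ?_⟩
  · linear_combination e02
  · linear_combination -e12
  · linear_combination e00
  · linear_combination e01
  · linear_combination e10 + δ * e12
  · linear_combination e21 + δ * e01 + c * β * e02
  · linear_combination -e11

/-- A vector with vanishing cross product with a unimodular one is a multiple of it. -/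
lemma eq_span_matF_matB {R : Type*} [CommRing R] {δ c α β γ : R}
    (hu : IsUnit α ∨ IsUnit β ∨ IsUnit γ) {G : Matrix (Fin 3) (Fin 3) R}
    (h : G 2 2 = G 0 0 ∧ G 1 0 = c * α * G 0 2 + δ * G 1 2 ∧
      G 2 0 = c * α * G 0 1 + (δ ^ 2 + c * γ) * G 0 2 ∧ G 2 1 = δ * G 0 1 + c * β * G 0 2)
    (h1 : α * (G 0 0 - G 1 1 + δ * G 0 2) - γ * G 1 2 = 0)
    (h2 : γ * G 0 1 - β * (G 0 0 - G 1 1 + δ * G 0 2) = 0)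
    (h3 : β * G 1 2 - α * G 0 1 = 0) :
    ∃ s z t : R, G = s • 1 + z • matF δ c α β γ + t • matB δ c α β γ := by
  obtain ⟨t, ht1, ht2, ht3⟩ : ∃ t, G 0 0 - G 1 1 + δ * G 0 2 = t * γ ∧ G 0 1 = t * β ∧
      G 1 2 = t * α := by
    rcases hu with hu | hu | hu <;> obtain ⟨i, hi⟩ := hu.exists_left_inv
    · refine ⟨i * G 1 2, ?_, ?_, ?_⟩
      · linear_combination -(G 0 0 - G 1 1 + δ * G 0 2) * hi + i * h1
      · linear_combination -G 0 1 * hi - i * h3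
      · linear_combination -G 1 2 * hi
    · refine ⟨i * G 0 1, ?_, ?_, ?_⟩
      · linear_combination -(G 0 0 - G 1 1 + δ * G 0 2) * hi - i * h2
      · linear_combination -G 0 1 * hi
      · linear_combination -G 1 2 * hi + i * h3
    · refine ⟨i * (G 0 0 - G 1 1 + δ * G 0 2), ?_, ?_, ?_⟩
      · linear_combination -(G 0 0 - G 1 1 + δ * G 0 2) * hi
      · linear_combination -G 0 1 * hi + i * h2
      · linear_combination -G 1 2 * hi - i * h1
  obtain ⟨e1, e2, e3, e4⟩ := h
  refine ⟨G 0 0 - t * γ, G 0 2, t, ?_⟩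
  ext1 i j
  fin_cases i <;> fin_cases j <;> simp [matF, matB]
  · linear_combination ht2
  · linear_combination e2 + δ * ht3
  · linear_combination -ht1
  · linear_combination ht3
  · linear_combination e3 + c * α * ht2
  · linear_combination e4 + δ * ht2
  · linear_combination e1

/-- The commutant of `matF`, modulo a power of `ϖ`, is spanned by `1`, `matF` and `matB`. The division
by `c = ϖ ^ m` is the reason why commuting modulo `ϖ ^ (m + n)` is needed. -/
lemma exists_sub_mem_of_matF_comm {R : Type*} [CommRing R] {ϖ δ c α β γ : R} {m n : ℕ}
    (hu : IsUnit α ∨ IsUnit β ∨ IsUnit γ) (hc : c = ϖ ^ m)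
    (hcan : ∀ x y, ϖ ^ m * x = ϖ ^ (m + n) * y → ∃ z, x = ϖ ^ n * z)
    {G : Matrix (Fin 3) (Fin 3) R}
    (h : matF δ c α β γ * G - G * matF δ c α β γ ∈ matP ϖ (m + n)) :
    ∃ s z t : R, G - (s • 1 + z • matF δ c α β γ + t • matB δ c α β γ) ∈ matP ϖ n := by
  have hmk : ∀ (k : ℕ) (x y : R), Ideal.Quotient.mk (Ideal.span {ϖ ^ k}) x =
      Ideal.Quotient.mk (Ideal.span {ϖ ^ k}) y ↔ ∃ z, x - y = ϖ ^ k * z := fun k x y => by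
    rw [Ideal.Quotient.eq, Ideal.mem_span_singleton]; rfl
  have hred : ∀ (k : ℕ) (X Y : Matrix (Fin 3) (Fin 3) R), X - Y ∈ matP ϖ k ↔
      X.map (Ideal.Quotient.mk (Ideal.span {ϖ ^ k})) =
        Y.map (Ideal.Quotient.mk (Ideal.span {ϖ ^ k})) := fun k X Y => by
    rw [mem_matP_iff, ← Matrix.ext_iff]
    exact forall₂_congr fun i j => by rw [Matrix.map_apply, Matrix.map_apply, hmk, Matrix.sub_apply]
  have hF : ∀ {S : Type _} [CommRing S] (f : R →+* S),
      (matF δ c α β γ).map f = matF (f δ) (f c) (f α) (f β) (f γ) := fun f => by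
    ext1 i j; fin_cases i <;> fin_cases j <;> simp [matF]
  have hB : ∀ {S : Type _} [CommRing S] (f : R →+* S),
      (matB δ c α β γ).map f = matB (f δ) (f c) (f α) (f β) (f γ) := fun f => by
    ext1 i j; fin_cases i <;> fin_cases j <;> simp [matB]
  set f := Ideal.Quotient.mk (Ideal.span {ϖ ^ (m + n)}) with hf
  set g := Ideal.Quotient.mk (Ideal.span {ϖ ^ n}) with hg
  rw [hred, Matrix.map_mul, Matrix.map_mul, hF] at h
  obtain ⟨⟨h1, h2, h3, h4⟩, h5, h6, h7⟩ := entries_of_matF_comm h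
  simp only [Matrix.map_apply, ← map_mul, ← map_add, ← map_sub, ← map_pow] at h1 h2 h3 h4 h5 h6 h7
  -- equations modulo `ϖ ^ (m + n)` hold modulo `ϖ ^ n`, after division by `ϖ ^ m` if possible
  have hlow : ∀ x y, f x = f y → g x = g y := fun x y hxy => by
    obtain ⟨z, hz⟩ := (hmk _ _ _).1 hxy
    exact (hmk _ _ _).2 ⟨ϖ ^ m * z, by rw [hz]; ring⟩
  have hdiv : ∀ x, f (c * x) = 0 → g x = 0 := fun x hx => by
    rw [← map_zero f] at hx
    obtain ⟨z, hz⟩ := (hmk _ _ _).1 hx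
    rw [sub_zero, hc] at hz
    obtain ⟨w, hw⟩ := hcan _ _ hz
    rw [← map_zero g]
    exact (hmk _ _ _).2 ⟨w, by rw [sub_zero, hw]⟩
  have k1 := hlow _ _ h1
  have k2 := hlow _ _ h2
  have k3 := hlow _ _ h3
  have k4 := hlow _ _ h4
  have k5 := hdiv _ h5
  have k6 := hdiv _ h6
  have k7 := hdiv _ h7
  simp only [map_mul, map_add, map_sub, map_pow] at k1 k2 k3 k4 k5 k6 k7
  obtain ⟨s, z, t, e⟩ := eq_span_matF_matB (δ := g δ) (c := g c) (α := g α) (β := g β) (γ := g γ)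
    (hu.imp (·.map g) (Or.imp (·.map g) (·.map g))) (G := G.map g) ⟨k1, k2, k3, k4⟩ k5 k6 k7
  obtain ⟨s, rfl⟩ := Ideal.Quotient.mk_surjective s
  obtain ⟨z, rfl⟩ := Ideal.Quotient.mk_surjective z
  obtain ⟨t, rfl⟩ := Ideal.Quotient.mk_surjective t
  refine ⟨s, z, t, (hred _ _ _).2 ?_⟩
  rw [e, ← hF, ← hB]
  ext1 i j
  by_cases hij : i = j <;>
    simp only [Matrix.map_apply, Matrix.add_apply, Matrix.smul_apply, smul_eq_mul, map_add, map_mul,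
      Matrix.one_apply, hij, if_true, if_false, map_one, map_zero, ← hg]

end NormalFormCommutant

/-! ### The inertia group for small `m` -/

section InertiaSmall

variable {o : Type*} [CommRing o] [IsLocalRing o] {u : o} {ℓ q k : ℕ} {ϖ : BigRing u ℓ}
  {ε : GroupType} {P : Params u ℓ} {ψ : AddChar (BigRing u ℓ) ℂ}

lemma mat_eq_smul_matF {R : Type*} [CommRing R] (ω δ c α β γ : R) :
    (!![ω, 0, 1; c * α, ω + δ, 0; δ ^ 2 + c * γ, c * β, ω] : Matrix (Fin 3) (Fin 3) R) =
      ω • 1 + matF δ c α β γ := by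
  ext1 i j
  fin_cases i <;> fin_cases j <;> simp [matF]

lemma theta_matF_matB {R : Type*} [CommRing R] [StarRing R] {δ c α β γ : R} (hδ : star δ = δ)
    (hc : star c = c) (hγ : star γ = γ) (h1 : ε = .linear → star α = α ∧ star β = β)
    (h2 : ε = .unitary → α = star β) :
    theta ε (matF δ c α β γ) = matF δ c α β γ ∧ theta ε (matB δ c α β γ) = matB δ c α β γ := by
  cases ε
  · obtain ⟨hα, hβ⟩ := h1 rfl
    constructor
    · change (matF δ c α β γ).map star = _
      rw [matF, map_of_fin_three]
      simp [hδ, hc, hγ, hα, hβ]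
    · change (matB δ c α β γ).map star = _
      rw [matB, map_of_fin_three]
      simp [hδ, hc, hγ, hα, hβ]
  · have hα := h2 rfl
    have hβ : star α = β := by rw [hα, star_star]
    constructor
    · change adj (matF δ c α β γ) = _
      rw [matF, adj_of_fin_three]
      simp [hδ, hc, hγ, hβ, ← hα]
    · change adj (matB δ c α β γ) = _
      rw [matB, adj_of_fin_three]
      simp [hδ, hc, hγ, hβ, ← hα]
      ring_nf
      simp

/-- The parameters `α`, `β`, `γ` divided by `π ^ m`. -/
lemma IsUniformized.exists_primitive (hS : IsUniformized u ℓ q ϖ) (hP : P.IsAdmissible ε)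
    (hm : P.m < ℓ) : ∃ α β γ : BigRing u ℓ, (IsUnit α ∨ IsUnit β ∨ IsUnit γ) ∧
      star γ = γ ∧ (ε = .linear → star α = α ∧ star β = β) ∧ (ε = .unitary → α = star β) ∧
      P.α = ϖ ^ P.m * α ∧ P.β = ϖ ^ P.m * β ∧ P.γ = ϖ ^ P.m * γ := by
  obtain ⟨-, ⟨-, -, hγs⟩, hlin, hun⟩ := hS.isAdmissible_iff.1 hP
  obtain ⟨⟨α, hα⟩, ⟨β, hβ⟩, γ, hγ⟩ := (hS.le_m_iff (P := P) hm.le).1 le_rfl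
  have hϖ : star (ϖ ^ P.m) = ϖ ^ P.m := by rw [star_pow, hS.star_unif]
  have hstar : ∀ x y : BigRing u ℓ, x = ϖ ^ P.m * y → star x = ϖ ^ P.m * star y := fun x y h => by
    rw [h, star_mul, hϖ, mul_comm]
  have hreal : ∀ x y : BigRing u ℓ, star x = x → x = ϖ ^ P.m * y →
      ∃ z, star z = z ∧ x = ϖ ^ P.m * z := fun x y hx hy => by
    refine ⟨Ring.inverse 2 * (y + star y), ?_, ?_⟩
    · rw [star_mul, hS.star_inverse_two, star_add, star_star, mul_comm, add_comm]
    · have h1 := hstar x y hy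
      rw [hx] at h1
      have h2 := hS.half_add_half x
      rw [← h2]
      nth_rw 1 [hy]
      rw [h1]
      ring
  have hunit : ∀ a b c, P.α = ϖ ^ P.m * a → P.β = ϖ ^ P.m * b → P.γ = ϖ ^ P.m * c →
      (IsUnit a ∨ IsUnit b ∨ IsUnit c) := fun a b c ha hb hc => by
    by_contra hcon
    push Not at hcon
    have hz : ∀ x : BigRing u ℓ, ¬ IsUnit x → ∃ y, x = ϖ * y := fun x hx => by
      have : x ∈ bigP u ℓ := by
        by_contra h
        exact hx (hS.isUnit_of_notMem x h)
      rw [hS.bigP_eq, Ideal.mem_span_singleton] at this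
      exact this
    obtain ⟨a', ha'⟩ := hz a hcon.1
    obtain ⟨b', hb'⟩ := hz b hcon.2.1
    obtain ⟨c', hc'⟩ := hz c hcon.2.2
    have := (hS.le_m_iff (P := P) (k := P.m + 1) hm).2 ⟨⟨a', by rw [ha, ha', pow_succ, mul_assoc]⟩,
      ⟨b', by rw [hb, hb', pow_succ, mul_assoc]⟩, c', by rw [hc, hc', pow_succ, mul_assoc]⟩
    omega
  obtain ⟨γ', hγ's, hγ'⟩ := hreal _ _ hγs hγ
  cases ε
  · obtain ⟨hαs, hβs⟩ := hlin rfl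
    obtain ⟨α', hα's, hα'⟩ := hreal _ _ hαs hα
    obtain ⟨β', hβ's, hβ'⟩ := hreal _ _ hβs hβ
    exact ⟨α', β', γ', hunit _ _ _ hα' hβ' hγ', hγ's, fun _ => ⟨hα's, hβ's⟩, nofun, hα', hβ', hγ'⟩
  · have hα' : P.α = ϖ ^ P.m * star β := by rw [hun rfl]; exact hstar _ _ hβ
    exact ⟨star β, β, γ', hunit _ _ _ hα' hβ hγ', hγ's, nofun, fun _ => rfl, hα', hβ, hγ'⟩

/-- The elements of `GL_3` that commute with every matrix commuting with `F` and `B`. -/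
def doubleComm {R : Type*} [CommRing R] (F B : Matrix (Fin 3) (Fin 3) R) :
    Subgroup (GL (Fin 3) R) :=
  ⨅ Y ∈ {Y : Matrix (Fin 3) (Fin 3) R | Y * F = F * Y ∧ Y * B = B * Y}, commSubgroup Y

lemma mem_doubleComm {R : Type*} [CommRing R] {F B : Matrix (Fin 3) (Fin 3) R} {g : GL (Fin 3) R} :
    g ∈ doubleComm F B ↔ ∀ Y, Y * F = F * Y → Y * B = B * Y → g.1 * Y = Y * g.1 := by
  simp only [doubleComm, Subgroup.mem_iInf, Set.mem_ofPred_eq, and_imp]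
  rfl

lemma sig_mem_doubleComm {R : Type*} [CommRing R] [StarRing R] {F B : Matrix (Fin 3) (Fin 3) R}
    (hF : theta ε F = F) (hB : theta ε B = B) {g : GL (Fin 3) R} (hg : g ∈ doubleComm F B) :
    sig ε g ∈ doubleComm F B := by
  have key : ∀ Y X : Matrix (Fin 3) (Fin 3) R, theta ε X = X → Y * X = X * Y →
      tau ε Y * X = X * tau ε Y := fun Y X hX h => by
    have h1 := theta_comm ε X Y
    rw [hX, h, sub_self] at h1
    have h2 : theta ε (0 : Matrix (Fin 3) (Fin 3) R) = 0 := by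
      rcases theta_eq ε (0 : Matrix (Fin 3) (Fin 3) R) with h | h <;> rw [h, tau_zero]
      exact neg_zero
    rw [h2] at h1
    exact (sub_eq_zero.1 h1.symm).symm
  refine mem_doubleComm.2 fun Y h1 h2 => ?_
  have h3 := sig_commute ε (mem_doubleComm.1 hg (tau ε Y) (key Y F hF h1) (key Y B hB h2))
  rcases theta_eq ε (tau ε Y) with h | h
  · rwa [h, tau_tau] at h3
  · rw [h, tau_tau, mul_neg, neg_mul, neg_inj] at h3
    exact h3

lemma commute_of_mem_doubleComm {R : Type*} [CommRing R] {F B : Matrix (Fin 3) (Fin 3) R}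
    (h : F * B = B * F) {s t : GL (Fin 3) R} (hs : s ∈ doubleComm F B) (ht : t ∈ doubleComm F B) :
    s * t = t * s :=
  Units.ext (mem_doubleComm.1 hs t.1 (mem_doubleComm.1 ht F rfl h)
    (mem_doubleComm.1 ht B h.symm rfl))

/-- A matrix pairing trivially, modulo `π ^ c`, with the commutant of `E` is a commutator with `E`
modulo `π ^ c`. -/
lemma sub_comm_sliceMatrix_mem {R : Type*} [CommRing R] {ϖ i δ : R} {c : ℕ}
    {H : Matrix (Fin 3) (Fin 3) R} (hi : ∀ x, i * x + i * x = x)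
    (h : ∀ J ∈ lieJ δ, ∃ y, trace (H * J) = ϖ ^ c * y) :
    H - (matE δ * sliceMatrix i H - sliceMatrix i H * matE δ) ∈ matP ϖ c := by
  have key : ∀ a b x y z : R, trace (H * matJ δ a b x y z) = a * (H 0 0 + H 2 2) + b * H 1 1 +
      x * (H 1 0 + δ * H 1 2) + y * (H 2 1 + δ * H 0 1) + z * (H 2 0 + δ ^ 2 * H 0 2) := by
    intro a b x y z
    simp only [matJ, trace_fin_three, Matrix.mul_apply, Fin.sum_univ_three]
    simp
    ring
  have hJ := fun a b x y z => h _ (matJ_mem_lieJ (δ := δ) a b x y z)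
  simp only [key] at hJ
  obtain ⟨y1, h1⟩ := hJ 1 0 0 0 0
  obtain ⟨y2, h2⟩ := hJ 0 1 0 0 0
  obtain ⟨y3, h3⟩ := hJ 0 0 1 0 0
  obtain ⟨y4, h4⟩ := hJ 0 0 0 1 0
  obtain ⟨y5, h5⟩ := hJ 0 0 0 0 1
  simp only [one_mul, zero_mul, add_zero, zero_add] at h1 h2 h3 h4 h5
  refine mem_matP.2 ⟨!![i * y1, 0, 0; y3, y2, 0; y5, y4, i * y1], ?_⟩
  rw [matE_comm]
  have e0 := hi (H 0 0)
  have e2 := hi (H 2 2)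
  have e02 := hi (H 0 2)
  ext1 a b
  fin_cases a <;> fin_cases b <;> simp [sliceMatrix]
  · linear_combination i * h1 - e0
  · linear_combination -e02
  · linear_combination h3
  · linear_combination h2
  · linear_combination h5 + δ ^ 2 * e02
  · linear_combination h4
  · linear_combination i * h1 - e2

/-- An element of the inertia group that fixes the character of the radical becomes, after a
modification by `G^{ℓ₁}`, an element commuting with `A` modulo `π ^ (m + n₁)`. -/
lemma IsDepth.exists_mul_comm_mem {n₁ n₂ : ℕ} (hd : IsDepth P P.m n₁ n₂)
    (hS : IsUniformized u ℓ q ϖ) (hψ : IsPrimitiveChar ψ) (hP : P.IsAdmissible ε) (hℓ : 2 ≤ ℓ)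
    (hm : P.m < ℓ - ℓ / 2) {g : GL (Fin 3) (BigRing u ℓ)} (hg : g ∈ inertia ε ψ (P.mat ε))
    (hfix : ∀ n ∈ (hd.isQuadraticChar hS hψ hP).radical,
      psiLog ψ (P.mat ε) (g * n * g⁻¹) = psiLog ψ (P.mat ε) n) :
    ∃ y ∈ cong (grp ε u ℓ) (ℓ / 2),
      P.mat ε * (g * y).1 - (g * y).1 * P.mat ε ∈ matP ϖ (P.m + n₁) := by
  have hsum := hd.sum_eq
  have hle := hd.le
  have hone := hd.one_le
  have h2n := hd.half_le_two_mul
  set A := P.mat ε with hA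
  have hδ : star P.δ = P.δ := (hS.isAdmissible_iff.1 hP).2.1.2.1
  have hτA : tau ε A = A := hS.tau_mat hP
  obtain ⟨hgG, hgA⟩ := (hS.mem_inertia hψ hℓ hτA).1 hg
  set D := (g⁻¹).1 * A * g.1 - A with hD
  have hDm : D ∈ matP ϖ (ℓ / 2) := conj_sub_mem_iff.2 hgA
  have hτD : tau ε D = D := by rw [hD, tau_sub, hS.tau_conj hgG, hτA]
  -- invariance of the character on `J^n₂` means that `D` is orthogonal to the commutant in `𝔓 ^ n₂`
  have htr0 : ∀ Z ∈ lieJ P.δ ⊓ matP ϖ n₂, trace (D * Z) = 0 := fun Z hZ => by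
    refine hS.trace_eq_zero_of_forall hψ hτD (C := lieJ P.δ ⊓ matP ϖ n₂)
      (fun X hX => ⟨tau_mem_lieJ ε hδ hX.1, tau_mem_matP ε hS.star_unif hX.2⟩) (fun Y hY hτY => ?_) hZ
    obtain ⟨n, hnJ, hnG, hn⟩ := hS.exists_mem_grp_sub_one ε (hone.trans hle) hY.2 hτY
      (H := commSubgroup (matE P.δ)) (fun x hx => by
        have hx' : x ∈ commSubgroup (matE P.δ) := by
          have : x.1 ∈ lieJ P.δ := hx ▸ add_mem one_mem_lieJ hY.1
          exact this.symm
        exact ⟨hx', IsUniformized.sig_mem_commSubgroup hδ hx'⟩)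
    have hn1 : n.1 - 1 ∈ matP ϖ n₂ := by
      rw [← sub_add_cancel (n.1 - 1) Y]
      exact add_mem (matP_anti (by omega) hn) hY.2
    have hnR : n ∈ (hd.isQuadraticChar hS hψ hP).radical :=
      hd.sup_le_radical hS hψ hP (le_sup_left (a := cong (grpJ ε P.δ) n₂)
        (hS.mem_cong.2 ⟨⟨hnG, hnJ⟩, hn1⟩))
    have h1 := hfix n hnR
    have hne : psiLog ψ A n ≠ 0 := (hd.isQuadraticChar hS hψ hP).ne_zero n
      ((hd.isQuadraticChar hS hψ hP).radical_le hnR)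
    rw [psiLog_conj, mul_eq_left₀ hne] at h1
    have h2 : psiLog ψ D n = psiLin ψ D n := hS.psiLog_eq_of_mem hDm hn1 (by omega)
    have h3 : trace (D * (n.1 - 1)) = trace (D * Y) := by
      rw [← sub_eq_zero, ← trace_sub, ← mul_sub]
      exact trace_mul_eq_zero hS.pow_eq_zero hDm hn (by omega)
    rw [← h3]
    exact h2.symm.trans h1
  obtain ⟨H, hH, hτH, hDH⟩ := hS.exists_eq_scal_smul hτD hDm
  have hHJ : ∀ J ∈ lieJ P.δ, ∃ y, trace (H * J) = ϖ ^ (P.m + n₁) * y := fun J hJ => by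
    refine hS.cancel n₂ (P.m + n₁) _ 0 (by omega) ?_
    have h1 := htr0 (ϖ ^ n₂ • J) ⟨Submodule.smul_mem _ _ hJ, J, rfl⟩
    rw [hDH, smul_mul_assoc, Matrix.mul_smul, trace_smul, trace_smul, smul_eq_mul, smul_eq_mul,
      (hS.isUnit_scal (ε := ε)).mul_right_eq_zero] at h1
    rw [h1, mul_zero]
  -- hence `D` is a commutator `[A, Z]` modulo `𝔓 ^ (m + n₁)`, and `y ≡ 1 - Z` corrects `g`
  set Z := sliceMatrix (Ring.inverse 2) H with hZ
  have hZm : Z ∈ matP ϖ (ℓ / 2) := by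
    obtain ⟨K, rfl⟩ := mem_matP.1 hH
    exact ⟨_, sliceMatrix_smul _ _ K⟩
  have hτZ : tau ε Z = Z := tau_sliceMatrix hS.star_inverse_two hτH
  obtain ⟨y, -, hyG, hy⟩ := hS.exists_mem_grp_sub_one ε (k := ℓ / 2) (by omega) (neg_mem hZm)
    (by rw [tau_neg, hτZ]) (H := ⊤) (fun _ _ => ⟨trivial, trivial⟩)
  have hy1 : y.1 - 1 ∈ matP ϖ (ℓ / 2) := by
    rw [← sub_add_cancel (y.1 - 1) (-Z)]
    exact add_mem (matP_anti (by omega) hy) (neg_mem hZm)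
  refine ⟨y, hS.mem_cong.2 ⟨hyG, hy1⟩, ?_⟩
  have hslice := sub_comm_sliceMatrix_mem (i := Ring.inverse 2) hS.half_add_half hHJ
  have hAZ : D - (A * Z - Z * A) ∈ matP ϖ (P.m + n₁) := by
    have e1 : D - (A * Z - Z * A) = scal ε u ℓ • (H - (matE P.δ * Z - Z * matE P.δ)) -
        ((A - scal ε u ℓ • (P.ω • 1 + matE P.δ)) * Z -
          Z * (A - scal ε u ℓ • (P.ω • 1 + matE P.δ))) := by
      rw [hDH]
      simp only [sub_mul, mul_sub, smul_add, add_mul, mul_add, smul_mul_assoc, Matrix.mul_smul,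
        one_mul, mul_one, smul_sub]
      abel
    rw [e1]
    exact sub_mem (Submodule.smul_mem _ _ hslice) (comm_mem_matP (hS.mat_sub_mem ε) hZm (by omega))
  have e2 : A * (g * y).1 - (g * y).1 * A = g.1 * ((D - (A * Z - Z * A)) +
      (A * (y.1 - 1 - -Z) - (y.1 - 1 - -Z) * A) + D * (y.1 - 1)) := by
    have e3 : g.1 * D = A * g.1 - g.1 * A := by
      rw [hD, mul_sub, ← mul_assoc, ← mul_assoc, Units.mul_inv, one_mul]
    have e4 : g.1 * ((D - (A * Z - Z * A)) +
      (A * (y.1 - 1 - -Z) - (y.1 - 1 - -Z) * A) + D * (y.1 - 1)) =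
      (g.1 * D) * y.1 + g.1 * (A * y.1 - y.1 * A) := by noncomm_ring
    rw [e4, e3, Units.val_mul]
    noncomm_ring
  rw [e2]
  refine mul_mem_matP_left _ (add_mem (add_mem hAZ ?_) ?_)
  · exact comm_mem_matP_left _ (matP_anti (by omega) hy)
  · exact mul_mem_matP hDm hy1 (by omega)

/-- For `m < ℓ₂` the stabiliser in the inertia group of the character of the radical is contained in
the product of `N` with an abelian group that commutes with `A`. -/
theorem IsDepth.exists_abelian {n₁ n₂ : ℕ} (hd : IsDepth P P.m n₁ n₂)
    (hS : IsUniformized u ℓ q ϖ) (hψ : IsPrimitiveChar ψ) (hP : P.IsAdmissible ε) (hℓ : 2 ≤ ℓ)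
    (hm : P.m < ℓ - ℓ / 2) :
    ∃ T ≤ inertia ε ψ (P.mat ε), (∀ s ∈ T, ∀ t ∈ T, s * t = t * s) ∧
      (∀ t ∈ T, P.mat ε * t.1 = t.1 * P.mat ε) ∧
      ∀ g ∈ inertia ε ψ (P.mat ε), (∀ n ∈ (hd.isQuadraticChar hS hψ hP).radical,
        psiLog ψ (P.mat ε) (g * n * g⁻¹) = psiLog ψ (P.mat ε) n) →
        ∃ t ∈ T, ∃ n ∈ cong (inertia ε ψ (P.mat ε)) n₁, g = t * n := by
  obtain ⟨α, β, γ, hu, hγ, hlin, hun, hα, hβ, hγm⟩ := hS.exists_primitive hP (by omega)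
  have hδ : star P.δ = P.δ := (hS.isAdmissible_iff.1 hP).2.1.2.1
  have hϖ : star (ϖ ^ P.m) = ϖ ^ P.m := by rw [star_pow, hS.star_unif]
  set F := matF P.δ (ϖ ^ P.m) α β γ with hF
  set B := matB P.δ (ϖ ^ P.m) α β γ with hB
  have hFB : F * B = B * F := matF_mul_matB ..
  have hmat : P.mat ε = scal ε u ℓ • (P.ω • 1 + F) := by
    rw [Params.mat, hα, hβ, hγm, mat_eq_smul_matF]
  obtain ⟨hθF, hθB⟩ := theta_matF_matB hδ hϖ hγ hlin hun
  have hcommF : ∀ t ∈ doubleComm F B, P.mat ε * t.1 = t.1 * P.mat ε := fun t ht => by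
    have h := mem_doubleComm.1 ht F rfl hFB
    rw [hmat, smul_mul_assoc, Matrix.mul_smul, add_mul, mul_add, h, smul_mul_assoc,
      Matrix.mul_smul, one_mul, mul_one]
  have hTI : grp ε u ℓ ⊓ doubleComm F B ≤ inertia ε ψ (P.mat ε) := fun t ht =>
    (hS.mem_inertia hψ hℓ (hS.tau_mat hP)).2 ⟨ht.1, by
      rw [hcommF t ht.2, sub_self]; exact zero_mem _⟩
  refine ⟨grp ε u ℓ ⊓ doubleComm F B, hTI,
    fun s hs t ht => commute_of_mem_doubleComm hFB hs.2 ht.2, fun t ht => hcommF t ht.2,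
    fun g hg hfix => ?_⟩
  obtain ⟨y, hy, hgy⟩ := hd.exists_mul_comm_mem hS hψ hP hℓ hm hg hfix
  have hyN := hd.cong_le_cong_inertia hS hψ hP hy
  have hgyF : F * (g * y).1 - (g * y).1 * F ∈ matP ϖ (P.m + n₁) := by
    rw [← smul_mem_matP_iff (hS.isUnit_scal (ε := ε))]
    convert hgy using 1
    rw [hmat, smul_mul_assoc, Matrix.mul_smul, ← smul_sub, add_mul, mul_add, smul_mul_assoc,
      Matrix.mul_smul, one_mul, mul_one, add_sub_add_left_eq_sub]
  have hsum := hd.sum_eq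
  -- modulo `𝔓 ^ n₁`, the element `g y` is a combination of `1`, `F`, `B`; such combinations commute
  obtain ⟨s, z, t, hx⟩ := exists_sub_mem_of_matF_comm hu rfl
    (fun x w h => hS.cancel P.m n₁ x w (by omega) h) hgyF
  set X := s • 1 + z • F + t • B with hX
  have hXu : IsUnit X := hS.isUnit_of_sub_mem_matP (g * y).isUnit
    (by rw [← neg_sub]; exact neg_mem (matP_anti hd.one_le hx))
  obtain ⟨x, hxX⟩ := hXu
  have hxH : x ∈ doubleComm F B := mem_doubleComm.2 fun Y h1 h2 => by
    rw [hxX, hX]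
    simp only [add_mul, mul_add, smul_mul_assoc, Matrix.mul_smul, one_mul, mul_one, h1, h2]
  have hgyG : g * y ∈ grp ε u ℓ := Subgroup.mul_mem _ (inertia_le _ _ _ hg) (cong_le _ _ hy)
  obtain ⟨w, hwH, hwG, hw⟩ := hS.exists_lift_of_congr hd.one_le
    (fun x hx => sig_mem_doubleComm hθF hθB hx) hgyG hxH (by rw [hxX]; exact hx)
  have hwI := hTI ⟨hwG, hwH⟩
  have hgyI : g * y ∈ inertia ε ψ (P.mat ε) := Subgroup.mul_mem _ hg (cong_le _ _ hyN)
  refine ⟨w, ⟨hwG, hwH⟩, w⁻¹ * (g * y) * y⁻¹, ?_, by group⟩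
  refine Subgroup.mul_mem _ (hS.mem_cong.2 ⟨Subgroup.mul_mem _ (Subgroup.inv_mem _ hwI) hgyI, ?_⟩)
    (Subgroup.inv_mem _ hyN)
  exact hS.mem_ker_redGL.1 (hS.inv_mul_mem_ker_iff.2 hw)

end InertiaSmall

/-! ### Extension and induction -/

section Induction

variable {M : Type*} [Group M]

lemma Extends.isIrreducible {N I : Subgroup M} {W : Type*} [AddCommGroup W] [Module ℂ W]
    {σ : Representation ℂ N W} {σ' : Representation ℂ I W} (h : Extends σ σ')
    (hσ : σ.IsIrreducible) : σ'.IsIrreducible := by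
  rw [isIrreducible_iff_invariant] at hσ ⊢
  refine ⟨hσ.1, fun U hU => hσ.2 U fun n v hv => ?_⟩
  have := hU ⟨n, h.1 n.2⟩ v hv
  rwa [h.2 n n.2] at this

lemma le_stabConj_character {N I : Subgroup M} {W : Type*} [AddCommGroup W] [Module ℂ W]
    (hNI : N ≤ I) (σ : Representation ℂ N W) :
    N ≤ stabConj I N σ.character := fun g hg => by
  refine ⟨hNI hg, fun n => ?_, fun n hn hn' => ?_⟩
  · rw [Subgroup.mul_mem_cancel_right _ (N.inv_mem hg), Subgroup.mul_mem_cancel_left _ hg]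
  · have e : (⟨g * n * g⁻¹, hn'⟩ : N) = ⟨g, hg⟩ * ⟨n, hn⟩ * ⟨g, hg⟩⁻¹ := rfl
    rw [e]
    exact σ.char_conj _ _

/-- Conjugations that fix the character of the Heisenberg representation fix `q` on the radical,
because the character is a multiple of `q` there and vanishes elsewhere. -/
lemma IsQuadraticChar.map_conj_of_mem_stabConj [Finite M] {N I : Subgroup M} {q : M → ℂ}
    {β : M → M → ℂ} (Q : IsQuadraticChar N q β) (hodd : Odd (Nat.card N)) {W : Type*}
    [AddCommGroup W] [Module ℂ W] [FiniteDimensional ℂ W] {σ : Representation ℂ N W}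
    (hσ : σ.IsIrreducible) (hσR : ∀ n : N, (n : M) ∈ Q.radical → σ n = q n • LinearMap.id)
    {g : M} (hg : g ∈ stabConj I N σ.character) {n : M} (hn : n ∈ Q.radical) :
    q (g * n * g⁻¹) = q n := by
  have hnN := Q.radical_le hn
  have hnN' := (hg.2.1 n).1 hnN
  have htr : LinearMap.trace ℂ W (σ ⟨g * n * g⁻¹, hnN'⟩) = LinearMap.trace ℂ W (σ ⟨n, hnN⟩) :=
    hg.2.2 n hnN hnN'
  have hnt := (isIrreducible_iff_invariant σ).1 hσ |>.1
  have hdim : (Module.finrank ℂ W : ℂ) ≠ 0 := by exact_mod_cast Module.finrank_pos.ne'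
  have h1 := Q.trace_of_mem_radical hσR ⟨n, hnN⟩ hn
  have hR : g * n * g⁻¹ ∈ Q.radical := by
    by_contra h
    rw [Q.trace_eq_zero_of_notMem_radical hσR hodd ⟨_, hnN'⟩ h, h1] at htr
    exact mul_ne_zero (Q.ne_zero n hnN) hdim htr.symm
  rw [h1, Q.trace_of_mem_radical hσR ⟨_, hnN'⟩ hR] at htr
  exact mul_right_cancel₀ hdim htr

/-- A character of a subgroup of an abelian group extends. -/
lemma exists_monoidHom_extension [Finite M] {T R : Subgroup M} (hRT : R ≤ T)
    (hT : ∀ s ∈ T, ∀ t ∈ T, s * t = t * s) (ν : R →* ℂ) :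
    ∃ f : T →* ℂ, ∀ r : R, f (Subgroup.inclusion hRT r) = ν r := by
  let _ : CommGroup T :=
    { (inferInstance : Group T) with mul_comm := fun s t => Subtype.ext (hT s s.2 t t.2) }
  exact exists_monoidHom_comp_eq (Subgroup.inclusion hRT) ν fun r hr => by
    rw [(Subgroup.inclusion_injective hRT) (hr.trans (_root_.map_one _).symm), _root_.map_one]

/-- An irreducible representation of `I = J B` that is trivial on `B` is inflated from its restriction
to `J`. -/
lemma exists_isInflation {J I B : Subgroup M} {W : Type*} [AddCommGroup W] [Module ℂ W]
    {φ' : Representation ℂ I W} (hI : ∀ x, x ∈ I ↔ ∃ j ∈ J, ∃ b ∈ B, x = j * b)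
    (hB : ∀ b : I, b.1 ∈ B → φ' b = 1) (hφ' : φ'.IsIrreducible) :
    ∃ φ : Representation ℂ J W, φ.IsIrreducible ∧ IsInflation B φ φ' := by
  have hJI : J ≤ I := fun j hj => (hI j).2 ⟨j, hj, 1, one_mem _, (mul_one j).symm⟩
  have hBI : B ≤ I := fun b hb => (hI b).2 ⟨1, one_mem _, b, hb, (one_mul b).symm⟩
  have hinf : ∀ j (hj : j ∈ J) b, b ∈ B → ∀ h : j * b ∈ I, φ' ⟨j * b, h⟩ = φ' ⟨j, hJI hj⟩ :=
    fun j hj b hb h => by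
      have e : (⟨j * b, h⟩ : I) = ⟨j, hJI hj⟩ * ⟨b, hBI hb⟩ := rfl
      rw [e, map_mul, hB ⟨b, hBI hb⟩ hb, mul_one]
  refine ⟨φ'.comp (Subgroup.inclusion hJI), ?_, hI, hinf⟩
  rw [isIrreducible_iff_invariant] at hφ' ⊢
  refine ⟨hφ'.1, fun U hU => hφ'.2 U fun x v hv => ?_⟩
  obtain ⟨j, hj, b, hb, hx⟩ := (hI x).1 x.2
  obtain ⟨x, hxI⟩ := x
  obtain rfl : x = j * b := hx
  rw [hinf j hj b hb]
  exact hU ⟨j, hj⟩ v hv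

variable {o : Type*} [CommRing o] [IsLocalRing o] {u : o} {ℓ q k : ℕ} {ϖ : BigRing u ℓ}
  {ε : GroupType} {P : Params u ℓ} {ψ : AddChar (BigRing u ℓ) ℂ}

/-- If a representation acts by the scalars `ψ_A` on `G^{ℓ₂}`, the elements that intertwine it
lie in the inertia group. -/
lemma mem_inertia_of_intertwiner {A : Matrix (Fin 3) (Fin 3) (BigRing u ℓ)}
    {H : Subgroup (GL (Fin 3) (BigRing u ℓ))} (hH : cong (grp ε u ℓ) (ℓ - ℓ / 2) ≤ H)
    {W : Type*} [AddCommGroup W] [Module ℂ W] {ρ : Representation ℂ H W}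
    (hρ : ∀ d (hd : d ∈ H), d ∈ cong (grp ε u ℓ) (ℓ - ℓ / 2) → ρ ⟨d, hd⟩ = psiLin ψ A d • LinearMap.id)
    {x : GL (Fin 3) (BigRing u ℓ)} (hx : x ∈ grp ε u ℓ) {f : W →ₗ[ℂ] W} (hf0 : f ≠ 0)
    (hf : ∀ d (hd : d ∈ H) (hd' : x * d * x⁻¹ ∈ H) w,
      f (ρ ⟨d, hd⟩ w) = ρ ⟨x * d * x⁻¹, hd'⟩ (f w)) : x ∈ inertia ε ψ A := by
  refine ⟨hx, fun n => mem_cong_conj_iff hx, fun n hn hn' => ?_⟩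
  obtain ⟨w, hw⟩ : ∃ w, f w ≠ 0 := by
    by_contra! h
    exact hf0 (LinearMap.ext h)
  have h := hf n (hH hn) (hH hn') w
  rw [hρ _ _ hn, hρ _ _ hn', LinearMap.smul_apply, LinearMap.smul_apply, map_smul] at h
  exact (smul_left_injective ℂ hw h).symm

variable {μ n₁ n₂ : ℕ} (hd : IsDepth P μ n₁ n₂) (hS : IsUniformized u ℓ q ϖ)
  (hψ : IsPrimitiveChar ψ) (hP : P.IsAdmissible ε)
include hS

lemma IsUniformized.psiLog_eq_psiLin (A : Matrix (Fin 3) (Fin 3) (BigRing u ℓ))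
    {g : GL (Fin 3) (BigRing u ℓ)} (hg : g ∈ cong (grp ε u ℓ) (ℓ - ℓ / 2)) :
    psiLog ψ A g = psiLin ψ A g :=
  hS.psiLog_eq_of_mem (mem_matP_zero A) (hS.mem_cong.1 hg).2 (by omega)

include hd hψ hP

lemma IsDepth.cong_le_radical :
    cong (grp ε u ℓ) (ℓ - ℓ / 2) ≤ (hd.isQuadraticChar hS hψ hP).radical :=
  le_sup_right.trans (hd.sup_le_radical hS hψ hP)

variable {V : Type*} [AddCommGroup V] [Module ℂ V] [FiniteDimensional ℂ V]
  {χ : Representation ℂ (grp ε u ℓ) V}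

/-- The representation of `N` below the given one, with its degree computed from the index of the
radical. -/
lemma IsDepth.exists_heisenberg {e : ℕ}
    (he : e = 2 * (ℓ - ℓ / 2 - ℓ / 2) + (n₂ - n₁)) {v : V} (hv : v ≠ 0)
    (hvR : ∀ g (hg : g ∈ grp ε u ℓ), g ∈ (hd.isQuadraticChar hS hψ hP).radical →
      χ ⟨g, hg⟩ v = psiLog ψ (P.mat ε) g • v) :
    ∃ σ : Representation ℂ (cong (inertia ε ψ (P.mat ε)) n₁)
        (Fin (q ^ e) → ℂ),
      IsMonomialAbove σ (hd.isQuadraticChar hS hψ hP).radical (psiLog ψ (P.mat ε)) ∧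
      Module.finrank ℂ (Fin (q ^ e) → ℂ) ^ 2 =
        (hd.isQuadraticChar hS hψ hP).radical.relIndex (cong (inertia ε ψ (P.mat ε)) n₁) ∧
      ∃ f ∈ equivariantMaps ((cong_le _ n₁).trans (inertia_le ε ψ (P.mat ε))) χ σ, f ≠ 0 := by
  have := hS.finite_GL
  subst he
  have hdim := hd.relIndex_radical hS hψ hP
  obtain ⟨σ, hσ, f, hf0, hf⟩ := (hd.isQuadraticChar hS hψ hP).exists_heisenberg
    (hd.odd_card_cong hS) (χ.comp (Subgroup.inclusion
      ((cong_le _ n₁).trans (inertia_le ε ψ (P.mat ε))))) v hv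
    (fun r hr => hvR r _ hr) hdim
  exact ⟨σ, hσ, by rw [Module.finrank_fin_fun, hdim], f, hf, hf0⟩

omit hd in
/-- For `m < ℓ₂` the representation of `N` extends to its stabiliser, and extensions induce
irreducibly; one of them induces to the given representation. -/
theorem IsDepth.exists_induced_of_lt (hd : IsDepth P P.m n₁ n₂) (hℓ : 2 ≤ ℓ)
    (hm : P.m < ℓ - ℓ / 2) (hχ : χ.IsIrreducible) {W : Type*} [AddCommGroup W] [Module ℂ W]
    [FiniteDimensional ℂ W] {σ : Representation ℂ (cong (inertia ε ψ (P.mat ε)) n₁) W}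
    (hσ : IsMonomialAbove σ (hd.isQuadraticChar hS hψ hP).radical (psiLog ψ (P.mat ε)))
    (hdim : Module.finrank ℂ W ^ 2 = (hd.isQuadraticChar hS hψ hP).radical.relIndex
      (cong (inertia ε ψ (P.mat ε)) n₁))
    {f₀ : W →ₗ[ℂ] V} (hf₀ : f₀ ≠ 0)
    (hf₀' : f₀ ∈ equivariantMaps ((cong_le _ n₁).trans (inertia_le ε ψ (P.mat ε))) χ σ) :
    (∀ σ' : Representation ℂ (stabConj (inertia ε ψ (P.mat ε))
          (cong (inertia ε ψ (P.mat ε)) n₁) σ.character) W, Extends σ σ' →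
        (indRep ((stabConj_le _ _ _).trans (inertia_le ε ψ (P.mat ε))) σ').IsIrreducible) ∧
    ∃ σ' : Representation ℂ (stabConj (inertia ε ψ (P.mat ε))
        (cong (inertia ε ψ (P.mat ε)) n₁) σ.character) W, Extends σ σ' ∧
      Nonempty (χ.Equiv (indRep ((stabConj_le _ _ _).trans (inertia_le ε ψ (P.mat ε))) σ')) := by
  have := hS.finite_GL
  set Q := hd.isQuadraticChar hS hψ hP
  have hσR : ∀ n : cong (inertia ε ψ (P.mat ε)) n₁, (n : GL (Fin 3) (BigRing u ℓ)) ∈ Q.radical →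
      σ n = psiLog ψ (P.mat ε) n • LinearMap.id := fun n hn => hσ.2.2.1 n n.2 hn
  have hNI : cong (inertia ε ψ (P.mat ε)) n₁ ≤ inertia ε ψ (P.mat ε) := cong_le _ _
  have hNS := le_stabConj_character hNI σ
  have hirr : ∀ σ' : Representation ℂ (stabConj (inertia ε ψ (P.mat ε))
      (cong (inertia ε ψ (P.mat ε)) n₁) σ.character) W, Extends σ σ' →
      (indRep ((stabConj_le _ _ _).trans (inertia_le ε ψ (P.mat ε))) σ').IsIrreducible := by
    intro σ' hσ'
    refine indRep_isIrreducible _ _ (hσ'.isIrreducible hσ.1) fun x hx hxN f hf => ?_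
    -- an intertwiner between the extension and its conjugate by `x` puts `x` into the inertia group,
    -- and then into the stabiliser of `σ`
    by_contra hf0
    have hGR := hd.cong_le_radical hS hψ hP
    have hxI : x ∈ inertia ε ψ (P.mat ε) := mem_inertia_of_intertwiner (hGR.trans (Q.radical_le.trans hNS))
      (fun d hd' hdG => by
        rw [hσ'.2 d (Q.radical_le (hGR hdG)) hd', hσ.2.2.1 d _ (hGR hdG),
          hS.psiLog_eq_psiLin _ hdG]) hx hf0 hf
    have hxc : ∀ n, n ∈ cong (inertia ε ψ (P.mat ε)) n₁ ↔ x * n * x⁻¹ ∈ cong (inertia ε ψ (P.mat ε)) n₁ := fun n => mem_cong_conj_iff hxI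
    refine hxN ⟨hxI, hxc, fun n hn hn' => ?_⟩
    exact trace_eq_of_intertwiner hσ.1 (a := fun n => ⟨x * n * x⁻¹, (hxc n).1 n.2⟩) hf0
      (fun n w => by
        have h := hf n (hNS n.2) (hNS ((hxc n).1 n.2)) w
        rwa [hσ'.2 _ n.2, hσ'.2 _ ((hxc n).1 n.2)] at h) ⟨n, hn⟩
  refine ⟨hirr, ?_⟩
  obtain ⟨T, hTI, hTc, hTA, hT⟩ := hd.exists_abelian hS hψ hP hℓ hm
  set T' := T ⊓ stabConj (inertia ε ψ (P.mat ε))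
      (cong (inertia ε ψ (P.mat ε)) n₁) σ.character
  have hT'c : ∀ s ∈ T', ∀ t ∈ T', s * t = t * s := fun s hs t ht => hTc s hs.1 t ht.1
  have hprod : ∀ x ∈ stabConj (inertia ε ψ (P.mat ε))
      (cong (inertia ε ψ (P.mat ε)) n₁) σ.character, ∃ t ∈ T', ∃ n ∈ cong (inertia ε ψ (P.mat ε)) n₁, x = t * n := fun x hx => by
    obtain ⟨t, ht, n, hn, rfl⟩ := hT x hx.1 fun n hn =>
      Q.map_conj_of_mem_stabConj (hd.odd_card_cong hS) hσ.1 hσR hx hn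
    exact ⟨t, ⟨ht, (Subgroup.mul_mem_cancel_right _ (hNS hn)).1 hx⟩, n, hn, rfl⟩
  -- elements of `T` commute with `A`, and thus pair trivially with `N`
  have hTR : T' ⊓ cong (inertia ε ψ (P.mat ε)) n₁ ≤ Q.radical := fun t ht => Q.mem_radical.2 ⟨ht.2, fun h _ => by
    rw [altForm, trace_comm_mul, hTA t ht.1.1, sub_self, zero_mul, trace_zero, mul_zero,
      AddChar.map_zero_eq_one]⟩
  obtain ⟨f, hf⟩ := exists_monoidHom_extension (R := T' ⊓ cong (inertia ε ψ (P.mat ε)) n₁) inf_le_left hT'c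
    { toFun := fun t => psiLog ψ (P.mat ε) t
      map_one' := Q.map_one
      map_mul' := fun a b => Q.map_radical_mul (hTR a.2) (Q.radical_le (hTR b.2)) }
  obtain ⟨σ', hσ'⟩ := Q.exists_extension hσR (hd.odd_card_cong hS) hσ.1 hdim hNS hprod
    (fun t ht n => mem_cong_conj_iff (hTI ht.1))
    (fun t ht n _ => psiLog_conj_of_commute (hTA t ht.1) n) hTR f
    (fun t ht => hf ⟨t, t.2, ht⟩)
  obtain ⟨σ'', hσ'', f, hf0, hf⟩ := exists_extension_intertwiner hNS
    ((stabConj_le _ _ _).trans (inertia_le ε ψ (P.mat ε))) χ hσ'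
    (fun i hi n hn => (hi.2.1 n).1 hn) (T := T') inf_le_right hT'c hprod f₀ hf₀ hf₀'
  exact ⟨σ'', hσ'', nonempty_equiv_indRep _ _ hχ (hirr σ'' hσ'') f hf0 hf⟩

/-- For `m ≥ ℓ₂` every extension to the inertia group, after a twist by a representation of the
quotient by `N`, induces to the given representation. -/
theorem IsDepth.exists_induced_of_le (hχ : χ.IsIrreducible) {W : Type*} [AddCommGroup W] [Module ℂ W]
    [FiniteDimensional ℂ W] {σ : Representation ℂ (cong (inertia ε ψ (P.mat ε)) n₁) W}
    (hσ : IsMonomialAbove σ (hd.isQuadraticChar hS hψ hP).radical (psiLog ψ (P.mat ε)))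
    {f₀ : W →ₗ[ℂ] V} (hf₀ : f₀ ≠ 0)
    (hf₀' : f₀ ∈ equivariantMaps ((cong_le _ n₁).trans (inertia_le ε ψ (P.mat ε))) χ σ)
    {σ' : Representation ℂ (inertia ε ψ (P.mat ε)) W} (hσ' : Extends σ σ') :
    ∃ (d : ℕ) (φ : Representation ℂ (inertia ε ψ (P.mat ε)) (Fin d → ℂ)), φ.IsIrreducible ∧
      (∀ n : inertia ε ψ (P.mat ε), n.1 ∈ cong (inertia ε ψ (P.mat ε)) n₁ → φ n = 1) ∧
      Nonempty (χ.Equiv (indRep (inertia_le ε ψ (P.mat ε)) (σ'.tprod φ))) := by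
  have := hS.finite_GL
  set Q := hd.isQuadraticChar hS hψ hP
  have hGR := hd.cong_le_radical hS hψ hP
  obtain ⟨d, φ, hφ, hφN, f, hf0, hf⟩ := exists_tprod_intertwiner (cong_le _ _)
    (inertia_le ε ψ (P.mat ε)) χ hσ' (fun i hi n hn => conj_mem_cong hi hn) f₀ hf₀ hf₀'
  refine ⟨d, φ, hφ, hφN, nonempty_equiv_indRep _ _ hχ ?_ f hf0 hf⟩
  refine indRep_isIrreducible _ _ (tprod_isIrreducible (cong_le _ _) hσ.1 hσ' hφ hφN)
    fun x hx hxI f hf => ?_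
  by_contra hf0
  refine hxI (mem_inertia_of_intertwiner (hGR.trans (Q.radical_le.trans (cong_le _ _)))
    (fun d hd' hdG => ?_) hx hf0 hf)
  rw [Representation.tprod_apply, hσ'.2 d (Q.radical_le (hGR hdG)) hd', hσ.2.2.1 d _ (hGR hdG),
    hφN _ (Q.radical_le (hGR hdG)), hS.psiLog_eq_psiLin _ hdG, TensorProduct.map_smul_left]
  congr 1
  exact TensorProduct.map_id

end Induction

end

end NilpotentA2

set_option maxHeartbeats 400000 in
open NilpotentA2 in
theorem mainTheorem7 {o : Type*} [CommRing o] [IsDomain o] [IsDiscreteValuationRing o]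
    [IsAdicComplete (IsLocalRing.maximalIdeal o) o] [Finite (IsLocalRing.ResidueField o)]
    (hp : 3 < ringChar (IsLocalRing.ResidueField o))
    (u : o) (hu : IsUnit u) (hu' : ¬ IsSquare u)
    (ε : GroupType) (ℓ : ℕ) (hℓ : 2 ≤ ℓ)
    (ψ : AddChar (BigRing u ℓ) ℂ) (hψ : IsPrimitiveChar ψ)
    (q : ℕ) (hq : q = Nat.card (IsLocalRing.ResidueField o))
    (ℓ₁ ℓ₂ : ℕ) (hℓ₁ : ℓ₁ = ℓ / 2) (hℓ₂ : ℓ₂ = ℓ - ℓ / 2)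
    {V : Type*} [AddCommGroup V] [Module ℂ V] [FiniteDimensional ℂ V]
    (χ : Representation ℂ (grp ε u ℓ) V) (hχ : χ.IsIrreducible)
    (hχ' : IsNonRegularNilpotent ε ψ χ) :
    ∃ P : Params u ℓ, P.IsAdmissible ε ∧ P.mat ε ∈ lieRing ε u ℓ ∧
      -- the stabiliser of `A` modulo `𝔓 ^ ℓ₂` in `G^ℓ₁`, and its character `ψ_{A_{ℓ₂}}`
      stabMod (cong (grp ε u ℓ) ℓ₁) (P.mat ε) ℓ₂ =
        cong (grpJ ε P.δ) ℓ₁ ⊔ cong (grp ε u ℓ) ℓ₂ ∧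
      cong (grp ε u ℓ) ℓ₂ ≤ stabMod (cong (grp ε u ℓ) ℓ₁) (P.mat ε) ℓ₂ ∧
      (∀ g ∈ cong (grp ε u ℓ) ℓ₂, psiLog ψ (P.mat ε) g = psiLin ψ (P.mat ε) g) ∧
      LiesAbove χ (stabMod (cong (grp ε u ℓ) ℓ₁) (P.mat ε) ℓ₂) (psiLog ψ (P.mat ε)) ∧
      -- (a)
      (P.m < ℓ₂ → ∀ m₁ m₂ : ℕ, m₁ = (ℓ - P.m) / 2 → m₂ = (ℓ - P.m) - (ℓ - P.m) / 2 →
        ∃ σ : Representation ℂ (cong (inertia ε ψ (P.mat ε)) m₁)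
            (Fin (q ^ (2 * (ℓ₂ - ℓ₁) + (m₂ - m₁))) → ℂ),
          stabMod (cong (grp ε u ℓ) ℓ₁) (P.mat ε) ℓ₂ ≤
            cong (grpJ ε P.δ) m₂ ⊔ cong (grp ε u ℓ) ℓ₂ ∧
          IsMonomialAbove σ (cong (grpJ ε P.δ) m₂ ⊔ cong (grp ε u ℓ) ℓ₂)
            (psiLog ψ (P.mat ε)) ∧
          (∀ σ' : Representation ℂ (stabConj (inertia ε ψ (P.mat ε))
                (cong (inertia ε ψ (P.mat ε)) m₁) σ.character)
                (Fin (q ^ (2 * (ℓ₂ - ℓ₁) + (m₂ - m₁))) → ℂ),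
            Extends σ σ' →
              (indRep ((stabConj_le _ _ _).trans (inertia_le ε ψ (P.mat ε))) σ').IsIrreducible) ∧
          ∃ σ' : Representation ℂ (stabConj (inertia ε ψ (P.mat ε))
              (cong (inertia ε ψ (P.mat ε)) m₁) σ.character)
              (Fin (q ^ (2 * (ℓ₂ - ℓ₁) + (m₂ - m₁))) → ℂ),
            Extends σ σ' ∧
            Nonempty (χ.Equiv
              (indRep ((stabConj_le _ _ _).trans (inertia_le ε ψ (P.mat ε))) σ'))) ∧
      -- (b)
      (ℓ₂ ≤ P.m →
        ∃ σ : Representation ℂ (cong (inertia ε ψ (P.mat ε)) ℓ₁)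
            (Fin (q ^ (2 * (ℓ₂ - ℓ₁))) → ℂ),
          IsMonomialAbove σ (stabMod (cong (grp ε u ℓ) ℓ₁) (P.mat ε) ℓ₂)
            (psiLog ψ (P.mat ε)) ∧
          (∃ σ' : Representation ℂ (inertia ε ψ (P.mat ε)) (Fin (q ^ (2 * (ℓ₂ - ℓ₁))) → ℂ),
            Extends σ σ') ∧
          ∀ σ' : Representation ℂ (inertia ε ψ (P.mat ε)) (Fin (q ^ (2 * (ℓ₂ - ℓ₁))) → ℂ),
            Extends σ σ' →
            ∃ (d : ℕ) (φ : Representation ℂ (grpJ ε P.δ) (Fin d → ℂ))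
              (φ' : Representation ℂ (inertia ε ψ (P.mat ε)) (Fin d → ℂ)),
              φ.IsIrreducible ∧ IsInflation (cong (grp ε u ℓ) ℓ₁) φ φ' ∧
              Nonempty (χ.Equiv (indRep (inertia_le ε ψ (P.mat ε)) (σ'.tprod φ')))) := by
  subst hq hℓ₁ hℓ₂
  obtain ⟨ϖ, hS⟩ := exists_isUniformized hp u hu hu' ℓ hℓ
  obtain ⟨P, hP, μ, n₁, n₂, hd, hlt, hle, v, hv, hvR⟩ :=
    hS.exists_eigenvector_psiLog hψ hℓ χ hχ'
  have hSK := hd.stabMod_le_sup hS hP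
  have hKR := hd.sup_le_radical hS hψ hP
  refine ⟨P, hP, hS.mem_lieRing_iff.2 (hS.tau_mat hP), hS.stabMod_eq hP hℓ,
    fun g hg => ?_, fun g hg => hS.psiLog_eq_psiLin _ hg,
    ⟨inf_le_left.trans (cong_le _ _), v, hv, fun g hg hgS => hvR g hg (hKR (hSK hgS))⟩,
    fun hm m₁ m₂ hm₁ hm₂ => ?_, fun hm => ?_⟩
  · rw [hS.stabMod_eq hP hℓ]
    exact le_sup_right (a := cong (grpJ ε P.δ) (ℓ / 2)) hg
  · obtain ⟨rfl, rfl, rfl⟩ := hlt hm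
    subst hm₁ hm₂
    obtain ⟨σ, hσ, hdim, f, hf, hf0⟩ := hd.exists_heisenberg hS hψ hP rfl hv hvR
    exact ⟨σ, hSK, hσ.mono hKR,
      hd.exists_induced_of_lt hS hψ hP hℓ hm hχ hσ hdim hf0 hf⟩
  · obtain ⟨h₁, h₂⟩ := hle hm
    have he : 2 * (ℓ - ℓ / 2 - ℓ / 2) = 2 * (ℓ - ℓ / 2 - ℓ / 2) + (n₂ - n₁) := by omega
    obtain ⟨σ, hσ, hdim, f, hf, hf0⟩ := hd.exists_heisenberg hS hψ hP he hv hvR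
    subst h₁ h₂
    refine ⟨σ, hσ.mono (hSK.trans hKR), hd.exists_extends_inertia hS hψ hP hℓ hm hσ hdim,
      fun σ' hσ' => ?_⟩
    obtain ⟨d, φ', hφ', hN, he⟩ := hd.exists_induced_of_le hS hψ hP hχ hσ hf0 hf hσ'
    obtain ⟨φ, hφ, hinf⟩ := exists_isInflation
      (fun x => hS.mem_inertia_iff_of_le hψ hℓ hP hm)
      (fun b hb => hN b (hd.cong_le_cong_inertia hS hψ hP hb)) hφ'
    exact ⟨d, φ, φ', hφ, hinf, he⟩
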